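/- Let $n\ge 2$, $m\ge n-1$, let $K\subset\mathbb R^m$ be compact, and let $T_s:\mathbb R^n\to\mathbb R^n$ be a family of maps that is $C^\infty$ jointly in $(s,x)$ for $s$ in an open neighbourhood of $K$ and $x\in\mathbb R^n$. Let $A\subset\mathbb R^{n-1}$ be open and let $\gamma:A\to\mathbb R^n$ be a regular parametrization of a convex hypersurface: $\gamma(A)$ lies in the boundary of a convex set with non-empty interior, and $\gamma$ is a $C^2$ immersion if $n\ge 3$, while for $n=2$ it is only assumed to be locally bi-Lipschitz (for example, parametrized by arc length). Let $\chi\in C_0^\infty(\mathbb R^{n-1})$ be real-valued with support in $A$, and set $$Rf(x,s)=\int_A f\bigl(x+T_s(\gamma(t))\bigr)\chi(t)\,dt,\qquad x\in\mathbb R^n,\ s\in K.$$ Denote by $J_F(x)$ the Jacobian matrix at $x$ of a map $F:\mathbb R^n\to\mathbb R^n$. Assume that for every unit vector $\Xi\in\mathbb S^{n-1}$, every $s\in K$ and every $x\in\gamma(A)$ one can select $n-1$ distinct parameters $s_{i_1},\dots,s_{i_{n-1}}$ among $s_1,\dots,s_m$ (all of them, if $m=n-1$) such that the $n\times n$ matrix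 $$\begin{bmatrix}\Xi^tJ_{T_s}(x)\\ \Xi^tJ_{\partial T_s/\partial s_{i_1}}(x)\\ \vdots\\ \Xi^tJ_{\partial T_s/\partial s_{i_{n-1}}}(x)\end{bmatrix}$$ has rank $n$. Then there is a constant $C$, independent of $f$, such that for every $f\in L^{(n+1)/n}(\mathbb R^n)$ the integral defining $Rf(x,s)$ converges absolutely for almost every $(x,s)\in\mathbb R^n\times K$, $Rf\in L^{n+1}(\mathbb R^n\times K)$, and $$\Bigl(\int_K\int_{\mathbb R^n}|Rf(x,s)|^{n+1}\,dx\,ds\Bigr)^{1/(n+1)}\le C\Bigl(\int_{\mathbb R^n}|f(x)|^{(n+1)/n}\,dx\Bigr)^{n/(n+1)}.$$ -/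

import Mathlib

open scoped ContDiff ENNReal NNReal

namespace OverdeterminedRadon

/-- The Jacobian matrix of `F : ℝⁿ → ℝⁿ` at `x`, with entry `∂ F_i / ∂ x_j` in row `i`,
column `j`. -/
noncomputable def jacobian {n : ℕ}
    (F : EuclideanSpace ℝ (Fin n) → EuclideanSpace ℝ (Fin n)) (x : EuclideanSpace ℝ (Fin n)) :
    Matrix (Fin n) (Fin n) ℝ :=
  Matrix.of fun i j => fderiv ℝ F x (EuclideanSpace.single j 1) i

/-- The map `∂ T_s / ∂ s_k : ℝⁿ → ℝⁿ` of a family of maps `T_s` with parameter `s ∈ ℝᵐ`. -/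
noncomputable def paramDeriv {n m : ℕ}
    (T : EuclideanSpace ℝ (Fin m) → EuclideanSpace ℝ (Fin n) → EuclideanSpace ℝ (Fin n))
    (k : Fin m) (s : EuclideanSpace ℝ (Fin m)) (x : EuclideanSpace ℝ (Fin n)) :
    EuclideanSpace ℝ (Fin n) :=
  fderiv ℝ (fun s' => T s' x) s (EuclideanSpace.single k 1)

/-- The matrix with rows `Ξᵗ J_{T_s}(x)` and `Ξᵗ J_{∂T_s/∂s_{ι 0}}(x)`, …,
`Ξᵗ J_{∂T_s/∂s_{ι (n-2)}}(x)`, for `n - 1` parameters selected by `ι`. -/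
noncomputable def rowMatrix {n m : ℕ}
    (T : EuclideanSpace ℝ (Fin m) → EuclideanSpace ℝ (Fin n) → EuclideanSpace ℝ (Fin n))
    (ι : Fin (n - 1) ↪ Fin m) (Ξ : EuclideanSpace ℝ (Fin n))
    (s : EuclideanSpace ℝ (Fin m)) (x : EuclideanSpace ℝ (Fin n)) :
    Matrix (Fin (n - 1 + 1)) (Fin n) ℝ :=
  Matrix.of (Fin.cons (Matrix.vecMul (fun i => Ξ i) (jacobian (T s) x))
    (fun k => Matrix.vecMul (fun i => Ξ i) (jacobian (paramDeriv T (ι k) s) x)))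

/-- `γ` restricted to `A ⊆ ℝⁿ⁻¹` parametrizes a convex hypersurface of `ℝⁿ`: its image lies in the
boundary of a convex set with interior points. The parametrization is regular: for `n = 2` it is
only asked to be locally bi-Lipschitz (as arc length is), for other `n` it is a `C²` immersion. -/
structure IsConvexParametrization {n : ℕ} (A : Set (EuclideanSpace ℝ (Fin (n - 1))))
    (γ : EuclideanSpace ℝ (Fin (n - 1)) → EuclideanSpace ℝ (Fin n)) : Prop where
  convex : ∃ B : Set (EuclideanSpace ℝ (Fin n)),
    Convex ℝ B ∧ (interior B).Nonempty ∧ Set.MapsTo γ A (frontier B)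
  bilipschitz_of_eq_two : n = 2 → ∀ t ∈ A, ∃ V ∈ nhds t, ∃ c > (0 : ℝ), ∃ L : ℝ,
    ∀ u ∈ V, ∀ v ∈ V, c * ‖u - v‖ ≤ ‖γ u - γ v‖ ∧ ‖γ u - γ v‖ ≤ L * ‖u - v‖
  contDiffOn_of_ne_two : n ≠ 2 → ContDiffOn ℝ 2 γ A
  immersion_of_ne_two : n ≠ 2 → ∀ t ∈ A, Function.Injective (fderiv ℝ γ t)

/-- `Rf(x, s) = ∫ f(x + T_s(γ(t))) χ(t) dt`. -/
noncomputable def radon {n m : ℕ}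
    (T : EuclideanSpace ℝ (Fin m) → EuclideanSpace ℝ (Fin n) → EuclideanSpace ℝ (Fin n))
    (γ : EuclideanSpace ℝ (Fin (n - 1)) → EuclideanSpace ℝ (Fin n))
    (χ : EuclideanSpace ℝ (Fin (n - 1)) → ℝ) (f : EuclideanSpace ℝ (Fin n) → ℂ)
    (p : EuclideanSpace ℝ (Fin n) × EuclideanSpace ℝ (Fin m)) : ℂ :=
  ∫ t, f (p.1 + T p.2 (γ t)) * (χ t : ℂ)

end OverdeterminedRadon

/-! Write `d = n - 1`. The operator is a convolution in `x` for each fixed `s`, with symbol `∫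
e^{2πi ζ·T_s(γ(t))} dν(t)`, called `charInt`. The exponents `(d+2)/(d+1)` and `d+2` come from Stein
interpolation in the family of forms obtained by multiplying this symbol by `(1 - 2πi ζ·e)^{-z}`,
where `e` is a direction transversal to the hypersurface.

On `Re z = 1` the extra factor is the Fourier transform of the density `u^{z-1}e^{-u}/Γ(z)` on the
half line along `e`. It thickens the surface measure into a measure with bounded density, which
gives an `L¹`–`L¹` bound for the bilinear form (`enorm_form_le_of_re_eq_one`). On `Re z = -d/2`
Plancherel and Cauchy–Schwarz reduce the `L²`–`L²` bound to decay of order `d` in `ζ` of the square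
of the symbol averaged over `s`. No decay for individual `s` is needed, so no curvature is required.
The three lines theorem at `z = 0` and duality give `exists_lintegral_average_rpow_le`.

The averaged decay comes from the rank condition. Expanding the square (`T T*`), the kernel in `(t,
τ)` is an oscillatory integral in `s` whose phase is `l|t-τ|` times a smooth difference quotient of
`Ξ·T_s`. If the mixed derivative of `Ξ·T_s(γ(t))` in `s` and `t` kills no tangent direction, the
phase is nonstationary in `s`, the kernel is `O((1+l|t-τ|)^{-N})`, and integration in `τ` yields
`l^{-d}` (`exists_lintegral_weight_mul_enorm_sq_le`). Otherwise the rank condition allows only one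
degenerate direction `v`, and along `v` the phase has a nonzero derivative in `t`. One integration
by parts along `v` gains `l^{-2}` after squaring, the `T T*` argument on the orthogonal complement
gains `l^{-(d-1)}`, and the total is even better than needed (`exists_decay_of_rankCondition`). One
integration by parts is what `γ ∈ C²` affords.

For `n = 2` the curve is only bi-Lipschitz, so convexity replaces `C²`. Near a point the curve
splits into two graphs of convex functions, each with a one-sided strict derivative. This is enough
for `T T*`. In the degenerate case a summation by parts with step comparable to `1/l` gives
`O(1/l)`, because second differences of a convex function are nonnegative and hence telescope
(`IsConvexArc.exists_norm_integral_le`). Bi-Lipschitz parametrizations are reduced to the graph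
parameter by comparison of Hausdorff measures.

All estimates are local in the direction `Ξ`, in `s` and in `t`. Compactness of the unit sphere, of
`K` and of the support of `χ` makes them global. -/

set_option linter.unusedSectionVars false

namespace OverdeterminedRadon

open MeasureTheory Complex Set Filter Topology
open scoped FourierTransform SchwartzMap

/-! ### Plancherel's theorem for functions in `L¹ ∩ L²`. -/

section Plancherel

variable {E : Type*} [NormedAddCommGroup E] [InnerProductSpace ℝ E] [FiniteDimensional ℝ E]
  [MeasurableSpace E] [BorelSpace E]

/-- For integrable `f`, pairing `𝓕 f` with a Schwartz function. -/
theorem integral_schwartz_smul_fourier {f : E → ℂ} (hf : Integrable f) (g : 𝓢(E, ℂ)) :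
    ∫ x, g x • 𝓕 f x = ∫ x, (𝓕 g) x • f x := by
  have := VectorFourier.integral_fourierIntegral_smul_eq_flip (μ := (volume : Measure E))
    (ν := (volume : Measure E)) (L := innerₗ E) Real.continuous_fourierChar
    (continuous_inner (𝕜 := ℝ) (E := E)) g.integrable hf
  rw [flip_innerₗ] at this
  rw [SchwartzMap.fourier_coe]
  exact this.symm

theorem integral_schwartz_smul_Lp_fourier (f : Lp (α := E) ℂ 2 volume) (G : 𝓢(E, ℂ)) :
    ∫ x, G x • (𝓕 f : Lp (α := E) ℂ 2 volume) x = ∫ x, (𝓕 G) x • f x := by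
  have h2 := DFunLike.congr_fun (Lp.fourier_toTemperedDistribution_eq f) G
  rw [TemperedDistribution.fourier_apply, Lp.toTemperedDistribution_apply,
    Lp.toTemperedDistribution_apply] at h2
  exact h2.symm

/-- Smooth compactly supported functions are Schwartz functions, and they already separate locally
integrable functions. -/
theorem ae_eq_of_integral_schwartz_smul_eq {u w : E → ℂ} (hu : LocallyIntegrable u)
    (hw : LocallyIntegrable w) (h : ∀ G : 𝓢(E, ℂ), ∫ x, G x • u x = ∫ x, G x • w x) :
    u =ᵐ[volume] w := by
  refine ae_eq_of_integral_contDiff_smul_eq hu hw fun g hg hgc => ?_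
  have hg' : ContDiff ℝ ∞ (fun x => (g x : ℂ)) := Complex.ofRealCLM.contDiff.comp hg
  have hgc' : HasCompactSupport (fun x => (g x : ℂ)) :=
    hgc.comp_left (g := fun y : ℝ => (y : ℂ)) Complex.ofReal_zero
  have hG := h (hgc'.toSchwartzMap hg')
  simpa using hG

/-- The Fourier integral of a function in `L¹ ∩ L²` is its Fourier transform in `L²`. -/
theorem fourier_ae_eq_of_ae_eq {f : E → ℂ} (hf : Integrable f) (f₂ : Lp (α := E) ℂ 2 volume)
    (hf2 : (f₂ : E → ℂ) =ᵐ[volume] f) :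
    (𝓕 f : E → ℂ) =ᵐ[volume] ((𝓕 f₂ : Lp (α := E) ℂ 2 volume) : E → ℂ) := by
  have hcont : Continuous (𝓕 f : E → ℂ) :=
    VectorFourier.fourierIntegral_continuous Real.continuous_fourierChar
      (continuous_inner (𝕜 := ℝ) (E := E)) hf
  have hloc := (Lp.memLp (𝓕 f₂ : Lp (α := E) ℂ 2 volume)).locallyIntegrable (by norm_num)
  refine ae_eq_of_integral_schwartz_smul_eq hcont.locallyIntegrable hloc fun G => ?_
  rw [integral_schwartz_smul_fourier hf G, integral_schwartz_smul_Lp_fourier f₂ G]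
  refine integral_congr_ae ?_
  filter_upwards [hf2] with x hx
  rw [hx]

theorem fourier_ae_eq_Lp_fourier {f : E → ℂ} (hf : Integrable f) (hf2 : MemLp f 2) :
    (𝓕 f : E → ℂ) =ᵐ[volume] ((𝓕 (hf2.toLp f) : Lp (α := E) ℂ 2 volume) : E → ℂ) :=
  fourier_ae_eq_of_ae_eq hf _ hf2.coeFn_toLp

/-- Plancherel: `𝓕 f ∈ L²` for `f ∈ L¹ ∩ L²`. -/
theorem memLp_two_fourier {f : E → ℂ} (hf : Integrable f) (hf2 : MemLp f 2) :
    MemLp (𝓕 f : E → ℂ) 2 :=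
  (memLp_congr_ae (fourier_ae_eq_Lp_fourier hf hf2)).2 (Lp.memLp _)

/-- Plancherel for inner products of functions in `L¹ ∩ L²`. -/
theorem integral_conj_fourier_mul_fourier {f g : E → ℂ} (hf : Integrable f) (hf2 : MemLp f 2)
    (hg : Integrable g) (hg2 : MemLp g 2) :
    ∫ ζ, 𝓕 f ζ * (starRingEnd ℂ) (𝓕 g ζ) = ∫ x, f x * (starRingEnd ℂ) (g x) := by
  have h := Lp.inner_fourier_eq (hg2.toLp g) (hf2.toLp f)
  rw [L2.inner_def, L2.inner_def] at h
  have h1 : ∫ ζ, 𝓕 f ζ * (starRingEnd ℂ) (𝓕 g ζ) = ∫ ζ, inner ℂ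
      ((𝓕 (hg2.toLp g) : Lp ℂ 2 (volume : Measure E)) ζ)
      ((𝓕 (hf2.toLp f) : Lp ℂ 2 (volume : Measure E)) ζ) := by
    refine integral_congr_ae ?_
    filter_upwards [fourier_ae_eq_Lp_fourier hf hf2, fourier_ae_eq_Lp_fourier hg hg2] with x h1 h2
    rw [h1, h2]; simp
  have h2 : ∫ x, f x * (starRingEnd ℂ) (g x) = ∫ x, inner ℂ ((hg2.toLp g) x) ((hf2.toLp f) x) := by
    refine integral_congr_ae ?_
    filter_upwards [hf2.coeFn_toLp, hg2.coeFn_toLp] with x h1 h2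
    rw [h1, h2]; simp
  rw [h1, h, h2]

/-- Plancherel in `ℝ≥0∞` form. -/
theorem lintegral_enorm_fourier_sq {f : E → ℂ} (hf : Integrable f) (hf2 : MemLp f 2) :
    ∫⁻ ζ, ‖𝓕 f ζ‖ₑ ^ 2 = ∫⁻ x, ‖f x‖ₑ ^ 2 := by
  have key : eLpNorm (𝓕 f : E → ℂ) 2 volume = eLpNorm f 2 volume := by
    rw [eLpNorm_congr_ae (fourier_ae_eq_Lp_fourier hf hf2)]
    have h := Lp.norm_fourier_eq (hf2.toLp f)
    rw [Lp.norm_def, Lp.norm_def, ENNReal.toReal_eq_toReal_iff' (Lp.eLpNorm_ne_top _)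
      (Lp.eLpNorm_ne_top _)] at h
    rw [h, eLpNorm_congr_ae hf2.coeFn_toLp]
  have e : ∀ u : E → ℂ, ∫⁻ x, ‖u x‖ₑ ^ 2 = eLpNorm u 2 volume ^ 2 := by
    intro u
    have := eLpNorm_nnreal_pow_eq_lintegral (μ := (volume : Measure E)) (f := u) (p := 2) (by simp)
    simpa using this.symm
  rw [e, e, key]

theorem fourier_comp_add_right (f : E → ℂ) (v ζ : E) :
    𝓕 (fun x => f (x + v)) ζ = (Real.fourierChar (inner ℝ ζ v) : ℂ) * 𝓕 f ζ := by
  have := congrFun (VectorFourier.fourierIntegral_comp_add_right Real.fourierChar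
    (volume : Measure E) (innerₗ E) f v) ζ
  rw [Real.fourier_eq, Real.fourier_eq]
  simp only [VectorFourier.fourierIntegral, innerₗ_apply_apply, Function.comp_def] at this
  rw [this, Circle.smul_def, smul_eq_mul, real_inner_comm]

/-- The correlation of two functions in `L¹ ∩ L²` on the Fourier side. -/
theorem integral_fourierChar_mul_fourier_mul_conj {f g : E → ℂ} (hf : Integrable f)
    (hf2 : MemLp f 2) (hg : Integrable g) (hg2 : MemLp g 2) (v : E) :
    ∫ ζ, (Real.fourierChar (inner ℝ ζ v) : ℂ) * (𝓕 f ζ * (starRingEnd ℂ) (𝓕 g ζ)) =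
      ∫ x, f (x + v) * (starRingEnd ℂ) (g x) := by
  rw [← integral_conj_fourier_mul_fourier (hf.comp_add_right v)
    (hf2.comp_measurePreserving (measurePreserving_add_right volume v)) hg hg2]
  simp_rw [fourier_comp_add_right, mul_assoc]

end Plancherel

/-! ### Complex powers of `1 - 2πiη` as Laplace transforms. -/

section GammaKernel

theorem norm_cpow_sub_one_mul_exp {a r : ℂ} {u : ℝ} (hu : 0 < u) :
    ‖(u : ℂ) ^ (a - 1) * exp (-(r * u))‖ = u ^ (a.re - 1) * Real.exp (-(r.re * u)) := by
  rw [norm_mul, norm_cpow_eq_rpow_re_of_pos hu, norm_exp]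
  simp

theorem integrableOn_rpow_mul_exp_neg_mul {a r : ℝ} (ha : 0 < a) (hr : 0 < r) :
    IntegrableOn (fun u : ℝ => u ^ (a - 1) * Real.exp (-(r * u))) (Ioi 0) := by
  have := integrableOn_rpow_mul_exp_neg_mul_rpow (p := 1) (s := a - 1) (b := r)
    (by linarith) one_pos hr
  simpa [neg_mul] using this

theorem aestronglyMeasurable_cpow_mul_exp (a r : ℂ) :
    AEStronglyMeasurable (fun u : ℝ => (u : ℂ) ^ (a - 1) * exp (-(r * u)))
      (volume.restrict (Ioi 0)) := by
  refine ContinuousOn.aestronglyMeasurable ?_ measurableSet_Ioi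
  refine ContinuousOn.mul ?_ (by fun_prop)
  intro u hu
  refine ContinuousAt.continuousWithinAt ?_
  exact ContinuousAt.comp (f := fun u : ℝ => (u : ℂ)) (g := fun w : ℂ => w ^ (a - 1))
    (continuousAt_cpow_const (Or.inl (by simpa using hu))) (by fun_prop)

theorem integrableOn_cpow_mul_exp_neg_mul {a r : ℂ} (ha : 0 < a.re) (hr : 0 < r.re) :
    IntegrableOn (fun u : ℝ => (u : ℂ) ^ (a - 1) * exp (-(r * u))) (Ioi 0) := by
  refine (integrableOn_rpow_mul_exp_neg_mul ha hr).mono'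
    (aestronglyMeasurable_cpow_mul_exp a r) ?_
  filter_upwards [ae_restrict_mem measurableSet_Ioi] with u hu
  rw [norm_cpow_sub_one_mul_exp hu]

/-- Differentiating in `r` costs a factor `u`, and on a ball of radius `r.re / 2` the exponential
still decays at rate `r.re / 2`. Holomorphy serves to continue the Gamma integral from positive real
`r` to the half plane. -/
theorem differentiableOn_integral_cpow_mul_exp_neg_mul {a : ℂ} (ha : 0 < a.re) :
    DifferentiableOn ℂ (fun r : ℂ => ∫ u : ℝ in Ioi 0, (u : ℂ) ^ (a - 1) * exp (-(r * u)))
      {r | 0 < r.re} := by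
  intro r hr
  have hr : 0 < r.re := hr
  refine DifferentiableAt.differentiableWithinAt ?_
  have hδ : 0 < r.re / 2 := by linarith
  refine (hasDerivAt_integral_of_dominated_loc_of_deriv_le (𝕜 := ℂ) (s := Metric.ball r (r.re / 2))
    (F' := fun r (u : ℝ) => (u : ℂ) ^ (a - 1) * (exp (-(r * u)) * (-u)))
    (bound := fun u => u ^ (a.re + 1 - 1) * Real.exp (-(r.re / 2 * u)))
    (Metric.ball_mem_nhds _ hδ) (Eventually.of_forall fun r =>
      aestronglyMeasurable_cpow_mul_exp a r)
    (integrableOn_cpow_mul_exp_neg_mul ha hr) ?_ ?_ ?_ ?_).2.differentiableAt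
  · have := (aestronglyMeasurable_cpow_mul_exp a r).mul
      (f := fun u : ℝ => (u : ℂ) ^ (a - 1) * exp (-(r * u))) (g := fun u : ℝ => -(u : ℂ))
      (by fun_prop)
    refine this.congr (Eventually.of_forall fun u => ?_)
    simp [mul_assoc]
  · filter_upwards [ae_restrict_mem measurableSet_Ioi] with u hu
    intro w hw
    have hu : 0 < u := hu
    have hw' : r.re / 2 ≤ w.re := by
      have := (abs_re_le_norm (w - r)).trans (mem_ball_iff_norm.1 hw).le
      rw [sub_re, abs_le] at this
      linarith [this.1]
    rw [← mul_assoc, norm_mul, norm_cpow_sub_one_mul_exp hu, norm_neg, norm_real,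
      Real.norm_of_nonneg hu.le, add_sub_cancel_right]
    have : u ^ a.re = u ^ (a.re - 1) * u := by
      rw [← Real.rpow_add_one hu.ne']; simp
    rw [this, mul_right_comm]
    gcongr
  · exact integrableOn_rpow_mul_exp_neg_mul (by linarith) hδ
  · refine Eventually.of_forall fun u w _ => ?_
    refine HasDerivAt.const_mul _ ?_
    have h1 : HasDerivAt (fun w : ℂ => -(w * u)) (-(u : ℂ)) w := by
      have := ((hasDerivAt_id w).mul_const (u : ℂ)).fun_neg
      simpa using this
    exact h1.cexp

/-- The Laplace transform of `u ^ (a - 1)` on the right half plane. -/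
theorem integral_cpow_mul_exp_neg_mul {a r : ℂ} (ha : 0 < a.re) (hr : 0 < r.re) :
    ∫ u : ℝ in Ioi 0, (u : ℂ) ^ (a - 1) * exp (-(r * u)) = r ^ (-a) * Gamma a := by
  have hopen : IsOpen {r : ℂ | 0 < r.re} := isOpen_lt continuous_const continuous_re
  have h1 := (differentiableOn_integral_cpow_mul_exp_neg_mul ha).analyticOnNhd hopen
  have h2 : AnalyticOnNhd ℂ (fun r : ℂ => r ^ (-a) * Gamma a) {r : ℂ | 0 < r.re} := by
    refine DifferentiableOn.analyticOnNhd ?_ hopen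
    intro r hr
    refine DifferentiableAt.differentiableWithinAt ?_
    exact (differentiableAt_id.cpow_const (Or.inl hr)).mul_const _
  refine h1.eqOn_of_preconnected_of_frequently_eq h2
    (convex_halfSpace_re_gt 0).isPreconnected (z₀ := 1) (by simp) ?_ hr
  -- The formula is known for real `r > 0`; real points accumulating at `1` are enough for the
  -- identity theorem.
  have hlim : Tendsto (fun n : ℕ => (((1 : ℝ) + 1 / ((n : ℝ) + 1) : ℝ) : ℂ)) atTop
      (𝓝[≠] (1 : ℂ)) := by
    refine tendsto_nhdsWithin_iff.2 ⟨?_, Eventually.of_forall fun n => ?_⟩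
    · have := (tendsto_one_div_add_atTop_nhds_zero_nat (𝕜 := ℝ)).const_add 1
      rw [add_zero] at this
      exact (continuous_ofReal.tendsto 1).comp this
    · have : (0 : ℝ) < 1 / ((n : ℝ) + 1) := by positivity
      simp only [mem_compl_iff, mem_singleton_iff, ofReal_eq_one]
      linarith
  refine hlim.frequently (Frequently.of_forall fun n => ?_)
  have hpos : (0 : ℝ) < 1 + 1 / ((n : ℝ) + 1) := by positivity
  generalize (1 : ℝ) + 1 / ((n : ℝ) + 1) = t at hpos
  rw [integral_cpow_mul_exp_neg_mul_Ioi ha hpos, cpow_neg, one_div,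
    inv_cpow _ _ (by rw [arg_ofReal_of_nonneg hpos.le]; exact Real.pi_pos.ne)]

/-- The reflection formula gives `|Γ(1+iy)|² = πy / sinh(πy)`, so the inverse grows at most
exponentially in `|y|`, a rate the three lines theorem tolerates after multiplication by `e^{z²}`.
-/
theorem norm_Gamma_inv_le {z : ℂ} (hz : z.re = 1) :
    ‖Gamma z‖⁻¹ ≤ Real.exp (Real.pi * |z.im|) := by
  obtain ⟨y, rfl⟩ : ∃ y : ℝ, z = 1 + y * I := ⟨z.im, by apply Complex.ext <;> simp [hz]⟩
  simp only [add_im, one_im, mul_im, ofReal_re, I_im, mul_one, ofReal_im, I_re, mul_zero,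
    add_zero, zero_add]
  rcases eq_or_ne y 0 with rfl | hy
  · simp
  have h1 : Gamma (1 + y * I) = (y * I) * Gamma (y * I) := by
    rw [add_comm]; exact Gamma_add_one _ (by simp [hy])
  have h2 := Gamma_mul_Gamma_one_sub (y * I)
  have h3 : Gamma (1 - y * I) = (starRingEnd ℂ) (Gamma (1 + y * I)) := by
    rw [← Gamma_conj]; congr 1; simp [sub_eq_add_neg]
  have h4 : sin (Real.pi * (y * I)) = Real.sinh (Real.pi * y) * I := by
    rw [← mul_assoc, sin_mul_I]; push_cast; rfl
  have hs : Real.sinh (Real.pi * y) ≠ 0 := by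
    simp [Real.sinh_eq_zero, hy, Real.pi_ne_zero]
  have h5 : ‖Gamma (1 + y * I)‖ ^ 2 * |Real.sinh (Real.pi * y)| = Real.pi * |y| := by
    have : Gamma (1 + y * I) * (starRingEnd ℂ) (Gamma (1 + y * I)) * Real.sinh (Real.pi * y)
        = Real.pi * y := by
      rw [← h3, h1, mul_assoc (y * I : ℂ), h2, h4]
      have : (Real.sinh (Real.pi * y) : ℂ) ≠ 0 := by exact_mod_cast hs
      field_simp
    have := congrArg norm this
    rw [norm_mul, norm_mul, RCLike.norm_conj, norm_mul, norm_real, norm_real, norm_real,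
      Real.norm_eq_abs, Real.norm_eq_abs, Real.norm_eq_abs, abs_of_pos Real.pi_pos] at this
    rw [sq, this]
  have h6 : |Real.sinh (Real.pi * y)| ≤ Real.pi * |y| * Real.exp (Real.pi * |y|) := by
    have hx : |Real.sinh (Real.pi * y)| = Real.sinh (Real.pi * |y|) := by
      rw [← abs_of_pos Real.pi_pos, ← abs_mul, ← Real.abs_sinh, abs_of_pos Real.pi_pos]
    rw [hx]
    have hp : 0 ≤ Real.pi * |y| := by positivity
    generalize Real.pi * |y| = x at hp
    rw [Real.sinh_eq]
    have e1 := Real.add_one_le_exp (-(2 * x))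
    have e2 : Real.exp (-x) = Real.exp x * Real.exp (-(2 * x)) := by
      rw [← Real.exp_add]; ring_nf
    rw [e2]
    nlinarith [Real.exp_pos x]
  have hy' : 0 < |y| := abs_pos.2 hy
  have h7 : ‖Gamma (1 + y * I)‖⁻¹ ^ 2 ≤ Real.exp (Real.pi * |y|) := by
    have hsp : 0 < |Real.sinh (Real.pi * y)| := abs_pos.2 hs
    have hG : ‖Gamma (1 + y * I)‖ ^ 2 = Real.pi * |y| / |Real.sinh (Real.pi * y)| := by
      rw [← h5]; field_simp
    rw [inv_pow, hG, inv_div, div_le_iff₀ (mul_pos Real.pi_pos hy'), mul_comm (Real.exp _)]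
    exact h6
  -- The previous bound is on the square; since the right side is at least `1`, it also bounds the
  -- norm itself.
  have h8 : (1 : ℝ) ≤ Real.exp (Real.pi * |y|) := Real.one_le_exp (by positivity)
  nlinarith [norm_nonneg (Gamma (1 + y * I)), inv_nonneg.2 (norm_nonneg (Gamma (1 + y * I)))]

/-- The symbol `1 - 2πiη` whose complex powers form the analytic family. -/
noncomputable def powBase (η : ℝ) : ℂ := 1 - 2 * Real.pi * η * I

theorem powBase_re (η : ℝ) : (powBase η).re = 1 := by simp [powBase]

theorem powBase_ne_zero (η : ℝ) : powBase η ≠ 0 := fun h => by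
  have := powBase_re η; rw [h] at this; simp at this

theorem powBase_mem_slitPlane (η : ℝ) : powBase η ∈ slitPlane := Or.inl (by simp [powBase_re])

theorem one_le_norm_powBase (η : ℝ) : 1 ≤ ‖powBase η‖ := by
  have := abs_re_le_norm (powBase η)
  rwa [powBase_re, abs_one] at this

theorem norm_powBase_le (η : ℝ) : ‖powBase η‖ ≤ 7 * (1 + |η|) := by
  calc ‖powBase η‖ ≤ ‖(1 : ℂ)‖ + ‖2 * Real.pi * η * I‖ := norm_sub_le _ _
    _ = 1 + 2 * Real.pi * |η| := by
      simp [abs_of_pos Real.pi_pos]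
    _ ≤ _ := by
      have := Real.pi_lt_d2
      nlinarith [abs_nonneg η]

theorem continuous_powBase : Continuous powBase := by unfold powBase; fun_prop

/-- The base has real part `1`, hence modulus at least `1`, so the modulus of the power is monotone
in the real exponent; the argument contributes the exponential factor. -/
theorem norm_powBase_cpow_le (η : ℝ) {z : ℂ} {b : ℝ} (hz : -b ≤ z.re) :
    ‖powBase η ^ (-z)‖ ≤ ‖powBase η‖ ^ b * Real.exp (Real.pi * |z.im|) := by
  rw [norm_cpow_of_ne_zero (powBase_ne_zero η), div_eq_mul_inv, ← Real.exp_neg]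
  refine mul_le_mul ?_ ?_ (Real.exp_pos _).le (by positivity)
  · exact Real.rpow_le_rpow_of_exponent_le (one_le_norm_powBase η) (by rw [neg_re]; linarith)
  · refine Real.exp_le_exp.2 ?_
    rw [neg_im, mul_neg, neg_neg]
    exact (le_abs_self _).trans (by rw [abs_mul]; gcongr; exact abs_arg_le_pi _)

end GammaKernel

/-! ### The analytic family of forms: `L²` estimate and holomorphy. -/

section Form

variable {E : Type*} [NormedAddCommGroup E] [InnerProductSpace ℝ E] [FiniteDimensional ℝ E]
  [MeasurableSpace E] [BorelSpace E]
  {S Y : Type*} [MeasurableSpace S] [MeasurableSpace Y]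

/-- The Fourier transform at `ζ` of the image of `ν` under `y ↦ Θ (s, y)`. -/
noncomputable def charInt (ν : Measure Y) (Θ : S × Y → E) (s : S) (ζ : E) : ℂ :=
  ∫ y, (Real.fourierChar (inner ℝ ζ (Θ (s, y))) : ℂ) ∂ν

/-- The Fourier side density of the pairing of `f(x + Θ(s, y))` with `g(s, x)`. -/
noncomputable def pairing (ν : Measure Y) (Θ : S × Y → E) (f : E → ℂ) (g : S × E → ℂ)
    (p : S × E) : ℂ :=
  charInt ν Θ p.1 p.2 * (𝓕 f p.2 * (starRingEnd ℂ) (𝓕 (fun x => g (p.1, x)) p.2))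

/-- The analytic family of forms. -/
noncomputable def form (σ : Measure S) (ν : Measure Y) (Θ : S × Y → E) (e : E) (z : ℂ)
    (f : E → ℂ) (g : S × E → ℂ) : ℂ :=
  ∫ p, powBase (inner ℝ p.2 e) ^ (-z) * pairing ν Θ f g p ∂(σ.prod volume)

variable {σ : Measure S} {ν : Measure Y} {Θ : S × Y → E} {e : E} {f : E → ℂ} {g : S × E → ℂ}

theorem continuous_fourier_of_integrable (hf : Integrable f) : Continuous (𝓕 f : E → ℂ) :=
  VectorFourier.fourierIntegral_continuous Real.continuous_fourierChar
    (continuous_inner (𝕜 := ℝ) (E := E)) hf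

theorem continuous_coe_fourierChar : Continuous fun t : ℝ => (Real.fourierChar t : ℂ) :=
  continuous_subtype_val.comp Real.continuous_fourierChar

theorem measurable_fourierChar_inner (hΘ : Measurable Θ) :
    Measurable fun q : (S × E) × Y => (Real.fourierChar (inner ℝ q.1.2 (Θ (q.1.1, q.2))) : ℂ) := by
  refine continuous_coe_fourierChar.measurable.comp ?_
  exact Measurable.inner (by fun_prop) (hΘ.comp (by fun_prop))

theorem stronglyMeasurable_charInt [SFinite ν] (hΘ : Measurable Θ) :
    StronglyMeasurable fun p : S × E => charInt ν Θ p.1 p.2 :=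
  (measurable_fourierChar_inner hΘ).stronglyMeasurable.integral_prod_right

theorem stronglyMeasurable_fourier_slice (hg : StronglyMeasurable g) :
    StronglyMeasurable fun p : S × E => 𝓕 (fun x => g (p.1, x)) p.2 := by
  simp_rw [Real.fourier_eq, Circle.smul_def]
  have : StronglyMeasurable fun q : (S × E) × E =>
      (Real.fourierChar (-(inner ℝ q.2 q.1.2)) : ℂ) • g (q.1.1, q.2) := by
    have hm : Measurable fun q : (S × E) × E => (q.1.1, q.2) := by fun_prop
    have hm2 : Measurable fun q : (S × E) × E =>
        (Real.fourierChar (-(inner ℝ q.2 q.1.2)) : ℂ) :=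
      continuous_coe_fourierChar.measurable.comp
        (Measurable.inner (by fun_prop) (by fun_prop)).neg
    exact hm2.stronglyMeasurable.smul (hg.comp_measurable hm)
  exact this.integral_prod_right

theorem stronglyMeasurable_pairing [SFinite ν] (hΘ : Measurable Θ) (hf : Integrable f)
    (hg : StronglyMeasurable g) : StronglyMeasurable (pairing ν Θ f g) := by
  have h1 := (continuous_fourier_of_integrable hf).stronglyMeasurable.comp_measurable
    (measurable_snd : Measurable (Prod.snd : S × E → E))
  have h2 := continuous_conj.comp_stronglyMeasurable (stronglyMeasurable_fourier_slice hg)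
  exact (stronglyMeasurable_charInt hΘ).mul (h1.mul h2)

theorem continuous_powBase_inner_cpow (e : E) (z : ℂ) :
    Continuous fun ζ : E => powBase (inner ℝ ζ e) ^ (-z) := by
  refine Continuous.cpow (continuous_powBase.comp (by fun_prop)) continuous_const ?_
  exact fun ζ => powBase_mem_slitPlane _

theorem ae_slice [SFinite σ] (hg1 : Integrable g (σ.prod volume))
    (hg2 : MemLp g 2 (σ.prod volume)) :
    ∀ᵐ s ∂σ, Integrable (fun x => g (s, x)) ∧ MemLp (fun x => g (s, x)) 2 := by
  have h2 := (memLp_two_iff_integrable_sq_norm hg2.1).1 hg2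
  filter_upwards [hg1.prod_right_ae, h2.prod_right_ae] with s hs1 hs2
  exact ⟨hs1, (memLp_two_iff_integrable_sq_norm hs1.1).2 hs2⟩

theorem lintegral_enorm_fourier_slice_sq [SFinite σ] (hg : StronglyMeasurable g)
    (hg1 : Integrable g (σ.prod volume)) (hg2 : MemLp g 2 (σ.prod volume)) :
    ∫⁻ p : S × E, ‖𝓕 (fun x => g (p.1, x)) p.2‖ₑ ^ 2 ∂(σ.prod volume) =
      ∫⁻ p, ‖g p‖ₑ ^ 2 ∂(σ.prod volume) := by
  rw [lintegral_prod _ ((stronglyMeasurable_fourier_slice hg).enorm.pow_const 2).aemeasurable,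
    lintegral_prod _ (hg.enorm.pow_const 2).aemeasurable]
  refine lintegral_congr_ae ?_
  filter_upwards [ae_slice hg1 hg2] with s hs
  exact lintegral_enorm_fourier_sq hs.1 hs.2

/-- The `L²` estimate. -/
theorem lintegral_weight_mul_pairing_le [SFinite σ] [SFinite ν] (hΘ : Measurable Θ) {w : E → ℝ≥0∞}
    (hw : Measurable w) {C : ℝ≥0∞}
    (hC : ∀ ζ, w ζ ^ 2 * ∫⁻ s, ‖charInt ν Θ s ζ‖ₑ ^ 2 ∂σ ≤ C)
    (hf : Integrable f) (hf2 : MemLp f 2) (hg : StronglyMeasurable g)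
    (hg1 : Integrable g (σ.prod volume)) (hg2 : MemLp g 2 (σ.prod volume)) :
    ∫⁻ p : S × E, w p.2 * ‖pairing ν Θ f g p‖ₑ ∂(σ.prod volume) ≤
      C ^ (1 / 2 : ℝ) * (∫⁻ x, ‖f x‖ₑ ^ 2) ^ (1 / 2 : ℝ) *
        (∫⁻ p, ‖g p‖ₑ ^ 2 ∂(σ.prod volume)) ^ (1 / 2 : ℝ) := by
  have hJ := stronglyMeasurable_charInt (ν := ν) hΘ
  have hF := (continuous_fourier_of_integrable hf).measurable
  have hG := stronglyMeasurable_fourier_slice hg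
  -- Cauchy–Schwarz in `(s, ζ)` with weight, symbol and `𝓕 f` in one factor and the transform of `g`
  -- in the other. Integrating the square of the first over `s` at fixed `ζ` produces the quantity
  -- bounded by `hC`.
  set u : S × E → ℝ≥0∞ := fun p => w p.2 * ‖charInt ν Θ p.1 p.2‖ₑ * ‖𝓕 f p.2‖ₑ with hu
  set v : S × E → ℝ≥0∞ := fun p => ‖𝓕 (fun x => g (p.1, x)) p.2‖ₑ with hv
  have hum : Measurable u :=
    ((hw.comp measurable_snd).mul hJ.enorm).mul (hF.comp measurable_snd).enorm
  have h1 : ∫⁻ p : S × E, w p.2 * ‖pairing ν Θ f g p‖ₑ ∂(σ.prod volume) =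
      ∫⁻ p, (u * v) p ∂(σ.prod volume) := by
    refine lintegral_congr fun p => ?_
    simp only [hu, hv, pairing, Pi.mul_apply, enorm_mul, RCLike.enorm_conj]
    ring
  have h2 : ∫⁻ p, u p ^ (2 : ℝ) ∂(σ.prod volume) ≤ C * ∫⁻ x, ‖f x‖ₑ ^ 2 := by
    have : Measurable fun p => u p ^ (2 : ℝ) := hum.pow_const _
    rw [lintegral_prod_symm _ this.aemeasurable, ← lintegral_enorm_fourier_sq hf hf2,
      ← lintegral_const_mul _ (hF.enorm.pow_const 2)]
    refine lintegral_mono fun ζ => ?_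
    simp only [hu, ENNReal.rpow_two, mul_pow]
    rw [lintegral_mul_const, lintegral_const_mul]
    · gcongr
      exact hC ζ
    · exact (hJ.enorm.comp measurable_prodMk_right).pow_const 2
    · exact ((hJ.enorm.comp measurable_prodMk_right).pow_const 2).const_mul _
  rw [h1]
  refine (ENNReal.lintegral_mul_le_Lp_mul_Lq _ Real.HolderConjugate.two_two hum.aemeasurable
    hG.enorm.aemeasurable).trans ?_
  rw [← ENNReal.mul_rpow_of_nonneg C _ (by norm_num : (0 : ℝ) ≤ 1 / 2)]
  have h3 := lintegral_enorm_fourier_slice_sq hg hg1 hg2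
  simp_rw [ENNReal.rpow_two] at h2 ⊢
  rw [h3]
  gcongr

theorem lintegral_enorm_sq_lt_top {X : Type*} [MeasurableSpace X] {μ : Measure X} {u : X → ℂ}
    (hu : MemLp u 2 μ) : ∫⁻ x, ‖u x‖ₑ ^ 2 ∂μ < ⊤ := by
  have := (eLpNorm_lt_top_iff_lintegral_rpow_enorm_lt_top (by norm_num) (by norm_num)).1 hu.2
  simpa using this

/-- This weighted modulus is the common dominating function for the growth, continuity and
differentiability of the form in `z` on the half plane `-b ≤ Re z`. -/
theorem integrable_weight_mul_pairing [SFinite σ] [SFinite ν] (hΘ : Measurable Θ) {b : ℝ} {C : ℝ≥0}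
    (hC : ∀ ζ, ENNReal.ofReal (‖powBase (inner ℝ ζ e)‖ ^ b) ^ 2 *
      ∫⁻ s, ‖charInt ν Θ s ζ‖ₑ ^ 2 ∂σ ≤ C)
    (hf : Integrable f) (hf2 : MemLp f 2) (hg : StronglyMeasurable g)
    (hg1 : Integrable g (σ.prod volume)) (hg2 : MemLp g 2 (σ.prod volume)) :
    Integrable (fun p : S × E => ‖powBase (inner ℝ p.2 e)‖ ^ b * ‖pairing ν Θ f g p‖)
      (σ.prod volume) := by
  have hmeas : Continuous fun ζ : E => ‖powBase (inner ℝ ζ e)‖ ^ b :=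
    ((continuous_powBase.comp (by fun_prop)).norm).rpow_const
      fun ζ => Or.inl (norm_ne_zero_iff.2 (powBase_ne_zero _))
  refine ⟨?_, ?_⟩
  · exact ((hmeas.measurable.comp measurable_snd).mul
      (stronglyMeasurable_pairing hΘ hf hg).norm.measurable).aestronglyMeasurable
  · rw [hasFiniteIntegral_iff_enorm]
    have := lintegral_weight_mul_pairing_le (ν := ν) hΘ (w := fun ζ => ENNReal.ofReal
      (‖powBase (inner ℝ ζ e)‖ ^ b)) hmeas.measurable.ennreal_ofReal hC hf hf2 hg hg1 hg2
    refine lt_of_le_of_lt (le_of_eq_of_le (lintegral_congr fun p => ?_) this) ?_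
    · rw [enorm_mul, enorm_norm, Real.enorm_of_nonneg (by positivity)]
    · refine ENNReal.mul_lt_top (ENNReal.mul_lt_top ?_ ?_) ?_ <;>
        refine ENNReal.rpow_lt_top_of_nonneg (by norm_num) ?_
      · exact ENNReal.coe_ne_top
      · exact (lintegral_enorm_sq_lt_top hf2).ne
      · exact (lintegral_enorm_sq_lt_top hg2).ne

theorem norm_cpow_mul_pairing_le {b : ℝ} {z : ℂ} (hz : -b ≤ z.re) (p : S × E) :
    ‖powBase (inner ℝ p.2 e) ^ (-z) * pairing ν Θ f g p‖ ≤ Real.exp (Real.pi * |z.im|) *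
      (‖powBase (inner ℝ p.2 e)‖ ^ b * ‖pairing ν Θ f g p‖) := by
  rw [norm_mul, mul_left_comm, ← mul_assoc]
  gcongr
  exact norm_powBase_cpow_le _ hz

/-- The derivative in `z` of a complex power brings out a logarithm; an arbitrarily small positive
power of the base absorbs it. -/
theorem norm_log_powBase_le (η : ℝ) {δ : ℝ} (hδ : 0 < δ) :
    ‖log (powBase η)‖ ≤ (1 / δ + Real.pi) * ‖powBase η‖ ^ δ := by
  have h1 := one_le_norm_powBase η
  have h2 : (1 : ℝ) ≤ ‖powBase η‖ ^ δ := Real.one_le_rpow h1 hδ.le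
  calc ‖log (powBase η)‖ ≤ |(log (powBase η)).re| + |(log (powBase η)).im| :=
        norm_le_abs_re_add_abs_im _
    _ ≤ ‖powBase η‖ ^ δ / δ + Real.pi := by
      gcongr
      · rw [log_re, abs_of_nonneg (Real.log_nonneg h1)]
        exact Real.log_le_rpow_div (norm_nonneg _) hδ
      · rw [log_im]; exact abs_arg_le_pi _
    _ ≤ _ := by
      rw [add_mul, one_div, inv_mul_eq_div]
      gcongr
      exact le_mul_of_one_le_right Real.pi_pos.le h2

section Holomorphy

variable {b : ℝ} (hp : StronglyMeasurable (pairing ν Θ f g))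
  (hint : Integrable (fun p : S × E => ‖powBase (inner ℝ p.2 e)‖ ^ b * ‖pairing ν Θ f g p‖)
      (σ.prod volume))

include hp hint

theorem integrable_cpow_mul_pairing {z : ℂ} (hz : -b ≤ z.re) :
    Integrable (fun p : S × E => powBase (inner ℝ p.2 e) ^ (-z) * pairing ν Θ f g p)
      (σ.prod volume) := by
  refine (hint.const_mul (Real.exp (Real.pi * |z.im|))).mono' ?_
    (Eventually.of_forall fun p => norm_cpow_mul_pairing_le hz p)
  refine StronglyMeasurable.aestronglyMeasurable (StronglyMeasurable.mul ?_ hp)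
  exact (continuous_powBase_inner_cpow e z).stronglyMeasurable.comp_measurable measurable_snd

theorem norm_form_le {z : ℂ} (hz : -b ≤ z.re) :
    ‖form σ ν Θ e z f g‖ ≤ Real.exp (Real.pi * |z.im|) *
      ∫ p : S × E, ‖powBase (inner ℝ p.2 e)‖ ^ b * ‖pairing ν Θ f g p‖ ∂(σ.prod volume) := by
  rw [form, ← integral_const_mul]
  exact norm_integral_le_of_norm_le (hint.const_mul _)
    (Eventually.of_forall fun p => norm_cpow_mul_pairing_le hz p)

theorem continuousOn_form : ContinuousOn (fun z => form σ ν Θ e z f g) {z | -b ≤ z.re} := by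
  intro z₀ hz₀
  unfold form
  refine continuousWithinAt_of_dominated (bound := fun p =>
    Real.exp (Real.pi * (|z₀.im| + 1)) *
      (‖powBase (inner ℝ p.2 e)‖ ^ b * ‖pairing ν Θ f g p‖)) ?_ ?_ (hint.const_mul _) ?_
  · filter_upwards [self_mem_nhdsWithin] with z hz
    exact (integrable_cpow_mul_pairing hp hint hz).1
  · have : ∀ᶠ z in 𝓝[{z | -b ≤ z.re}] z₀, |z.im| < |z₀.im| + 1 :=
      nhdsWithin_le_nhds ((continuous_im.abs.tendsto z₀).eventually (gt_mem_nhds (lt_add_one _)))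
    filter_upwards [self_mem_nhdsWithin, this] with z hz hz'
    refine Eventually.of_forall fun p => (norm_cpow_mul_pairing_le hz p).trans ?_
    gcongr
  · refine Eventually.of_forall fun p => ContinuousAt.continuousWithinAt ?_
    refine ContinuousAt.mul ?_ continuousAt_const
    exact (continuousAt_const_cpow (powBase_ne_zero _)).comp continuousAt_neg

theorem differentiableAt_form {z₀ : ℂ} (hz₀ : -b < z₀.re) :
    DifferentiableAt ℂ (fun z => form σ ν Θ e z f g) z₀ := by
  -- Half the distance to the line `Re z = -b`: on the ball of radius `δ` the real part stays above
  -- `-(b - δ)`, and the spare power `δ` pays for the logarithm.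
  set δ := (z₀.re + b) / 2 with hδ
  have hδ0 : 0 < δ := by rw [hδ]; linarith
  have hmeas : ∀ z : ℂ, StronglyMeasurable
      (fun p : S × E => powBase (inner ℝ p.2 e) ^ (-z) * pairing ν Θ f g p) := fun z =>
    StronglyMeasurable.mul ((continuous_powBase_inner_cpow e z).stronglyMeasurable.comp_measurable
      measurable_snd) hp
  have hlog : Continuous fun ζ : E => -log (powBase (inner ℝ ζ e)) :=
    ((continuous_powBase.comp (by fun_prop)).clog fun ζ => powBase_mem_slitPlane _).neg
  refine (hasDerivAt_integral_of_dominated_loc_of_deriv_le (𝕜 := ℂ) (s := Metric.ball z₀ δ)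
    (F' := fun z (p : S × E) => -log (powBase (inner ℝ p.2 e)) *
      (powBase (inner ℝ p.2 e) ^ (-z) * pairing ν Θ f g p))
    (bound := fun p => (1 / δ + Real.pi) * Real.exp (Real.pi * (|z₀.im| + δ)) *
      (‖powBase (inner ℝ p.2 e)‖ ^ b * ‖pairing ν Θ f g p‖))
    (Metric.ball_mem_nhds _ hδ0) (Eventually.of_forall fun z => (hmeas z).aestronglyMeasurable)
    (integrable_cpow_mul_pairing hp hint hz₀.le) ?_ ?_ (hint.const_mul _) ?_).2.differentiableAt
  · exact ((hlog.stronglyMeasurable.comp_measurable measurable_snd).mul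
      (hmeas z₀)).aestronglyMeasurable
  · refine Eventually.of_forall fun p z hz => ?_
    have hz1 := mem_ball_iff_norm.1 hz
    have hre : -(b - δ) ≤ z.re := by
      have := (abs_re_le_norm (z - z₀)).trans hz1.le
      rw [sub_re, abs_le] at this
      linarith [this.1]
    have him : |z.im| ≤ |z₀.im| + δ := by
      have := (abs_im_le_norm (z - z₀)).trans hz1.le
      rw [sub_im] at this
      linarith [abs_sub_abs_le_abs_sub z.im z₀.im]
    rw [norm_mul, norm_neg]
    calc _ ≤ ((1 / δ + Real.pi) * ‖powBase (inner ℝ p.2 e)‖ ^ δ) *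
          (Real.exp (Real.pi * |z.im|) *
            (‖powBase (inner ℝ p.2 e)‖ ^ (b - δ) * ‖pairing ν Θ f g p‖)) := by
          gcongr
          · exact norm_log_powBase_le _ hδ0
          · exact norm_cpow_mul_pairing_le hre p
      _ = (1 / δ + Real.pi) * Real.exp (Real.pi * |z.im|) *
            (‖powBase (inner ℝ p.2 e)‖ ^ b * ‖pairing ν Θ f g p‖) := by
          have : ‖powBase (inner ℝ p.2 e)‖ ^ b = ‖powBase (inner ℝ p.2 e)‖ ^ δ *
              ‖powBase (inner ℝ p.2 e)‖ ^ (b - δ) := by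
            rw [← Real.rpow_add (norm_pos_iff.2 (powBase_ne_zero _))]; simp
          rw [this]; ring
      _ ≤ _ := by gcongr
  · refine Eventually.of_forall fun p z _ => ?_
    have h := ((hasDerivAt_neg z).const_cpow (c := powBase (inner ℝ p.2 e))
      (Or.inl (powBase_ne_zero _))).mul_const (pairing ν Θ f g p)
    exact h.congr_deriv (by ring)

end Holomorphy

end Form

/-! ### The forms at `z = 0` and on the line `Re z = 1`. -/

section Edge

variable {E : Type*} [NormedAddCommGroup E] [InnerProductSpace ℝ E] [FiniteDimensional ℝ E]
  [MeasurableSpace E] [BorelSpace E]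
  {S Y : Type*} [MeasurableSpace S] [MeasurableSpace Y]

theorem norm_coe_fourierChar (t : ℝ) : ‖(Real.fourierChar t : ℂ)‖ = 1 :=
  Circle.norm_coe _

theorem integrable_mul_conj_fourier {f h : E → ℂ} (hf : Integrable f) (hf2 : MemLp f 2)
    (hh : Integrable h) (hh2 : MemLp h 2) :
    Integrable fun ζ => 𝓕 f ζ * (starRingEnd ℂ) (𝓕 h ζ) := by
  have h1 := memLp_two_fourier hf hf2
  have h2 := (memLp_two_fourier hh hh2).star
  exact h1.integrable_mul h2

/-- Superpositions of translations on the Fourier side. -/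
theorem integral_superposition_mul_fourier {Q : Type*} [MeasurableSpace Q] {μ : Measure Q}
    [SFinite μ] {k : Q → ℂ} (hk : Integrable k μ) {V : Q → E} (hV : Measurable V) {f h : E → ℂ}
    (hf : Integrable f) (hf2 : MemLp f 2) (hh : Integrable h) (hh2 : MemLp h 2) :
    ∫ ζ, (∫ q, k q * (Real.fourierChar (inner ℝ ζ (V q)) : ℂ) ∂μ) *
      (𝓕 f ζ * (starRingEnd ℂ) (𝓕 h ζ)) =
      ∫ q, k q * (∫ x, f (x + V q) * (starRingEnd ℂ) (h x)) ∂μ := by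
  have hH := integrable_mul_conj_fourier hf hf2 hh hh2
  simp_rw [← integral_fourierChar_mul_fourier_mul_conj hf hf2 hh hh2, ← integral_mul_const,
    ← integral_const_mul]
  rw [integral_integral_swap]
  · simp_rw [mul_assoc]
  · have h1 : Integrable (fun p : E × Q => (𝓕 f p.1 * (starRingEnd ℂ) (𝓕 h p.1)) * k p.2)
        (volume.prod μ) := hH.mul_prod hk
    have h2 : Measurable fun p : E × Q => (Real.fourierChar (inner ℝ p.1 (V p.2)) : ℂ) :=
      continuous_coe_fourierChar.measurable.comp
        (Measurable.inner (by fun_prop) (hV.comp measurable_snd))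
    refine (h1.bdd_mul (c := 1) h2.aestronglyMeasurable
      (Eventually.of_forall fun p => (norm_coe_fourierChar _).le)).congr
      (Eventually.of_forall fun p => ?_)
    simp only [Function.uncurry]
    ring

variable {σ : Measure S} {ν : Measure Y} {Θ : S × Y → E} {e : E} {f : E → ℂ} {g : S × E → ℂ}

theorem integral_pairing_slice [IsFiniteMeasure ν] (hΘ : Measurable Θ) (hf : Integrable f)
    (hf2 : MemLp f 2) {s : S} (hh : Integrable fun x => g (s, x))
    (hh2 : MemLp (fun x => g (s, x)) 2) :
    ∫ ζ, pairing ν Θ f g (s, ζ) =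
      ∫ y, (∫ x, f (x + Θ (s, y)) * (starRingEnd ℂ) (g (s, x))) ∂ν := by
  have := integral_superposition_mul_fourier (μ := ν) (integrable_const (1 : ℂ))
    (V := fun y => Θ (s, y)) (hΘ.comp measurable_prodMk_left) hf hf2 hh hh2
  simp only [one_mul] at this
  exact this

/-- The form at `z = 0` is the bilinear pairing. -/
theorem form_zero [SFinite σ] [IsFiniteMeasure ν] (hΘ : Measurable Θ) (hf : Integrable f)
    (hf2 : MemLp f 2)
    (hg1 : Integrable g (σ.prod volume)) (hg2 : MemLp g 2 (σ.prod volume))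
    (hint : Integrable (fun p : S × E => powBase (inner ℝ p.2 e) ^ (-(0 : ℂ)) * pairing ν Θ f g p)
      (σ.prod volume)) :
    form σ ν Θ e 0 f g =
      ∫ s, (∫ y, (∫ x, f (x + Θ (s, y)) * (starRingEnd ℂ) (g (s, x))) ∂ν) ∂σ := by
  rw [form, integral_prod _ hint]
  refine integral_congr_ae ?_
  filter_upwards [ae_slice hg1 hg2] with s hs
  simp only [neg_zero, cpow_zero, one_mul]
  exact integral_pairing_slice hΘ hf hf2 hs.1 hs.2

/-- The power times `Γ(z)` is the Laplace integral of `u^{z-1}e^{-u}` against `e^{2πiu ζ·e}`.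
Multiplying the symbol by the power therefore superposes the further translations `u • e`, `u > 0`.
-/
theorem integral_cpow_mul_pairing_slice [IsFiniteMeasure ν] (hΘ : Measurable Θ) {z : ℂ}
    (hz : z.re = 1) (hf : Integrable f) (hf2 : MemLp f 2) {s : S}
    (hh : Integrable fun x => g (s, x)) (hh2 : MemLp (fun x => g (s, x)) 2) :
    ∫ ζ, powBase (inner ℝ ζ e) ^ (-z) * pairing ν Θ f g (s, ζ) =
      (Gamma z)⁻¹ * ∫ q : ℝ × Y, ((q.1 : ℂ) ^ (z - 1) * exp (-((1 : ℂ) * q.1))) *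
        (∫ x, f (x + (Θ (s, q.2) + q.1 • e)) * (starRingEnd ℂ) (g (s, x)))
        ∂((volume.restrict (Ioi 0)).prod ν) := by
  have hz0 : 0 < z.re := by rw [hz]; exact one_pos
  have hΓ : Gamma z ≠ 0 := Gamma_ne_zero_of_re_pos hz0
  have hk : Integrable (fun u : ℝ => (u : ℂ) ^ (z - 1) * exp (-((1 : ℂ) * u)))
      (volume.restrict (Ioi 0)) := integrableOn_cpow_mul_exp_neg_mul hz0 (by simp)
  have hk2 : Integrable (fun q : ℝ × Y => (q.1 : ℂ) ^ (z - 1) * exp (-((1 : ℂ) * q.1)))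
      ((volume.restrict (Ioi 0)).prod ν) := by
    simpa using hk.mul_prod (integrable_const (μ := ν) (1 : ℂ))
  have hV : Measurable fun q : ℝ × Y => Θ (s, q.2) + q.1 • e := by
    have := hΘ.comp (measurable_prodMk_left (x := s))
    exact (this.comp measurable_snd).add (by fun_prop)
  rw [← integral_superposition_mul_fourier hk2 hV hf hf2 hh hh2, ← integral_const_mul]
  refine integral_congr_ae (Eventually.of_forall fun ζ => ?_)
  simp only
  have key : ∫ q : ℝ × Y, ((q.1 : ℂ) ^ (z - 1) * exp (-((1 : ℂ) * q.1))) *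
      (Real.fourierChar (inner ℝ ζ (Θ (s, q.2) + q.1 • e)) : ℂ) ∂((volume.restrict (Ioi 0)).prod ν)
      = (powBase (inner ℝ ζ e) ^ (-z) * Gamma z) * charInt ν Θ s ζ := by
    rw [charInt, ← integral_cpow_mul_exp_neg_mul hz0 (r := powBase (inner ℝ ζ e))
      (by rw [powBase_re]; exact one_pos), ← integral_prod_mul]
    refine integral_congr_ae (Eventually.of_forall fun q => ?_)
    simp only
    have : (Real.fourierChar (inner ℝ ζ (Θ (s, q.2) + q.1 • e)) : ℂ) =
        (Real.fourierChar (inner ℝ ζ (Θ (s, q.2))) : ℂ) *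
          exp (2 * Real.pi * (q.1 * inner ℝ ζ e) * I) := by
      rw [inner_add_right, AddChar.map_add_eq_mul, Circle.coe_mul, real_inner_smul_right,
        Real.fourierChar_apply (q.1 * _)]
      push_cast; rfl
    rw [this, powBase]
    have h2 : exp (-((1 - 2 * Real.pi * (inner ℝ ζ e : ℝ) * I) * q.1)) =
        exp (-((1 : ℂ) * q.1)) * exp (2 * Real.pi * (q.1 * (inner ℝ ζ e : ℝ)) * I) := by
      rw [← Complex.exp_add]; congr 1; ring
    rw [h2]; ring
  rw [key, pairing]
  field_simp

/-- The hypothesis says that surface measure smeared along `e` has density at most `C`. After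
Tonelli the inner integral is at most `C ∫ F` by translation invariance, for every `x`. -/
theorem lintegral_translates_le [SFinite ν] (hΘ : Measurable Θ) {C : ℝ≥0∞}
    (hC : ∀ s, ∀ F : E → ℝ≥0∞, Measurable F →
      ∫⁻ y, (∫⁻ u : ℝ, F (Θ (s, y) + u • e)) ∂ν ≤ C * ∫⁻ x, F x)
    {F H : E → ℝ≥0∞} (hF : Measurable F) (hH : Measurable H) (s : S) :
    ∫⁻ q : ℝ × Y, (∫⁻ x, F (x + (Θ (s, q.2) + q.1 • e)) * H x) ∂((volume.restrict (Ioi 0)).prod ν) ≤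
      C * (∫⁻ x, F x) * ∫⁻ x, H x := by
  have hΘs : Measurable fun y => Θ (s, y) := hΘ.comp measurable_prodMk_left
  have hV : Measurable fun q : ℝ × Y => Θ (s, q.2) + q.1 • e :=
    (hΘs.comp measurable_snd).add (by fun_prop)
  have hm : Measurable fun r : (ℝ × Y) × E => F (r.2 + (Θ (s, r.1.2) + r.1.1 • e)) :=
    hF.comp (measurable_snd.add (hV.comp measurable_fst))
  rw [lintegral_lintegral_swap (hm.mul (hH.comp measurable_snd)).aemeasurable,
    ← lintegral_const_mul _ hH]
  refine lintegral_mono fun x => ?_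
  have hmx : Measurable fun q : ℝ × Y => F (x + (Θ (s, q.2) + q.1 • e)) :=
    hF.comp (hV.const_add x)
  rw [lintegral_mul_const _ hmx]
  gcongr
  calc ∫⁻ q : ℝ × Y, F (x + (Θ (s, q.2) + q.1 • e)) ∂((volume.restrict (Ioi 0)).prod ν)
      ≤ ∫⁻ q : ℝ × Y, F (x + (Θ (s, q.2) + q.1 • e)) ∂(volume.prod ν) :=
        lintegral_mono' (Measure.prod_mono Measure.restrict_le_self le_rfl) le_rfl
    _ = ∫⁻ y, (∫⁻ u : ℝ, F (x + (Θ (s, y) + u • e))) ∂ν := lintegral_prod_symm _ hmx.aemeasurable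
    _ ≤ C * ∫⁻ v, F (x + v) := hC s (fun v => F (x + v)) (hF.comp (measurable_const_add x))
    _ = C * ∫⁻ v, F v := by rw [lintegral_add_left_eq_self]

/-- The `L¹` estimate. -/
theorem enorm_form_le_of_re_eq_one [SFinite σ] [IsFiniteMeasure ν] (hΘ : Measurable Θ) {C : ℝ≥0∞}
    (hC : ∀ s, ∀ F : E → ℝ≥0∞, Measurable F →
      ∫⁻ y, (∫⁻ u : ℝ, F (Θ (s, y) + u • e)) ∂ν ≤ C * ∫⁻ x, F x)
    {z : ℂ} (hz : z.re = 1) (hfm : StronglyMeasurable f) (hf : Integrable f) (hf2 : MemLp f 2)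
    (hg : StronglyMeasurable g) (hg1 : Integrable g (σ.prod volume))
    (hg2 : MemLp g 2 (σ.prod volume))
    (hint : Integrable (fun p : S × E => powBase (inner ℝ p.2 e) ^ (-z) * pairing ν Θ f g p)
      (σ.prod volume)) :
    ‖form σ ν Θ e z f g‖ₑ ≤ ‖(Gamma z)⁻¹‖ₑ * (C * (∫⁻ x, ‖f x‖ₑ) * ∫⁻ p, ‖g p‖ₑ ∂(σ.prod volume)) := by
  rw [form, integral_prod _ hint, lintegral_prod _ hg.enorm.aemeasurable,
    ← lintegral_const_mul _ hg.enorm.lintegral_prod_right', ← lintegral_const_mul]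
  swap
  · exact hg.enorm.lintegral_prod_right'.const_mul _
  refine (enorm_integral_le_lintegral_enorm _).trans (lintegral_mono_ae ?_)
  filter_upwards [ae_slice hg1 hg2] with s hs
  rw [integral_cpow_mul_pairing_slice hΘ hz hf hf2 hs.1 hs.2, enorm_mul]
  gcongr
  refine (enorm_integral_le_lintegral_enorm _).trans ?_
  have hgs : Measurable fun x => ‖g (s, x)‖ₑ := hg.enorm.comp measurable_prodMk_left
  refine le_trans ?_ (lintegral_translates_le hΘ hC (F := fun x => ‖f x‖ₑ) hfm.enorm hgs s)
  have hpos : ∀ᵐ q : ℝ × Y ∂((volume.restrict (Ioi 0)).prod ν), q.1 ∈ Ioi (0 : ℝ) :=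
    Measure.quasiMeasurePreserving_fst.ae (ae_restrict_mem measurableSet_Ioi)
  refine lintegral_mono_ae ?_
  filter_upwards [hpos] with q hq
  -- On `Re z = 1` the factor `u^{z-1}` is unimodular, so the only growth in `z` comes from the
  -- inverse of `Γ(z)`.
  have hk : ‖(q.1 : ℂ) ^ (z - 1) * exp (-((1 : ℂ) * q.1))‖ₑ ≤ 1 := by
    have hq' : (0 : ℝ) < q.1 := hq
    rw [← ofReal_norm, norm_cpow_sub_one_mul_exp hq', hz]
    simp [hq'.le]
  rw [enorm_mul]
  refine (mul_le_of_le_one_left' hk).trans ?_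
  refine (enorm_integral_le_lintegral_enorm _).trans (le_of_eq (lintegral_congr fun x => ?_))
  rw [enorm_mul, RCLike.enorm_conj]

end Edge

/-! ### Finite combinations of indicator functions. -/

section Interpolation

/-- Measurable functions in `L¹ ∩ L²`. -/
structure IsL1L2 {X : Type*} [MeasurableSpace X] (f : X → ℂ) (μ : Measure X) : Prop where
  meas : StronglyMeasurable f
  int : Integrable f μ
  sq : MemLp f 2 μ

theorem isL1L2_indicator {X : Type*} [MeasurableSpace X] {μ : Measure X} {A : Set X}
    (hA : MeasurableSet A) (hμ : μ A ≠ ⊤) : IsL1L2 (A.indicator fun _ => (1 : ℂ)) μ where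
  meas := stronglyMeasurable_const.indicator hA
  int := (integrable_indicator_iff hA).2 (integrableOn_const hμ)
  sq := memLp_indicator_const 2 hA 1 (Or.inr hμ)

theorem IsL1L2.sum {X ι : Type*} [MeasurableSpace X] {μ : Measure X} {I : Finset ι}
    {f : ι → X → ℂ} (hf : ∀ i ∈ I, IsL1L2 (f i) μ) (a : ι → ℂ) :
    IsL1L2 (fun x => ∑ i ∈ I, a i * f i x) μ where
  meas := Finset.stronglyMeasurable_fun_sum _ fun i hi => (hf i hi).meas.const_mul _
  int := integrable_finsetSum _ fun i hi => (hf i hi).int.const_mul _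
  sq := memLp_finsetSum _ fun i hi => (hf i hi).sq.const_mul _

variable {E : Type*} [NormedAddCommGroup E] [InnerProductSpace ℝ E] [FiniteDimensional ℝ E]
  [MeasurableSpace E] [BorelSpace E]
  {S Y : Type*} [MeasurableSpace S] [MeasurableSpace Y]

theorem fourier_finsetSum {ι : Type*} {I : Finset ι} {f : ι → E → ℂ}
    (hf : ∀ i ∈ I, Integrable (f i)) (a : ι → ℂ) (ζ : E) :
    𝓕 (fun x => ∑ i ∈ I, a i * f i x) ζ = ∑ i ∈ I, a i * 𝓕 (f i) ζ := by
  simp only [Real.fourier_eq, Circle.smul_def, smul_eq_mul, Finset.mul_sum]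
  rw [integral_finsetSum]
  · refine Finset.sum_congr rfl fun i _ => ?_
    rw [← integral_const_mul]
    refine integral_congr_ae (Eventually.of_forall fun x => ?_)
    simp only; ring
  · intro i hi
    have := (Real.fourierIntegral_convergent_iff ζ).2 ((hf i hi).const_mul (a i))
    simpa only [Circle.smul_def, smul_eq_mul] using this

variable {σ : Measure S} {ν : Measure Y} {Θ : S × Y → E} {e : E}

/-- For simple functions the `z`-dependence of the inputs sits in finitely many scalar coefficients,
so holomorphy with moving inputs reduces to that of the forms of fixed indicators. -/
theorem form_finset_sum [SFinite σ] {ι κ : Type*} {I : Finset ι} {J : Finset κ} {f : ι → E → ℂ}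
    {g : κ → S × E → ℂ} (hf : ∀ i ∈ I, IsL1L2 (f i) volume)
    (hg : ∀ j ∈ J, IsL1L2 (g j) (σ.prod volume)) (a : ι → ℂ) (b : κ → ℂ) {z : ℂ}
    (hint : ∀ i ∈ I, ∀ j ∈ J, Integrable (fun p : S × E => powBase (inner ℝ p.2 e) ^ (-z) *
      pairing ν Θ (f i) (g j) p) (σ.prod volume)) :
    form σ ν Θ e z (fun x => ∑ i ∈ I, a i * f i x) (fun p => ∑ j ∈ J, b j * g j p) =
      ∑ i ∈ I, ∑ j ∈ J, a i * (starRingEnd ℂ) (b j) * form σ ν Θ e z (f i) (g j) := by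
  simp only [form, ← integral_const_mul]
  have hI : ∀ i ∈ I, ∀ j ∈ J, Integrable (fun p : S × E => a i * (starRingEnd ℂ) (b j) *
      (powBase (inner ℝ p.2 e) ^ (-z) * pairing ν Θ (f i) (g j) p)) (σ.prod volume) :=
    fun i hi j hj => (hint i hi j hj).const_mul _
  rw [Finset.sum_congr rfl fun i hi => (integral_finsetSum J (hI i hi)).symm,
    ← integral_finsetSum I fun i hi => integrable_finsetSum J (hI i hi)]
  refine integral_congr_ae ?_
  have hslice : ∀ᵐ p : S × E ∂(σ.prod volume), ∀ j ∈ J, Integrable fun x => g j (p.1, x) := by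
    have hq : Measure.QuasiMeasurePreserving (Prod.fst : S × E → S) (σ.prod volume) σ :=
      Measure.quasiMeasurePreserving_fst
    refine hq.ae (p := fun s => ∀ j ∈ J, Integrable fun x => g j (s, x)) ?_
    exact (Finset.eventually_all J).2 fun j hj => (hg j hj).int.prod_right_ae
  filter_upwards [hslice] with p hp
  simp only [pairing]
  rw [fourier_finsetSum (fun i hi => (hf i hi).int), fourier_finsetSum hp, map_sum,
    Finset.sum_mul_sum, Finset.mul_sum, Finset.mul_sum]
  refine Finset.sum_congr rfl fun i _ => ?_
  rw [Finset.mul_sum, Finset.mul_sum]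
  refine Finset.sum_congr rfl fun j _ => ?_
  rw [map_mul]; ring

/-- Nonzero values of a simple function. -/
noncomputable def posValues {X : Type*} [MeasurableSpace X] (F : SimpleFunc X ℝ≥0) : Finset ℝ≥0 :=
  F.range.filter (· ≠ 0)

/-- The complex power of a simple function, as a combination of indicator functions. -/
theorem sum_posValues_indicator {X : Type*} [MeasurableSpace X] (F : SimpleFunc X ℝ≥0)
    (φ : ℝ≥0 → ℂ) (x : X) :
    ∑ c ∈ posValues F, φ c * (F ⁻¹' {c}).indicator (fun _ => (1 : ℂ)) x =
      if F x = 0 then 0 else φ (F x) := by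
  classical
  have h : ∀ c ∈ posValues F, φ c * (F ⁻¹' {c}).indicator (fun _ => (1 : ℂ)) x =
      if c = F x then φ (F x) else 0 := by
    intro c _
    by_cases hc : F x = c
    · simp [indicator, hc]
    · simp [indicator, hc, Ne.symm hc]
  rw [Finset.sum_congr rfl h, Finset.sum_ite_eq']
  simp [posValues, F.mem_range_self x]

theorem enorm_ite_cpow (c : ℝ≥0) {α : ℂ} (hα : 0 < α.re) :
    ‖(if c = 0 then (0 : ℂ) else (c : ℂ) ^ α)‖ₑ = (c : ℝ≥0∞) ^ α.re := by
  split_ifs with h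
  · simp [h, hα]
  · have hc : (0 : ℝ) < c := by positivity
    have : ((c : ℝ≥0) : ℂ) = ((c : ℝ) : ℂ) := rfl
    rw [this, ← ofReal_norm, norm_cpow_eq_rpow_re_of_pos hc, ← ENNReal.ofReal_rpow_of_pos hc,
      ENNReal.ofReal_coe_nnreal]

theorem isL1L2_indicator_preimage {X : Type*} [MeasurableSpace X] {μ : Measure X}
    {F : SimpleFunc X ℝ≥0} (hF : F.FinMeasSupp μ) {c : ℝ≥0} (hc : c ∈ posValues F) :
    IsL1L2 ((F ⁻¹' {c}).indicator fun _ => (1 : ℂ)) μ :=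
  isL1L2_indicator (F.measurableSet_preimage _)
    (hF.meas_preimage_singleton_ne_zero (by simpa [posValues] using (Finset.mem_filter.1 hc).2)).ne

theorem lintegral_rpow_lt_top_of_finMeasSupp {X : Type*} [MeasurableSpace X] {μ : Measure X}
    {F : SimpleFunc X ℝ≥0} (hF : F.FinMeasSupp μ) {p : ℝ} (hp : 0 < p) :
    ∫⁻ x, (F x : ℝ≥0∞) ^ p ∂μ < ⊤ := by
  have h : (fun x => (F x : ℝ≥0∞) ^ p) = F.map (fun c : ℝ≥0 => (c : ℝ≥0∞) ^ p) := rfl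
  rw [h, SimpleFunc.lintegral_eq_lintegral]
  refine SimpleFunc.FinMeasSupp.lintegral_lt_top (hF.map (by simp [hp])) ?_
  exact Eventually.of_forall fun x => by
    simp [ENNReal.rpow_eq_top_iff, hp.not_gt]

end Interpolation

/-! ### The three lines theorem under exponential growth. -/

section ThreeLines

/-- On the strip `|e^{z²}|` decays like a Gaussian in `Im z`, and completing the square shows that
it beats `e^{π|Im z|}`. -/
theorem exp_sq_growth_le {b : ℝ} (hb : 0 < b) {z : ℂ} (hz : z ∈ HadamardThreeLines.verticalClosedStrip (-b) 1) :
    ‖exp (z ^ 2)‖ * Real.exp (Real.pi * |z.im|) ≤ Real.exp (b ^ 2 + 1 + Real.pi ^ 2) := by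
  rw [norm_exp, ← Real.exp_add]
  refine Real.exp_le_exp.2 ?_
  have h1 : -b ≤ z.re := hz.1
  have h2 : z.re ≤ 1 := hz.2
  have h3 : (z ^ 2).re = z.re ^ 2 - z.im ^ 2 := by rw [sq, mul_re]; ring
  rw [h3]
  have h4 : z.re ^ 2 ≤ b ^ 2 + 1 := by
    rcases le_total 0 z.re with h | h <;> nlinarith
  nlinarith [sq_abs z.im, sq_nonneg (Real.pi - |z.im|), Real.pi_pos, abs_nonneg z.im,
    sq_nonneg Real.pi, sq_nonneg (z.im)]

/-- Three lines theorem for functions growing at most exponentially on vertical lines. -/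
theorem norm_le_of_three_lines {Λ : ℂ → ℂ} {b a a' M : ℝ} (hb : 0 < b)
    (ha0 : 0 ≤ a) (ha0' : 0 ≤ a')
    (hΛ : DiffContOnCl ℂ Λ (HadamardThreeLines.verticalStrip (-b) 1))
    (hM : ∀ z ∈ HadamardThreeLines.verticalClosedStrip (-b) 1,
      ‖Λ z‖ ≤ M * Real.exp (Real.pi * |z.im|))
    (ha : ∀ z : ℂ, z.re = -b → ‖Λ z‖ ≤ a * Real.exp (Real.pi * |z.im|))
    (ha' : ∀ z : ℂ, z.re = 1 → ‖Λ z‖ ≤ a' * Real.exp (Real.pi * |z.im|)) :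
    ‖Λ 0‖ ≤ Real.exp (b ^ 2 + 1 + Real.pi ^ 2) * (a ^ (1 - b / (1 + b)) * a' ^ (b / (1 + b))) := by
  set K := Real.exp (b ^ 2 + 1 + Real.pi ^ 2) with hK
  have hK0 : 0 < K := Real.exp_pos _
  have hmul : ∀ {z : ℂ} {c : ℝ}, 0 ≤ c → z ∈ HadamardThreeLines.verticalClosedStrip (-b) 1 →
      ‖Λ z‖ ≤ c * Real.exp (Real.pi * |z.im|) → ‖exp (z ^ 2) * Λ z‖ ≤ K * c := by
    intro z c hc hz h
    rw [norm_mul]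
    calc _ ≤ ‖exp (z ^ 2)‖ * (c * Real.exp (Real.pi * |z.im|)) := by gcongr
      _ = (‖exp (z ^ 2)‖ * Real.exp (Real.pi * |z.im|)) * c := by ring
      _ ≤ K * c := by gcongr; exact exp_sq_growth_le hb hz
  have hmem : ∀ {z : ℂ}, z.re = -b ∨ z.re = 1 →
      z ∈ HadamardThreeLines.verticalClosedStrip (-b) 1 := by
    rintro z (h | h)
    · exact ⟨h.ge, by rw [h]; linarith⟩
    · exact ⟨by rw [h]; linarith, h.le⟩
  have hM0 : 0 ≤ M := by
    have := (norm_nonneg _).trans (hM 0 ⟨by simp [hb.le], by simp⟩)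
    simpa using this
  have h0 : (0 : ℂ) ∈ HadamardThreeLines.verticalClosedStrip (-b) 1 := ⟨by simp [hb.le], by simp⟩
  -- The damped function `e^{z²} Λ z` is bounded on the strip and agrees with `Λ` at `0`, which lies
  -- at the fraction `b / (1 + b)` of the way from `-b` to `1`.
  have key := HadamardThreeLines.norm_le_interp_of_mem_verticalClosedStrip'
    (f := fun z => exp (z ^ 2) * Λ z) (z := 0) (a := K * a) (b := K * a') (l := -b) (u := 1)
    (by linarith) h0 ?_ ?_ ?_ ?_
  · have ht : (((0 : ℂ).re - -b) / (1 - -b)) = b / (1 + b) := by simp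
    rw [ht] at key
    simp only [ne_eq, OfNat.ofNat_ne_zero, not_false_eq_true, zero_pow, exp_zero, one_mul] at key
    refine key.trans (le_of_eq ?_)
    rw [Real.mul_rpow hK0.le ha0, Real.mul_rpow hK0.le ha0']
    have : K ^ (1 - b / (1 + b)) * K ^ (b / (1 + b)) = K := by
      rw [← Real.rpow_add hK0]; simp
    calc _ = (K ^ (1 - b / (1 + b)) * K ^ (b / (1 + b))) *
        (a ^ (1 - b / (1 + b)) * a' ^ (b / (1 + b))) := by ring
      _ = _ := by rw [this]
  · have : Differentiable ℂ fun z : ℂ => exp (z ^ 2) := by fun_prop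
    exact this.diffContOnCl.smul hΛ
  · refine ⟨K * M, ?_⟩
    rintro _ ⟨z, hz, rfl⟩
    exact hmul hM0 hz (hM z hz)
  · intro z hz
    exact hmul ha0 (hmem (Or.inl hz)) (ha z hz)
  · intro z hz
    exact hmul ha0' (hmem (Or.inr hz)) (ha' z hz)

end ThreeLines

/-! ### Stein interpolation for simple functions. -/

section Bilinear

variable {E : Type*} [NormedAddCommGroup E] [InnerProductSpace ℝ E] [FiniteDimensional ℝ E]
  [MeasurableSpace E] [BorelSpace E]
  {S Y : Type*} [MeasurableSpace S] [MeasurableSpace Y]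
  {σ : Measure S} {ν : Measure Y} {Θ : S × Y → E} {e : E}

/-- The `L²` edge: the modulus of the power is dominated by the weight of exponent `b`, so the
weighted Cauchy–Schwarz estimate applies, up to the growth factor in `Im z`. -/
theorem enorm_form_le_left [SFinite σ] [IsFiniteMeasure ν] (hΘ : Measurable Θ) {b : ℝ} {C : ℝ≥0}
    (hC : ∀ ζ, ENNReal.ofReal (‖powBase (inner ℝ ζ e)‖ ^ b) ^ 2 *
      ∫⁻ s, ‖charInt ν Θ s ζ‖ₑ ^ 2 ∂σ ≤ C) {f : E → ℂ} {g : S × E → ℂ}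
    (hf : IsL1L2 f volume) (hg : IsL1L2 g (σ.prod volume)) {z : ℂ} (hz : -b ≤ z.re) :
    ‖form σ ν Θ e z f g‖ₑ ≤ ENNReal.ofReal (Real.exp (Real.pi * |z.im|)) *
      ((C : ℝ≥0∞) ^ (1 / 2 : ℝ) * (∫⁻ x, ‖f x‖ₑ ^ 2) ^ (1 / 2 : ℝ) *
        (∫⁻ p, ‖g p‖ₑ ^ 2 ∂(σ.prod volume)) ^ (1 / 2 : ℝ)) := by
  have hmeas : Continuous fun ζ : E => ‖powBase (inner ℝ ζ e)‖ ^ b :=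
    ((continuous_powBase.comp (by fun_prop)).norm).rpow_const
      fun ζ => Or.inl (norm_ne_zero_iff.2 (powBase_ne_zero _))
  refine (enorm_integral_le_lintegral_enorm _).trans (le_trans ?_ (mul_le_mul_right
    (lintegral_weight_mul_pairing_le (ν := ν) hΘ (w := fun ζ => ENNReal.ofReal
      (‖powBase (inner ℝ ζ e)‖ ^ b)) hmeas.measurable.ennreal_ofReal hC hf.int hf.sq hg.meas
      hg.int hg.sq) _))
  rw [← lintegral_const_mul]
  · refine lintegral_mono fun p => ?_
    have := norm_cpow_mul_pairing_le (ν := ν) (Θ := Θ) (f := f) (g := g) (e := e) hz p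
    rw [← ofReal_norm, ← ofReal_norm, ← ENNReal.ofReal_mul (by positivity),
      ← ENNReal.ofReal_mul (by positivity)]
    exact ENNReal.ofReal_le_ofReal this
  · exact (hmeas.measurable.ennreal_ofReal.comp measurable_snd).mul
      (stronglyMeasurable_pairing hΘ hf.int hg.meas).enorm

theorem lintegral_triple_lt_top [SFinite σ] [IsFiniteMeasure ν] (Θ : S × Y → E)
    (F : SimpleFunc E ℝ≥0) (G : SimpleFunc (S × E) ℝ≥0) (hG : G.FinMeasSupp (σ.prod volume)) :
    ∫⁻ s, (∫⁻ y, (∫⁻ x, (F (x + Θ (s, y)) : ℝ≥0∞) * G (s, x)) ∂ν) ∂σ < ⊤ := by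
  obtain ⟨M, hM⟩ : ∃ M : ℝ≥0, ∀ x, F x ≤ M := by
    obtain ⟨M, hM⟩ := F.range.exists_le
    exact ⟨M, fun x => hM _ (F.mem_range_self x)⟩
  have hGm : Measurable fun p => (G p : ℝ≥0∞) := G.measurable.coe_nnreal_ennreal
  calc ∫⁻ s, (∫⁻ y, (∫⁻ x, (F (x + Θ (s, y)) : ℝ≥0∞) * G (s, x)) ∂ν) ∂σ
      ≤ ∫⁻ s, (∫⁻ _, (∫⁻ x, (M : ℝ≥0∞) * G (s, x)) ∂ν) ∂σ := by
        gcongr with s y x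
        exact hM _
    _ = M * ν univ * ∫⁻ p, G p ∂(σ.prod volume) := by
        rw [lintegral_prod _ hGm.aemeasurable,
          ← lintegral_const_mul _ hGm.lintegral_prod_right']
        refine lintegral_congr fun s => ?_
        have := lintegral_const_mul (μ := (volume : Measure E)) (M : ℝ≥0∞)
          (hGm.comp (measurable_prodMk_left (x := s)))
        simp only [Function.comp_def] at this
        rw [lintegral_const, this]
        ring
    _ < ⊤ := by
        refine ENNReal.mul_lt_top (ENNReal.mul_lt_top ENNReal.coe_lt_top (measure_lt_top _ _)) ?_
        simpa using lintegral_rpow_lt_top_of_finMeasSupp hG one_pos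

theorem integral_triple_eq_toReal [SFinite σ] [IsFiniteMeasure ν] (hΘ : Measurable Θ)
    (F : SimpleFunc E ℝ≥0) (G : SimpleFunc (S × E) ℝ≥0) (hG : G.FinMeasSupp (σ.prod volume)) :
    ∫ s, (∫ y, (∫ x, ((F (x + Θ (s, y)) : ℝ≥0) : ℂ) * (starRingEnd ℂ) ((G (s, x) : ℝ≥0) : ℂ)) ∂ν) ∂σ =
      ((∫⁻ s, (∫⁻ y, (∫⁻ x, (F (x + Θ (s, y)) : ℝ≥0∞) * G (s, x)) ∂ν) ∂σ).toReal : ℂ) := by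
  have hm : Measurable fun q : (S × Y) × E => (F (q.2 + Θ q.1) : ℝ≥0∞) * G (q.1.1, q.2) :=
    ((F.measurable.comp (measurable_snd.add (hΘ.comp measurable_fst))).coe_nnreal_ennreal).mul
      ((G.measurable.comp (by fun_prop)).coe_nnreal_ennreal)
  have hm2 : Measurable fun q : S × Y => ∫⁻ x, (F (x + Θ q) : ℝ≥0∞) * G (q.1, x) :=
    hm.lintegral_prod_right'
  have hm3 : Measurable fun s => ∫⁻ y, (∫⁻ x, (F (x + Θ (s, y)) : ℝ≥0∞) * G (s, x)) ∂ν :=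
    hm2.lintegral_prod_right'
  have hfin := lintegral_triple_lt_top (ν := ν) Θ F G hG
  have hx : ∀ s y, ∫ x, ((F (x + Θ (s, y)) : ℝ≥0) : ℂ) * (starRingEnd ℂ) ((G (s, x) : ℝ≥0) : ℂ) =
      ((∫⁻ x, (F (x + Θ (s, y)) : ℝ≥0∞) * G (s, x)).toReal : ℂ) := by
    intro s y
    have hmx : Measurable fun x => (F (x + Θ (s, y)) : ℝ≥0∞) * G (s, x) :=
      hm.comp (measurable_prodMk_left (x := (s, y)))
    rw [← integral_toReal hmx.aemeasurable
      (Eventually.of_forall fun x => ENNReal.mul_lt_top ENNReal.coe_lt_top ENNReal.coe_lt_top),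
      ← integral_complex_ofReal]
    refine integral_congr_ae (Eventually.of_forall fun x => ?_)
    simp only [ENNReal.toReal_mul, ENNReal.coe_toReal, ofReal_mul]
    congr 1
    exact conj_ofReal _
  simp_rw [hx]
  rw [← integral_toReal hm3.aemeasurable (ae_lt_top hm3 hfin.ne), ← integral_complex_ofReal]
  refine integral_congr_ae ?_
  filter_upwards [ae_lt_top hm3 hfin.ne] with s hs
  have hmy : Measurable fun y => ∫⁻ x, (F (x + Θ (s, y)) : ℝ≥0∞) * G (s, x) :=
    hm2.comp measurable_prodMk_left
  rw [integral_complex_ofReal, integral_toReal hmy.aemeasurable (ae_lt_top hmy hs.ne)]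

/-- Complex interpolation between the `L²` edge `Re z = -d/2` and the `L¹` edge `Re z = 1`, with the
inputs replaced by their powers of exponent `α z`. At `z = 0` the form is the pairing of the average
of `F` with `G`. -/
theorem simple_bilinear_estimate [SFinite σ] [IsFiniteMeasure ν] (hΘ : Measurable Θ)
    {d b : ℝ} (hd : 0 < d) (hb : b = d / 2) {C₁ C₂ : ℝ≥0}
    (h1 : ∀ s, ∀ F : E → ℝ≥0∞, Measurable F →
      ∫⁻ y, (∫⁻ u : ℝ, F (Θ (s, y) + u • e)) ∂ν ≤ C₁ * ∫⁻ x, F x)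
    (h2 : ∀ ζ, ENNReal.ofReal (‖powBase (inner ℝ ζ e)‖ ^ b) ^ 2 *
      ∫⁻ s, ‖charInt ν Θ s ζ‖ₑ ^ 2 ∂σ ≤ C₂)
    {F : SimpleFunc E ℝ≥0} {G : SimpleFunc (S × E) ℝ≥0} (hF : F.FinMeasSupp volume)
    (hG : G.FinMeasSupp (σ.prod volume)) {p : ℝ} (hp : p = (d + 2) / (d + 1)) :
    (∫⁻ s, (∫⁻ y, (∫⁻ x, (F (x + Θ (s, y)) : ℝ≥0∞) * G (s, x)) ∂ν) ∂σ).toReal ≤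
      Real.exp (b ^ 2 + 1 + Real.pi ^ 2) * ((((C₂ : ℝ) ^ (1 / 2 : ℝ)) ^ (1 - b / (1 + b)) *
        (C₁ : ℝ) ^ (b / (1 + b))) *
        (((∫⁻ x, (F x : ℝ≥0∞) ^ p).toReal * (∫⁻ q, (G q : ℝ≥0∞) ^ p ∂(σ.prod volume)).toReal)
          ^ (1 / p))) := by
  have hp0 : 0 < p := by rw [hp]; positivity
  have hb0 : 0 < b := by rw [hb]; positivity
  set X := ∫⁻ x, (F x : ℝ≥0∞) ^ p with hX
  set Z := ∫⁻ q, (G q : ℝ≥0∞) ^ p ∂(σ.prod volume) with hZ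
  have hXt : X < ⊤ := lintegral_rpow_lt_top_of_finMeasSupp hF hp0
  have hZt : Z < ⊤ := lintegral_rpow_lt_top_of_finMeasSupp hG hp0
  -- The affine exponent with `α 0 = 1`, `Re α = p / 2` on `Re z = -d/2` and `Re α = p` on `Re z =
  -- 1`. Both edge norms of the powers are thus expressed by the integrals `X` and `Z` alone.
  set α : ℂ → ℂ := fun z => 1 + z / (d + 1 : ℝ) with hα
  have hαre : ∀ z : ℂ, (α z).re = 1 + z.re / (d + 1) := by
    intro z
    simp only [hα, add_re, one_re, div_ofReal_re]
  have hαpos : ∀ z : ℂ, -b ≤ z.re → 0 < (α z).re := by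
    intro z hz
    rw [hαre, hb] at *
    rw [← sub_pos]
    have : -(d / 2) / (d + 1) ≤ z.re / (d + 1) := by gcongr
    have h3 : 0 < 1 + -(d / 2) / (d + 1) := by
      rw [neg_div, ← sub_eq_add_neg, sub_pos, div_lt_one (by positivity)]; linarith
    linarith
  set f : ℝ≥0 → E → ℂ := fun c => (F ⁻¹' {c}).indicator fun _ => (1 : ℂ) with hf
  set g : ℝ≥0 → S × E → ℂ := fun c => (G ⁻¹' {c}).indicator fun _ => (1 : ℂ) with hg
  have hfi : ∀ c ∈ posValues F, IsL1L2 (f c) volume := fun c hc => isL1L2_indicator_preimage hF hc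
  have hgi : ∀ c ∈ posValues G, IsL1L2 (g c) (σ.prod volume) :=
    fun c hc => isL1L2_indicator_preimage hG hc
  have hP : ∀ c ∈ posValues F, ∀ c' ∈ posValues G, StronglyMeasurable (pairing ν Θ (f c) (g c')) :=
    fun c hc c' hc' => stronglyMeasurable_pairing hΘ (hfi c hc).int (hgi c' hc').meas
  have hI : ∀ c ∈ posValues F, ∀ c' ∈ posValues G,
      Integrable (fun p : S × E => ‖powBase (inner ℝ p.2 e)‖ ^ b * ‖pairing ν Θ (f c) (g c') p‖)
      (σ.prod volume) := fun c hc c' hc' =>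
    integrable_weight_mul_pairing hΘ h2 (hfi c hc).int (hfi c hc).sq (hgi c' hc').meas
      (hgi c' hc').int (hgi c' hc').sq
  -- The form is antilinear in its second argument, so the coefficients of `gz` are conjugated in
  -- advance; the double conjugate makes `Λ` holomorphic.
  set Λ : ℂ → ℂ := fun z => ∑ c ∈ posValues F, ∑ c' ∈ posValues G,
    (c : ℂ) ^ α z * (starRingEnd ℂ) ((starRingEnd ℂ) ((c' : ℂ) ^ α z)) *
      form σ ν Θ e z (f c) (g c') with hΛdef
  set fz : ℂ → E → ℂ := fun z x => ∑ c ∈ posValues F, (c : ℂ) ^ α z * f c x with hfz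
  set gz : ℂ → S × E → ℂ := fun z q =>
    ∑ c ∈ posValues G, (starRingEnd ℂ) ((c : ℂ) ^ α z) * g c q with hgz
  have hfzg : ∀ z, IsL1L2 (fz z) volume := fun z => IsL1L2.sum hfi _
  have hgzg : ∀ z, IsL1L2 (gz z) (σ.prod volume) := fun z => IsL1L2.sum hgi _
  have hΛ : ∀ z : ℂ, -b ≤ z.re → Λ z = form σ ν Θ e z (fz z) (gz z) := by
    intro z hz
    exact (form_finset_sum hfi hgi _ _ fun c hc c' hc' =>
      integrable_cpow_mul_pairing (hP c hc c' hc') (hI c hc c' hc') hz).symm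
  have hfzn : ∀ z : ℂ, -b ≤ z.re → ∀ x, ‖fz z x‖ₑ = (F x : ℝ≥0∞) ^ (α z).re := by
    intro z hz x
    rw [hfz]
    simp only [hf]
    rw [sum_posValues_indicator F (fun c => (c : ℂ) ^ α z), enorm_ite_cpow _ (hαpos z hz)]
  have hgzn : ∀ z : ℂ, -b ≤ z.re → ∀ q, ‖gz z q‖ₑ = (G q : ℝ≥0∞) ^ (α z).re := by
    intro z hz q
    rw [hgz]
    simp only [hg]
    rw [sum_posValues_indicator G (fun c => (starRingEnd ℂ) ((c : ℂ) ^ α z)),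
      ← enorm_ite_cpow _ (hαpos z hz)]
    split_ifs
    · rfl
    · exact RCLike.enorm_conj _
  have key := norm_le_of_three_lines (Λ := Λ) (b := b)
    (a := (C₂ : ℝ) ^ (1 / 2 : ℝ) * X.toReal ^ (1 / 2 : ℝ) * Z.toReal ^ (1 / 2 : ℝ))
    (a' := C₁ * X.toReal * Z.toReal)
    (M := ∑ c ∈ posValues F, ∑ c' ∈ posValues G, ((c : ℝ) + 1) ^ 2 * ((c' : ℝ) + 1) ^ 2 *
      ∫ p : S × E, ‖powBase (inner ℝ p.2 e)‖ ^ b * ‖pairing ν Θ (f c) (g c') p‖ ∂(σ.prod volume))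
    hb0 (by positivity) (by positivity) ?_ ?_ ?_ ?_
  · have hΛ0 : Λ 0 = ((∫⁻ s, (∫⁻ y, (∫⁻ x, (F (x + Θ (s, y)) : ℝ≥0∞) * G (s, x)) ∂ν) ∂σ).toReal :
        ℂ) := by
      have h0 : -b ≤ (0 : ℂ).re := by simp [hb0.le]
      have hα0 : α 0 = 1 := by simp [hα]
      have hI0 := integrable_cpow_mul_pairing (e := e) (b := b)
        (stronglyMeasurable_pairing (ν := ν) hΘ (hfzg 0).int (hgzg 0).meas)
        (integrable_weight_mul_pairing hΘ h2 (hfzg 0).int (hfzg 0).sq (hgzg 0).meas (hgzg 0).int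
          (hgzg 0).sq) h0
      rw [hΛ 0 h0, form_zero hΘ (hfzg 0).int (hfzg 0).sq (hgzg 0).int (hgzg 0).sq hI0,
        ← integral_triple_eq_toReal hΘ F G hG]
      have e1 : ∀ x, fz 0 x = ((F x : ℝ≥0) : ℂ) := by
        intro x
        rw [hfz]
        simp only [hf]
        rw [sum_posValues_indicator F (fun c => (c : ℂ) ^ α 0), hα0, cpow_one]
        split_ifs with h
        · simp [h]
        · rfl
      have e2 : ∀ q, gz 0 q = ((G q : ℝ≥0) : ℂ) := by
        intro q
        rw [hgz]
        simp only [hg]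
        rw [sum_posValues_indicator G (fun c => (starRingEnd ℂ) ((c : ℂ) ^ α 0)), hα0, cpow_one]
        split_ifs with h
        · simp [h]
        · exact conj_ofReal _
      simp only [e1, e2]
    rw [hΛ0, norm_real, Real.norm_of_nonneg ENNReal.toReal_nonneg] at key
    refine key.trans (le_of_eq ?_)
    congr 1
    set t := b / (1 + b) with ht
    -- The exponent of `X * Z` interpolates between `1/2` on the `L²` edge and `1` on the `L¹` edge.
    have ht1 : (1 / 2 : ℝ) * (1 - t) + t = 1 / p := by
      rw [ht, hb, hp]; field_simp; ring
    have hu : X.toReal * Z.toReal = X.toReal * Z.toReal := rfl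
    have hu0 : 0 ≤ X.toReal * Z.toReal := by positivity
    have ht0 : 0 < t := by rw [ht]; positivity
    have ht2 : 0 < 1 - t := by
      rw [ht, sub_pos, div_lt_one (by positivity)]; linarith
    rw [mul_assoc, ← Real.mul_rpow (by positivity) (by positivity), mul_assoc,
      Real.mul_rpow (by positivity) (by positivity), Real.mul_rpow (by positivity) hu0,
      ← Real.rpow_mul hu0, ← ht1, Real.rpow_add_of_nonneg hu0 (by positivity) ht0.le]
    ring
  · refine ⟨?_, ?_⟩
    · refine DifferentiableOn.fun_sum fun c hc => DifferentiableOn.fun_sum fun c' hc' => ?_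
      refine DifferentiableOn.mul ?_ fun z hz => (differentiableAt_form (hP c hc c' hc')
        (hI c hc c' hc') hz.1).differentiableWithinAt
      simp only [starRingEnd_self_apply]
      have hne : ∀ c : ℝ≥0, c ≠ 0 → Differentiable ℂ fun z => (c : ℂ) ^ α z := by
        intro c hc
        have : Differentiable ℂ α := by simp only [hα]; fun_prop
        exact fun z => (this z).const_cpow (Or.inl (by exact_mod_cast hc))
      exact ((hne c (by simpa [posValues] using (Finset.mem_filter.1 hc).2)).mul
        (hne c' (by simpa [posValues] using (Finset.mem_filter.1 hc').2))).differentiableOn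
    · have hcl : closure (HadamardThreeLines.verticalStrip (-b) 1) ⊆ {z | -b ≤ z.re} :=
        closure_minimal (fun z hz => le_of_lt hz.1) (isClosed_le continuous_const continuous_re)
      refine continuousOn_finsetSum _ fun c hc => continuousOn_finsetSum _ fun c' hc' => ?_
      refine ContinuousOn.mul ?_ ((continuousOn_form (hP c hc c' hc') (hI c hc c' hc')).mono hcl)
      simp only [starRingEnd_self_apply]
      have hne : ∀ c : ℝ≥0, c ≠ 0 → Continuous fun z => (c : ℂ) ^ α z := by
        intro c hc
        have : Continuous α := by simp only [hα]; fun_prop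
        exact this.const_cpow (Or.inl (by exact_mod_cast hc))
      exact ((hne c (by simpa [posValues] using (Finset.mem_filter.1 hc).2)).mul
        (hne c' (by simpa [posValues] using (Finset.mem_filter.1 hc').2))).continuousOn
  · intro z hz
    have hzb : -b ≤ z.re := hz.1
    have hz1 : z.re ≤ 1 := hz.2
    rw [Finset.sum_mul]
    refine (norm_sum_le _ _).trans (Finset.sum_le_sum fun c hc => ?_)
    rw [Finset.sum_mul]
    refine (norm_sum_le _ _).trans (Finset.sum_le_sum fun c' hc' => ?_)
    -- A crude bound from `0 < Re α ≤ 2` on the strip; the constant `M` enters only qualitatively.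
    have hn : ∀ c : ℝ≥0, c ≠ 0 → ‖(c : ℂ) ^ α z‖ ≤ ((c : ℝ) + 1) ^ 2 := by
      intro c hc
      have hc0 : (0 : ℝ) < c := by positivity
      have : ((c : ℝ≥0) : ℂ) = ((c : ℝ) : ℂ) := rfl
      rw [this, norm_cpow_eq_rpow_re_of_pos hc0, ← Real.rpow_natCast]
      have hα2 : (α z).re ≤ 2 := by
        rw [hαre]
        have : z.re / (d + 1) ≤ 1 := by
          rw [div_le_one (by positivity)]; linarith
        linarith
      calc (c : ℝ) ^ (α z).re ≤ ((c : ℝ) + 1) ^ (α z).re :=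
            Real.rpow_le_rpow hc0.le (by linarith) (hαpos z hzb).le
        _ ≤ _ := Real.rpow_le_rpow_of_exponent_le (by linarith) (by exact_mod_cast hα2)
    rw [starRingEnd_self_apply, norm_mul, norm_mul, mul_assoc (_ * _) _ (Real.exp _),
      mul_comm _ (Real.exp _)]
    gcongr
    · exact hn c (by simpa [posValues] using (Finset.mem_filter.1 hc).2)
    · exact hn c' (by simpa [posValues] using (Finset.mem_filter.1 hc').2)
    · exact norm_form_le (hP c hc c' hc') (hI c hc c' hc') hzb
  · intro z hz
    have hzb : -b ≤ z.re := hz.ge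
    rw [hΛ z hzb]
    have h := enorm_form_le_left hΘ h2 (hfzg z) (hgzg z) hzb
    have hre : (α z).re * 2 = p := by
      rw [hαre, hz, hb, hp]; field_simp; ring
    have eX : ∫⁻ x, ‖fz z x‖ₑ ^ 2 = X := by
      refine lintegral_congr fun x => ?_
      rw [hfzn z hzb, ← ENNReal.rpow_natCast, ← ENNReal.rpow_mul, ← hre]; norm_num
    have eZ : ∫⁻ q, ‖gz z q‖ₑ ^ 2 ∂(σ.prod volume) = Z := by
      refine lintegral_congr fun x => ?_
      rw [hgzn z hzb, ← ENNReal.rpow_natCast, ← ENNReal.rpow_mul, ← hre]; norm_num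
    rw [eX, eZ] at h
    have hfin : ENNReal.ofReal (Real.exp (Real.pi * |z.im|)) *
      ((C₂ : ℝ≥0∞) ^ (1 / 2 : ℝ) * X ^ (1 / 2 : ℝ) * Z ^ (1 / 2 : ℝ)) ≠ ⊤ := by
      refine ENNReal.mul_ne_top ENNReal.ofReal_ne_top (ENNReal.mul_ne_top
        (ENNReal.mul_ne_top ?_ ?_) ?_) <;>
        refine ENNReal.rpow_ne_top_of_nonneg (by norm_num) ?_
      exacts [ENNReal.coe_ne_top, hXt.ne, hZt.ne]
    have := ENNReal.toReal_mono hfin h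
    rw [toReal_enorm] at this
    refine this.trans (le_of_eq ?_)
    rw [ENNReal.toReal_mul, ENNReal.toReal_ofReal (Real.exp_pos _).le, ENNReal.toReal_mul,
      ENNReal.toReal_mul, ← ENNReal.toReal_rpow, ← ENNReal.toReal_rpow, ← ENNReal.toReal_rpow,
      ENNReal.coe_toReal]
    ring
  · intro z hz
    have hzb : -b ≤ z.re := by rw [hz]; linarith
    rw [hΛ z hzb]
    have hI1 := integrable_cpow_mul_pairing (e := e) (b := b)
        (stronglyMeasurable_pairing (ν := ν) hΘ (hfzg z).int (hgzg z).meas)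
        (integrable_weight_mul_pairing hΘ h2 (hfzg z).int (hfzg z).sq (hgzg z).meas (hgzg z).int
          (hgzg z).sq) hzb
    have h := enorm_form_le_of_re_eq_one hΘ h1 hz (hfzg z).meas (hfzg z).int (hfzg z).sq
      (hgzg z).meas (hgzg z).int (hgzg z).sq hI1
    have hre : (α z).re = p := by
      rw [hαre, hz, hp]; field_simp; ring
    have eX : ∫⁻ x, ‖fz z x‖ₑ = X := lintegral_congr fun x => by rw [hfzn z hzb, hre]
    have eZ : ∫⁻ q, ‖gz z q‖ₑ ∂(σ.prod volume) = Z :=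
      lintegral_congr fun x => by rw [hgzn z hzb, hre]
    rw [eX, eZ] at h
    have hfin : ‖(Gamma z)⁻¹‖ₑ * (C₁ * X * Z) ≠ ⊤ :=
      ENNReal.mul_ne_top enorm_ne_top (ENNReal.mul_ne_top
        (ENNReal.mul_ne_top ENNReal.coe_ne_top hXt.ne) hZt.ne)
    have := ENNReal.toReal_mono hfin h
    rw [toReal_enorm] at this
    refine this.trans ?_
    rw [ENNReal.toReal_mul, toReal_enorm, ENNReal.toReal_mul, ENNReal.toReal_mul,
      ENNReal.coe_toReal, norm_inv, mul_comm]
    gcongr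
    exact norm_Gamma_inv_le hz

end Bilinear

/-! ### Monotone approximation and the converse of Hölder's inequality. -/

section Duality

theorem exists_simpleFunc_approx {X : Type*} [MeasurableSpace X] (μ : Measure X) [SigmaFinite μ]
    {F : X → ℝ≥0∞} (hF : Measurable F) :
    ∃ f : ℕ → SimpleFunc X ℝ≥0, (∀ n, (f n).FinMeasSupp μ) ∧
      (Monotone fun n x => (f n x : ℝ≥0∞)) ∧ ∀ x, ⨆ n, (f n x : ℝ≥0∞) = F x := by
  set f : ℕ → SimpleFunc X ℝ≥0 := fun n =>
    ((SimpleFunc.eapprox F n).map ENNReal.toNNReal).restrict (spanningSets μ n) with hf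
  have hval : ∀ n x, (f n x : ℝ≥0∞) =
      (spanningSets μ n).indicator (fun x => SimpleFunc.eapprox F n x) x := by
    intro n x
    rw [hf]
    simp only
    rw [SimpleFunc.restrict_apply _ (measurableSet_spanningSets μ n)]
    by_cases hx : x ∈ spanningSets μ n
    · rw [indicator_of_mem hx, indicator_of_mem hx, SimpleFunc.map_apply,
        ENNReal.coe_toNNReal (SimpleFunc.eapprox_lt_top F n x).ne]
    · simp [indicator_of_notMem hx]
  have hmono : Monotone fun n x => (f n x : ℝ≥0∞) := by
    intro n m hnm x
    simp only [hval]
    refine (indicator_le_indicator_of_subset (monotone_spanningSets μ hnm) (by simp) x).trans ?_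
    exact indicator_le_indicator (SimpleFunc.monotone_eapprox F hnm x)
  refine ⟨f, fun n => ?_, hmono, fun x => ?_⟩
  · rw [SimpleFunc.finMeasSupp_iff_support]
    refine lt_of_le_of_lt (measure_mono ?_) (measure_spanningSets_lt_top μ n)
    intro x hx
    by_contra h
    refine hx ?_
    have := hval n x
    rw [indicator_of_notMem h] at this
    exact_mod_cast this
  · refine le_antisymm (iSup_le fun n => ?_) ?_
    · rw [hval]
      refine (indicator_le_self _ _ _).trans ?_
      rw [← SimpleFunc.iSup_eapprox_apply hF x]
      exact le_iSup (fun n => SimpleFunc.eapprox F n x) n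
    · rw [← SimpleFunc.iSup_eapprox_apply hF x]
      refine iSup_le fun n => ?_
      have hx : x ∈ ⋃ i, spanningSets μ i := by rw [iUnion_spanningSets]; trivial
      obtain ⟨k, hk⟩ := mem_iUnion.1 hx
      refine le_trans ?_ (le_iSup _ (max n k))
      rw [hval, indicator_of_mem (monotone_spanningSets μ (le_max_right n k) hk)]
      exact SimpleFunc.monotone_eapprox F (le_max_left n k) x

/-- Converse of Hölder's inequality. -/
theorem lintegral_rpow_le_of_forall_simpleFunc {X : Type*} [MeasurableSpace X] {μ : Measure X}
    [SigmaFinite μ] {p q : ℝ} (hpq : p.HolderConjugate q) {H : X → ℝ≥0∞} (hH : Measurable H)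
    {B : ℝ≥0∞} (hB : ∀ G : SimpleFunc X ℝ≥0, G.FinMeasSupp μ →
      ∫⁻ x, H x * G x ∂μ ≤ B * (∫⁻ x, (G x : ℝ≥0∞) ^ p ∂μ) ^ (1 / p)) :
    ∫⁻ x, H x ^ q ∂μ ≤ B ^ q := by
  have hq0 : 0 < q := hpq.symm.pos
  obtain ⟨f, hfin, hmono, hsup⟩ := exists_simpleFunc_approx μ hH
  have hlim : ∫⁻ x, H x ^ q ∂μ = ⨆ n, ∫⁻ x, (f n x : ℝ≥0∞) ^ q ∂μ := by
    rw [← lintegral_iSup (fun n => (f n).measurable.coe_nnreal_ennreal.pow_const q)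
      fun n m hnm x => ENNReal.rpow_le_rpow (hmono hnm x) hq0.le]
    refine lintegral_congr fun x => ?_
    rw [← hsup x]
    exact (ENNReal.orderIsoRpow q hq0).map_iSup _
  rw [hlim]
  refine iSup_le fun n => ?_
  set I := ∫⁻ x, (f n x : ℝ≥0∞) ^ q ∂μ with hI
  have hIfin : I < ⊤ := lintegral_rpow_lt_top_of_finMeasSupp (hfin n) hq0
  rcases eq_or_ne I 0 with h0 | h0
  · rw [h0]; exact zero_le
  have hq1 : 0 < q - 1 := by linarith [hpq.symm.lt]
  -- The extremal function of Hölder's inequality: `(q - 1) p = q`, so the `p`-th power of `G`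
  -- integrates to `I`.
  set G : SimpleFunc X ℝ≥0 := (f n).map fun c => c ^ (q - 1) with hG
  have hGn : ∀ x, (G x : ℝ≥0∞) = (f n x : ℝ≥0∞) ^ (q - 1) := fun x => by
    rw [hG, SimpleFunc.map_apply, ENNReal.coe_rpow_of_nonneg _ hq1.le]
  have h := hB G ((hfin n).map (by simp [hq1.ne']))
  have e1 : ∫⁻ x, (G x : ℝ≥0∞) ^ p ∂μ = I := by
    refine lintegral_congr fun x => ?_
    rw [hGn, ← ENNReal.rpow_mul, hpq.symm.sub_one_mul_conj]
  have e2 : I ≤ ∫⁻ x, H x * G x ∂μ := by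
    refine lintegral_mono fun x => ?_
    rw [hGn]
    calc (f n x : ℝ≥0∞) ^ q = (f n x : ℝ≥0∞) * (f n x : ℝ≥0∞) ^ (q - 1) := by
          nth_rewrite 2 [← ENNReal.rpow_one (f n x : ℝ≥0∞)]
          rw [← ENNReal.rpow_add_of_nonneg _ _ zero_le_one hq1.le]; ring_nf
      _ ≤ _ := by
          gcongr
          rw [← hsup x]; exact le_iSup (fun n => (f n x : ℝ≥0∞)) n
  rw [e1] at h
  have h3 := e2.trans h
  -- Dividing by `I ^ (1 / p)` is legitimate only because `I` is finite and nonzero; this is why `H`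
  -- is first replaced by the approximants `f n`.
  have h4 : I ^ (1 / q) ≤ B := by
    have : I ^ (1 / q) * I ^ (1 / p) = I := by
      rw [← ENNReal.rpow_add _ _ h0 hIfin.ne, one_div, one_div, add_comm, hpq.inv_add_inv_eq_one,
        ENNReal.rpow_one]
    nth_rewrite 1 [← this] at h3
    refine (ENNReal.mul_le_mul_iff_left ?_ ?_).1 h3
    · simp [h0, hIfin.ne]
    · exact ENNReal.rpow_ne_top_of_nonneg (by simpa using hpq.pos.le) hIfin.ne
  calc I = (I ^ (1 / q)) ^ q := by
        rw [← ENNReal.rpow_mul]; simp [hq0.ne']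
    _ ≤ B ^ q := ENNReal.rpow_le_rpow h4 hq0.le

end Duality

/-! ### The abstract averaging estimate. -/

section Core

variable {E : Type*} [NormedAddCommGroup E] [InnerProductSpace ℝ E] [FiniteDimensional ℝ E]
  [MeasurableSpace E] [BorelSpace E]
  {S Y : Type*} [MeasurableSpace S] [MeasurableSpace Y]
  {σ : Measure S} {ν : Measure Y} {Θ : S × Y → E} {e : E}

theorem measurable_average [SFinite ν] (hΘ : Measurable Θ) {F : E → ℝ≥0∞} (hF : Measurable F) :
    Measurable fun p : S × E => ∫⁻ y, F (p.2 + Θ (p.1, y)) ∂ν := by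
  have : Measurable fun q : (S × E) × Y => F (q.1.2 + Θ (q.1.1, q.2)) := by
    refine hF.comp (Measurable.add (by fun_prop) (hΘ.comp (by fun_prop)))
  exact this.lintegral_prod_right'

theorem lintegral_average_mul [SFinite σ] [SFinite ν] (hΘ : Measurable Θ) {F : E → ℝ≥0∞}
    (hF : Measurable F) {G : S × E → ℝ≥0∞} (hG : Measurable G) :
    ∫⁻ p : S × E, (∫⁻ y, F (p.2 + Θ (p.1, y)) ∂ν) * G p ∂(σ.prod volume) =
      ∫⁻ s, (∫⁻ y, (∫⁻ x, F (x + Θ (s, y)) * G (s, x)) ∂ν) ∂σ := by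
  have hprod : Measurable fun p : S × E => (∫⁻ y, F (p.2 + Θ (p.1, y)) ∂ν) * G p :=
    (measurable_average hΘ hF).mul hG
  rw [lintegral_prod _ hprod.aemeasurable]
  refine lintegral_congr fun s => ?_
  have hV : Measurable fun y => Θ (s, y) := hΘ.comp measurable_prodMk_left
  have hm : Measurable fun q : Y × E => F (q.2 + Θ (s, q.1)) :=
    hF.comp (measurable_snd.add (hV.comp measurable_fst))
  have hGs : Measurable fun x => G (s, x) := hG.comp measurable_prodMk_left
  rw [lintegral_lintegral_swap (hm.mul (hGs.comp measurable_snd)).aemeasurable]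
  refine lintegral_congr fun x => ?_
  have hmx : Measurable fun y => F (x + Θ (s, y)) := hF.comp (hV.const_add x)
  rw [lintegral_mul_const _ hmx]

/-- Averaging operators with `L²` smoothing of order `d / 2` and a bounded density after
averaging in one direction are bounded from `L^((d+2)/(d+1))` to `L^(d+2)`. -/
theorem exists_lintegral_average_rpow_le [SigmaFinite σ] [IsFiniteMeasure ν] (hΘ : Measurable Θ)
    {d : ℕ} (hd : 0 < d) {C₁ C₂ : ℝ≥0}
    (h1 : ∀ s, ∀ F : E → ℝ≥0∞, Measurable F →
      ∫⁻ y, (∫⁻ u : ℝ, F (Θ (s, y) + u • e)) ∂ν ≤ C₁ * ∫⁻ x, F x)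
    (h2 : ∀ ζ, ENNReal.ofReal ((1 + |inner ℝ ζ e|) ^ d) *
      ∫⁻ s, ‖charInt ν Θ s ζ‖ₑ ^ 2 ∂σ ≤ C₂) :
    ∃ C : ℝ≥0, ∀ F : E → ℝ≥0∞, Measurable F →
      ∫⁻ p : S × E, (∫⁻ y, F (p.2 + Θ (p.1, y)) ∂ν) ^ ((d : ℝ) + 2) ∂(σ.prod volume) ≤
        C * (∫⁻ x, F x ^ (((d : ℝ) + 2) / ((d : ℝ) + 1))) ^ ((d : ℝ) + 1) := by
  have hd0 : (0 : ℝ) < d := by exact_mod_cast hd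
  set p : ℝ := ((d : ℝ) + 2) / ((d : ℝ) + 1) with hp
  set q : ℝ := (d : ℝ) + 2 with hq
  have hp0 : 0 < p := by positivity
  have hq0 : 0 < q := by positivity
  have hpq : p.HolderConjugate q := by
    rw [Real.holderConjugate_iff]
    refine ⟨?_, ?_⟩
    · rw [hp, one_lt_div (by positivity)]; linarith
    · rw [hp, hq]; field_simp; ring
  set b : ℝ := d / 2 with hb
  -- The squared weight of exponent `b = d / 2` is a full `d`-th power, bounded through `‖powBase η‖
  -- ≤ 7 (1 + |η|)`.
  have h2' : ∀ ζ, ENNReal.ofReal (‖powBase (inner ℝ ζ e)‖ ^ b) ^ 2 *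
      ∫⁻ s, ‖charInt ν Θ s ζ‖ₑ ^ 2 ∂σ ≤ ((7 ^ d * C₂ : ℝ≥0) : ℝ≥0∞) := by
    intro ζ
    have h3 : ENNReal.ofReal (‖powBase (inner ℝ ζ e)‖ ^ b) ^ 2 ≤
        ENNReal.ofReal (7 ^ d) * ENNReal.ofReal ((1 + |inner ℝ ζ e|) ^ d) := by
      rw [← ENNReal.ofReal_pow (by positivity), ← ENNReal.ofReal_mul (by positivity)]
      refine ENNReal.ofReal_le_ofReal ?_
      rw [← mul_pow, ← Real.rpow_natCast, ← Real.rpow_mul (norm_nonneg _), hb]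
      have : (d : ℝ) / 2 * ((2 : ℕ) : ℝ) = d := by push_cast; ring
      rw [this, Real.rpow_natCast]
      gcongr
      exact norm_powBase_le _
    calc _ ≤ (ENNReal.ofReal (7 ^ d) * ENNReal.ofReal ((1 + |inner ℝ ζ e|) ^ d)) *
          ∫⁻ s, ‖charInt ν Θ s ζ‖ₑ ^ 2 ∂σ := by gcongr
      _ ≤ ENNReal.ofReal (7 ^ d) * C₂ := by rw [mul_assoc]; gcongr; exact h2 ζ
      _ = _ := by
        push_cast
        rw [ENNReal.ofReal_pow (by norm_num)]
        norm_num
  set K : ℝ := Real.exp (b ^ 2 + 1 + Real.pi ^ 2) *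
    (((((7 ^ d * C₂ : ℝ≥0) : ℝ) ^ (1 / 2 : ℝ)) ^ (1 - b / (1 + b)) *
        (C₁ : ℝ) ^ (b / (1 + b)))) with hK
  have hK0 : 0 ≤ K := by positivity
  have hsimple : ∀ (F : SimpleFunc E ℝ≥0) (G : SimpleFunc (S × E) ℝ≥0), F.FinMeasSupp volume →
      G.FinMeasSupp (σ.prod volume) →
      ∫⁻ r : S × E, (∫⁻ y, (F (r.2 + Θ (r.1, y)) : ℝ≥0∞) ∂ν) * G r ∂(σ.prod volume) ≤
        ENNReal.ofReal K * ((∫⁻ x, (F x : ℝ≥0∞) ^ p) ^ (1 / p) *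
          (∫⁻ r, (G r : ℝ≥0∞) ^ p ∂(σ.prod volume)) ^ (1 / p)) := by
    intro F G hF hG
    have h := simple_bilinear_estimate hΘ hd0 hb h1 h2' hF hG hp
    rw [lintegral_average_mul hΘ F.measurable.coe_nnreal_ennreal G.measurable.coe_nnreal_ennreal,
      ← ENNReal.ofReal_toReal (lintegral_triple_lt_top Θ F G hG).ne]
    refine (ENNReal.ofReal_le_ofReal h).trans (le_of_eq ?_)
    have hX := lintegral_rpow_lt_top_of_finMeasSupp hF hp0
    have hZ := lintegral_rpow_lt_top_of_finMeasSupp hG hp0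
    rw [← mul_assoc, ← hK, ENNReal.ofReal_mul hK0, ← ENNReal.mul_rpow_of_nonneg _ _ (by positivity),
      ← ENNReal.toReal_mul, ENNReal.toReal_rpow, ENNReal.ofReal_toReal]
    exact ENNReal.rpow_ne_top_of_nonneg (by positivity) (ENNReal.mul_lt_top hX hZ).ne
  refine ⟨Real.toNNReal (K ^ q), fun F hF => ?_⟩
  have hmain := lintegral_rpow_le_of_forall_simpleFunc (μ := σ.prod (volume : Measure E)) hpq
    (measurable_average (ν := ν) hΘ hF) (B := ENNReal.ofReal K * (∫⁻ x, F x ^ p) ^ (1 / p)) ?_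
  · refine hmain.trans (le_of_eq ?_)
    rw [ENNReal.mul_rpow_of_nonneg _ _ hq0.le, ← ENNReal.rpow_mul,
      ENNReal.ofReal_rpow_of_nonneg hK0 hq0.le]
    congr 2
    rw [hp, hq]; field_simp
  -- The bilinear estimate is available for simple `F` only; monotone convergence in the inner
  -- average and then in the pairing removes this restriction.
  · intro G hG
    obtain ⟨f, hfin, hmono, hsup⟩ := exists_simpleFunc_approx (volume : Measure E) hF
    have hlim : ∀ r : S × E, ∫⁻ y, F (r.2 + Θ (r.1, y)) ∂ν =
        ⨆ n, ∫⁻ y, (f n (r.2 + Θ (r.1, y)) : ℝ≥0∞) ∂ν := by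
      intro r
      simp_rw [← hsup]
      refine lintegral_iSup (fun n => ?_) fun n m hnm y => hmono hnm _
      have hV : Measurable fun y => Θ (r.1, y) := hΘ.comp measurable_prodMk_left
      exact (f n).measurable.coe_nnreal_ennreal.comp (hV.const_add _)
    simp_rw [hlim, ENNReal.iSup_mul]
    have hmeas : ∀ n, Measurable fun r : S × E =>
        (∫⁻ y, (f n (r.2 + Θ (r.1, y)) : ℝ≥0∞) ∂ν) * G r := fun n => (measurable_average hΘ
      (f n).measurable.coe_nnreal_ennreal).mul G.measurable.coe_nnreal_ennreal
    rw [lintegral_iSup hmeas]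
    · refine iSup_le fun n => (hsimple (f n) G (hfin n) hG).trans ?_
      rw [mul_assoc]
      gcongr with x
      rw [← hsup x]; exact le_iSup (fun n => (f n x : ℝ≥0∞)) n
    · intro n m hnm r
      exact mul_le_mul_left (lintegral_mono fun y => hmono hnm _) _

end Core

/-! ### Smooth dependence of an integral on parameters. -/

section ParametricIntegral

variable {P F : Type*} [NormedAddCommGroup P] [NormedSpace ℝ P]
  [NormedAddCommGroup F] [NormedSpace ℝ F] [CompleteSpace F]

/-- The integral is the value at `0` of the convolution of the indicator of `(0, 1]` with `u ↦ h (p,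
-u)`, cut off by a bump equal to `1` on `[-2, 2]`. Smoothness in `p` is then that of convolutions
with parameters. -/
theorem contDiff_integral_zero_one {h : P × ℝ → F} (hh : ContDiff ℝ ∞ h) :
    ContDiff ℝ ∞ (fun p => ∫ u in (0 : ℝ)..1, h (p, u)) := by
  let b : ContDiffBump (0 : ℝ) := ⟨2, 3, by norm_num, by norm_num⟩
  let f : ℝ → ℝ := (Ioc (0 : ℝ) 1).indicator 1
  let g : P → ℝ → F := fun p x => b x • h (p, -x)
  have hf : LocallyIntegrable f volume :=
    ((integrable_indicator_iff measurableSet_Ioc).2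
      (integrableOn_const (by simp) (by simp))).locallyIntegrable
  have hg : ContDiff ℝ ∞ (Function.uncurry g) := by
    have h1 : ContDiff ℝ ∞ (fun q : P × ℝ => b q.2) := b.contDiff.comp contDiff_snd
    exact h1.smul (hh.comp (contDiff_fst.prodMk contDiff_snd.neg))
  have key := contDiffOn_convolution_right_with_param_comp (n := ⊤) (μ := volume)
    (ContinuousLinearMap.lsmul ℝ ℝ : ℝ →L[ℝ] F →L[ℝ] F) (v := fun _ : P => (0 : ℝ))
    (contDiffOn_const) isOpen_univ (isCompact_closedBall (0 : ℝ) 3) (g := g)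
    (fun p x _ hx => by
      have : b x = 0 := b.zero_of_le_dist (by
        simp only [Metric.mem_closedBall, not_le] at hx; exact hx.le)
      simp [g, this]) hf hg.contDiffOn
  rw [contDiffOn_univ] at key
  convert key using 2 with p
  rw [intervalIntegral.integral_of_le zero_le_one, ← integral_indicator measurableSet_Ioc]
  unfold convolution
  congr 1
  ext u
  by_cases hu : u ∈ Ioc (0 : ℝ) 1
  · have : b (0 - u) = 1 := b.one_of_mem_closedBall (by
      simp only [Metric.mem_closedBall, dist_zero_right, Real.norm_eq_abs, zero_sub, abs_neg]
      rw [abs_of_pos hu.1]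
      exact hu.2.trans (by norm_num [b]))
    rw [zero_sub] at this
    simp [f, hu, g, this]
  · simp [f, hu]

end ParametricIntegral

/-! ### Smooth difference quotients. -/

section Quotient

variable {W E : Type*} [NormedAddCommGroup W] [NormedSpace ℝ W]
  [NormedAddCommGroup E] [NormedSpace ℝ E] [CompleteSpace E]

/-- The smooth extension of the difference quotient `(T (s, x + r w) - T (s, x)) / r` to `r = 0`. -/
noncomputable def diffQuot (T : W × E → E) (q : W × E × E × ℝ) : E :=
  ∫ u in (0 : ℝ)..1, fderiv ℝ T (q.1, q.2.1 + (u * q.2.2.2) • q.2.2.1) (0, q.2.2.1)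

/-- Joint smoothness across `r = 0` is what makes the `T T*` phases, divided by `|t - τ|`, a smooth
family up to the diagonal. -/
theorem contDiff_diffQuot {T : W × E → E} (hT : ContDiff ℝ ∞ T) :
    ContDiff ℝ ∞ (diffQuot T) := by
  apply contDiff_integral_zero_one
    (h := fun z : (W × E × E × ℝ) × ℝ => fderiv ℝ T
      (z.1.1, z.1.2.1 + (z.2 * z.1.2.2.2) • z.1.2.2.1) (0, z.1.2.2.1))
  have h1 : ContDiff ℝ ∞ (fderiv ℝ T) := hT.fderiv_right (by simp)
  refine (h1.comp (g := fderiv ℝ T) ?_).clm_apply ?_ <;> fun_prop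

theorem smul_diffQuot {T : W × E → E} (hT : ContDiff ℝ ∞ T) (s : W) (x w : E) (r : ℝ) :
    r • diffQuot T (s, x, w, r) = T (s, x + r • w) - T (s, x) := by
  have hd : ∀ u : ℝ, HasDerivAt (fun u : ℝ => T (s, x + (u * r) • w))
      (r • fderiv ℝ T (s, x + (u * r) • w) (0, w)) u := by
    intro u
    have h1 : HasFDerivAt T (fderiv ℝ T (s, x + (u * r) • w)) (s, x + (u * r) • w) :=
      (hT.differentiable (by simp) _).hasFDerivAt
    have h2 : HasDerivAt (fun u : ℝ => (s, x + (u * r) • w)) ((0 : W), r • w) u := by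
      refine (hasDerivAt_const u s).prodMk ?_
      have := (((hasDerivAt_id u).mul_const r).smul_const w).const_add x
      simpa using this
    have := h1.comp_hasDerivAt u h2
    refine this.congr_deriv ?_
    rw [← map_smul]; simp
  have hc : Continuous fun u : ℝ => r • fderiv ℝ T (s, x + (u * r) • w) (0, w) := by
    have h1 : Continuous (fderiv ℝ T) := hT.continuous_fderiv (by simp)
    fun_prop
  have := intervalIntegral.integral_eq_sub_of_hasDerivAt (a := 0) (b := 1)
    (fun u _ => hd u) (hc.intervalIntegrable _ _)
  simp only [one_mul, zero_mul, zero_smul, add_zero] at this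
  rw [← this, diffQuot, intervalIntegral.integral_smul]

theorem diffQuot_zero (T : W × E → E) (s : W) (x w : E) :
    diffQuot T (s, x, w, 0) = fderiv ℝ T (s, x) (0, w) := by
  simp [diffQuot]

end Quotient

/-! ### Nonstationary phase with parameters. -/

section NonstationaryPhase

variable {W P : Type*} [NormedAddCommGroup W] [NormedSpace ℝ W] [FiniteDimensional ℝ W]
  [MeasurableSpace W] [BorelSpace W] {μ : Measure W} [μ.IsAddHaarMeasure]
  [NormedAddCommGroup P] [NormedSpace ℝ P] [FiniteDimensional ℝ P]

/-- A smooth function which near a point is the inverse of a function not vanishing there. -/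
theorem exists_contDiff_inv_near {X : Type*} [NormedAddCommGroup X] [NormedSpace ℝ X]
    [FiniteDimensional ℝ X] {D : X → ℝ} (hD : ContDiff ℝ ∞ D) {x₀ : X} (h0 : D x₀ ≠ 0) :
    ∃ κ : X → ℝ, ContDiff ℝ ∞ κ ∧ ∀ᶠ x in 𝓝 x₀, κ x * D x = 1 := by
  have hne : ∀ᶠ x in 𝓝 x₀, D x ≠ 0 := hD.continuous.continuousAt.eventually_ne h0
  obtain ⟨ε, hε, hball⟩ := Metric.eventually_nhds_iff_ball.1 hne
  let b : ContDiffBump x₀ := ⟨ε / 4, ε / 2, by positivity, by linarith⟩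
  refine ⟨fun x => b x * (D x)⁻¹, ?_, ?_⟩
  · rw [contDiff_iff_contDiffAt]
    intro x
    by_cases hx : x ∈ Metric.ball x₀ ε
    · exact b.contDiff.contDiffAt.mul (hD.contDiffAt.inv (hball x hx))
    · have : ∀ᶠ y in 𝓝 x, b y = 0 := by
        have h1 : x ∈ (Metric.closedBall x₀ (ε / 2))ᶜ := by
          simp only [Metric.mem_ball, not_lt] at hx
          simp only [mem_compl_iff, Metric.mem_closedBall, not_le]
          linarith
        filter_upwards [Metric.isClosed_closedBall.isOpen_compl.mem_nhds h1] with y hy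
        apply b.zero_of_le_dist
        simp only [mem_compl_iff, Metric.mem_closedBall, not_le] at hy
        exact hy.le
      refine (contDiffAt_const (c := (0 : ℝ))).congr_of_eventuallyEq ?_
      filter_upwards [this] with y hy
      simp [hy]
  · filter_upwards [b.eventuallyEq_one, hne] with x hx hx'
    simp only [hx, Pi.one_apply, one_mul]
    exact inv_mul_cancel₀ hx'

theorem contDiff_cexp_phase {X : Type*} [NormedAddCommGroup X] [NormedSpace ℝ X]
    {Φ : X → ℝ} (hΦ : ContDiff ℝ ∞ Φ) (l : ℝ) :
    ContDiff ℝ ∞ (fun z => cexp (I * ((l * Φ z : ℝ) : ℂ))) := by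
  have h1 : ContDiff ℝ ∞ (fun z => ((l * Φ z : ℝ) : ℂ)) :=
    ofRealCLM.contDiff.comp (contDiff_const.mul hΦ)
  exact (contDiff_const.mul h1).cexp

theorem norm_cexp_phase (x : ℝ) : ‖cexp (I * (x : ℂ))‖ = 1 := by
  rw [mul_comm]; exact norm_exp_ofReal_mul_I x

/-- Since `κ ∂ᵥΦ = 1` on the support of `a`, one integration by parts along `v` gains a factor `1 /
l` and replaces `a` by `∂ᵥ(κ a)`, an amplitude of the same kind. The induction therefore runs over
all amplitudes at once. -/
theorem exists_pow_mul_norm_integral_phase_le {Φ : W × P → ℝ} (hΦ : ContDiff ℝ ∞ Φ)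
    {s₀ : W} {p₀ : P} {v : W} {κ : W × P → ℝ} (hκ : ContDiff ℝ ∞ κ) {ε : ℝ}
    (hinv : ∀ s ∈ Metric.closedBall s₀ ε, ∀ p ∈ Metric.closedBall p₀ ε,
      κ (s, p) * fderiv ℝ Φ (s, p) (v, 0) = 1) (N : ℕ) :
    ∀ a : W × P → ℂ, ContDiff ℝ ∞ a →
      (∀ s p, s ∉ Metric.closedBall s₀ ε → a (s, p) = 0) →
      ∃ C : ℝ, ∀ p ∈ Metric.closedBall p₀ ε, ∀ l : ℝ, 0 ≤ l →
        l ^ N * ‖∫ s, cexp (I * ((l * Φ (s, p) : ℝ) : ℂ)) * a (s, p) ∂μ‖ ≤ C := by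
  induction N with
  | zero =>
    intro a ha hsupp
    obtain ⟨M, hM⟩ := ((isCompact_closedBall s₀ ε).prod
      (isCompact_closedBall p₀ ε)).exists_bound_of_continuousOn ha.continuous.continuousOn
    refine ⟨M * μ.real (Metric.closedBall s₀ ε), fun p hp l _ => ?_⟩
    rw [pow_zero, one_mul]
    rw [← setIntegral_eq_integral_of_forall_compl_eq_zero (s := Metric.closedBall s₀ ε)
      (fun s hs => by rw [hsupp s p hs, mul_zero])]
    refine norm_setIntegral_le_of_norm_le_const measure_closedBall_lt_top ?_
    intro s hs
    rw [norm_mul, norm_cexp_phase, one_mul]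
    exact hM (s, p) ⟨hs, hp⟩
  | succ N ih =>
    intro a ha hsupp
    let a' : W × P → ℂ := fun z => fderiv ℝ (fun z => (κ z : ℂ) * a z) z (v, 0)
    have hκa : ContDiff ℝ ∞ (fun z => (κ z : ℂ) * a z) := (ofRealCLM.contDiff.comp hκ).mul ha
    have ha' : ContDiff ℝ ∞ a' :=
      (hκa.fderiv_right (m := ∞) (by simp)).clm_apply contDiff_const
    have hsupp' : ∀ s p, s ∉ Metric.closedBall s₀ ε → a' (s, p) = 0 := by
      intro s p hs
      have : (fun z => (κ z : ℂ) * a z) =ᶠ[𝓝 (s, p)] fun _ => 0 := by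
        have : ∀ᶠ z : W × P in 𝓝 (s, p), z.1 ∉ Metric.closedBall s₀ ε :=
          (continuous_fst.continuousAt (x := (s, p))).eventually
            (Metric.isClosed_closedBall.isOpen_compl.mem_nhds (x := s) hs)
        filter_upwards [this] with z hz
        rw [hsupp z.1 z.2 hz, mul_zero]
      simp only [a']
      rw [this.fderiv_eq]
      simp
    obtain ⟨C, hC⟩ := ih a' ha' hsupp'
    refine ⟨C, fun p hp l hl => ?_⟩
    have hpd : ∀ {F : Type _} [NormedAddCommGroup F] [NormedSpace ℝ F] {G : W × P → F},
        ContDiff ℝ ∞ G → ∀ s, HasFDerivAt (fun s => G (s, p))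
          ((fderiv ℝ G (s, p)).comp (ContinuousLinearMap.inl ℝ W P)) s := by
      intro F _ _ G hG s
      exact ((hG.differentiable (by simp) (s, p)).hasFDerivAt).comp s
        (hasFDerivAt_prodMk_left s p)
    let e : W → ℂ := fun s => cexp (I * ((l * Φ (s, p) : ℝ) : ℂ))
    have he : ContDiff ℝ ∞ e := (contDiff_cexp_phase hΦ l).comp (contDiff_prodMk_left p)
    have hed : ∀ s, fderiv ℝ e s v = e s * (I * l * fderiv ℝ Φ (s, p) (v, 0)) := by
      intro s
      have h1 := hpd hΦ s
      have h2 : HasFDerivAt (fun s => ((l * Φ (s, p) : ℝ) : ℂ)) _ s :=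
        ofRealCLM.hasFDerivAt.comp s (h1.const_mul l)
      have h3 := (h2.const_mul I).cexp
      have : fderiv ℝ e s = _ := h3.fderiv
      rw [this]
      simp [e]
      ring
    let g : W → ℂ := fun s => (κ (s, p) : ℂ) * a (s, p)
    have hg : ContDiff ℝ ∞ g := hκa.comp (contDiff_prodMk_left p)
    have hgd : ∀ s, fderiv ℝ g s v = a' (s, p) := by
      intro s
      have := (hpd hκa s).fderiv
      simp only [g, a']
      rw [this]
      simp
    have hgs : HasCompactSupport g :=
      HasCompactSupport.intro (isCompact_closedBall s₀ ε) fun s hs => by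
        simp [g, hsupp s p hs]
    have hcd : Continuous (fun s => fderiv ℝ g s v) :=
      (hg.continuous_fderiv (by simp)).clm_apply continuous_const
    have hce : Continuous (fun s => fderiv ℝ e s v) :=
      (he.continuous_fderiv (by simp)).clm_apply continuous_const
    have key := integral_mul_fderiv_eq_neg_fderiv_mul_of_integrable (μ := μ) (f := g) (g := e)
      (v := v)
      ((hcd.mul he.continuous).integrable_of_hasCompactSupport
        ((hgs.fderiv_apply (𝕜 := ℝ) v).mul_right))
      ((hg.continuous.mul hce).integrable_of_hasCompactSupport hgs.mul_right)
      ((hg.continuous.mul he.continuous).integrable_of_hasCompactSupport hgs.mul_right)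
      (fun s _ => hg.differentiable (by simp) s) (fun s _ => he.differentiable (by simp) s)
    have h1 : ∫ s, g s * fderiv ℝ e s v ∂μ =
        I * l * ∫ s, e s * a (s, p) ∂μ := by
      rw [← integral_const_mul]
      congr 1
      ext s
      rw [hed]
      by_cases hs : s ∈ Metric.closedBall s₀ ε
      · have := hinv s hs p hp
        have h2 : (κ (s, p) : ℂ) * (fderiv ℝ Φ (s, p) (v, 0) : ℝ) = 1 := by
          rw [← ofReal_mul, this, ofReal_one]
        simp only [g]
        linear_combination (I * l * e s * a (s, p)) * h2
      · simp [g, hsupp s p hs]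
    have h2 : ∫ s, fderiv ℝ g s v * e s ∂μ = ∫ s, e s * a' (s, p) ∂μ := by
      congr 1
      ext s
      rw [hgd, mul_comm]
    rw [h1, h2] at key
    have h3 : l * ‖∫ s, e s * a (s, p) ∂μ‖ = ‖∫ s, e s * a' (s, p) ∂μ‖ := by
      rw [← norm_neg (∫ s, e s * a' (s, p) ∂μ), ← key]
      simp [abs_of_nonneg hl]
    have := hC p hp l hl
    calc _ = l ^ N * (l * ‖∫ s, e s * a (s, p) ∂μ‖) := by rw [pow_succ]; simp only [e]; ring
      _ ≤ C := by rw [h3]; exact this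

/-- The radius depends only on where the directional derivative stays invertible, so it is fixed
before the order `N` and the amplitude. -/
theorem exists_norm_integral_phase_le {Φ : W × P → ℝ} (hΦ : ContDiff ℝ ∞ Φ)
    {s₀ : W} {p₀ : P} {v : W} (hv : fderiv ℝ (fun s => Φ (s, p₀)) s₀ v ≠ 0) :
    ∃ ε > 0, ∀ (N : ℕ) (a : W × P → ℂ), ContDiff ℝ ∞ a →
      (∀ s p, s ∉ Metric.closedBall s₀ ε → a (s, p) = 0) →
      ∃ C : ℝ, ∀ p ∈ Metric.closedBall p₀ ε, ∀ l : ℝ, 0 ≤ l →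
        (1 + l) ^ N * ‖∫ s, cexp (I * ((l * Φ (s, p) : ℝ) : ℂ)) * a (s, p) ∂μ‖ ≤ C := by
  have h1 : fderiv ℝ Φ (s₀, p₀) (v, 0) ≠ 0 := by
    have h2 := ((hΦ.differentiable (by simp) (s₀, p₀)).hasFDerivAt).comp s₀
        (hasFDerivAt_prodMk_left (𝕜 := ℝ) s₀ p₀)
    have h3 : fderiv ℝ (fun s => Φ (s, p₀)) s₀ = _ := h2.fderiv
    rw [h3] at hv
    simpa using hv
  obtain ⟨κ, hκ, hκ1⟩ := exists_contDiff_inv_near (D := fun z => fderiv ℝ Φ z (v, 0))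
    ((hΦ.fderiv_right (m := ∞) (by simp)).clm_apply contDiff_const) h1
  obtain ⟨ε, hε, hball⟩ := Metric.eventually_nhds_iff_ball.1 hκ1
  have hinv : ∀ s ∈ Metric.closedBall s₀ (ε / 2), ∀ p ∈ Metric.closedBall p₀ (ε / 2),
      κ (s, p) * fderiv ℝ Φ (s, p) (v, 0) = 1 := by
    intro s hs p hp
    apply hball
    rw [Metric.mem_ball, Prod.dist_eq, max_lt_iff]
    rw [Metric.mem_closedBall] at hs hp
    exact ⟨by simp only; linarith, by simp only; linarith⟩
  refine ⟨ε / 2, by positivity, fun N a ha hsupp => ?_⟩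
  obtain ⟨C₀, h0⟩ := exists_pow_mul_norm_integral_phase_le (μ := μ) hΦ hκ hinv 0 a ha hsupp
  obtain ⟨C₁, h1⟩ := exists_pow_mul_norm_integral_phase_le (μ := μ) hΦ hκ hinv N a ha hsupp
  -- From `(1 + l)^N ≤ 2^(N-1) (1 + l^N)` and the bounds of orders `0` and `N`.
  refine ⟨2 ^ (N - 1) * (C₀ + C₁), fun p hp l hl => ?_⟩
  have h2 := h0 p hp l hl
  have h3 := h1 p hp l hl
  rw [pow_zero, one_mul] at h2
  have h4 := add_pow_le (zero_le_one (α := ℝ)) hl N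
  set J := ‖∫ s, cexp (I * ((l * Φ (s, p) : ℝ) : ℂ)) * a (s, p) ∂μ‖
  calc (1 + l) ^ N * J ≤ (2 ^ (N - 1) * (1 ^ N + l ^ N)) * J := by gcongr
    _ = 2 ^ (N - 1) * (J + l ^ N * J) := by rw [one_pow]; ring
    _ ≤ _ := by gcongr

end NonstationaryPhase

open scoped ComplexConjugate

/-! ### The `T T*` estimate for oscillatory integral operators. -/

section OscillatoryOperator

variable {W E F Q : Type*} [NormedAddCommGroup W] [NormedSpace ℝ W] [FiniteDimensional ℝ W]
  [MeasurableSpace W] [BorelSpace W] {μ : Measure W} [μ.IsAddHaarMeasure]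
  [NormedAddCommGroup E] [InnerProductSpace ℝ E] [FiniteDimensional ℝ E]
  [NormedAddCommGroup F] [NormedSpace ℝ F] [FiniteDimensional ℝ F]
  [NormedAddCommGroup Q] [NormedSpace ℝ Q] [FiniteDimensional ℝ Q]

/-- Frequency, base point, direction, step and amplitude arguments are all treated as parameters of
one phase integral in `s`. At step `0` the phase is `Ξ · D_xT(w)`, nonstationary by `hv`. Two
factors `B` occur because `T T*` multiplies one amplitude by a conjugate. -/
theorem exists_norm_integral_diffQuot_phase_le_near {T : W × E → E} (hT : ContDiff ℝ ∞ T)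
    {B : W × Q → ℝ} (hB : ContDiff ℝ ∞ B) {s₀ : W} {x₀ w₀ Ξ₀ : E} (q₀ : Q) {v : W}
    (hv : fderiv ℝ (fun s => inner ℝ Ξ₀ (fderiv ℝ T (s, x₀) (0, w₀))) s₀ v ≠ 0) :
    ∃ ε > 0, ∀ (N : ℕ) (ψ : W → ℝ), ContDiff ℝ ∞ ψ →
      (∀ s, s ∉ Metric.closedBall s₀ ε → ψ s = 0) →
      ∃ C : ℝ, ∀ Ξ x w : E, ∀ r : ℝ, ∀ q q' : Q, ‖Ξ - Ξ₀‖ ≤ ε → ‖x - x₀‖ ≤ ε → ‖w - w₀‖ ≤ ε →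
        |r| ≤ ε → ‖q - q₀‖ ≤ ε → ‖q' - q₀‖ ≤ ε → ∀ l : ℝ, 0 ≤ l →
        (1 + l) ^ N * ‖∫ s, cexp (I * ((l * inner ℝ Ξ (diffQuot T (s, x, w, r)) : ℝ) : ℂ)) *
          ((ψ s * B (s, q) * B (s, q') : ℝ) : ℂ) ∂μ‖ ≤ C := by
  let Φ : W × (E × E × E × ℝ × Q × Q) → ℝ := fun z =>
    inner ℝ z.2.1 (diffQuot T (z.1, z.2.2.1, z.2.2.2.1, z.2.2.2.2.1))
  have hΦ : ContDiff ℝ ∞ Φ :=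
    (contDiff_fst.comp contDiff_snd).inner ℝ ((contDiff_diffQuot hT).comp (by fun_prop))
  obtain ⟨ε, hε, h⟩ := exists_norm_integral_phase_le (μ := μ) hΦ (s₀ := s₀)
    (p₀ := (Ξ₀, x₀, w₀, 0, q₀, q₀)) (v := v) (by simpa only [Φ, diffQuot_zero] using hv)
  refine ⟨ε, hε, fun N ψ hψ hψs => ?_⟩
  obtain ⟨C, hC⟩ := h N (fun z => ((ψ z.1 * B (z.1, z.2.2.2.2.2.1) *
      B (z.1, z.2.2.2.2.2.2) : ℝ) : ℂ))
    (ofRealCLM.contDiff.comp (((hψ.comp contDiff_fst).mul (hB.comp (by fun_prop))).mul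
      (hB.comp (by fun_prop)))) (fun s p hs => by simp [hψs s hs])
  refine ⟨C, fun Ξ x w r q q' h1 h2 h3 h4 h5 h6 l hl => ?_⟩
  refine hC (Ξ, x, w, r, q, q') ?_ l hl
  simp only [Metric.mem_closedBall, Prod.dist_eq, max_le_iff]
  simp only [dist_eq_norm, sub_zero]
  exact ⟨h1, h2, h3, h4, h5, h6⟩

/-- Compactness of the unit sphere of directions `θ` makes the radius and the constant uniform. -/
theorem exists_norm_integral_diffQuot_phase_le {T : W × E → E} (hT : ContDiff ℝ ∞ T)
    {B : W × Q → ℝ} (hB : ContDiff ℝ ∞ B) {s₀ : W} {x₀ Ξ₀ : E} (q₀ : Q) {A : F →L[ℝ] E}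
    (hA : ∀ θ ≠ 0, ∃ v, fderiv ℝ (fun s => inner ℝ Ξ₀ (fderiv ℝ T (s, x₀) (0, A θ))) s₀ v ≠ 0) :
    ∃ ε > 0, ∀ (N : ℕ) (ψ : W → ℝ), ContDiff ℝ ∞ ψ →
      (∀ s, s ∉ Metric.closedBall s₀ ε → ψ s = 0) →
      ∃ C : ℝ, ∀ θ ∈ Metric.sphere (0 : F) 1, ∀ Ξ x w : E, ∀ r : ℝ, ∀ q q' : Q,
        ‖Ξ - Ξ₀‖ ≤ ε → ‖x - x₀‖ ≤ ε → ‖w - A θ‖ ≤ ε →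
        |r| ≤ ε → ‖q - q₀‖ ≤ ε → ‖q' - q₀‖ ≤ ε → ∀ l : ℝ, 0 ≤ l →
        (1 + l) ^ N * ‖∫ s, cexp (I * ((l * inner ℝ Ξ (diffQuot T (s, x, w, r)) : ℝ) : ℂ)) *
          ((ψ s * B (s, q) * B (s, q') : ℝ) : ℂ) ∂μ‖ ≤ C := by
  refine (isCompact_sphere (0 : F) 1).induction_on (p := fun S : Set F =>
    ∃ ε > 0, ∀ (N : ℕ) (ψ : W → ℝ), ContDiff ℝ ∞ ψ →
      (∀ s, s ∉ Metric.closedBall s₀ ε → ψ s = 0) →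
      ∃ C : ℝ, ∀ θ ∈ S, ∀ Ξ x w : E, ∀ r : ℝ, ∀ q q' : Q,
        ‖Ξ - Ξ₀‖ ≤ ε → ‖x - x₀‖ ≤ ε → ‖w - A θ‖ ≤ ε →
        |r| ≤ ε → ‖q - q₀‖ ≤ ε → ‖q' - q₀‖ ≤ ε → ∀ l : ℝ, 0 ≤ l →
        (1 + l) ^ N * ‖∫ s, cexp (I * ((l * inner ℝ Ξ (diffQuot T (s, x, w, r)) : ℝ) : ℂ)) *
          ((ψ s * B (s, q) * B (s, q') : ℝ) : ℂ) ∂μ‖ ≤ C) ?_ ?_ ?_ ?_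
  · exact ⟨1, one_pos, fun _ _ _ _ => ⟨0, fun θ hθ => absurd hθ (notMem_empty θ)⟩⟩
  · rintro S S' hSS' ⟨ε, hε, h⟩
    refine ⟨ε, hε, fun N ψ h1 h2 => ?_⟩
    obtain ⟨C, hC⟩ := h N ψ h1 h2
    exact ⟨C, fun θ hθ => hC θ (hSS' hθ)⟩
  · rintro S S' ⟨ε, hε, h⟩ ⟨ε', hε', h'⟩
    refine ⟨min ε ε', lt_min hε hε', fun N ψ h1 h2 => ?_⟩
    obtain ⟨C, hC⟩ := h N ψ h1 fun s hs => h2 s fun hs' =>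
      hs (Metric.closedBall_subset_closedBall (min_le_left _ _) hs')
    obtain ⟨C', hC'⟩ := h' N ψ h1 fun s hs => h2 s fun hs' =>
      hs (Metric.closedBall_subset_closedBall (min_le_right _ _) hs')
    refine ⟨max C C', ?_⟩
    rintro θ (hθ | hθ) Ξ x w r q q' a1 a2 a3 a4 a5 a6 l hl
    · exact (hC θ hθ Ξ x w r q q' (a1.trans (min_le_left _ _)) (a2.trans (min_le_left _ _))
        (a3.trans (min_le_left _ _)) (a4.trans (min_le_left _ _)) (a5.trans (min_le_left _ _))
        (a6.trans (min_le_left _ _)) l hl).trans (le_max_left _ _)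
    · exact (hC' θ hθ Ξ x w r q q' (a1.trans (min_le_right _ _)) (a2.trans (min_le_right _ _))
        (a3.trans (min_le_right _ _)) (a4.trans (min_le_right _ _)) (a5.trans (min_le_right _ _))
        (a6.trans (min_le_right _ _)) l hl).trans (le_max_right _ _)
  · intro θ₀ hθ₀
    obtain ⟨v, hv⟩ := hA θ₀ (by rintro rfl; simp at hθ₀)
    obtain ⟨ε, hε, h⟩ := exists_norm_integral_diffQuot_phase_le_near (μ := μ) hT hB q₀ hv
    refine ⟨_, mem_nhdsWithin_of_mem_nhds (A.continuous.continuousAt.preimage_mem_nhds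
      (Metric.closedBall_mem_nhds (A θ₀) (half_pos hε))), ε / 2, half_pos hε, ?_⟩
    intro N ψ h1 h2
    obtain ⟨C, hC⟩ := h N ψ h1 fun s hs => h2 s fun hs' =>
      hs (Metric.closedBall_subset_closedBall (by linarith) hs')
    refine ⟨C, fun θ hθ Ξ x w r q q' a1 a2 a3 a4 a5 a6 l hl => ?_⟩
    refine hC Ξ x w r q q' (by linarith) (by linarith) ?_ (by linarith) (by linarith)
      (by linarith) l hl
    have h3 : ‖A θ - A θ₀‖ ≤ ε / 2 := by
      rw [← dist_eq_norm]; exact hθ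
    calc ‖w - A θ₀‖ = ‖(w - A θ) + (A θ - A θ₀)‖ := by congr 1; abel
      _ ≤ _ := (norm_add_le _ _).trans (by linarith)

variable [MeasurableSpace F] [BorelSpace F] {m : Measure F} [m.IsAddHaarMeasure]

theorem lintegral_inv_one_add_mul_norm_pow {l : ℝ} (hl : 0 < l) :
    ∫⁻ y : F, ENNReal.ofReal (((1 + l * ‖y‖) ^ (Module.finrank ℝ F + 1))⁻¹) ∂m =
      ENNReal.ofReal ((l ^ Module.finrank ℝ F)⁻¹) *
        ∫⁻ y : F, ENNReal.ofReal (((1 + ‖y‖) ^ (Module.finrank ℝ F + 1))⁻¹) ∂m := by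
  have h := Measure.map_addHaar_smul m hl.ne'
  have hm : Measurable fun y : F =>
      ENNReal.ofReal (((1 + ‖y‖) ^ (Module.finrank ℝ F + 1))⁻¹) := by fun_prop
  have := lintegral_map (μ := m) hm (measurable_const_smul l)
  rw [h, lintegral_smul_measure] at this
  rw [abs_of_pos (by positivity)] at this
  rw [smul_eq_mul] at this
  rw [this]
  simp_rw [norm_smul, Real.norm_eq_abs, abs_of_pos hl]

theorem lintegral_inv_one_add_norm_pow_lt_top :
    ∫⁻ y : F, ENNReal.ofReal (((1 + ‖y‖) ^ (Module.finrank ℝ F + 1))⁻¹) ∂m < ⊤ := by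
  have := finite_integral_one_add_norm (E := F) (μ := m) (r := (Module.finrank ℝ F + 1 : ℕ))
    (by push_cast; linarith)
  convert this using 4 with y
  rw [Real.rpow_neg (by positivity), Real.rpow_natCast]

/-- The `T T*` argument for an operator with kernel `k s t`, weighted by `ψ`. -/
theorem lintegral_weight_mul_enorm_sq_integral_le {Y : Type*} [MeasurableSpace Y]
    {ν : Measure Y} [IsFiniteMeasure ν] {ψ : W → ℝ} (hψ : Integrable ψ μ) (hψ0 : ∀ s, 0 ≤ ψ s)
    {k : W → Y → ℂ} (hk : AEStronglyMeasurable (fun z : W × Y => k z.1 z.2) (μ.prod ν))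
    {M : ℝ} (hM : ∀ᵐ t ∂ν, ∀ s, ψ s ≠ 0 → ‖k s t‖ ≤ M) :
    ∫⁻ s, ENNReal.ofReal (ψ s) * ‖∫ t, k s t ∂ν‖ₑ ^ 2 ∂μ ≤
      ∫⁻ t, (∫⁻ τ, ‖∫ s, (ψ s : ℂ) * (k s t * conj (k s τ)) ∂μ‖ₑ ∂ν) ∂ν := by
  have hk1 : AEStronglyMeasurable (fun z : W × Y × Y => k z.1 z.2.1) (μ.prod (ν.prod ν)) := by
    have h1 : Measure.QuasiMeasurePreserving (fun z : W × Y × Y => (z.1, z.2.1))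
        (μ.prod (ν.prod ν)) (μ.prod ν) := by
      exact MeasureTheory.QuasiMeasurePreserving.prodMap (Measure.QuasiMeasurePreserving.id μ)
        Measure.quasiMeasurePreserving_fst
    exact hk.comp_quasiMeasurePreserving h1
  have hk2 : AEStronglyMeasurable (fun z : W × Y × Y => k z.1 z.2.2) (μ.prod (ν.prod ν)) := by
    have h1 : Measure.QuasiMeasurePreserving (fun z : W × Y × Y => (z.1, z.2.2))
        (μ.prod (ν.prod ν)) (μ.prod ν) := by
      exact MeasureTheory.QuasiMeasurePreserving.prodMap (Measure.QuasiMeasurePreserving.id μ)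
        Measure.quasiMeasurePreserving_snd
    exact hk.comp_quasiMeasurePreserving h1
  have hψ1 : AEStronglyMeasurable (fun z : W × Y × Y => (ψ z.1 : ℂ)) (μ.prod (ν.prod ν)) :=
    (continuous_ofReal.comp_aestronglyMeasurable hψ.aestronglyMeasurable).comp_fst
  let H : W × Y × Y → ℂ := fun z => (ψ z.1 : ℂ) * (k z.1 z.2.1 * conj (k z.1 z.2.2))
  have hHm : AEStronglyMeasurable H (μ.prod (ν.prod ν)) :=
    hψ1.mul (hk1.mul (continuous_conj.comp_aestronglyMeasurable hk2))
  have hHi : Integrable H (μ.prod (ν.prod ν)) := by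
    have hb : Integrable (fun z : W × Y × Y => |ψ z.1| * M ^ 2) (μ.prod (ν.prod ν)) :=
      (hψ.abs).mul_prod (integrable_const (M ^ 2))
    refine hb.mono' hHm ?_
    have e1 : ∀ᵐ z ∂(μ.prod (ν.prod ν)), ∀ s, ψ s ≠ 0 → ‖k s z.2.1‖ ≤ M :=
      (Measure.quasiMeasurePreserving_fst.comp Measure.quasiMeasurePreserving_snd).ae hM
    have e2 : ∀ᵐ z ∂(μ.prod (ν.prod ν)), ∀ s, ψ s ≠ 0 → ‖k s z.2.2‖ ≤ M :=
      (Measure.quasiMeasurePreserving_snd.comp Measure.quasiMeasurePreserving_snd).ae hM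
    filter_upwards [e1, e2] with z h1 h2
    by_cases h0 : ψ z.1 = 0
    · simp [H, h0]
    · simp only [H, norm_mul, RCLike.norm_conj, norm_real, Real.norm_eq_abs]
      have a1 := h1 _ h0
      have a2 := h2 _ h0
      have : 0 ≤ M := (norm_nonneg _).trans a1
      rw [pow_two]
      gcongr
  -- The square of the modulus is a double integral in `(t, τ)`; the `s`-integration is then moved
  -- inside by Fubini.
  have hsq : ∀ s, (ψ s : ℂ) * (((‖∫ t, k s t ∂ν‖ ^ 2 : ℝ)) : ℂ) =
      ∫ z, H (s, z) ∂(ν.prod ν) := by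
    intro s
    simp only [H]
    rw [integral_const_mul, integral_prod_mul (fun t => k s t) (fun t => conj (k s t)),
      integral_conj, mul_conj, normSq_eq_norm_sq]
  have hsi : Integrable (fun s => ψ s * ‖∫ t, k s t ∂ν‖ ^ 2) μ := by
    have h1 := hHi.integral_prod_left
    simp_rw [← hsq, ← ofReal_mul] at h1
    exact h1.re.congr (ae_of_all _ fun s => RCLike.ofReal_re_ax _)
  have hre : (((∫ s, ψ s * ‖∫ t, k s t ∂ν‖ ^ 2 ∂μ : ℝ)) : ℂ) =
      ∫ z, (∫ s, H (s, z) ∂μ) ∂(ν.prod ν) := by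
    rw [← integral_integral_swap (f := fun s z => H (s, z)) hHi, ← integral_complex_ofReal]
    congr 1
    ext s
    rw [← hsq, ofReal_mul]
  calc ∫⁻ s, ENNReal.ofReal (ψ s) * ‖∫ t, k s t ∂ν‖ₑ ^ 2 ∂μ
      = ∫⁻ s, ENNReal.ofReal (ψ s * ‖∫ t, k s t ∂ν‖ ^ 2) ∂μ := by
        congr 1
        ext s
        rw [ENNReal.ofReal_mul (hψ0 s), ENNReal.ofReal_pow (norm_nonneg _), ofReal_norm]
    _ = ENNReal.ofReal (∫ s, ψ s * ‖∫ t, k s t ∂ν‖ ^ 2 ∂μ) :=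
        (ofReal_integral_eq_lintegral_ofReal hsi
          (ae_of_all _ fun s => mul_nonneg (hψ0 s) (sq_nonneg _))).symm
    _ ≤ ‖(((∫ s, ψ s * ‖∫ t, k s t ∂ν‖ ^ 2 ∂μ : ℝ)) : ℂ)‖ₑ := by
        rw [← ofReal_norm, norm_real]
        exact ENNReal.ofReal_le_ofReal (Real.le_norm_self _)
    _ ≤ ∫⁻ z, ‖∫ s, H (s, z) ∂μ‖ₑ ∂(ν.prod ν) := by
        rw [hre]
        exact enorm_integral_le_lintegral_enorm _
    _ = _ := by
        rw [lintegral_prod _ hHi.integral_prod_right.aestronglyMeasurable.enorm]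

/-- The `T T*` kernel is bounded by a multiple of `(1 + l‖t - τ‖)^{-(dim F + 1)}`, whose integral
over `F` scales like `l^{-dim F}`. Only near-linearity of `Γ` on `D` is assumed, so one-sided
differentiable curves are admitted. The amplitude depends on `t` through `q t`, and no smoothness of
`q` in `t` is required. -/
theorem exists_lintegral_weight_mul_enorm_sq_le [Nontrivial F] {T : W × E → E}
    (hT : ContDiff ℝ ∞ T) {B : W × Q → ℝ} (hB : ContDiff ℝ ∞ B) {s₀ : W} {x₀ Ξ₀ : E} (q₀ : Q)
    {A : F →L[ℝ] E}
    (hA : ∀ θ ≠ 0, ∃ v, fderiv ℝ (fun s => inner ℝ Ξ₀ (fderiv ℝ T (s, x₀) (0, A θ))) s₀ v ≠ 0) :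
    ∃ ε > 0, ∀ ψ : W → ℝ, ContDiff ℝ ∞ ψ → (∀ s, 0 ≤ ψ s) →
      (∀ s, s ∉ Metric.closedBall s₀ ε → ψ s = 0) →
      ∃ C : ℝ≥0, ∀ (Ξ : E) (D : Set F) (Γ : F → E) (q : F → Q) (f : F → ℂ) (M : ℝ≥0),
        ‖Ξ - Ξ₀‖ ≤ ε → MeasurableSet D → m D ≠ ⊤ → AEStronglyMeasurable Γ (m.restrict D) →
        AEStronglyMeasurable q (m.restrict D) → AEStronglyMeasurable f (m.restrict D) →
        (∀ t ∈ D, ‖Γ t - x₀‖ ≤ ε) → (∀ t ∈ D, ‖q t - q₀‖ ≤ ε) → (∀ t ∈ D, ‖f t‖ ≤ M) →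
        (∀ t ∈ D, ∀ τ ∈ D, ‖t - τ‖ ≤ ε ∧ ‖Γ t - Γ τ - A (t - τ)‖ ≤ ε * ‖t - τ‖) →
        ∀ l : ℝ, 0 < l →
        ∫⁻ s, ENNReal.ofReal (ψ s) * ‖∫ t in D, cexp (I * ((l * inner ℝ Ξ (T (s, Γ t)) : ℝ) : ℂ)) *
          (f t * (B (s, q t) : ℂ)) ∂m‖ₑ ^ 2 ∂μ ≤
        C * M ^ 2 * m D * ENNReal.ofReal ((l ^ Module.finrank ℝ F)⁻¹) := by
  obtain ⟨ε, hε, h⟩ := exists_norm_integral_diffQuot_phase_le (μ := μ) hT hB q₀ hA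
  refine ⟨ε, hε, fun ψ hψ hψ0 hψs => ?_⟩
  obtain ⟨C, hC⟩ := h (Module.finrank ℝ F + 1) ψ hψ hψs
  set J : ℝ≥0∞ := ∫⁻ y : F, ENNReal.ofReal (((1 + ‖y‖) ^ (Module.finrank ℝ F + 1))⁻¹) ∂m with hJ
  have hJt : J ≠ ⊤ := lintegral_inv_one_add_norm_pow_lt_top.ne
  refine ⟨C.toNNReal * J.toNNReal, ?_⟩
  intro Ξ D Γ q f M hΞ hD hDt hΓm hqm hfm hΓ hq hf hdiff l hl
  have : IsFiniteMeasure (m.restrict D) := ⟨by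
    rw [Measure.restrict_apply_univ]; exact hDt.lt_top⟩
  have hψc : HasCompactSupport ψ :=
    HasCompactSupport.intro (isCompact_closedBall s₀ ε) hψs
  have hψi : Integrable ψ μ := hψ.continuous.integrable_of_hasCompactSupport hψc
  let k : W → F → ℂ := fun s t => cexp (I * ((l * inner ℝ Ξ (T (s, Γ t)) : ℝ) : ℂ)) *
          (f t * (B (s, q t) : ℂ))
  obtain ⟨Mb, hMb⟩ := ((isCompact_closedBall s₀ ε).prod
      (isCompact_closedBall q₀ ε)).exists_bound_of_continuousOn hB.continuous.continuousOn
  have hk : AEStronglyMeasurable (fun z : W × F => k z.1 z.2) (μ.prod (m.restrict D)) := by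
    have a1 : AEStronglyMeasurable (fun z : W × F => (z.1, Γ z.2)) (μ.prod (m.restrict D)) :=
      continuous_fst.aestronglyMeasurable.prodMk hΓm.comp_snd
    have a2 : AEStronglyMeasurable (fun z : W × F => (z.1, q z.2)) (μ.prod (m.restrict D)) :=
      continuous_fst.aestronglyMeasurable.prodMk hqm.comp_snd
    have c1 : Continuous fun z : W × E => cexp (I * ((l * inner ℝ Ξ (T z) : ℝ) : ℂ)) := by
      have := hT.continuous
      fun_prop
    have c2 : Continuous fun z : W × Q => ((B z : ℝ) : ℂ) :=
      continuous_ofReal.comp hB.continuous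
    exact (c1.comp_aestronglyMeasurable a1).mul
      (hfm.comp_snd.mul (c2.comp_aestronglyMeasurable a2))
  have hkM : ∀ᵐ t ∂(m.restrict D), ∀ s, ψ s ≠ 0 → ‖k s t‖ ≤ M * Mb := by
    filter_upwards [ae_restrict_mem hD] with t ht s hs
    have hs' : s ∈ Metric.closedBall s₀ ε := by
      by_contra h0; exact hs (hψs s h0)
    simp only [k, norm_mul, norm_cexp_phase, one_mul, norm_real]
    have := hMb (s, q t) ⟨hs', by rw [Metric.mem_closedBall, dist_eq_norm]; exact hq t ht⟩
    gcongr
    exact hf t ht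
  refine (lintegral_weight_mul_enorm_sq_integral_le hψi hψ0 hk hkM).trans ?_
  have hker : ∀ t ∈ D, ∀ τ ∈ D, ‖∫ s, (ψ s : ℂ) * (k s t * conj (k s τ)) ∂μ‖ₑ ≤
      C.toNNReal * M ^ 2 *
        ENNReal.ofReal (((1 + l * ‖t - τ‖) ^ (Module.finrank ℝ F + 1))⁻¹) := by
    intro t ht τ hτ
    -- Polar form of the increment of `Γ`: a length `‖t - τ‖` times a vector close to the image of a
    -- unit direction. On the diagonal any unit vector does.
    obtain ⟨θ, w, hθ, hw, hwd⟩ : ∃ θ : F, ∃ w : E, ‖θ‖ = 1 ∧ ‖w - A θ‖ ≤ ε ∧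
        Γ t = Γ τ + ‖t - τ‖ • w := by
      by_cases h0 : t = τ
      · obtain ⟨θ, hθ⟩ := exists_norm_eq (E := F) (c := 1) zero_le_one
        exact ⟨θ, A θ, hθ, by simp [hε.le], by simp [h0]⟩
      · have hn : 0 < ‖t - τ‖ := norm_pos_iff.2 (sub_ne_zero.2 h0)
        refine ⟨‖t - τ‖⁻¹ • (t - τ), ‖t - τ‖⁻¹ • (Γ t - Γ τ), ?_, ?_, ?_⟩
        · rw [norm_smul, norm_inv, norm_norm, inv_mul_cancel₀ hn.ne']
        · rw [map_smul, ← smul_sub, norm_smul, norm_inv, norm_norm, inv_mul_le_iff₀ hn, mul_comm]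
          exact (hdiff t ht τ hτ).2
        · rw [smul_smul, mul_inv_cancel₀ hn.ne', one_smul]; abel
    have hid : ∫ s, (ψ s : ℂ) * (k s t * conj (k s τ)) ∂μ = (f t * conj (f τ)) *
        ∫ s, cexp (I * (((l * ‖t - τ‖) *
          inner ℝ Ξ (diffQuot T (s, Γ τ, w, ‖t - τ‖)) : ℝ) : ℂ)) *
          ((ψ s * B (s, q t) * B (s, q τ) : ℝ) : ℂ) ∂μ := by
      rw [← integral_const_mul]
      congr 1
      ext s
      have hph : (l * ‖t - τ‖) * inner ℝ Ξ (diffQuot T (s, Γ τ, w, ‖t - τ‖)) =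
          l * inner ℝ Ξ (T (s, Γ t)) - l * inner ℝ Ξ (T (s, Γ τ)) := by
        have := smul_diffQuot hT s (Γ τ) w ‖t - τ‖
        rw [← hwd] at this
        rw [← mul_sub, ← inner_sub_right, ← this, real_inner_smul_right]; ring
      rw [hph, ofReal_sub, mul_sub, Complex.exp_sub]
      simp only [k, map_mul, conj_ofReal, ← Complex.exp_conj, conj_I]
      rw [neg_mul, Complex.exp_neg]
      push_cast
      ring
    rw [hid, ← ofReal_norm, norm_mul]
    have hb := hC θ (by simpa using hθ) Ξ (Γ τ) w ‖t - τ‖ (q t) (q τ) hΞ (hΓ τ hτ) hw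
      (by rw [abs_of_nonneg (norm_nonneg _)]; exact (hdiff t ht τ hτ).1) (hq t ht) (hq τ hτ)
      (l * ‖t - τ‖) (by positivity)
    set X := ‖∫ s, cexp (I * (((l * ‖t - τ‖) *
          inner ℝ Ξ (diffQuot T (s, Γ τ, w, ‖t - τ‖)) : ℝ) : ℂ)) *
          ((ψ s * B (s, q t) * B (s, q τ) : ℝ) : ℂ) ∂μ‖
    have hX : X ≤ C.toNNReal * ((1 + l * ‖t - τ‖) ^ (Module.finrank ℝ F + 1))⁻¹ := by
      rw [← div_eq_mul_inv, le_div_iff₀ (by positivity), mul_comm]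
      exact hb.trans (Real.le_coe_toNNReal C)
    have hff : ‖f t * conj (f τ)‖ ≤ (M : ℝ) ^ 2 := by
      rw [norm_mul, RCLike.norm_conj, pow_two]
      have := hf t ht
      have := hf τ hτ
      gcongr
    have hfin : ‖f t * conj (f τ)‖ * X ≤ C.toNNReal * (M : ℝ) ^ 2 *
        ((1 + l * ‖t - τ‖) ^ (Module.finrank ℝ F + 1))⁻¹ := by
      calc _ ≤ (M : ℝ) ^ 2 * (C.toNNReal * ((1 + l * ‖t - τ‖) ^ (Module.finrank ℝ F + 1))⁻¹) := by
            gcongr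
        _ = _ := by ring
    refine (ENNReal.ofReal_le_ofReal hfin).trans (le_of_eq ?_)
    rw [ENNReal.ofReal_mul (by positivity), ENNReal.ofReal_mul (by positivity),
      ENNReal.ofReal_pow (by positivity), ENNReal.ofReal_coe_nnreal, ENNReal.ofReal_coe_nnreal]
  calc ∫⁻ t in D, (∫⁻ τ in D, ‖∫ s, (ψ s : ℂ) * (k s t * conj (k s τ)) ∂μ‖ₑ ∂m) ∂m
      ≤ ∫⁻ t in D, (C.toNNReal * M ^ 2 *
          (ENNReal.ofReal ((l ^ Module.finrank ℝ F)⁻¹) * J)) ∂m := by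
        refine lintegral_mono_ae ?_
        filter_upwards [ae_restrict_mem hD] with t ht
        calc ∫⁻ τ in D, ‖∫ s, (ψ s : ℂ) * (k s t * conj (k s τ)) ∂μ‖ₑ ∂m
            ≤ ∫⁻ τ in D, C.toNNReal * M ^ 2 *
                ENNReal.ofReal (((1 + l * ‖t - τ‖) ^ (Module.finrank ℝ F + 1))⁻¹) ∂m := by
              refine lintegral_mono_ae ?_
              filter_upwards [ae_restrict_mem hD] with τ hτ
              exact hker t ht τ hτ
          _ ≤ ∫⁻ τ, C.toNNReal * M ^ 2 *
                ENNReal.ofReal (((1 + l * ‖t - τ‖) ^ (Module.finrank ℝ F + 1))⁻¹) ∂m :=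
              setLIntegral_le_lintegral _ _
          _ = _ := by
              rw [lintegral_const_mul _ (by fun_prop),
                lintegral_sub_left_eq_self (fun y => ENNReal.ofReal
                  (((1 + l * ‖y‖) ^ (Module.finrank ℝ F + 1))⁻¹)) t,
                lintegral_inv_one_add_mul_norm_pow hl]
    _ = _ := by
        rw [lintegral_const, Measure.restrict_apply_univ]
        push_cast
        rw [ENNReal.coe_toNNReal hJt]
        ring

end OscillatoryOperator

/-! ### Decay for `C²` hypersurfaces. -/

theorem sq_lintegral_le_measure_mul_lintegral_sq {α : Type*} [MeasurableSpace α] {μ : Measure α}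
    {g : α → ℝ≥0∞} (hg : AEMeasurable g μ) :
    (∫⁻ a, g a ∂μ) ^ 2 ≤ μ univ * ∫⁻ a, g a ^ 2 ∂μ := by
  have h := ENNReal.lintegral_mul_le_Lp_mul_Lq μ (p := 2) (q := 2)
    (Real.HolderConjugate.two_two) (aemeasurable_const (b := (1 : ℝ≥0∞))) hg
  simp only [Pi.mul_apply, one_mul, lintegral_const, ENNReal.rpow_two] at h
  calc _ ≤ _ := pow_le_pow_left' h 2
    _ = _ := by
      have hsq : ∀ x : ℝ≥0∞, (x ^ (1 / 2 : ℝ)) ^ 2 = x := fun x => by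
        rw [← ENNReal.rpow_two, ← ENNReal.rpow_mul]
        norm_num
      rw [mul_pow, hsq, hsq, one_pow, one_mul]

/-- One integration by parts with `g` in the role of `p / N`. Writing `p = N g` avoids dividing
where `N` vanishes outside the support, and only `C¹` regularity is used. -/
theorem integral_phase_mul_eq {P N g g' p : ℝ → ℝ} (hP : ∀ u, HasDerivAt P (N u) u)
    (hN : Continuous N) (hg : ∀ u, HasDerivAt g (g' u) u) (hg' : Continuous g')
    (hgs : HasCompactSupport g) (hp : ∀ u, N u * g u = p u) {l : ℝ} (hl : 0 < l) :
    ∫ u, cexp (I * ((l * P u : ℝ) : ℂ)) * (p u : ℂ) =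
      (I / l) * ∫ u, cexp (I * ((l * P u : ℝ) : ℂ)) * (g' u : ℂ) := by
  let e : ℝ → ℂ := fun u => cexp (I * ((l * P u : ℝ) : ℂ))
  have hPc : Continuous P := continuous_iff_continuousAt.2 fun u => (hP u).continuousAt
  have hgc : Continuous g := continuous_iff_continuousAt.2 fun u => (hg u).continuousAt
  have hec : Continuous e := by fun_prop
  have he : ∀ u, HasDerivAt e (e u * (I * (l * N u : ℝ))) u := by
    intro u
    exact ((((hP u).const_mul l).ofReal_comp).const_mul I).cexp
  have hG : ∀ u, HasDerivAt (fun u => (g u : ℂ)) (g' u : ℂ) u := fun u => (hg u).ofReal_comp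
  have hg's : HasCompactSupport g' := by
    have : g' = deriv g := funext fun u => (hg u).deriv.symm
    rw [this]; exact hgs.deriv
  have hGs : HasCompactSupport (fun u => (g u : ℂ)) :=
    HasCompactSupport.comp_left (g := fun x : ℝ => (x : ℂ)) hgs ofReal_zero
  have hG's : HasCompactSupport (fun u => (g' u : ℂ)) :=
    HasCompactSupport.comp_left (g := fun x : ℝ => (x : ℂ)) hg's ofReal_zero
  have key := integral_mul_deriv_eq_deriv_mul_of_integrable (u := fun u => (g u : ℂ)) (v := e)
    (fun u _ => hG u) (fun u _ => he u)
    (Continuous.integrable_of_hasCompactSupport (by fun_prop) hGs.mul_right)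
    (Continuous.integrable_of_hasCompactSupport (by fun_prop) hG's.mul_right)
    (Continuous.integrable_of_hasCompactSupport (by fun_prop) hGs.mul_right)
  have h1 : ∫ u, (g u : ℂ) * (e u * (I * (l * N u : ℝ))) = (I * l) * ∫ u, e u * (p u : ℂ) := by
    rw [← integral_const_mul]
    congr 1
    ext u
    rw [← hp u]
    push_cast
    ring
  have h2 : ∫ u, (g' u : ℂ) * e u = ∫ u, e u * (g' u : ℂ) := by
    congr 1
    ext u
    ring
  rw [h1, h2] at key
  have hl' : (l : ℂ) ≠ 0 := ofReal_ne_zero.2 hl.ne'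
  change ∫ u, e u * (p u : ℂ) = (I / l) * ∫ u, e u * (g' u : ℂ)
  rw [← neg_eq_iff_eq_neg.2 key.symm.symm]
  field_simp
  rw [I_sq]
  ring

section SmoothHypersurface

variable {W E G : Type*} [NormedAddCommGroup W] [NormedSpace ℝ W] [FiniteDimensional ℝ W]
  [MeasurableSpace W] [BorelSpace W] {μ : Measure W} [μ.IsAddHaarMeasure]
  [NormedAddCommGroup E] [InnerProductSpace ℝ E] [FiniteDimensional ℝ E]
  [NormedAddCommGroup G] [InnerProductSpace ℝ G] [FiniteDimensional ℝ G]
  [MeasurableSpace G] [BorelSpace G]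

theorem exists_closedBall_strict {X Y : Type*} [NormedAddCommGroup X] [NormedSpace ℝ X]
    [NormedAddCommGroup Y] [NormedSpace ℝ Y] {γ : X → Y} {A : X →L[ℝ] Y} {t₀ : X}
    (h : HasStrictFDerivAt γ A t₀) {ε : ℝ} (hε : 0 < ε) :
    ∃ δ > 0, ∀ t ∈ Metric.closedBall t₀ δ, ∀ τ ∈ Metric.closedBall t₀ δ,
      ‖t - τ‖ ≤ ε ∧ ‖γ t - γ t₀‖ ≤ ε ∧ ‖γ t - γ τ - A (t - τ)‖ ≤ ε * ‖t - τ‖ := by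
  have h1 := h.isLittleO.def hε
  rw [nhds_prod_eq] at h1
  have h2 : ∀ᶠ t in 𝓝 t₀, ‖γ t - γ t₀‖ ≤ ε := by
    have := h.continuousAt.eventually (Metric.closedBall_mem_nhds (γ t₀) hε)
    filter_upwards [this] with t ht
    rwa [← dist_eq_norm]
  obtain ⟨U, hU, hU'⟩ := Filter.mem_prod_self_iff.1 h1
  obtain ⟨δ, hδ, hδ'⟩ := Metric.nhds_basis_closedBall.mem_iff.1 (inter_mem hU h2)
  refine ⟨min δ (ε / 2), by positivity, fun t ht τ hτ => ?_⟩
  have a1 := Metric.closedBall_subset_closedBall (min_le_left _ _) ht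
  have a2 := Metric.closedBall_subset_closedBall (min_le_left _ _) hτ
  refine ⟨?_, (hδ' a1).2, hU' (mk_mem_prod (hδ' a1).1 (hδ' a2).1)⟩
  have b1 := Metric.closedBall_subset_closedBall (min_le_right _ _) ht
  have b2 := Metric.closedBall_subset_closedBall (min_le_right _ _) hτ
  rw [← dist_eq_norm]
  rw [Metric.mem_closedBall] at b1 b2
  linarith [dist_triangle_right t τ t₀]

/-- When no tangent direction is degenerate, the `T T*` estimate applies on all of `G` with trivial
amplitude `B`; strict differentiability at `t₀` supplies the near-linearity. -/
theorem exists_decay_of_nondegenerate [Nontrivial G] {T : W × E → E} (hT : ContDiff ℝ ∞ T)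
    {γ : G → E} (hγ : Continuous γ) {s₀ : W} {t₀ : G} {A : G →L[ℝ] E}
    (hA : HasStrictFDerivAt γ A t₀) {Ξ₀ : E}
    (hnd : ∀ θ ≠ 0, ∃ v,
      fderiv ℝ (fun s => inner ℝ Ξ₀ (fderiv ℝ T (s, γ t₀) (0, A θ))) s₀ v ≠ 0) :
    ∃ ε > 0, ∀ ψ : W → ℝ, ContDiff ℝ ∞ ψ → (∀ s, 0 ≤ ψ s) →
      (∀ s, s ∉ Metric.closedBall s₀ ε → ψ s = 0) →
      ∀ φ : G → ℝ, ContDiff ℝ ∞ φ → (∀ t, t ∉ Metric.closedBall t₀ ε → φ t = 0) →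
      ∃ C : ℝ≥0, ∀ Ξ : E, ‖Ξ - Ξ₀‖ ≤ ε → ∀ l : ℝ, 0 < l →
        ∫⁻ s, ENNReal.ofReal (ψ s) *
          ‖∫ t, cexp (I * ((l * inner ℝ Ξ (T (s, γ t)) : ℝ) : ℂ)) * (φ t : ℂ)‖ₑ ^ 2 ∂μ ≤
        C * ENNReal.ofReal ((l ^ Module.finrank ℝ G)⁻¹) := by
  obtain ⟨ε, hε, h⟩ := exists_lintegral_weight_mul_enorm_sq_le (μ := μ) (m := volume) hT
    (B := fun _ : W × ℝ => 1) contDiff_const (0 : ℝ) hnd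
  obtain ⟨δ, hδ, hstrict⟩ := exists_closedBall_strict hA hε
  refine ⟨min ε δ, by positivity, fun ψ hψ hψ0 hψs φ hφ hφs => ?_⟩
  obtain ⟨C, hC⟩ := h ψ hψ hψ0 fun s hs => hψs s fun hs' =>
    hs (Metric.closedBall_subset_closedBall (min_le_left _ _) hs')
  have hφc : HasCompactSupport φ := HasCompactSupport.intro (isCompact_closedBall t₀ _) hφs
  obtain ⟨M, hM⟩ := hφc.exists_bound_of_continuous hφ.continuous
  let D := Metric.closedBall t₀ δ
  refine ⟨C * M.toNNReal ^ 2 * (volume D).toNNReal, fun Ξ hΞ l hl => ?_⟩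
  have := hC Ξ D γ (fun _ => 0) (fun t => (φ t : ℂ)) M.toNNReal (hΞ.trans (min_le_left _ _))
    measurableSet_closedBall measure_closedBall_lt_top.ne hγ.aestronglyMeasurable
    aestronglyMeasurable_const (continuous_ofReal.comp hφ.continuous).aestronglyMeasurable
    (fun t ht => (hstrict t ht t ht).2.1) (fun t _ => by simpa using hε.le)
    (fun t _ => by
      rw [norm_real]; exact (hM t).trans (Real.le_coe_toNNReal M))
    (fun t ht τ hτ => ⟨(hstrict t ht τ hτ).1, (hstrict t ht τ hτ).2.2⟩) l hl
  refine le_trans (le_of_eq ?_) (this.trans (le_of_eq ?_))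
  · congr 1
    ext s
    congr 3
    rw [setIntegral_eq_integral_of_forall_compl_eq_zero]
    · simp
    · intro t ht
      rw [hφs t fun ht' => ht (Metric.closedBall_subset_closedBall (min_le_right _ _) ht')]
      simp
  · push_cast
    rw [ENNReal.coe_toNNReal measure_closedBall_lt_top.ne]

/-- Orthogonal coordinates adapted to a unit vector. -/
theorem exists_orthogonal_coordinates {v : G} (hv : ‖v‖ = 1) :
    ∃ L : (ℝ × (Submodule.span ℝ {v})ᗮ) ≃L[ℝ] G, (∀ z, L z = z.1 • v + (z.2 : G)) ∧
      ∀ z, |z.1| ≤ ‖L z‖ ∧ ‖z.2‖ ≤ ‖L z‖ := by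
  let f : (ℝ × (Submodule.span ℝ {v})ᗮ) →ₗ[ℝ] G :=
    (LinearMap.toSpanSingleton ℝ G v).coprod (Submodule.subtype _)
  have hf : ∀ z, f z = z.1 • v + (z.2 : G) := fun z => by simp [f]
  have horth : ∀ τ : (Submodule.span ℝ {v})ᗮ, inner ℝ v (τ : G) = 0 := fun τ =>
    Submodule.mem_orthogonal_singleton_iff_inner_right.1 τ.2
  have hsq : ∀ z, ‖f z‖ ^ 2 = z.1 ^ 2 + ‖z.2‖ ^ 2 := by
    intro z
    rw [hf, norm_add_sq_real, real_inner_smul_left, horth, norm_smul, hv]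
    simp
  have hb : ∀ z, |z.1| ≤ ‖f z‖ ∧ ‖z.2‖ ≤ ‖f z‖ := by
    intro z
    have := hsq z
    constructor
    · refine abs_le_of_sq_le_sq' ?_ (norm_nonneg _) |> abs_le.2
      nlinarith [sq_nonneg ‖z.2‖]
    · exact le_of_sq_le_sq (by nlinarith [sq_nonneg z.1]) (norm_nonneg _)
  have hbij : Function.Bijective f := by
    constructor
    · rw [← LinearMap.ker_eq_bot, LinearMap.ker_eq_bot']
      intro z hz
      have := hb z
      rw [hz, norm_zero] at this
      exact Prod.ext (abs_nonpos_iff.1 this.1) (norm_le_zero_iff.1 this.2)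
    · intro t
      refine ⟨(inner ℝ v t, ⟨t - (inner ℝ v t) • v, ?_⟩), ?_⟩
      · rw [Submodule.mem_orthogonal_singleton_iff_inner_right, inner_sub_right,
          real_inner_smul_right, real_inner_self_eq_norm_sq, hv]
        ring
      · rw [hf]; simp
  exact ⟨(LinearEquiv.ofBijective f hbij).toContinuousLinearEquiv, hf, hb⟩

theorem exists_integral_eq_integral_orthogonal {v : G}
    (L : (ℝ × (Submodule.span ℝ {v})ᗮ) ≃L[ℝ] G) (t₀ : G) :
    ∃ c : ℝ, ∀ h : G → ℂ, ∫ t, h t = c * ∫ z, h (t₀ + L z) := by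
  have hH : (Measure.map L.symm (volume : Measure G)).IsAddHaarMeasure :=
    L.symm.isAddHaarMeasure_map _
  have : (volume : Measure (ℝ × (Submodule.span ℝ {v})ᗮ)).IsAddHaarMeasure :=
    inferInstanceAs ((volume : Measure ℝ).prod
      (volume : Measure (Submodule.span ℝ {v})ᗮ)).IsAddHaarMeasure
  refine ⟨((Measure.map L.symm (volume : Measure G)).addHaarScalarFactor volume : ℝ≥0),
    fun h => ?_⟩
  have h1 := Measure.isAddLeftInvariant_eq_smul (Measure.map L.symm (volume : Measure G)) volume
  have h2 : ∫ t, h t = ∫ t, h (t₀ + t) := (integral_add_left_eq_self h t₀).symm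
  have h3 : ∫ z, h (t₀ + L z) ∂(Measure.map L.symm (volume : Measure G)) = ∫ t, h (t₀ + t) := by
    have := L.symm.toHomeomorph.measurableEmbedding.integral_map (μ := volume)
      (fun z => h (t₀ + L z))
    simpa using this
  rw [h2, ← h3]
  conv_lhs => rw [h1]
  rw [integral_smul_nnreal_measure]
  rfl

end SmoothHypersurface

/-- Cauchy–Schwarz in `u` and Tonelli carry square bounds on the slices over to the integral over
the slices, at the cost of the squared total mass. -/
theorem lintegral_weight_mul_enorm_sq_integral_add_le {S Y : Type*} [MeasurableSpace S]
    [MeasurableSpace Y] {μ : Measure S} [SFinite μ] {ν : Measure Y} [IsFiniteMeasure ν]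
    {w : S → ℝ≥0∞} (hw : Measurable w) {g₁ g₂ : S → Y → ℂ}
    (h₁ : Measurable (Function.uncurry g₁)) (h₂ : Measurable (Function.uncurry g₂))
    {K₁ K₂ : ℝ≥0∞} (hK₁ : ∀ᵐ u ∂ν, ∫⁻ s, w s * ‖g₁ s u‖ₑ ^ 2 ∂μ ≤ K₁)
    (hK₂ : ∀ᵐ u ∂ν, ∫⁻ s, w s * ‖g₂ s u‖ₑ ^ 2 ∂μ ≤ K₂) :
    ∫⁻ s, w s * ‖∫ u, (g₁ s u + g₂ s u) ∂ν‖ₑ ^ 2 ∂μ ≤ ν univ ^ 2 * (2 * (K₁ + K₂)) := by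
  have hm : ∀ s, Measurable fun u => g₁ s u := fun s => h₁.comp measurable_prodMk_left
  have hm' : ∀ s, Measurable fun u => g₂ s u := fun s => h₂.comp measurable_prodMk_left
  have hn : ∀ u, Measurable fun s => g₁ s u := fun s => h₁.comp measurable_prodMk_right
  have hn' : ∀ u, Measurable fun s => g₂ s u := fun s => h₂.comp measurable_prodMk_right
  have hpt : ∀ a b : ℂ, ‖a + b‖ₑ ^ 2 ≤ 2 * (‖a‖ₑ ^ 2 + ‖b‖ₑ ^ 2) := by
    intro a b
    calc ‖a + b‖ₑ ^ 2 ≤ (‖a‖ₑ + ‖b‖ₑ) ^ 2 := pow_le_pow_left' (enorm_add_le _ _) 2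
      _ ≤ 2 ^ (2 - 1) * (‖a‖ₑ ^ 2 + ‖b‖ₑ ^ 2) := by
        have := ENNReal.rpow_add_le_mul_rpow_add_rpow ‖a‖ₑ ‖b‖ₑ (p := 2) (by norm_num)
        norm_num at this ⊢
        exact this
      _ = _ := by norm_num
  calc ∫⁻ s, w s * ‖∫ u, (g₁ s u + g₂ s u) ∂ν‖ₑ ^ 2 ∂μ
      ≤ ∫⁻ s, ν univ * ∫⁻ u, w s * (2 * (‖g₁ s u‖ₑ ^ 2 + ‖g₂ s u‖ₑ ^ 2)) ∂ν ∂μ := by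
        refine lintegral_mono fun s => ?_
        have hms : Measurable fun u => g₁ s u + g₂ s u := (hm s).add (hm' s)
        calc w s * ‖∫ u, (g₁ s u + g₂ s u) ∂ν‖ₑ ^ 2
            ≤ w s * (∫⁻ u, ‖g₁ s u + g₂ s u‖ₑ ∂ν) ^ 2 := by
              gcongr
              exact enorm_integral_le_lintegral_enorm _
          _ ≤ w s * (ν univ * ∫⁻ u, ‖g₁ s u + g₂ s u‖ₑ ^ 2 ∂ν) := by
              gcongr
              exact sq_lintegral_le_measure_mul_lintegral_sq hms.enorm.aemeasurable
          _ ≤ w s * (ν univ * ∫⁻ u, (2 * (‖g₁ s u‖ₑ ^ 2 + ‖g₂ s u‖ₑ ^ 2)) ∂ν) := by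
              gcongr with u
              exact hpt _ _
          _ = ν univ * (w s * ∫⁻ u, (2 * (‖g₁ s u‖ₑ ^ 2 + ‖g₂ s u‖ₑ ^ 2)) ∂ν) := by ring
          _ = _ := by
              congr 1
              have e1 := (hm s).enorm
              have e2 := (hm' s).enorm
              have e3 : Measurable fun u => 2 * (‖g₁ s u‖ₑ ^ 2 + ‖g₂ s u‖ₑ ^ 2) := by fun_prop
              exact (lintegral_const_mul _ e3).symm
    _ = ν univ * ∫⁻ u, ∫⁻ s, w s * (2 * (‖g₁ s u‖ₑ ^ 2 + ‖g₂ s u‖ₑ ^ 2)) ∂μ ∂ν := by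
        have e1 : Measurable fun z : S × Y => ‖g₁ z.1 z.2‖ₑ := h₁.enorm
        have e2 : Measurable fun z : S × Y => ‖g₂ z.1 z.2‖ₑ := h₂.enorm
        have e3 : Measurable fun z : S × Y =>
            w z.1 * (2 * (‖g₁ z.1 z.2‖ₑ ^ 2 + ‖g₂ z.1 z.2‖ₑ ^ 2)) := by fun_prop
        rw [lintegral_const_mul, lintegral_lintegral_swap]
        · exact e3.aemeasurable
        · exact e3.lintegral_prod_right'
    _ ≤ ν univ * ∫⁻ _, 2 * (K₁ + K₂) ∂ν := by
        gcongr 1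
        refine lintegral_mono_ae ?_
        filter_upwards [hK₁, hK₂] with u hu hu'
        have e1 := (hn u).enorm
        have e2 := (hn' u).enorm
        have e3 : Measurable fun s => w s * ‖g₁ s u‖ₑ ^ 2 := by fun_prop
        have e4 : Measurable fun s => w s * ‖g₂ s u‖ₑ ^ 2 := by fun_prop
        calc ∫⁻ s, w s * (2 * (‖g₁ s u‖ₑ ^ 2 + ‖g₂ s u‖ₑ ^ 2)) ∂μ
            = ∫⁻ s, 2 * (w s * ‖g₁ s u‖ₑ ^ 2 + w s * ‖g₂ s u‖ₑ ^ 2) ∂μ := by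
              congr 1; ext s; ring
          _ = 2 * (∫⁻ s, w s * ‖g₁ s u‖ₑ ^ 2 ∂μ + ∫⁻ s, w s * ‖g₂ s u‖ₑ ^ 2 ∂μ) := by
              rw [lintegral_const_mul _ (by fun_prop), lintegral_add_left e3]
          _ ≤ _ := by gcongr
    _ = _ := by rw [lintegral_const]; ring

section SmoothHypersurface

variable {W E G : Type*} [NormedAddCommGroup W] [NormedSpace ℝ W] [FiniteDimensional ℝ W]
  [MeasurableSpace W] [BorelSpace W] {μ : Measure W} [μ.IsAddHaarMeasure]
  [NormedAddCommGroup E] [InnerProductSpace ℝ E] [FiniteDimensional ℝ E]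
  [NormedAddCommGroup G] [InnerProductSpace ℝ G] [FiniteDimensional ℝ G]
  [MeasurableSpace G] [BorelSpace G]

/-- Integration by parts along the direction `v`, in orthogonal coordinates. -/
theorem integral_phase_eq_integral_orthogonal {T : W × E → E} (hT : ContDiff ℝ ∞ T)
    {γ γ₁ γ₂ : G → E} (hγ : ContDiff ℝ 1 γ) {v : G} (h1 : ∀ t, fderiv ℝ γ t v = γ₁ t)
    (hγ₁ : ContDiff ℝ 1 γ₁) (h2 : ∀ t, fderiv ℝ γ₁ t v = γ₂ t) (hγ₂ : Continuous γ₂)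
    {κ : W × E × E × E → ℝ} (hκ : ContDiff ℝ ∞ κ) {s : W} {Ξ : E} {t₀ : G} {δ : ℝ}
    {φ : G → ℝ} (hφ : ContDiff ℝ ∞ φ) (hφs : ∀ t, t ∉ Metric.closedBall t₀ δ → φ t = 0)
    (hinv : ∀ t ∈ Metric.closedBall t₀ δ, κ (s, Ξ, γ t, γ₁ t) *
      inner ℝ Ξ (fderiv ℝ T (s, γ t) (0, γ₁ t)) = 1)
    {L : (ℝ × (Submodule.span ℝ {v})ᗮ) ≃L[ℝ] G} (hL : ∀ z, L z = z.1 • v + (z.2 : G))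
    (hLn : ∀ z, |z.1| ≤ ‖L z‖ ∧ ‖z.2‖ ≤ ‖L z‖) {l : ℝ} (hl : 0 < l) :
    ∫ z, cexp (I * ((l * inner ℝ Ξ (T (s, γ (t₀ + L z))) : ℝ) : ℂ)) * (φ (t₀ + L z) : ℂ) =
      (I / l) * ∫ u in Icc (-δ) δ,
        ((∫ τ in Metric.closedBall (0 : (Submodule.span ℝ {v})ᗮ) δ,
          cexp (I * ((l * inner ℝ Ξ (T (s, γ (t₀ + L (u, τ)))) : ℝ) : ℂ)) *
          ((fderiv ℝ φ (t₀ + L (u, τ)) v : ℂ) *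
            (κ (s, Ξ, γ (t₀ + L (u, τ)), γ₁ (t₀ + L (u, τ))) : ℂ))) +
        ∫ τ in Metric.closedBall (0 : (Submodule.span ℝ {v})ᗮ) δ,
          cexp (I * ((l * inner ℝ Ξ (T (s, γ (t₀ + L (u, τ)))) : ℝ) : ℂ)) *
          ((φ (t₀ + L (u, τ)) : ℂ) *
            (fderiv ℝ κ (s, Ξ, γ (t₀ + L (u, τ)), γ₁ (t₀ + L (u, τ)))
              (0, 0, γ₁ (t₀ + L (u, τ)), γ₂ (t₀ + L (u, τ))) : ℂ))) := by
  let Z := ℝ × (Submodule.span ℝ {v})ᗮ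
  let x : Z → G := fun z => t₀ + L z
  let e : Z → ℂ := fun z => cexp (I * ((l * inner ℝ Ξ (T (s, γ (x z))) : ℝ) : ℂ))
  let B₁ : Z → ℝ := fun z => κ (s, Ξ, γ (x z), γ₁ (x z))
  let B₂ : Z → ℝ := fun z => fderiv ℝ κ (s, Ξ, γ (x z), γ₁ (x z)) (0, 0, γ₁ (x z), γ₂ (x z))
  let f₁ : Z → ℝ := fun z => fderiv ℝ φ (x z) v
  let f₂ : Z → ℝ := fun z => φ (x z)
  have hx : Continuous x := by fun_prop
  have hγc := hγ.continuous
  have hγ₁c := hγ₁.continuous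
  have hTc := hT.continuous
  have hκc := hκ.continuous
  have hφc := hφ.continuous
  have hec : Continuous e := by fun_prop
  have hB₁ : Continuous B₁ := by fun_prop
  have hB₂ : Continuous B₂ := by
    have : Continuous (fderiv ℝ κ) := hκ.continuous_fderiv (by simp)
    fun_prop
  have hf₁ : Continuous f₁ := by
    have : Continuous (fderiv ℝ φ) := hφ.continuous_fderiv (by simp)
    fun_prop
  have hf₂ : Continuous f₂ := by fun_prop
  have hφs' : ∀ t, t ∉ Metric.closedBall t₀ δ → fderiv ℝ φ t v = 0 := by
    intro t ht
    have : φ =ᶠ[𝓝 t] fun _ => 0 := by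
      filter_upwards [Metric.isClosed_closedBall.isOpen_compl.mem_nhds ht] with y hy
      exact hφs y hy
    rw [this.fderiv_eq]
    simp
  have hout : ∀ z : Z, z ∉ Icc (-δ) δ ×ˢ Metric.closedBall (0 : (Submodule.span ℝ {v})ᗮ) δ →
      x z ∉ Metric.closedBall t₀ δ := by
    intro z hz hz'
    apply hz
    rw [Metric.mem_closedBall, dist_eq_norm] at hz'
    simp only [x, add_sub_cancel_left] at hz'
    obtain ⟨a, b⟩ := hLn z
    refine ⟨abs_le.1 (a.trans hz'), ?_⟩
    rw [Metric.mem_closedBall, dist_zero_right]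
    exact b.trans hz'
  have hout₁ : ∀ z : Z, z ∉ Icc (-δ) δ ×ˢ Metric.closedBall (0 : (Submodule.span ℝ {v})ᗮ) δ →
      f₁ z = 0 := fun z hz => hφs' _ (hout z hz)
  have hout₂ : ∀ z : Z, z ∉ Icc (-δ) δ ×ˢ Metric.closedBall (0 : (Submodule.span ℝ {v})ᗮ) δ →
      f₂ z = 0 := fun z hz => hφs _ (hout z hz)
  have hcomp : IsCompact (Icc (-δ) δ ×ˢ Metric.closedBall (0 : (Submodule.span ℝ {v})ᗮ) δ) :=
    isCompact_Icc.prod (isCompact_closedBall _ _)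
  let k : Z → ℂ := fun z => e z * ((f₁ z * B₁ z + f₂ z * B₂ z : ℝ) : ℂ)
  have hk : Integrable k (volume.prod volume) := by
    refine Continuous.integrable_of_hasCompactSupport (by fun_prop) ?_
    exact HasCompactSupport.intro hcomp fun z hz => by simp [k, hout₁ z hz, hout₂ z hz]
  have hI : Integrable (fun z => e z * (f₂ z : ℂ)) (volume.prod volume) := by
    refine Continuous.integrable_of_hasCompactSupport (by fun_prop) ?_
    exact HasCompactSupport.intro hcomp fun z hz => by simp [hout₂ z hz]
  have hcurve : ∀ u τ, HasDerivAt (fun u => x (u, τ)) v u := by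
    intro u τ
    have h3 : HasDerivAt (fun u : ℝ => t₀ + (u • v + (τ : G))) ((1 : ℝ) • v) u :=
      (((hasDerivAt_id u).smul_const v).add_const _).const_add _
    rw [one_smul] at h3
    refine h3.congr_of_eventuallyEq (Eventually.of_forall fun u => ?_)
    simp only [x, hL]
  have hγd : ∀ u τ, HasDerivAt (fun u => γ (x (u, τ))) (γ₁ (x (u, τ))) u := by
    intro u τ
    rw [← h1]
    exact ((hγ.differentiable (by simp) _).hasFDerivAt).comp_hasDerivAt u (hcurve u τ)
  have hγ₁d : ∀ u τ, HasDerivAt (fun u => γ₁ (x (u, τ))) (γ₂ (x (u, τ))) u := by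
    intro u τ
    rw [← h2]
    exact ((hγ₁.differentiable (by simp) _).hasFDerivAt).comp_hasDerivAt u (hcurve u τ)
  -- On each line parallel to `v` the function integrated by parts is `φ κ`; the product rule gives
  -- the two amplitudes.
  have hstep : ∀ τ, ∫ u, e (u, τ) * (f₂ (u, τ) : ℂ) = (I / l) * ∫ u, k (u, τ) := by
    intro τ
    refine integral_phase_mul_eq (P := fun u => inner ℝ Ξ (T (s, γ (x (u, τ)))))
      (N := fun u => inner ℝ Ξ (fderiv ℝ T (s, γ (x (u, τ))) (0, γ₁ (x (u, τ)))))
      (g := fun u => f₂ (u, τ) * B₁ (u, τ)) (p := fun u => f₂ (u, τ))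
      (g' := fun u => f₁ (u, τ) * B₁ (u, τ) + f₂ (u, τ) * B₂ (u, τ)) ?_ ?_ ?_ ?_ ?_ ?_ hl
    · intro u
      have h3 : HasDerivAt (fun u => T (s, γ (x (u, τ))))
          (fderiv ℝ T (s, γ (x (u, τ))) (0, γ₁ (x (u, τ)))) u :=
        ((hT.differentiable (by simp) _).hasFDerivAt).comp_hasDerivAt u
          ((hasDerivAt_const u s).prodMk (hγd u τ))
      simpa using (hasDerivAt_const u Ξ).inner ℝ h3
    · have : Continuous (fderiv ℝ T) := hT.continuous_fderiv (by simp)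
      fun_prop
    · intro u
      have h3 : HasDerivAt (fun u => f₂ (u, τ)) (f₁ (u, τ)) u :=
        ((hφ.differentiable (by simp) _).hasFDerivAt).comp_hasDerivAt u (hcurve u τ)
      have h4 : HasDerivAt (fun u => B₁ (u, τ)) (B₂ (u, τ)) u :=
        ((hκ.differentiable (by simp) _).hasFDerivAt).comp_hasDerivAt u
          ((hasDerivAt_const u s).prodMk ((hasDerivAt_const u Ξ).prodMk
            ((hγd u τ).prodMk (hγ₁d u τ))))
      exact h3.mul h4
    · fun_prop
    · refine HasCompactSupport.intro (isCompact_Icc (a := -δ) (b := δ)) fun u hu => ?_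
      rw [hout₂ (u, τ) fun h => hu h.1, zero_mul]
    · intro u
      by_cases hu : x (u, τ) ∈ Metric.closedBall t₀ δ
      · have := hinv _ hu
        simp only [B₁]
        linear_combination f₂ (u, τ) * this
      · have : f₂ (u, τ) = 0 := hφs _ hu
        simp [this]
  change ∫ z : Z, e z * (f₂ z : ℂ) = _
  have hvol : (volume : Measure Z) = volume.prod volume := rfl
  rw [hvol, integral_prod_symm _ hI]
  simp_rw [hstep]
  rw [integral_const_mul, integral_integral_swap (f := fun τ u => k (u, τ)) hk.swap]
  congr 1
  rw [← setIntegral_eq_integral_of_forall_compl_eq_zero (s := Icc (-δ) δ)]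
  · congr 1
    ext u
    rw [← integral_add]
    · rw [← setIntegral_eq_integral_of_forall_compl_eq_zero
        (s := Metric.closedBall (0 : (Submodule.span ℝ {v})ᗮ) δ)]
      · congr 1
        ext τ
        simp only [k, e, f₁, f₂, B₁, B₂, x]
        push_cast
        ring
      · intro τ hτ
        simp [k, hout₁ (u, τ) fun h => hτ h.2, hout₂ (u, τ) fun h => hτ h.2]
    · have : Continuous fun τ => e (u, τ) * ((f₁ (u, τ) : ℂ) * (B₁ (u, τ) : ℂ)) := by fun_prop
      exact this.continuousOn.integrableOn_compact (isCompact_closedBall _ _)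
    · have : Continuous fun τ => e (u, τ) * ((f₂ (u, τ) : ℂ) * (B₂ (u, τ) : ℂ)) := by fun_prop
      exact this.continuousOn.integrableOn_compact (isCompact_closedBall _ _)
  · intro u hu
    have : ∀ τ, k (u, τ) = 0 := fun τ => by
      simp [k, hout₁ (u, τ) fun h => hu h.1, hout₂ (u, τ) fun h => hu h.1]
    simp [this]

end SmoothHypersurface

section SmoothHypersurface

variable {W E G : Type*} [NormedAddCommGroup W] [NormedSpace ℝ W] [FiniteDimensional ℝ W]
  [MeasurableSpace W] [BorelSpace W] {μ : Measure W} [μ.IsAddHaarMeasure]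
  [NormedAddCommGroup E] [InnerProductSpace ℝ E] [FiniteDimensional ℝ E]
  [NormedAddCommGroup G] [InnerProductSpace ℝ G] [FiniteDimensional ℝ G]
  [MeasurableSpace G] [BorelSpace G]

/-- By `hne` the phase moves along `v`, so one integration by parts there gains `1 / l`, that is
`l^{-2}` after squaring. On each slice parallel to the orthogonal complement the mixed derivative is
nondegenerate, and `T T*` gains a power equal to its dimension. -/
theorem exists_decay_of_degenerate {T : W × E → E} (hT : ContDiff ℝ ∞ T)
    {γ : G → E} (hγ : ContDiff ℝ 2 γ) {s₀ : W} {t₀ : G} {Ξ₀ : E} {v : G} (hv : ‖v‖ = 1)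
    [Nontrivial (Submodule.span ℝ {v})ᗮ]
    (hne : inner ℝ Ξ₀ (fderiv ℝ T (s₀, γ t₀) (0, fderiv ℝ γ t₀ v)) ≠ 0)
    (hnd : ∀ θ : (Submodule.span ℝ {v})ᗮ, θ ≠ 0 → ∃ w,
      fderiv ℝ (fun s => inner ℝ Ξ₀ (fderiv ℝ T (s, γ t₀) (0, fderiv ℝ γ t₀ θ))) s₀ w ≠ 0) :
    ∃ ε > 0, ∀ ψ : W → ℝ, ContDiff ℝ ∞ ψ → (∀ s, 0 ≤ ψ s) →
      (∀ s, s ∉ Metric.closedBall s₀ ε → ψ s = 0) →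
      ∀ φ : G → ℝ, ContDiff ℝ ∞ φ → (∀ t, t ∉ Metric.closedBall t₀ ε → φ t = 0) →
      ∃ C : ℝ≥0, ∀ Ξ : E, ‖Ξ - Ξ₀‖ ≤ ε → ∀ l : ℝ, 0 < l →
        ∫⁻ s, ENNReal.ofReal (ψ s) *
          ‖∫ t, cexp (I * ((l * inner ℝ Ξ (T (s, γ t)) : ℝ) : ℂ)) * (φ t : ℂ)‖ₑ ^ 2 ∂μ ≤
        C * ENNReal.ofReal ((l ^ (Module.finrank ℝ (Submodule.span ℝ {v})ᗮ + 2))⁻¹) := by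
  set F := (Submodule.span ℝ {v})ᗮ with hF
  let γ₁ : G → E := fun t => fderiv ℝ γ t v
  have hγ₁ : ContDiff ℝ 1 γ₁ := (hγ.fderiv_right (m := 1) (by norm_num)).clm_apply contDiff_const
  let γ₂ : G → E := fun t => fderiv ℝ γ₁ t v
  have hγ₂ : Continuous γ₂ := (hγ₁.continuous_fderiv (by simp)).clm_apply continuous_const
  have hγ' : ContDiff ℝ 1 γ := hγ.of_le (by norm_num)
  obtain ⟨κ, hκ, hκ1⟩ := exists_contDiff_inv_near
    (D := fun z : W × E × E × E => inner ℝ z.2.1 (fderiv ℝ T (z.1, z.2.2.1) (0, z.2.2.2)))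
    (x₀ := (s₀, Ξ₀, γ t₀, γ₁ t₀)) (by
      have h1 : ContDiff ℝ ∞ (fderiv ℝ T) := hT.fderiv_right (by simp)
      have h2 : ContDiff ℝ ∞ (fun z : W × E × E × E => fderiv ℝ T (z.1, z.2.2.1) (0, z.2.2.2)) :=
        (h1.comp (by fun_prop)).clm_apply (by fun_prop)
      exact ContDiff.inner ℝ (by fun_prop) h2) hne
  obtain ⟨ε₁, hε₁, hball⟩ := Metric.eventually_nhds_iff_ball.1 hκ1
  -- The amplitudes created by the integration by parts are smooth functions of `s` and of the
  -- vectors `Ξ`, `γ`, `γ₁`, `γ₂`. The low regularity of `γ` is thus confined to the parameter `q`,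
  -- where continuity suffices.
  let B₁ : W × E × E × E × E → ℝ := fun z => κ (z.1, z.2.1, z.2.2.1, z.2.2.2.1)
  have hB₁ : ContDiff ℝ ∞ B₁ := hκ.comp (by fun_prop)
  let B₂ : W × E × E × E × E → ℝ := fun z =>
    fderiv ℝ κ (z.1, z.2.1, z.2.2.1, z.2.2.2.1) (0, 0, z.2.2.2.1, z.2.2.2.2)
  have hB₂ : ContDiff ℝ ∞ B₂ := by
    have h1 : ContDiff ℝ ∞ (fderiv ℝ κ) := hκ.fderiv_right (by simp)
    exact (h1.comp (g := fderiv ℝ κ) (f := fun z : W × E × E × E × E =>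
      (z.1, z.2.1, z.2.2.1, z.2.2.2.1)) (by fun_prop)).clm_apply (by fun_prop)
  let A : F →L[ℝ] E := (fderiv ℝ γ t₀).comp F.subtypeL
  obtain ⟨ε₂, hε₂, hest₁⟩ := exists_lintegral_weight_mul_enorm_sq_le (μ := μ)
    (m := (volume : Measure F)) hT hB₁ (Ξ₀, γ t₀, γ₁ t₀, γ₂ t₀) (A := A) hnd
  obtain ⟨ε₃, hε₃, hest₂⟩ := exists_lintegral_weight_mul_enorm_sq_le (μ := μ)
    (m := (volume : Measure F)) hT hB₂ (Ξ₀, γ t₀, γ₁ t₀, γ₂ t₀) (A := A) hnd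
  obtain ⟨ε, hε, hεε₁, hεε₂, hεε₃⟩ : ∃ ε > 0, ε < ε₁ ∧ ε ≤ ε₂ ∧ ε ≤ ε₃ :=
    ⟨min (ε₁ / 2) (min ε₂ ε₃), by positivity, (min_le_left _ _).trans_lt (by linarith),
      (min_le_right _ _).trans (min_le_left _ _), (min_le_right _ _).trans (min_le_right _ _)⟩
  obtain ⟨δ₁, hδ₁, hstrict⟩ := exists_closedBall_strict
    (hγ'.contDiffAt.hasStrictFDerivAt (x := t₀) (by simp)) hε
  have hc : ∀ᶠ t in 𝓝 t₀, ‖γ₁ t - γ₁ t₀‖ ≤ ε ∧ ‖γ₂ t - γ₂ t₀‖ ≤ ε := by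
    have h1 := hγ₁.continuous.continuousAt.eventually (Metric.closedBall_mem_nhds (γ₁ t₀) hε)
    have h2 := hγ₂.continuousAt.eventually (Metric.closedBall_mem_nhds (γ₂ t₀) hε)
    filter_upwards [h1, h2] with t h1 h2
    rw [← dist_eq_norm, ← dist_eq_norm]
    exact ⟨h1, h2⟩
  obtain ⟨δ₂, hδ₂, hc'⟩ := Metric.nhds_basis_closedBall.mem_iff.1 hc
  -- Points `t₀ + L (u, τ)` with both coordinates at most `δ` may be at distance up to `2 * δ` from
  -- `t₀`.
  obtain ⟨δ, hδ, hδε, hδ1, hδ2⟩ : ∃ δ > 0, δ ≤ ε ∧ 2 * δ ≤ δ₁ ∧ 2 * δ ≤ δ₂ :=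
    ⟨min ε (min (δ₁ / 2) (δ₂ / 2)), by positivity, min_le_left _ _, by
      have := (min_le_right ε (min (δ₁ / 2) (δ₂ / 2))).trans (min_le_left _ _)
      linarith, by
      have := (min_le_right ε (min (δ₁ / 2) (δ₂ / 2))).trans (min_le_right _ _)
      linarith⟩
  obtain ⟨L, hL, hLn⟩ := exists_orthogonal_coordinates hv
  obtain ⟨c, hcL⟩ := exists_integral_eq_integral_orthogonal L t₀
  refine ⟨δ, hδ, fun ψ hψ hψ0 hψs φ hφ hφs => ?_⟩
  obtain ⟨C₁, hC₁⟩ := hest₁ ψ hψ hψ0 fun s hs => hψs s fun hs' =>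
    hs (Metric.closedBall_subset_closedBall (hδε.trans hεε₂) hs')
  obtain ⟨C₂, hC₂⟩ := hest₂ ψ hψ hψ0 fun s hs => hψs s fun hs' =>
    hs (Metric.closedBall_subset_closedBall (hδε.trans hεε₃) hs')
  have hφc : HasCompactSupport φ := HasCompactSupport.intro (isCompact_closedBall t₀ _) hφs
  have hφ'c : Continuous fun t => fderiv ℝ φ t v :=
    (hφ.continuous_fderiv (by simp)).clm_apply continuous_const
  obtain ⟨M₁, hM₁⟩ := (hφc.fderiv_apply (𝕜 := ℝ) v).exists_bound_of_continuous hφ'c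
  obtain ⟨M₂, hM₂⟩ := hφc.exists_bound_of_continuous hφ.continuous
  let D : Set F := Metric.closedBall 0 δ
  have hDt : volume D ≠ ⊤ := measure_closedBall_lt_top.ne
  let k := Module.finrank ℝ F
  refine ⟨‖c‖₊ ^ 2 * (volume (Icc (-δ) δ)).toNNReal ^ 2 *
    (2 * (C₁ * M₁.toNNReal ^ 2 * (volume D).toNNReal + C₂ * M₂.toNNReal ^ 2 *
      (volume D).toNNReal)), fun Ξ hΞ l hl => ?_⟩
  have hmem : ∀ u ∈ Icc (-δ) δ, ∀ τ ∈ D, t₀ + L (u, τ) ∈ Metric.closedBall t₀ (2 * δ) := by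
    intro u hu τ hτ
    rw [Metric.mem_closedBall, dist_eq_norm, add_sub_cancel_left, hL]
    rw [Metric.mem_closedBall, dist_zero_right] at hτ
    refine (norm_add_le _ _).trans ?_
    rw [norm_smul, hv, mul_one, Real.norm_eq_abs]
    have := abs_le.2 hu
    have h2 : ‖(τ : G)‖ ≤ δ := hτ
    linarith
  let x : ℝ → F → G := fun u τ => t₀ + L (u, τ)
  have hxc : ∀ u, Continuous (x u) := fun u => by fun_prop
  have hφcont := hφ.continuous
  have hγcont := hγ.continuous
  have hγ₁cont := hγ₁.continuous
  have hTcont := hT.continuous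
  have hB₁cont := hB₁.continuous
  have hB₂cont := hB₂.continuous
  let q : ℝ → F → E × E × E × E := fun u τ => (Ξ, γ (x u τ), γ₁ (x u τ), γ₂ (x u τ))
  have hqc : ∀ u, Continuous (q u) := fun u => by fun_prop
  have hqb : ∀ u ∈ Icc (-δ) δ, ∀ τ ∈ D, ‖q u τ - (Ξ₀, γ t₀, γ₁ t₀, γ₂ t₀)‖ ≤ ε := by
    intro u hu τ hτ
    have hm := hmem u hu τ hτ
    have h1 := hstrict _ (Metric.closedBall_subset_closedBall hδ1 hm) _
      (Metric.closedBall_subset_closedBall hδ1 hm)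
    have h2 := hc' (Metric.closedBall_subset_closedBall hδ2 hm)
    simp only [q, Prod.mk_sub_mk, Prod.norm_mk, max_le_iff]
    exact ⟨hΞ.trans hδε, h1.2.1, h2.1, h2.2⟩
  have hdiff : ∀ u ∈ Icc (-δ) δ, ∀ t ∈ D, ∀ τ ∈ D, ‖t - τ‖ ≤ ε ∧
      ‖γ (x u t) - γ (x u τ) - A (t - τ)‖ ≤ ε * ‖t - τ‖ := by
    intro u hu t ht τ hτ
    have h1 := hstrict _ (Metric.closedBall_subset_closedBall hδ1 (hmem u hu t ht)) _
      (Metric.closedBall_subset_closedBall hδ1 (hmem u hu τ hτ))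
    have h2 : t₀ + L (u, t) - (t₀ + L (u, τ)) = ((t - τ : F) : G) := by
      rw [add_sub_add_left_eq_sub, ← map_sub, hL]
      simp
    rw [h2] at h1
    exact ⟨h1.1, h1.2.2⟩
  let e : W → ℝ → F → ℂ := fun s u τ => cexp (I * ((l * inner ℝ Ξ (T (s, γ (x u τ))) : ℝ) : ℂ))
  let g₁ : W → ℝ → ℂ := fun s u => ∫ τ in D, e s u τ *
    ((fderiv ℝ φ (x u τ) v : ℂ) * (B₁ (s, q u τ) : ℂ))
  let g₂ : W → ℝ → ℂ := fun s u => ∫ τ in D, e s u τ * ((φ (x u τ) : ℂ) * (B₂ (s, q u τ) : ℂ))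
  have hg₁ : ∀ u ∈ Icc (-δ) δ, ∫⁻ s, ENNReal.ofReal (ψ s) * ‖g₁ s u‖ₑ ^ 2 ∂μ ≤
      C₁ * M₁.toNNReal ^ 2 * volume D * ENNReal.ofReal ((l ^ k)⁻¹) := by
    intro u hu
    refine hC₁ Ξ D (fun τ => γ (x u τ)) (q u) (fun τ => (fderiv ℝ φ (x u τ) v : ℂ)) M₁.toNNReal
      (hΞ.trans (hδε.trans hεε₂)) measurableSet_closedBall hDt
      (Continuous.aestronglyMeasurable (by fun_prop)) (hqc u).aestronglyMeasurable
      (continuous_ofReal.comp (hφ'c.comp (hxc u))).aestronglyMeasurable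
      (fun t ht => ?_) (fun t ht => (hqb u hu t ht).trans hεε₂)
      (fun t _ => by rw [norm_real]; exact (hM₁ _).trans (Real.le_coe_toNNReal _))
      (fun t ht τ hτ => ?_) l hl
    · have hm := Metric.closedBall_subset_closedBall hδ1 (hmem u hu t ht)
      exact ((hstrict _ hm _ hm).2.1).trans hεε₂
    · have h1 := hdiff u hu t ht τ hτ
      exact ⟨h1.1.trans hεε₂, h1.2.trans (by gcongr)⟩
  have hg₂ : ∀ u ∈ Icc (-δ) δ, ∫⁻ s, ENNReal.ofReal (ψ s) * ‖g₂ s u‖ₑ ^ 2 ∂μ ≤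
      C₂ * M₂.toNNReal ^ 2 * volume D * ENNReal.ofReal ((l ^ k)⁻¹) := by
    intro u hu
    refine hC₂ Ξ D (fun τ => γ (x u τ)) (q u) (fun τ => (φ (x u τ) : ℂ)) M₂.toNNReal
      (hΞ.trans (hδε.trans hεε₃)) measurableSet_closedBall hDt
      (Continuous.aestronglyMeasurable (by fun_prop)) (hqc u).aestronglyMeasurable
      (continuous_ofReal.comp (hφcont.comp (hxc u))).aestronglyMeasurable
      (fun t ht => ?_) (fun t ht => (hqb u hu t ht).trans hεε₃)
      (fun t _ => by rw [norm_real]; exact (hM₂ _).trans (Real.le_coe_toNNReal _))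
      (fun t ht τ hτ => ?_) l hl
    · have hm := Metric.closedBall_subset_closedBall hδ1 (hmem u hu t ht)
      exact ((hstrict _ hm _ hm).2.1).trans hεε₃
    · have h1 := hdiff u hu t ht τ hτ
      exact ⟨h1.1.trans hεε₃, h1.2.trans (by gcongr)⟩
  have hxcont : Continuous fun z : (W × ℝ) × F => x z.1.2 z.2 :=
    continuous_const.add (L.continuous.comp
      ((continuous_snd.comp continuous_fst).prodMk continuous_snd))
  have hscont : Continuous fun z : (W × ℝ) × F => z.1.1 := continuous_fst.comp continuous_fst
  have hecont : Continuous fun z : (W × ℝ) × F => e z.1.1 z.1.2 z.2 := by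
    have h1 : Continuous fun y : W × E => cexp (I * ((l * inner ℝ Ξ (T y) : ℝ) : ℂ)) := by
      fun_prop
    exact h1.comp (hscont.prodMk (hγcont.comp hxcont))
  have hqcont : Continuous fun z : (W × ℝ) × F => (z.1.1, q z.1.2 z.2) :=
    hscont.prodMk (continuous_const.prodMk ((hγcont.comp hxcont).prodMk
      ((hγ₁cont.comp hxcont).prodMk (hγ₂.comp hxcont))))
  have hg₁m : Measurable (Function.uncurry g₁) := by
    have h1 : Continuous fun z : (W × ℝ) × F => e z.1.1 z.1.2 z.2 *
        ((fderiv ℝ φ (x z.1.2 z.2) v : ℂ) * (B₁ (z.1.1, q z.1.2 z.2) : ℂ)) := by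
      have a1 : Continuous fun z : (W × ℝ) × F => fderiv ℝ φ (x z.1.2 z.2) v :=
        hφ'c.comp hxcont
      have a2 := hB₁cont.comp hqcont
      exact hecont.mul ((continuous_ofReal.comp a1).mul (continuous_ofReal.comp a2))
    exact (h1.stronglyMeasurable.integral_prod_right' (ν := volume.restrict D)).measurable
  have hg₂m : Measurable (Function.uncurry g₂) := by
    have h1 : Continuous fun z : (W × ℝ) × F => e z.1.1 z.1.2 z.2 *
        ((φ (x z.1.2 z.2) : ℂ) * (B₂ (z.1.1, q z.1.2 z.2) : ℂ)) := by
      have a1 : Continuous fun z : (W × ℝ) × F => φ (x z.1.2 z.2) := hφcont.comp hxcont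
      have a2 := hB₂cont.comp hqcont
      exact hecont.mul ((continuous_ofReal.comp a1).mul (continuous_ofReal.comp a2))
    exact (h1.stronglyMeasurable.integral_prod_right' (ν := volume.restrict D)).measurable
  have hI : ∀ s ∈ Metric.closedBall s₀ δ,
      ∫ t, cexp (I * ((l * inner ℝ Ξ (T (s, γ t)) : ℝ) : ℂ)) * (φ t : ℂ) =
        c * ((I / l) * ∫ u in Icc (-δ) δ, (g₁ s u + g₂ s u)) := by
    intro s hs
    rw [hcL]
    congr 1
    refine integral_phase_eq_integral_orthogonal hT hγ' (fun t => rfl) hγ₁ (fun t => rfl) hγ₂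
      hκ hφ hφs (fun t ht => ?_) hL hLn hl
    refine hball (s, Ξ, γ t, γ₁ t) ?_
    have hm1 := Metric.closedBall_subset_closedBall (by linarith : δ ≤ δ₁) ht
    have hm2 := Metric.closedBall_subset_closedBall (by linarith : δ ≤ δ₂) ht
    have h1 := (hstrict _ hm1 _ hm1).2.1
    have h2 := (hc' hm2).1
    rw [Metric.mem_closedBall, dist_eq_norm] at hs
    simp only [Metric.mem_ball, dist_eq_norm, Prod.mk_sub_mk, Prod.norm_mk, max_lt_iff]
    exact ⟨(hs.trans hδε).trans_lt hεε₁, (hΞ.trans hδε).trans_lt hεε₁, h1.trans_lt hεε₁,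
      h2.trans_lt hεε₁⟩
  have hψm : Measurable fun s => ENNReal.ofReal (ψ s) := hψ.continuous.measurable.ennreal_ofReal
  -- The gain of the integration by parts, squared.
  have hl2 : ‖I / (l : ℂ)‖ₑ ^ 2 = ENNReal.ofReal ((l ^ 2)⁻¹) := by
    rw [← ofReal_norm, ← ENNReal.ofReal_pow (norm_nonneg _), norm_div, norm_I, norm_real,
      Real.norm_eq_abs, abs_of_pos hl]
    congr 1
    field_simp
  calc ∫⁻ s, ENNReal.ofReal (ψ s) *
          ‖∫ t, cexp (I * ((l * inner ℝ Ξ (T (s, γ t)) : ℝ) : ℂ)) * (φ t : ℂ)‖ₑ ^ 2 ∂μ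
      ≤ ∫⁻ s, ‖c‖ₑ ^ 2 * ENNReal.ofReal ((l ^ 2)⁻¹) * (ENNReal.ofReal (ψ s) *
          ‖∫ u in Icc (-δ) δ, (g₁ s u + g₂ s u)‖ₑ ^ 2) ∂μ := by
        refine lintegral_mono fun s => ?_
        by_cases hs : s ∈ Metric.closedBall s₀ δ
        · simp only
          rw [hI s hs, enorm_mul, enorm_mul, mul_pow, mul_pow, hl2]
          have : ‖(c : ℂ)‖ₑ = ‖c‖ₑ := by
            rw [← ofReal_norm, ← ofReal_norm, norm_real]
          rw [this]
          apply le_of_eq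
          ring
        · simp [hψs s hs]
    _ = ‖c‖ₑ ^ 2 * ENNReal.ofReal ((l ^ 2)⁻¹) * ∫⁻ s, (ENNReal.ofReal (ψ s) *
          ‖∫ u in Icc (-δ) δ, (g₁ s u + g₂ s u)‖ₑ ^ 2) ∂μ := by
        rw [lintegral_const_mul' _ _ (by finiteness)]
    _ ≤ ‖c‖ₑ ^ 2 * ENNReal.ofReal ((l ^ 2)⁻¹) * (volume (Icc (-δ) δ) ^ 2 * (2 *
          (C₁ * M₁.toNNReal ^ 2 * volume D * ENNReal.ofReal ((l ^ k)⁻¹) +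
          C₂ * M₂.toNNReal ^ 2 * volume D * ENNReal.ofReal ((l ^ k)⁻¹)))) := by
        gcongr
        have hfin : IsFiniteMeasure (volume.restrict (Icc (-δ) δ)) := inferInstance
        have := lintegral_weight_mul_enorm_sq_integral_add_le (μ := μ)
          (ν := volume.restrict (Icc (-δ) δ)) hψm hg₁m hg₂m
          ((ae_restrict_mem measurableSet_Icc).mono hg₁)
          ((ae_restrict_mem measurableSet_Icc).mono hg₂)
        rwa [Measure.restrict_apply_univ] at this
    _ = _ := by
        push_cast
        rw [ENNReal.coe_toNNReal hDt, ENNReal.coe_toNNReal measure_Icc_lt_top.ne]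
        have : ENNReal.ofReal ((l ^ (k + 2))⁻¹) =
            ENNReal.ofReal ((l ^ k)⁻¹) * ENNReal.ofReal ((l ^ 2)⁻¹) := by
          rw [← ENNReal.ofReal_mul (by positivity), ← mul_inv, ← pow_add]
        rw [this, enorm_eq_nnnorm]
        ring

end SmoothHypersurface

/-! ### Averaged decay from the rank condition. -/

section Decay

variable {W E G : Type*} [NormedAddCommGroup W] [NormedSpace ℝ W] [FiniteDimensional ℝ W]
  [MeasurableSpace W] [BorelSpace W] {μ : Measure W} [μ.IsAddHaarMeasure]
  [NormedAddCommGroup E] [InnerProductSpace ℝ E] [FiniteDimensional ℝ E]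

/-- The rank condition on the family `T` in the direction `Ξ`, at the point `(s, x)`. -/
def RankCondition (T : W × E → E) (Ξ : E) (s : W) (x : E) : Prop :=
  ∀ y, inner ℝ Ξ (fderiv ℝ T (s, x) (0, y)) = 0 →
    (∀ w, fderiv ℝ (fun s' => inner ℝ Ξ (fderiv ℝ T (s', x) (0, y))) s w = 0) → y = 0

theorem fderiv_inner_add_smul {T : W × E → E} (hT : ContDiff ℝ ∞ T) (Ξ : E) (s w : W)
    (x y z : E) (c : ℝ) :
    fderiv ℝ (fun s' => inner ℝ Ξ (fderiv ℝ T (s', x) (0, y - c • z))) s w =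
      fderiv ℝ (fun s' => inner ℝ Ξ (fderiv ℝ T (s', x) (0, y))) s w -
        c * fderiv ℝ (fun s' => inner ℝ Ξ (fderiv ℝ T (s', x) (0, z))) s w := by
  have hd : ∀ y, DifferentiableAt ℝ (fun s' => inner ℝ Ξ (fderiv ℝ T (s', x) (0, y))) s := by
    intro y
    have h1 : ContDiff ℝ ∞ (fderiv ℝ T) := hT.fderiv_right (by simp)
    have h2 : ContDiff ℝ ∞ (fun s' : W => fderiv ℝ T (s', x) (0, y)) :=
      (h1.comp (g := fderiv ℝ T) (by fun_prop)).clm_apply (by fun_prop)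
    exact (contDiff_const.inner ℝ h2).differentiable (by simp) s
  have heq : (fun s' => inner ℝ Ξ (fderiv ℝ T (s', x) (0, y - c • z))) =
      fun s' => inner ℝ Ξ (fderiv ℝ T (s', x) (0, y)) -
        c * inner ℝ Ξ (fderiv ℝ T (s', x) (0, z)) := by
    ext s'
    have : ((0 : W), y - c • z) = (0, y) - c • (0, z) := by ext <;> simp
    rw [this, map_sub, map_smul, inner_sub_right, real_inner_smul_right]
  rw [heq, fderiv_fun_sub (hd y) ((hd z).const_mul c), fderiv_const_mul (hd z)]
  simp

variable [NormedAddCommGroup G] [InnerProductSpace ℝ G] [FiniteDimensional ℝ G]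
  [MeasurableSpace G] [BorelSpace G]

/-- Either no tangent direction is killed by the mixed derivative, or some `v` is. In the latter
case the rank condition makes the phase nonstationary along `v` and excludes degeneracy on the
orthogonal complement. Dimension at least `2` keeps that complement nontrivial. -/
theorem exists_decay_of_rankCondition (hG : 2 ≤ Module.finrank ℝ G) {T : W × E → E}
    (hT : ContDiff ℝ ∞ T) {γ : G → E} (hγ : ContDiff ℝ 2 γ) {s₀ : W} {t₀ : G} {Ξ₀ : E}
    (hinj : Function.Injective (fderiv ℝ γ t₀)) (hR : RankCondition T Ξ₀ s₀ (γ t₀)) :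
    ∃ ε > 0, ∀ ψ : W → ℝ, ContDiff ℝ ∞ ψ → (∀ s, 0 ≤ ψ s) →
      (∀ s, s ∉ Metric.closedBall s₀ ε → ψ s = 0) →
      ∀ φ : G → ℝ, ContDiff ℝ ∞ φ → (∀ t, t ∉ Metric.closedBall t₀ ε → φ t = 0) →
      ∃ C : ℝ≥0, ∀ Ξ : E, ‖Ξ - Ξ₀‖ ≤ ε → ∀ l : ℝ, 1 ≤ l →
        ∫⁻ s, ENNReal.ofReal (ψ s) *
          ‖∫ t, cexp (I * ((l * inner ℝ Ξ (T (s, γ t)) : ℝ) : ℂ)) * (φ t : ℂ)‖ₑ ^ 2 ∂μ ≤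
        C * ENNReal.ofReal ((l ^ Module.finrank ℝ G)⁻¹) := by
  by_cases hnd : ∀ θ : G, θ ≠ 0 → ∃ w,
      fderiv ℝ (fun s => inner ℝ Ξ₀ (fderiv ℝ T (s, γ t₀) (0, fderiv ℝ γ t₀ θ))) s₀ w ≠ 0
  · have : Nontrivial G := Module.nontrivial_of_finrank_pos (R := ℝ) (by omega)
    obtain ⟨ε, hε, h⟩ := exists_decay_of_nondegenerate (μ := μ) hT hγ.continuous
      (hγ.contDiffAt.hasStrictFDerivAt (x := t₀) (by simp)) hnd
    refine ⟨ε, hε, fun ψ h1 h2 h3 φ h4 h5 => ?_⟩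
    obtain ⟨C, hC⟩ := h ψ h1 h2 h3 φ h4 h5
    exact ⟨C, fun Ξ hΞ l hl => hC Ξ hΞ l (by linarith)⟩
  · push Not at hnd
    obtain ⟨v', hv'0, hv'⟩ := hnd
    obtain ⟨v, hv, hvd⟩ : ∃ v : G, ‖v‖ = 1 ∧ ∀ w, fderiv ℝ (fun s => inner ℝ Ξ₀
        (fderiv ℝ T (s, γ t₀) (0, fderiv ℝ γ t₀ v))) s₀ w = 0 := by
      refine ⟨‖v'‖⁻¹ • v', by rw [norm_smul, norm_inv, norm_norm, inv_mul_cancel₀ (norm_ne_zero_iff.2 hv'0)], fun w => ?_⟩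
      have := fderiv_inner_add_smul hT Ξ₀ s₀ w (γ t₀) 0 (fderiv ℝ γ t₀ v') (-‖v'‖⁻¹)
      rw [hv' w] at this
      simp only [neg_smul, sub_neg_eq_add, zero_add] at this
      rw [map_smul, this]
      simp [show ((0 : W), (0 : E)) = 0 from rfl]
    have hv0 : v ≠ 0 := by rintro rfl; simp at hv
    have hne : inner ℝ Ξ₀ (fderiv ℝ T (s₀, γ t₀) (0, fderiv ℝ γ t₀ v)) ≠ 0 := by
      intro h0
      exact hv0 (hinj ((hR _ h0 hvd).trans (map_zero _).symm))
    have hdim : Module.finrank ℝ (Submodule.span ℝ {v})ᗮ + 1 = Module.finrank ℝ G := by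
      have := Submodule.finrank_add_finrank_orthogonal (Submodule.span ℝ {v})
      rw [finrank_span_singleton hv0] at this
      omega
    have : Nontrivial (Submodule.span ℝ {v})ᗮ :=
      Module.nontrivial_of_finrank_pos (R := ℝ) (by omega)
    obtain ⟨ε, hε, h⟩ := exists_decay_of_degenerate (μ := μ) hT hγ (s₀ := s₀) (t₀ := t₀) hv hne
      (by
        intro θ hθ
        by_contra! hcon
        set a := inner ℝ Ξ₀ (fderiv ℝ T (s₀, γ t₀) (0, fderiv ℝ γ t₀ v))
        set b := inner ℝ Ξ₀ (fderiv ℝ T (s₀, γ t₀) (0, fderiv ℝ γ t₀ θ))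
        -- If `θ` were degenerate too, subtracting a multiple of `v` would annihilate the
        -- first-order term as well. The rank condition then forces `θ` to be a multiple of `v`,
        -- against orthogonality.
        have h1 := hR (fderiv ℝ γ t₀ θ - (b / a) • fderiv ℝ γ t₀ v) (by
          have : ((0 : W), fderiv ℝ γ t₀ θ - (b / a) • fderiv ℝ γ t₀ v) =
            (0, fderiv ℝ γ t₀ θ) - (b / a) • (0, fderiv ℝ γ t₀ v) := by ext <;> simp
          rw [this, map_sub, map_smul, inner_sub_right, real_inner_smul_right]
          change b - b / a * a = 0
          field_simp
          ring) (by
          intro w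
          rw [fderiv_inner_add_smul hT, hcon, hvd]
          simp)
        rw [← map_smul, ← map_sub] at h1
        have h2 : (θ : G) - (b / a) • v = 0 := hinj (h1.trans (map_zero _).symm)
        have h3 : inner ℝ v (θ : G) = 0 := Submodule.mem_orthogonal_singleton_iff_inner_right.1 θ.2
        rw [sub_eq_zero] at h2
        rw [h2, real_inner_smul_right, real_inner_self_eq_norm_sq, hv] at h3
        apply hθ
        ext
        rw [h2]
        norm_num at h3
        simp [h3])
    refine ⟨ε, hε, fun ψ h1 h2 h3 φ h4 h5 => ?_⟩
    obtain ⟨C, hC⟩ := h ψ h1 h2 h3 φ h4 h5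
    -- The degenerate case yields one power of `l` more than required, dropped using `1 ≤ l`.
    refine ⟨C, fun Ξ hΞ l hl => (hC Ξ hΞ l (by linarith)).trans ?_⟩
    gcongr
    omega

/-- Uniform decay over the unit sphere from decay near each direction. The set `𝓜 ε` collects the
admissible measures at scale `ε`. -/
theorem exists_decay_sphere {X : Type*} [MeasurableSpace X] {T : W × E → E} {Γ : X → E} {s₀ : W}
    {𝓜 : ℝ → Set (Measure X)} (h𝓜 : Monotone 𝓜) {d : ℕ}
    (h : ∀ Ξ₀ : E, ‖Ξ₀‖ = 1 → ∃ ε > 0, ∀ ψ : W → ℝ, ContDiff ℝ ∞ ψ → (∀ s, 0 ≤ ψ s) →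
      (∀ s, s ∉ Metric.closedBall s₀ ε → ψ s = 0) → ∀ ν ∈ 𝓜 ε,
      ∃ C : ℝ≥0, ∀ Ξ : E, ‖Ξ - Ξ₀‖ ≤ ε → ∀ l : ℝ, 1 ≤ l →
        ∫⁻ s, ENNReal.ofReal (ψ s) *
          ‖∫ t, cexp (I * ((l * inner ℝ Ξ (T (s, Γ t)) : ℝ) : ℂ)) ∂ν‖ₑ ^ 2 ∂μ ≤
        C * ENNReal.ofReal ((l ^ d)⁻¹)) :
    ∃ ε > 0, ∀ ψ : W → ℝ, ContDiff ℝ ∞ ψ → (∀ s, 0 ≤ ψ s) →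
      (∀ s, s ∉ Metric.closedBall s₀ ε → ψ s = 0) → ∀ ν ∈ 𝓜 ε,
      ∃ C : ℝ≥0, ∀ Ξ ∈ Metric.sphere (0 : E) 1, ∀ l : ℝ, 1 ≤ l →
        ∫⁻ s, ENNReal.ofReal (ψ s) *
          ‖∫ t, cexp (I * ((l * inner ℝ Ξ (T (s, Γ t)) : ℝ) : ℂ)) ∂ν‖ₑ ^ 2 ∂μ ≤
        C * ENNReal.ofReal ((l ^ d)⁻¹) := by
  refine (isCompact_sphere (0 : E) 1).induction_on (p := fun S : Set E =>
    ∃ ε > 0, ∀ ψ : W → ℝ, ContDiff ℝ ∞ ψ → (∀ s, 0 ≤ ψ s) →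
      (∀ s, s ∉ Metric.closedBall s₀ ε → ψ s = 0) → ∀ ν ∈ 𝓜 ε,
      ∃ C : ℝ≥0, ∀ Ξ ∈ S, ∀ l : ℝ, 1 ≤ l →
        ∫⁻ s, ENNReal.ofReal (ψ s) *
          ‖∫ t, cexp (I * ((l * inner ℝ Ξ (T (s, Γ t)) : ℝ) : ℂ)) ∂ν‖ₑ ^ 2 ∂μ ≤
        C * ENNReal.ofReal ((l ^ d)⁻¹)) ?_ ?_ ?_ ?_
  · exact ⟨1, one_pos, fun _ _ _ _ _ _ => ⟨0, fun Ξ hΞ => absurd hΞ (notMem_empty Ξ)⟩⟩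
  · rintro S S' hSS' ⟨ε, hε, h⟩
    refine ⟨ε, hε, fun ψ h1 h2 h3 ν hν => ?_⟩
    obtain ⟨C, hC⟩ := h ψ h1 h2 h3 ν hν
    exact ⟨C, fun Ξ hΞ => hC Ξ (hSS' hΞ)⟩
  · rintro S S' ⟨ε, hε, h⟩ ⟨ε', hε', h'⟩
    refine ⟨min ε ε', lt_min hε hε', fun ψ h1 h2 h3 ν hν => ?_⟩
    obtain ⟨C, hC⟩ := h ψ h1 h2 (fun s hs => h3 s fun hs' =>
      hs (Metric.closedBall_subset_closedBall (min_le_left _ _) hs')) ν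
      (h𝓜 (min_le_left _ _) hν)
    obtain ⟨C', hC'⟩ := h' ψ h1 h2 (fun s hs => h3 s fun hs' =>
      hs (Metric.closedBall_subset_closedBall (min_le_right _ _) hs')) ν
      (h𝓜 (min_le_right _ _) hν)
    refine ⟨max C C', ?_⟩
    rintro Ξ (hΞ | hΞ) l hl
    · refine (hC Ξ hΞ l hl).trans ?_
      gcongr
      exact le_max_left _ _
    · refine (hC' Ξ hΞ l hl).trans ?_
      gcongr
      exact le_max_right _ _
  · intro Ξ₀ hΞ₀
    obtain ⟨ε, hε, h⟩ := h Ξ₀ (by simpa using hΞ₀)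
    refine ⟨_, mem_nhdsWithin_of_mem_nhds (Metric.closedBall_mem_nhds Ξ₀ hε), ε, hε, ?_⟩
    intro ψ h1 h2 h3 ν hν
    obtain ⟨C, hC⟩ := h ψ h1 h2 h3 ν hν
    exact ⟨C, fun Ξ hΞ => hC Ξ (by rw [← dist_eq_norm]; exact hΞ)⟩

/-- From decay over the unit sphere to the Fourier side hypothesis of the averaging estimate. -/
theorem exists_lintegral_charInt_le {X : Type*} [MeasurableSpace X] {ν : Measure X}
    [IsFiniteMeasure ν] {T : W × E → E} {Γ : X → E} {ψ : W → ℝ}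
    (hψ : Continuous ψ) (hψc : HasCompactSupport ψ) {d : ℕ} {C : ℝ≥0}
    (h : ∀ Ξ ∈ Metric.sphere (0 : E) 1, ∀ l : ℝ, 1 ≤ l →
        ∫⁻ s, ENNReal.ofReal (ψ s) *
          ‖∫ t, cexp (I * ((l * inner ℝ Ξ (T (s, Γ t)) : ℝ) : ℂ)) ∂ν‖ₑ ^ 2 ∂μ ≤
        C * ENNReal.ofReal ((l ^ d)⁻¹)) (e : E) :
    ∃ C₂ : ℝ≥0, ∀ ζ : E, ENNReal.ofReal ((1 + |inner ℝ ζ e|) ^ d) *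
      ∫⁻ s, ENNReal.ofReal (ψ s) *
        ‖∫ t, (Real.fourierChar (inner ℝ ζ (T (s, Γ t))) : ℂ) ∂ν‖ₑ ^ 2 ∂μ ≤ C₂ := by
  have hfin : ∫⁻ s, ENNReal.ofReal (ψ s) ∂μ ≠ ⊤ := by
    have := (hψ.integrable_of_hasCompactSupport (μ := μ) hψc).hasFiniteIntegral
    refine ne_top_of_le_ne_top this.ne (lintegral_mono fun s => ?_)
    rw [← ofReal_norm]
    exact ENNReal.ofReal_le_ofReal (Real.le_norm_self _)
  set P := ∫⁻ s, ENNReal.ofReal (ψ s) ∂μ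
  have hb : ∀ ζ : E, ∀ l : ℝ, ‖ζ‖ ≤ l → 1 ≤ l →
      (1 + |inner ℝ ζ e|) ^ d ≤ (1 + ‖e‖) ^ d * l ^ d := by
    intro ζ l h1 h2
    rw [← mul_pow]
    have := abs_real_inner_le_norm ζ e
    have h3 : ‖ζ‖ * ‖e‖ ≤ l * ‖e‖ := by gcongr
    gcongr
    linarith
  refine ⟨((1 + ‖e‖₊) ^ d) * (P.toNNReal * (ν univ).toNNReal ^ 2 + C), fun ζ => ?_⟩
  have hpi := Real.pi_gt_three
  have he : ENNReal.ofReal ((1 + ‖e‖) ^ d) = (1 + (‖e‖₊ : ℝ≥0∞)) ^ d := by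
    rw [ENNReal.ofReal_pow (by positivity), ENNReal.ofReal_add zero_le_one (norm_nonneg _),
      ENNReal.ofReal_one, ofReal_norm, enorm_eq_nnnorm]
  push_cast
  rw [ENNReal.coe_toNNReal hfin, ENNReal.coe_toNNReal (measure_ne_top ν univ), ← he]
  -- High frequencies use the decay with `l = 2π‖ζ‖`; for low frequencies the weight is bounded and
  -- the symbol is at most the mass of `ν`.
  rcases le_or_gt 1 (2 * Real.pi * ‖ζ‖) with hζ | hζ
  · set l := 2 * Real.pi * ‖ζ‖ with hl
    have hn : 0 < ‖ζ‖ := by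
      by_contra hcon
      have : ‖ζ‖ = 0 := le_antisymm (not_lt.1 hcon) (norm_nonneg _)
      rw [hl, this] at hζ
      norm_num at hζ
    have h1 := h (‖ζ‖⁻¹ • ζ) (by simp [norm_smul, hn.ne']) l hζ
    have h2 : ∀ s t, (Real.fourierChar (inner ℝ ζ (T (s, Γ t))) : ℂ) =
        cexp (I * ((l * inner ℝ (‖ζ‖⁻¹ • ζ) (T (s, Γ t)) : ℝ) : ℂ)) := by
      intro s t
      rw [Real.fourierChar_apply, real_inner_smul_left, mul_comm I, hl]
      congr 3
      field_simp
    simp_rw [h2]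
    calc _ ≤ ENNReal.ofReal ((1 + ‖e‖) ^ d * l ^ d) *
          (C * ENNReal.ofReal ((l ^ d)⁻¹)) := by
          gcongr
          exact hb ζ l (by nlinarith) hζ
      _ = ENNReal.ofReal ((1 + ‖e‖) ^ d) * (C * ENNReal.ofReal (l ^ d * (l ^ d)⁻¹)) := by
          rw [ENNReal.ofReal_mul (by positivity), ENNReal.ofReal_mul (by positivity)]
          ring
      _ = ENNReal.ofReal ((1 + ‖e‖) ^ d) * C := by
          rw [mul_inv_cancel₀ (by positivity), ENNReal.ofReal_one, mul_one]
      _ ≤ _ := by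
          gcongr
          exact le_add_self
  · calc _ ≤ ENNReal.ofReal ((1 + ‖e‖) ^ d * 1 ^ d) *
          ∫⁻ s, ENNReal.ofReal (ψ s) * ν univ ^ 2 ∂μ := by
          gcongr with s
          · exact hb ζ 1 (by nlinarith [norm_nonneg ζ]) le_rfl
          · refine (enorm_integral_le_lintegral_enorm _).trans (le_of_eq ?_)
            have : ∀ t, ‖(Real.fourierChar (inner ℝ ζ (T (s, Γ t))) : ℂ)‖ₑ = 1 := by
              intro t
              rw [← ofReal_norm, Circle.norm_coe, ENNReal.ofReal_one]
            simp [this]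
      _ = ENNReal.ofReal ((1 + ‖e‖) ^ d) * (P * ν univ ^ 2) := by
          rw [lintegral_mul_const _ (hψ.measurable.ennreal_ofReal), one_pow, mul_one]
      _ ≤ _ := by
          gcongr
          exact le_self_add

end Decay

/-! ### Measure comparison under antilipschitz maps and transversal averages. -/

section Antilipschitz

/-- Haar measure is a multiple of Hausdorff measure of the same dimension, and antilipschitz
preimages enlarge the latter by at most a power of `K`. This replaces a change of variables without
any differentiability. -/
theorem exists_measure_preimage_le_of_antilipschitz {X Y : Type*} [NormedAddCommGroup X]
    [NormedSpace ℝ X] [FiniteDimensional ℝ X] [MeasurableSpace X] [BorelSpace X]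
    [NormedAddCommGroup Y] [NormedSpace ℝ Y] [FiniteDimensional ℝ Y] [MeasurableSpace Y]
    [BorelSpace Y] (μ : Measure X) [μ.IsAddHaarMeasure] (ν : Measure Y) [ν.IsAddHaarMeasure]
    (hdim : Module.finrank ℝ X = Module.finrank ℝ Y) (K : ℝ≥0) :
    ∃ C : ℝ≥0, ∀ (D : Set X) (f : X → Y),
      (∀ x ∈ D, ∀ y ∈ D, ‖x - y‖ ≤ K * ‖f x - f y‖) → ∀ S : Set Y,
      μ (D ∩ f ⁻¹' S) ≤ C * ν S := by
  let c₁ : ℝ≥0 := μ.addHaarScalarFactor (Measure.hausdorffMeasure (Module.finrank ℝ X))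
  let c₂ : ℝ≥0 := (Measure.hausdorffMeasure (Module.finrank ℝ Y)).addHaarScalarFactor ν
  have h1 : μ = c₁ • Measure.hausdorffMeasure (Module.finrank ℝ X) :=
    Measure.isAddLeftInvariant_eq_smul _ _
  have h2 : Measure.hausdorffMeasure (Module.finrank ℝ Y) = c₂ • ν :=
    Measure.isAddLeftInvariant_eq_smul _ _
  refine ⟨c₁ * (K ^ (Module.finrank ℝ X) * c₂), fun D f hf S => ?_⟩
  have hal : AntilipschitzWith K (fun x : D => f x) := by
    apply AntilipschitzWith.of_le_mul_dist
    intro x y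
    rw [Subtype.dist_eq, dist_eq_norm, dist_eq_norm]
    exact hf x x.2 y y.2
  have h3 := hal.hausdorffMeasure_preimage_le (d := Module.finrank ℝ X) (by positivity) S
  have h4 := (isometry_subtype_coe (s := D)).hausdorffMeasure_image
    (d := Module.finrank ℝ X) (Or.inl (by positivity)) ((fun x : D => f x) ⁻¹' S)
  have h5 : (Subtype.val : D → X) '' ((fun x : D => f x) ⁻¹' S) = D ∩ f ⁻¹' S := by
    ext x
    simp only [mem_image, mem_preimage, Subtype.exists, mem_inter_iff]
    constructor
    · rintro ⟨a, ha, h, rfl⟩; exact ⟨ha, h⟩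
    · rintro ⟨ha, h⟩; exact ⟨x, ha, h, rfl⟩
  rw [h5] at h4
  calc μ (D ∩ f ⁻¹' S) = c₁ * Measure.hausdorffMeasure (Module.finrank ℝ X) (D ∩ f ⁻¹' S) := by
        conv_lhs => rw [h1]
        rfl
    _ ≤ c₁ * ((K : ℝ≥0∞) ^ (Module.finrank ℝ X : ℝ) *
          Measure.hausdorffMeasure (Module.finrank ℝ X) S) := by
        rw [h4]; gcongr
    _ = _ := by
        rw [hdim, h2, ← hdim, ENNReal.rpow_natCast]
        push_cast
        rw [Pi.smul_apply, ENNReal.smul_def, smul_eq_mul]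
        ring

theorem exists_lintegral_comp_le_of_antilipschitz {X Y : Type*} [NormedAddCommGroup X]
    [NormedSpace ℝ X] [FiniteDimensional ℝ X] [MeasurableSpace X] [BorelSpace X]
    [NormedAddCommGroup Y] [NormedSpace ℝ Y] [FiniteDimensional ℝ Y] [MeasurableSpace Y]
    [BorelSpace Y] (μ : Measure X) [μ.IsAddHaarMeasure] (ν : Measure Y) [ν.IsAddHaarMeasure]
    (hdim : Module.finrank ℝ X = Module.finrank ℝ Y) (K : ℝ≥0) :
    ∃ C : ℝ≥0, ∀ (D : Set X) (f : X → Y), MeasurableSet D → Measurable f →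
      (∀ x ∈ D, ∀ y ∈ D, ‖x - y‖ ≤ K * ‖f x - f y‖) → ∀ F : Y → ℝ≥0∞, Measurable F →
      ∫⁻ x in D, F (f x) ∂μ ≤ C * ∫⁻ y, F y ∂ν := by
  obtain ⟨C, hC⟩ := exists_measure_preimage_le_of_antilipschitz μ ν hdim K
  refine ⟨C, fun D f hD hf hK F hF => ?_⟩
  have hle : Measure.map f (μ.restrict D) ≤ C • ν := by
    refine Measure.le_iff.2 fun S hS => ?_
    rw [Measure.map_apply hf hS, Measure.restrict_apply (hf hS), inter_comm]
    exact hC D f hK S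
  calc ∫⁻ x in D, F (f x) ∂μ = ∫⁻ y, F y ∂(Measure.map f (μ.restrict D)) :=
        (lintegral_map hF hf).symm
    _ ≤ ∫⁻ y, F y ∂(C • ν) := lintegral_mono' hle le_rfl
    _ = C * ∫⁻ y, F y ∂ν := by rw [lintegral_smul_measure]; rfl

variable {W E G : Type*} [NormedAddCommGroup W] [NormedSpace ℝ W]
  [NormedAddCommGroup E] [InnerProductSpace ℝ E] [FiniteDimensional ℝ E]
  [MeasurableSpace E] [BorelSpace E]
  [NormedAddCommGroup G] [NormedSpace ℝ G] [FiniteDimensional ℝ G]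
  [MeasurableSpace G] [BorelSpace G] {m : Measure G} [m.IsAddHaarMeasure]

/-- Averages along a transversal direction of the translates of a hypersurface. -/
theorem exists_lintegral_transversal_le {T : W × E → E} (hT : ContDiff ℝ ∞ T) {s₀ : W} {x₀ : E}
    {A : G →L[ℝ] E} {e : E}
    (hinj : ∀ t : G, ∀ u : ℝ, fderiv ℝ T (s₀, x₀) (0, A t) + u • e = 0 → t = 0 ∧ u = 0)
    (hdim : Module.finrank ℝ G + 1 = Module.finrank ℝ E) :
    ∃ ε > 0, ∃ C : ℝ≥0, ∀ (D : Set G) (Γ : G → E), MeasurableSet D → Measurable Γ →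
      (∀ t ∈ D, ‖Γ t - x₀‖ ≤ ε) →
      (∀ t ∈ D, ∀ τ ∈ D, ‖Γ t - Γ τ - A (t - τ)‖ ≤ ε * ‖t - τ‖) →
      ∀ s ∈ Metric.closedBall s₀ ε, ∀ F : E → ℝ≥0∞, Measurable F →
      ∫⁻ t in D, (∫⁻ u : ℝ, F (T (s, Γ t) + u • e)) ∂m ≤ C * ∫⁻ x, F x := by
  let J : E →L[ℝ] E := (fderiv ℝ T (s₀, x₀)).comp (ContinuousLinearMap.inr ℝ W E)
  have hJ : ∀ y, J y = fderiv ℝ T (s₀, x₀) (0, y) := fun y => by simp [J]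
  -- The linear model of `(t, u) ↦ T (s, Γ t) + u • e`; it is injective by transversality and hence
  -- antilipschitz.
  let Λ : G × ℝ →L[ℝ] E :=
    (J.comp A).coprod ((ContinuousLinearMap.id ℝ ℝ).smulRight e)
  have hΛ : ∀ z, Λ z = J (A z.1) + z.2 • e := fun z => by simp [Λ]
  obtain ⟨K, hK0, hK⟩ := (Λ : G × ℝ →ₗ[ℝ] E).exists_antilipschitzWith (by
    rw [LinearMap.ker_eq_bot']
    rintro ⟨t, u⟩ h
    have h' : Λ (t, u) = 0 := h
    rw [hΛ, hJ] at h'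
    obtain ⟨h1, h2⟩ := hinj t u h'
    rw [h1, h2]; rfl)
  have hKn : ∀ z : G × ℝ, ‖z‖ ≤ K * ‖Λ z‖ := fun z => by
    have := hK.le_mul_dist z 0
    simpa [dist_eq_norm] using this
  have hstr : HasStrictFDerivAt T (fderiv ℝ T (s₀, x₀)) (s₀, x₀) :=
    hT.contDiffAt.hasStrictFDerivAt (by simp)
  have hK0' : (0 : ℝ) < K := hK0
  -- Small enough that the nonlinear error costs at most half, so the actual map is antilipschitz
  -- with constant `2 * K`, uniformly in `s`.
  obtain ⟨η, hη, hηK⟩ : ∃ η > 0, K * (η * (‖A‖ + 1) + ‖J‖ * η) ≤ 1 / 2 := by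
    refine ⟨1 / (2 * K * (‖A‖ + 1 + ‖J‖)), by positivity, le_of_eq ?_⟩
    field_simp
  obtain ⟨δ, hδ, hδ'⟩ := exists_closedBall_strict hstr hη
  obtain ⟨C, hC⟩ := exists_lintegral_comp_le_of_antilipschitz
    (m.prod (volume : Measure ℝ)) (volume : Measure E)
    (by rw [Module.finrank_prod, Module.finrank_self, hdim]) (2 * K)
  refine ⟨min δ (min η 1), by positivity, C, ?_⟩
  intro D Γ hD hΓm hΓ hdiff s hs F hF
  have hmin1 : min δ (min η 1) ≤ δ := min_le_left _ _
  have hmin2 : min δ (min η 1) ≤ η := (min_le_right _ _).trans (min_le_left _ _)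
  have hmin3 : min δ (min η 1) ≤ 1 := (min_le_right _ _).trans (min_le_right _ _)
  let f : G × ℝ → E := fun z => T (s, Γ z.1) + z.2 • e
  have hf : Measurable f := by
    have h1 : Measurable fun z : G × ℝ => T (s, Γ z.1) :=
      (hT.continuous.comp (continuous_const.prodMk continuous_id)).measurable.comp
        (hΓm.comp measurable_fst)
    have h2 : Measurable fun z : G × ℝ => z.2 • e := by fun_prop
    exact h1.add h2
  have hanti : ∀ x ∈ D ×ˢ (univ : Set ℝ), ∀ y ∈ D ×ˢ (univ : Set ℝ),
      ‖x - y‖ ≤ ((2 * K : ℝ≥0) : ℝ) * ‖f x - f y‖ := by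
    rintro ⟨t, u⟩ ⟨ht, -⟩ ⟨τ, u'⟩ ⟨hτ, -⟩
    simp only at ht hτ
    have hb : ∀ t ∈ D, (s, Γ t) ∈ Metric.closedBall (s₀, x₀) δ := by
      intro t ht
      rw [Metric.mem_closedBall, Prod.dist_eq, max_le_iff]
      refine ⟨(Metric.mem_closedBall.1 hs).trans hmin1, ?_⟩
      rw [dist_eq_norm]
      exact (hΓ t ht).trans hmin1
    have h1 := (hδ' _ (hb t ht) _ (hb τ hτ)).2.2
    have h2 : (s, Γ t) - (s, Γ τ) = ((0 : W), Γ t - Γ τ) := by simp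
    rw [h2, ← hJ] at h1
    have h3 : ‖((0 : W), Γ t - Γ τ)‖ = ‖Γ t - Γ τ‖ := by simp
    rw [h3] at h1
    have h4 := hdiff t ht τ hτ
    have h5 : ‖Γ t - Γ τ‖ ≤ (‖A‖ + 1) * ‖t - τ‖ := by
      calc ‖Γ t - Γ τ‖ = ‖(Γ t - Γ τ - A (t - τ)) + A (t - τ)‖ := by rw [sub_add_cancel]
        _ ≤ min δ (min η 1) * ‖t - τ‖ + ‖A‖ * ‖t - τ‖ :=
          (norm_add_le _ _).trans (add_le_add h4 (A.le_opNorm _))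
        _ ≤ 1 * ‖t - τ‖ + ‖A‖ * ‖t - τ‖ := by gcongr
        _ = _ := by ring
    have h6 : ‖J (Γ t - Γ τ - A (t - τ))‖ ≤ ‖J‖ * (η * ‖t - τ‖) := by
      refine (J.le_opNorm _).trans ?_
      gcongr
      exact h4.trans (by gcongr)
    have h7 : Λ ((t, u) - (τ, u')) = (f (t, u) - f (τ, u')) -
        ((T (s, Γ t) - T (s, Γ τ) - J (Γ t - Γ τ)) + J (Γ t - Γ τ - A (t - τ))) := by
      rw [hΛ]
      simp only [f, Prod.mk_sub_mk, map_sub, sub_smul]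
      abel
    have h8 : ‖t - τ‖ ≤ ‖(t, u) - (τ, u')‖ := by
      rw [Prod.mk_sub_mk, Prod.norm_mk]
      exact le_max_left _ _
    have h9 := hKn ((t, u) - (τ, u'))
    have h10 : ‖Λ ((t, u) - (τ, u'))‖ ≤ ‖f (t, u) - f (τ, u')‖ +
        (η * (‖A‖ + 1) + ‖J‖ * η) * ‖(t, u) - (τ, u')‖ := by
      rw [h7]
      refine (norm_sub_le _ _).trans ?_
      gcongr
      refine (norm_add_le _ _).trans ?_
      calc _ ≤ η * ((‖A‖ + 1) * ‖t - τ‖) + ‖J‖ * (η * ‖t - τ‖) :=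
            add_le_add (h1.trans (by gcongr)) h6
        _ = (η * (‖A‖ + 1) + ‖J‖ * η) * ‖t - τ‖ := by ring
        _ ≤ _ := by gcongr
    set X := ‖(t, u) - (τ, u')‖
    have h11 : X ≤ K * ‖f (t, u) - f (τ, u')‖ + 1 / 2 * X := by
      calc X ≤ K * (‖f (t, u) - f (τ, u')‖ + (η * (‖A‖ + 1) + ‖J‖ * η) * X) :=
            h9.trans (by gcongr)
        _ = K * ‖f (t, u) - f (τ, u')‖ + K * (η * (‖A‖ + 1) + ‖J‖ * η) * X := by ring
        _ ≤ _ := by gcongr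
    push_cast
    linarith
  have := hC (D ×ˢ univ) f (hD.prod MeasurableSet.univ) hf hanti F hF
  rw [← Measure.prod_restrict, Measure.restrict_univ, lintegral_prod _ (by fun_prop)] at this
  exact this

end Antilipschitz

/-! ### Stability properties of the averaging bound. -/

section AverageBound

variable {W E X Y : Type*} [MeasurableSpace W]
  [NormedAddCommGroup E] [InnerProductSpace ℝ E] [FiniteDimensional ℝ E]
  [MeasurableSpace E] [BorelSpace E] [MeasurableSpace X] [MeasurableSpace Y]

/-- The `L^{(d+2)/(d+1)} → L^{d+2}` bound for averages of nonnegative functions over the translates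
of the sets parametrized by `t ↦ T (s, Γ t)`. -/
def AverageBound (d : ℕ) (σ : Measure W) (ν : Measure X) (T : W × E → E) (Γ : X → E) : Prop :=
  ∃ C : ℝ≥0, ∀ F : E → ℝ≥0∞, Measurable F →
    ∫⁻ s, (∫⁻ x, (∫⁻ t, F (x + T (s, Γ t)) ∂ν) ^ ((d : ℝ) + 2)) ∂σ ≤
      C * (∫⁻ x, F x ^ (((d : ℝ) + 2) / ((d : ℝ) + 1))) ^ ((d : ℝ) + 1)

variable {d : ℕ} {σ σ' : Measure W} {ν ν₁ : Measure X} {ν₂ : Measure Y} {T T' : W × E → E}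
  {Γ Γ₁ : X → E} {Γ₂ : Y → E}

theorem AverageBound.mono_left (h : AverageBound d σ ν T Γ) (hσ : σ' ≤ σ) :
    AverageBound d σ' ν T Γ := by
  obtain ⟨C, hC⟩ := h
  exact ⟨C, fun F hF => (lintegral_mono' hσ le_rfl).trans (hC F hF)⟩

theorem AverageBound.add_left (h : AverageBound d σ ν T Γ) (h' : AverageBound d σ' ν T Γ) :
    AverageBound d (σ + σ') ν T Γ := by
  obtain ⟨C, hC⟩ := h
  obtain ⟨C', hC'⟩ := h'
  refine ⟨C + C', fun F hF => ?_⟩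
  rw [lintegral_add_measure]
  push_cast
  rw [add_mul]
  exact add_le_add (hC F hF) (hC' F hF)

theorem AverageBound.congr_ae (h : AverageBound d σ ν T Γ)
    (hT : ∀ᵐ s ∂σ, ∀ x, T' (s, x) = T (s, x)) : AverageBound d σ ν T' Γ := by
  obtain ⟨C, hC⟩ := h
  refine ⟨C, fun F hF => le_trans (le_of_eq ?_) (hC F hF)⟩
  refine lintegral_congr_ae ?_
  filter_upwards [hT] with s hs
  simp only [hs]

theorem AverageBound.of_le_mul (h : AverageBound d σ ν₂ T Γ₂) (hT : ∀ s, Measurable fun x => T (s, x))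
    {c : ℝ≥0} (hle : ∀ F : E → ℝ≥0∞, Measurable F →
      ∫⁻ t, F (Γ t) ∂ν ≤ c * ∫⁻ t, F (Γ₂ t) ∂ν₂) : AverageBound d σ ν T Γ := by
  obtain ⟨C, hC⟩ := h
  have hd : (0 : ℝ) ≤ d + 2 := by positivity
  refine ⟨c ^ ((d : ℝ) + 2) * C, fun F hF => ?_⟩
  calc ∫⁻ s, (∫⁻ x, (∫⁻ t, F (x + T (s, Γ t)) ∂ν) ^ ((d : ℝ) + 2)) ∂σ
      ≤ ∫⁻ s, (∫⁻ x, (c : ℝ≥0∞) ^ ((d : ℝ) + 2) *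
          (∫⁻ t, F (x + T (s, Γ₂ t)) ∂ν₂) ^ ((d : ℝ) + 2)) ∂σ := by
        gcongr with s x
        rw [← ENNReal.mul_rpow_of_nonneg _ _ hd]
        gcongr
        exact hle (fun y => F (x + T (s, y))) (hF.comp ((hT s).const_add x))
    _ = (c : ℝ≥0∞) ^ ((d : ℝ) + 2) * ∫⁻ s, (∫⁻ x,
          (∫⁻ t, F (x + T (s, Γ₂ t)) ∂ν₂) ^ ((d : ℝ) + 2)) ∂σ := by
        have hc : (c : ℝ≥0∞) ^ ((d : ℝ) + 2) ≠ ⊤ := ENNReal.rpow_ne_top_of_nonneg hd (by simp)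
        rw [← lintegral_const_mul' _ _ hc]
        congr 1
        ext s
        rw [lintegral_const_mul' _ _ hc]
    _ ≤ _ := by
        push_cast
        rw [ENNReal.coe_rpow_of_nonneg _ hd, mul_assoc]
        gcongr
        exact hC F hF

/-- Splitting the surface into pieces costs only the convexity inequality `(a + b)^q ≤ 2^{q-1}(a^q +
b^q)`. -/
theorem AverageBound.of_le_add [SFinite ν₁]
    (h₁ : AverageBound d σ ν₁ T Γ₁) (h₂ : AverageBound d σ ν₂ T Γ₂)
    (hT : Measurable T) (hΓ₁ : Measurable Γ₁)
    (hle : ∀ F : E → ℝ≥0∞, Measurable F →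
      ∫⁻ t, F (Γ t) ∂ν ≤ ∫⁻ t, F (Γ₁ t) ∂ν₁ + ∫⁻ t, F (Γ₂ t) ∂ν₂) : AverageBound d σ ν T Γ := by
  obtain ⟨C, hC⟩ := h₁
  obtain ⟨C', hC'⟩ := h₂
  have hd : (0 : ℝ) ≤ d + 2 := by positivity
  have hd1 : (1 : ℝ) ≤ d + 2 := by linarith [(Nat.cast_nonneg d : (0 : ℝ) ≤ d)]
  have hTs : ∀ s, Measurable fun x => T (s, x) := fun s => hT.comp measurable_prodMk_left
  refine ⟨2 ^ ((d : ℝ) + 2 - 1) * (C + C'), fun F hF => ?_⟩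
  let I₁ : W → E → ℝ≥0∞ := fun s x => (∫⁻ t, F (x + T (s, Γ₁ t)) ∂ν₁) ^ ((d : ℝ) + 2)
  let I₂ : W → E → ℝ≥0∞ := fun s x => (∫⁻ t, F (x + T (s, Γ₂ t)) ∂ν₂) ^ ((d : ℝ) + 2)
  have hI₁ : Measurable (Function.uncurry I₁) := by
    have h3 : Measurable fun z : (W × E) × X => F (z.1.2 + T (z.1.1, Γ₁ z.2)) := by fun_prop
    exact h3.lintegral_prod_right'.pow_const _
  have h2c : (2 : ℝ≥0∞) ^ ((d : ℝ) + 2 - 1) ≠ ⊤ :=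
    ENNReal.rpow_ne_top_of_nonneg (by linarith) (by simp)
  calc ∫⁻ s, (∫⁻ x, (∫⁻ t, F (x + T (s, Γ t)) ∂ν) ^ ((d : ℝ) + 2)) ∂σ
      ≤ ∫⁻ s, (∫⁻ x, 2 ^ ((d : ℝ) + 2 - 1) * (I₁ s x + I₂ s x)) ∂σ := by
        gcongr with s x
        refine le_trans ?_ (ENNReal.rpow_add_le_mul_rpow_add_rpow _ _ hd1)
        gcongr
        exact hle (fun y => F (x + T (s, y))) (hF.comp ((hTs s).const_add x))
    _ = 2 ^ ((d : ℝ) + 2 - 1) * ((∫⁻ s, (∫⁻ x, I₁ s x) ∂σ) + ∫⁻ s, (∫⁻ x, I₂ s x) ∂σ) := by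
        have : ∀ s, ∫⁻ x, 2 ^ ((d : ℝ) + 2 - 1) * (I₁ s x + I₂ s x) =
            2 ^ ((d : ℝ) + 2 - 1) * ((∫⁻ x, I₁ s x) + ∫⁻ x, I₂ s x) := by
          intro s
          have hm : Measurable (I₁ s) := hI₁.comp measurable_prodMk_left
          rw [lintegral_const_mul' _ _ h2c, lintegral_add_left hm]
        have hm : Measurable fun s => ∫⁻ x, I₁ s x := hI₁.lintegral_prod_right'
        simp_rw [this]
        rw [lintegral_const_mul' _ _ h2c, lintegral_add_left hm]
    _ ≤ _ := by
        push_cast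
        rw [ENNReal.coe_rpow_of_nonneg _ (by linarith), mul_assoc, add_mul]
        gcongr
        · simp
        · exact hC F hF
        · exact hC' F hF

end AverageBound

/-! ### From decay and transversality to a local averaging bound. -/

section LocalEstimate

variable {W E G X : Type*} [NormedAddCommGroup W] [NormedSpace ℝ W] [FiniteDimensional ℝ W]
  [MeasurableSpace W] [BorelSpace W] {μ : Measure W} [μ.IsAddHaarMeasure]
  [NormedAddCommGroup E] [InnerProductSpace ℝ E] [FiniteDimensional ℝ E]
  [MeasurableSpace E] [BorelSpace E]
  [NormedAddCommGroup G] [NormedSpace ℝ G] [FiniteDimensional ℝ G]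
  [MeasurableSpace G] [BorelSpace G] {m : Measure G} [m.IsAddHaarMeasure]

/-- The abstract estimate asks for the density bound at every `s`, whereas transversality is only
available near `s₀`. Parameters outside the ball are sent to `s₀`. -/
theorem exists_measurable_retraction_closedBall (s₀ : W) {ε : ℝ} (hε : 0 < ε) :
    ∃ r : W → W, Measurable r ∧ (∀ s, r s ∈ Metric.closedBall s₀ ε) ∧
      ∀ s ∈ Metric.closedBall s₀ ε, r s = s := by
  classical
  refine ⟨(Metric.closedBall s₀ ε).piecewise id fun _ => s₀,
    measurable_id.piecewise measurableSet_closedBall measurable_const, fun s => ?_,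
    fun s hs => by simp [hs]⟩
  by_cases hs : s ∈ Metric.closedBall s₀ ε
  · simp [hs]
  · simp [hs, hε.le]

/-- The cutoff `ψ` is taken as the density of the parameter measure. It vanishes where the
retraction alters the family, and dominates `1` on `V`. -/
theorem averageBound_of_decay [MeasurableSpace X] {ν : Measure X} [IsFiniteMeasure ν]
    {T : W × E → E} (hT : Continuous T)
    {Γ : X → E} (hΓ : Measurable Γ) {ψ : W → ℝ} (hψ : Continuous ψ)
    {s₀ : W} {ε : ℝ} (hε : 0 < ε) (hψs : ∀ s, s ∉ Metric.closedBall s₀ ε → ψ s = 0)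
    {d : ℕ} (hd : 0 < d) {C : ℝ≥0}
    (h : ∀ Ξ ∈ Metric.sphere (0 : E) 1, ∀ l : ℝ, 1 ≤ l →
        ∫⁻ s, ENNReal.ofReal (ψ s) *
          ‖∫ t, cexp (I * ((l * inner ℝ Ξ (T (s, Γ t)) : ℝ) : ℂ)) ∂ν‖ₑ ^ 2 ∂μ ≤
        C * ENNReal.ofReal ((l ^ d)⁻¹)) {e : E} {C₁ : ℝ≥0}
    (h1 : ∀ s ∈ Metric.closedBall s₀ ε, ∀ F : E → ℝ≥0∞, Measurable F →
      ∫⁻ t, (∫⁻ u : ℝ, F (T (s, Γ t) + u • e)) ∂ν ≤ C₁ * ∫⁻ x, F x) {V : Set W}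
    (hV : MeasurableSet V) (hψV : ∀ s ∈ V, 1 ≤ ψ s) :
    AverageBound d (μ.restrict V) ν T Γ := by
  have hψc : HasCompactSupport ψ := HasCompactSupport.intro (isCompact_closedBall s₀ ε) hψs
  obtain ⟨C₂, hC₂⟩ := exists_lintegral_charInt_le hψ hψc h e
  obtain ⟨r, hr, hrmem, hrid⟩ := exists_measurable_retraction_closedBall s₀ hε
  let Θ : W × X → E := fun z => T (r z.1, Γ z.2)
  have hΘ : Measurable Θ :=
    hT.measurable.comp ((hr.comp measurable_fst).prodMk (hΓ.comp measurable_snd))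
  have hψm : Measurable fun s => ENNReal.ofReal (ψ s) := hψ.measurable.ennreal_ofReal
  have : IsFiniteMeasure (μ.withDensity fun s => ENNReal.ofReal (ψ s)) :=
    isFiniteMeasure_withDensity_ofReal (hψ.integrable_of_hasCompactSupport hψc).hasFiniteIntegral
  obtain ⟨C₃, hC₃⟩ := exists_lintegral_average_rpow_le
    (σ := μ.withDensity fun s => ENNReal.ofReal (ψ s)) (ν := ν) hΘ (e := e) hd
    (C₁ := C₁) (C₂ := C₂) (fun s => h1 (r s) (hrmem s)) (fun ζ => by
      have hm : Measurable fun s => ‖charInt ν Θ s ζ‖ₑ ^ 2 := by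
        have h3 : Measurable fun z : W × X => (Real.fourierChar (inner ℝ ζ (Θ z)) : ℂ) := by
          have : Continuous fun y : E => (Real.fourierChar (inner ℝ ζ y) : ℂ) := by
            fun_prop
          exact this.measurable.comp hΘ
        exact (h3.stronglyMeasurable.integral_prod_right' (ν := ν)).measurable.enorm.pow_const _
      rw [lintegral_withDensity_eq_lintegral_mul _ hψm hm]
      refine le_trans (le_of_eq ?_) (hC₂ ζ)
      congr 1
      refine lintegral_congr fun s => ?_
      simp only [Pi.mul_apply]
      by_cases hs : s ∈ Metric.closedBall s₀ ε
      · simp only [charInt, Θ, hrid s hs]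
      · simp [hψs s hs])
  refine ⟨C₃, fun F hF => le_trans ?_ (hC₃ F hF)⟩
  have hm : Measurable fun p : W × E =>
      (∫⁻ y, F (p.2 + Θ (p.1, y)) ∂ν) ^ ((d : ℝ) + 2) := by
    have h3 : Measurable fun z : (W × E) × X => F (z.1.2 + Θ (z.1.1, z.2)) := by fun_prop
    exact h3.lintegral_prod_right'.pow_const _
  rw [lintegral_prod _ hm.aemeasurable,
    lintegral_withDensity_eq_lintegral_mul _ hψm hm.lintegral_prod_right',
    ← lintegral_indicator hV]
  refine lintegral_mono fun s => ?_
  by_cases hs : s ∈ V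
  · have hs' : s ∈ Metric.closedBall s₀ ε := by
      by_contra h0
      have := hψV s hs
      rw [hψs s h0] at this
      linarith
    simp only [indicator_of_mem hs, Pi.mul_apply, Θ, hrid s hs']
    refine le_mul_of_one_le_left zero_le ?_
    rw [← ENNReal.ofReal_one]
    exact ENNReal.ofReal_le_ofReal (hψV s hs)
  · simp [indicator_of_notMem hs]

/-- The image of the tangent space has codimension one; any vector outside it will do. -/
theorem exists_transversal {J : E →L[ℝ] E} (hJ : Function.Injective J) {A : G →L[ℝ] E}
    (hA : Function.Injective A) (hdim : Module.finrank ℝ G + 1 = Module.finrank ℝ E) :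
    ∃ e : E, ∀ t : G, ∀ u : ℝ, J (A t) + u • e = 0 → t = 0 ∧ u = 0 := by
  let R := LinearMap.range (J.comp A : G →ₗ[ℝ] E)
  have hR : R ≠ ⊤ := by
    intro h
    have h1 := LinearMap.finrank_range_le (J.comp A : G →ₗ[ℝ] E)
    change Module.finrank ℝ R ≤ _ at h1
    rw [h, finrank_top] at h1
    omega
  obtain ⟨e, -, he⟩ := SetLike.exists_of_lt (lt_top_iff_ne_top.2 hR)
  refine ⟨e, fun t u h => ?_⟩
  have hu : u = 0 := by
    by_contra hu
    apply he
    refine ⟨-(u⁻¹ • t), ?_⟩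
    have h2 : J (A t) = -(u • e) := eq_neg_of_add_eq_zero_left h
    simp [h2, smul_smul, hu]
  rw [hu, zero_smul, add_zero] at h
  exact ⟨hA (hJ (h.trans (by simp))), hu⟩

end LocalEstimate

/-! ### The local averaging bound for `C²` hypersurfaces. -/

section SmoothHypersurface

variable {W E G : Type*} [NormedAddCommGroup W] [NormedSpace ℝ W] [FiniteDimensional ℝ W]
  [MeasurableSpace W] [BorelSpace W] {μ : Measure W} [μ.IsAddHaarMeasure]
  [NormedAddCommGroup E] [InnerProductSpace ℝ E] [FiniteDimensional ℝ E]
  [MeasurableSpace E] [BorelSpace E]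
  [NormedAddCommGroup G] [InnerProductSpace ℝ G] [FiniteDimensional ℝ G]
  [MeasurableSpace G] [BorelSpace G]

theorem integral_withDensity_ofReal {Y : Type*} [MeasurableSpace Y] {ν : Measure Y} {φ : Y → ℝ}
    (hφ : Measurable φ) (h0 : ∀ t, 0 ≤ φ t) (f : Y → ℂ) :
    ∫ t, f t ∂(ν.withDensity fun t => ENNReal.ofReal (φ t)) = ∫ t, f t * (φ t : ℂ) ∂ν := by
  rw [integral_withDensity_eq_integral_toReal_smul hφ.ennreal_ofReal (by simp)]
  refine integral_congr_ae (ae_of_all _ fun t => ?_)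
  simp only [ENNReal.toReal_ofReal (h0 t)]
  rw [mul_comm, real_smul]

theorem exists_averageBound_of_contDiff (hG : 2 ≤ Module.finrank ℝ G)
    (hdim : Module.finrank ℝ G + 1 = Module.finrank ℝ E) {T : W × E → E}
    (hT : ContDiff ℝ ∞ T) {γ : G → E} (hγ : ContDiff ℝ 2 γ) {s₀ : W} {t₀ : G}
    (hinj : Function.Injective (fderiv ℝ γ t₀))
    (hJ : Function.Injective fun y => fderiv ℝ T (s₀, γ t₀) (0, y))
    (hR : ∀ Ξ, ‖Ξ‖ = 1 → RankCondition T Ξ s₀ (γ t₀)) :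
    ∃ V ∈ 𝓝 s₀, ∃ V' ∈ 𝓝 t₀,
      AverageBound (Module.finrank ℝ G) (μ.restrict V) (volume.restrict V') T γ := by
  -- The measures must be admissible at every smaller scale, since covering the sphere of directions
  -- shrinks `ε`. Smooth densities are what the integration by parts needs.
  let 𝓜 : ℝ → Set (Measure G) := fun ε => {ν | ∃ φ : G → ℝ, ContDiff ℝ ∞ φ ∧ (∀ t, 0 ≤ φ t) ∧
    (∀ t, t ∉ Metric.closedBall t₀ ε → φ t = 0) ∧
    ν = volume.withDensity fun t => ENNReal.ofReal (φ t)}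
  have h𝓜 : Monotone 𝓜 := by
    rintro ε ε' hεε' ν ⟨φ, h1, h2, h3, h4⟩
    exact ⟨φ, h1, h2, fun t ht => h3 t fun h => ht
      (Metric.closedBall_subset_closedBall hεε' h), h4⟩
  obtain ⟨ε₁, hε₁, hdec⟩ := exists_decay_sphere (μ := μ) (T := T) (Γ := γ) (s₀ := s₀) h𝓜
    (d := Module.finrank ℝ G) (fun Ξ₀ hΞ₀ => by
      obtain ⟨ε, hε, h⟩ := exists_decay_of_rankCondition (μ := μ) hG hT hγ hinj (hR Ξ₀ hΞ₀)
      refine ⟨ε, hε, fun ψ h1 h2 h3 ν hν => ?_⟩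
      obtain ⟨φ, h4, h5, h6, rfl⟩ := hν
      obtain ⟨C, hC⟩ := h ψ h1 h2 h3 φ h4 h6
      refine ⟨C, fun Ξ hΞ l hl => ?_⟩
      simp_rw [integral_withDensity_ofReal h4.continuous.measurable h5]
      exact hC Ξ hΞ l hl)
  let J : E →L[ℝ] E := (fderiv ℝ T (s₀, γ t₀)).comp (ContinuousLinearMap.inr ℝ W E)
  have hJ' : ∀ y, J y = fderiv ℝ T (s₀, γ t₀) (0, y) := fun y => by simp [J]
  obtain ⟨e, he⟩ := exists_transversal (J := J) (by
    intro a b hab; rw [hJ', hJ'] at hab; exact hJ hab) hinj hdim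
  simp_rw [hJ'] at he
  obtain ⟨ε₂, hε₂, C₁, htr⟩ := exists_lintegral_transversal_le (m := (volume : Measure G)) hT he
    hdim
  obtain ⟨δ, hδ, hstrict⟩ := exists_closedBall_strict
    (hγ.contDiffAt.hasStrictFDerivAt (x := t₀) (by simp)) hε₂
  obtain ⟨ε, hε, hεε₁, hεε₂, hεδ⟩ : ∃ ε > 0, ε ≤ ε₁ ∧ ε ≤ ε₂ ∧ ε ≤ δ :=
    ⟨min ε₁ (min ε₂ δ), by positivity, min_le_left _ _,
      (min_le_right _ _).trans (min_le_left _ _), (min_le_right _ _).trans (min_le_right _ _)⟩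
  let ψ : ContDiffBump s₀ := ⟨ε / 2, ε, by positivity, by linarith⟩
  let φ : ContDiffBump t₀ := ⟨ε / 2, ε, by positivity, by linarith⟩
  have hψs : ∀ s, s ∉ Metric.closedBall s₀ ε → ψ s = 0 := fun s hs =>
    ψ.zero_of_le_dist (le_of_lt (by simpa using hs))
  have hφs : ∀ t, t ∉ Metric.closedBall t₀ ε → φ t = 0 := fun t ht =>
    φ.zero_of_le_dist (le_of_lt (by simpa using ht))
  let ν : Measure G := volume.withDensity fun t => ENNReal.ofReal (φ t)
  have hφm : Measurable fun t => ENNReal.ofReal (φ t) := φ.continuous.measurable.ennreal_ofReal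
  obtain ⟨C, hC⟩ := hdec ψ ψ.contDiff (fun s => ψ.nonneg) (fun s hs => hψs s fun h => hs
    (Metric.closedBall_subset_closedBall hεε₁ h)) ν
    (h𝓜 hεε₁ ⟨φ, φ.contDiff, fun t => φ.nonneg, hφs, rfl⟩)
  have : IsFiniteMeasure ν := isFiniteMeasure_withDensity_ofReal
    (φ.continuous.integrable_of_hasCompactSupport φ.hasCompactSupport).hasFiniteIntegral
  have hbound := averageBound_of_decay (μ := μ) (ν := ν) hT.continuous
    hγ.continuous.measurable ψ.continuous hε hψs (d := Module.finrank ℝ G) (by omega) hC (e := e)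
    (C₁ := C₁) (fun s hs F hF => by
      have hm : Measurable fun t => ∫⁻ u : ℝ, F (T (s, γ t) + u • e) := by
        have h1 : Continuous fun z : G × ℝ => T (s, γ z.1) + z.2 • e := by
          have := hT.continuous
          have := hγ.continuous
          fun_prop
        exact (hF.comp h1.measurable).lintegral_prod_right'
      rw [lintegral_withDensity_eq_lintegral_mul _ hφm hm]
      refine le_trans ?_ (htr (Metric.closedBall t₀ ε) γ measurableSet_closedBall
        hγ.continuous.measurable (fun t ht => ?_) (fun t ht τ hτ => ?_) s
        (Metric.closedBall_subset_closedBall hεε₂ hs) F hF)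
      · rw [← lintegral_indicator measurableSet_closedBall]
        refine lintegral_mono fun t => ?_
        by_cases ht : t ∈ Metric.closedBall t₀ ε
        · simp only [indicator_of_mem ht, Pi.mul_apply]
          refine mul_le_of_le_one_left' ?_
          rw [← ENNReal.ofReal_one]
          exact ENNReal.ofReal_le_ofReal φ.le_one
        · simp [hφs t ht]
      · have ht' := Metric.closedBall_subset_closedBall hεδ ht
        exact (hstrict t ht' t ht').2.1
      · exact (hstrict t (Metric.closedBall_subset_closedBall hεδ ht) τ
          (Metric.closedBall_subset_closedBall hεδ hτ)).2.2)
    (V := Metric.closedBall s₀ (ε / 2)) measurableSet_closedBall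
    (fun s hs => (ψ.one_of_mem_closedBall hs).ge)
  refine ⟨_, Metric.closedBall_mem_nhds s₀ (half_pos hε), _,
    Metric.closedBall_mem_nhds t₀ (half_pos hε), ?_⟩
  refine hbound.of_le_mul (c := 1) (fun s => (hT.continuous.comp
    (continuous_const.prodMk continuous_id)).measurable) fun F hF => ?_
  have hFm : Measurable fun t => F (γ t) := hF.comp hγ.continuous.measurable
  rw [lintegral_withDensity_eq_lintegral_mul _ hφm hFm,
    ENNReal.coe_one, one_mul, ← lintegral_indicator measurableSet_closedBall]
  refine lintegral_mono fun t => ?_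
  by_cases ht : t ∈ Metric.closedBall t₀ (ε / 2)
  · simp only [indicator_of_mem ht, Pi.mul_apply]
    have : φ t = 1 := φ.one_of_mem_closedBall ht
    simp [this]
  · simp [indicator_of_notMem ht]

end SmoothHypersurface

/-! ### Oscillatory integrals through finite differences. -/

section FiniteDifferences

theorem norm_exp_I_mul_sub_le (x y : ℝ) : ‖cexp (I * x) - cexp (I * y)‖ ≤ |x - y| := by
  have h : cexp (I * x) - cexp (I * y) = cexp (I * y) * (cexp (I * ((x - y : ℝ) : ℂ)) - 1) := by
    rw [mul_sub, ← Complex.exp_add]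
    push_cast
    ring_nf
  rw [h, norm_mul, norm_cexp_phase, one_mul]
  exact Real.norm_exp_I_mul_ofReal_sub_one_le

theorem quarter_le_norm_exp_I_mul_sub_one {x : ℝ} (h1 : 1 / 2 ≤ |x|) (h2 : |x| ≤ 3 / 2) :
    1 / 4 ≤ ‖cexp (I * x) - 1‖ := by
  have h3 : (cexp (I * x) - 1).im = Real.sin x := by
    rw [mul_comm]
    simp [Complex.exp_ofReal_mul_I_im]
  refine le_trans ?_ (abs_im_le_norm _)
  rw [h3]
  have hpi := Real.pi_gt_three
  have hpi' := Real.pi_lt_four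
  have key : ∀ y : ℝ, 1 / 2 ≤ y → y ≤ 3 / 2 → 1 / 4 ≤ Real.sin y := by
    intro y hy1 hy2
    have h4 := Real.mul_le_sin (x := y) (by linarith) (by linarith)
    have h5 : 1 / 2 ≤ 2 / Real.pi := by
      rw [div_le_div_iff₀ (by norm_num) (by linarith)]
      linarith
    nlinarith
  rcases le_total 0 x with hx | hx
  · rw [abs_of_nonneg hx] at h1 h2
    exact (key x h1 h2).trans (le_abs_self _)
  · rw [abs_of_nonpos hx] at h1 h2
    have := key (-x) h1 h2
    rw [Real.sin_neg] at this
    exact this.trans (neg_le_abs _)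

/-- Summation by parts for an oscillatory integral over an interval with step `h`. -/
theorem norm_integral_phase_le_of_second_difference {P : ℝ → ℝ} {δ h l B : ℝ} (hh : 0 < h)
    (hl : 0 < l) (hδ : 0 ≤ δ) (hP : ContinuousOn P (Icc 0 δ))
    (h1 : ∀ x ∈ Icc 0 (δ - h), 1 / 2 ≤ |l * (P (x + h) - P x)| ∧ |l * (P (x + h) - P x)| ≤ 3 / 2)
    (h2 : 2 * h ≤ δ → ∫ x in (0 : ℝ)..(δ - 2 * h), |P (x + 2 * h) - 2 * P (x + h) + P x| ≤ B)
    (hB : 0 ≤ B) :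
    ‖∫ x in (0 : ℝ)..δ, cexp (I * ((l * P x : ℝ) : ℂ))‖ ≤ 9 * h + 16 * l * B := by
  -- A short interval is absorbed by the term `9 * h`.
  rcases lt_or_ge δ (2 * h) with hδh | hδh
  · have := intervalIntegral.norm_integral_le_of_norm_le_const (a := 0) (b := δ) (C := 1)
      (f := fun x => cexp (I * ((l * P x : ℝ) : ℂ))) (fun x _ => (norm_cexp_phase _).le)
    rw [sub_zero, abs_of_nonneg hδ, one_mul] at this
    refine this.trans ?_
    have : 0 ≤ 16 * l * B := by positivity
    linarith
  let e : ℝ → ℂ := fun x => cexp (I * ((l * P x : ℝ) : ℂ))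
  let θ : ℝ → ℝ := fun x => l * (P (x + h) - P x)
  -- With this factor `e x = q x * (e (x + h) - e x)`, a discrete substitute for dividing by the
  -- derivative of the phase. The bounds on `θ` keep the denominator at least `1 / 4`.
  let q : ℝ → ℂ := fun x => (cexp (I * (θ x : ℝ)) - 1)⁻¹
  have hec : ContinuousOn e (Icc 0 δ) := by fun_prop
  have hPs : ContinuousOn (fun x => P (x + h)) (Icc 0 (δ - h)) :=
    hP.comp (by fun_prop) fun x hx => ⟨by linarith [hx.1], by linarith [hx.2]⟩
  have hPr : ContinuousOn P (Icc 0 (δ - h)) := hP.mono (Icc_subset_Icc_right (by linarith))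
  have hθc : ContinuousOn θ (Icc 0 (δ - h)) := continuousOn_const.mul (hPs.sub hPr)
  have hne : ∀ x ∈ Icc 0 (δ - h), 1 / 4 ≤ ‖cexp (I * (θ x : ℝ)) - 1‖ := fun x hx =>
    quarter_le_norm_exp_I_mul_sub_one (h1 x hx).1 (h1 x hx).2
  have hne0 : ∀ x ∈ Icc 0 (δ - h), cexp (I * (θ x : ℝ)) - 1 ≠ 0 := fun x hx h0 => by
    have := hne x hx
    rw [h0, norm_zero] at this
    norm_num at this
  have hqc : ContinuousOn q (Icc 0 (δ - h)) := by
    refine ContinuousOn.inv₀ (by fun_prop) hne0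
  have hq4 : ∀ x ∈ Icc 0 (δ - h), ‖q x‖ ≤ 4 := by
    intro x hx
    rw [norm_inv]
    exact (inv_anti₀ (by norm_num) (hne x hx)).trans (by norm_num)
  have hqd : ∀ x ∈ Icc 0 (δ - h), ∀ y ∈ Icc 0 (δ - h), ‖q x - q y‖ ≤ 16 * |θ x - θ y| := by
    intro x hx y hy
    have : q x - q y = q x * (cexp (I * (θ y : ℝ)) - cexp (I * (θ x : ℝ))) * q y := by
      simp only [q]
      have a := hne0 x hx
      have b := hne0 y hy
      field_simp
      ring
    rw [this, norm_mul, norm_mul]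
    have a1 := hq4 x hx
    have a2 := hq4 y hy
    have a3 := norm_exp_I_mul_sub_le (θ y) (θ x)
    calc _ ≤ 4 * |θ y - θ x| * 4 := by gcongr
      _ = _ := by rw [abs_sub_comm]; ring
  have hstep : ∀ x ∈ Icc 0 (δ - h), e x = q x * e (x + h) - q x * e x := by
    intro x hx
    have h3 : e (x + h) = e x * cexp (I * (θ x : ℝ)) := by
      simp only [e, θ]
      rw [← Complex.exp_add]
      congr 1
      push_cast
      ring
    have h4 : q x * (cexp (I * (θ x : ℝ)) - 1) = 1 := inv_mul_cancel₀ (hne0 x hx)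
    rw [h3]
    linear_combination (-e x) * h4
  have hi : ∀ {f : ℝ → ℂ} {a b : ℝ}, a ≤ b → ContinuousOn f (Icc a b) →
      IntervalIntegrable f volume a b := fun hab hf => by
    rw [← uIcc_of_le hab] at hf
    exact hf.intervalIntegrable
  have hec' : ContinuousOn (fun x => e (x + h)) (Icc 0 (δ - h)) :=
    hec.comp (by fun_prop) fun x hx => ⟨by linarith [hx.1], by linarith [hx.2]⟩
  have hqe : ContinuousOn (fun x => q x * e x) (Icc 0 (δ - h)) :=
    hqc.mul (hec.mono (Icc_subset_Icc_right (by linarith)))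
  have hqe' : ContinuousOn (fun x => q (x - h) * e x) (Icc h δ) :=
    (hqc.comp (by fun_prop) fun x hx => ⟨by linarith [hx.1], by linarith [hx.2]⟩).mul
      (hec.mono (Icc_subset_Icc_left (by linarith)))
  have e1 : ∫ x in (0 : ℝ)..(δ - h), e x =
      (∫ x in h..δ, q (x - h) * e x) - ∫ x in (0 : ℝ)..(δ - h), q x * e x := by
    have h3 : ∫ x in (0 : ℝ)..(δ - h), e x =
        ∫ x in (0 : ℝ)..(δ - h), (q x * e (x + h) - q x * e x) := by
      refine intervalIntegral.integral_congr fun x hx => ?_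
      rw [uIcc_of_le (by linarith)] at hx
      exact hstep x hx
    have hqe'' : ContinuousOn (fun x => q x * e (x + h)) (Icc 0 (δ - h)) := hqc.mul hec'
    rw [h3, intervalIntegral.integral_sub (hi (by linarith) hqe'')
      (hi (by linarith) hqe)]
    congr 1
    have := intervalIntegral.integral_comp_add_right (a := 0) (b := δ - h)
      (fun x => q (x - h) * e x) h
    simp only [add_sub_cancel_right, zero_add, sub_add_cancel] at this
    exact this
  have e2 : ∫ x in h..δ, q (x - h) * e x =
      (∫ x in h..(δ - h), q (x - h) * e x) + ∫ x in (δ - h)..δ, q (x - h) * e x :=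
    (intervalIntegral.integral_add_adjacent_intervals
      (hi (by linarith) (hqe'.mono (Icc_subset_Icc_right (by linarith))))
      (hi (by linarith) (hqe'.mono (Icc_subset_Icc_left (by linarith))))).symm
  have e3 : ∫ x in (0 : ℝ)..(δ - h), q x * e x =
      (∫ x in (0 : ℝ)..h, q x * e x) + ∫ x in h..(δ - h), q x * e x :=
    (intervalIntegral.integral_add_adjacent_intervals
      (hi hh.le (hqe.mono (Icc_subset_Icc_right (by linarith))))
      (hi (by linarith) (hqe.mono (Icc_subset_Icc_left hh.le)))).symm
  have e4 : ∫ x in (0 : ℝ)..δ, e x =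
      (∫ x in (0 : ℝ)..(δ - h), e x) + ∫ x in (δ - h)..δ, e x :=
    (intervalIntegral.integral_add_adjacent_intervals
      (hi (by linarith) (hec.mono (Icc_subset_Icc_right (by linarith))))
      (hi (by linarith) (hec.mono (Icc_subset_Icc_left (by linarith))))).symm
  -- After the shift by `h` only differences of `q` remain inside, controlled by second differences
  -- of `P`, plus end pieces of length `h`.
  have e5 : (∫ x in h..(δ - h), q (x - h) * e x) - ∫ x in h..(δ - h), q x * e x =
      ∫ x in h..(δ - h), (q (x - h) - q x) * e x := by
    rw [← intervalIntegral.integral_sub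
      (hi (by linarith) (hqe'.mono (Icc_subset_Icc_right (by linarith))))
      (hi (by linarith) (hqe.mono (Icc_subset_Icc_left hh.le)))]
    congr 1
    ext x
    ring
  have b1 : ‖∫ x in (δ - h)..δ, e x‖ ≤ h := by
    have := intervalIntegral.norm_integral_le_of_norm_le_const (a := δ - h) (b := δ) (C := 1)
      (f := e) (fun x _ => (norm_cexp_phase _).le)
    rwa [sub_sub_cancel, abs_of_pos hh, one_mul] at this
  have b2 : ‖∫ x in (δ - h)..δ, q (x - h) * e x‖ ≤ 4 * h := by
    have := intervalIntegral.norm_integral_le_of_norm_le_const (a := δ - h) (b := δ) (C := 4)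
      (f := fun x => q (x - h) * e x) (fun x hx => by
        rw [uIoc_of_le (by linarith)] at hx
        rw [norm_mul, norm_cexp_phase, mul_one]
        exact hq4 _ ⟨by linarith [hx.1], by linarith [hx.2]⟩)
    rwa [sub_sub_cancel, abs_of_pos hh] at this
  have b3 : ‖∫ x in (0 : ℝ)..h, q x * e x‖ ≤ 4 * h := by
    have := intervalIntegral.norm_integral_le_of_norm_le_const (a := 0) (b := h) (C := 4)
      (f := fun x => q x * e x) (fun x hx => by
        rw [uIoc_of_le hh.le] at hx
        rw [norm_mul, norm_cexp_phase, mul_one]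
        exact hq4 _ ⟨by linarith [hx.1], by linarith [hx.2]⟩)
    rwa [sub_zero, abs_of_pos hh] at this
  have b4 : ‖∫ x in h..(δ - h), (q (x - h) - q x) * e x‖ ≤ 16 * l * B := by
    have hc : ContinuousOn (fun x => |P (x + h) - 2 * P x + P (x - h)|) (Icc h (δ - h)) := by
      have a1 : ContinuousOn (fun x => P (x + h)) (Icc h (δ - h)) :=
        hPs.mono (Icc_subset_Icc_left hh.le)
      have a2 : ContinuousOn P (Icc h (δ - h)) := hPr.mono (Icc_subset_Icc_left hh.le)
      have a3 : ContinuousOn (fun x => P (x - h)) (Icc h (δ - h)) :=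
        hP.comp (by fun_prop) fun x hx => ⟨by linarith [hx.1], by linarith [hx.2]⟩
      exact ((a1.sub (continuousOn_const.mul a2)).add a3).abs
    have hle : ‖∫ x in h..(δ - h), (q (x - h) - q x) * e x‖ ≤
        ∫ x in h..(δ - h), 16 * l * |P (x + h) - 2 * P x + P (x - h)| := by
      refine intervalIntegral.norm_integral_le_of_norm_le (by linarith)
        (ae_of_all _ fun x hx => ?_) ?_
      · rw [norm_mul, norm_cexp_phase, mul_one]
        refine (hqd (x - h) ⟨by linarith [hx.1], by linarith [hx.2]⟩ x
          ⟨by linarith [hx.1], by linarith [hx.2]⟩).trans (le_of_eq ?_)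
        have : θ (x - h) - θ x = -(l * (P (x + h) - 2 * P x + P (x - h))) := by
          simp only [θ, sub_add_cancel]; ring
        rw [this, abs_neg, abs_mul, abs_of_pos hl, mul_assoc]
      · rw [← uIcc_of_le (by linarith)] at hc
        exact (hc.intervalIntegrable).const_mul _
    refine hle.trans ?_
    rw [intervalIntegral.integral_const_mul]
    have := intervalIntegral.integral_comp_add_right (a := 0) (b := δ - 2 * h)
      (fun x => |P (x + h) - 2 * P x + P (x - h)|) h
    simp only [add_sub_cancel_right, zero_add] at this
    rw [show δ - 2 * h + h = δ - h by ring] at this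
    rw [← this]
    gcongr
    refine le_trans (le_of_eq ?_) (h2 hδh)
    congr 1
    ext x
    rw [show x + h + h = x + 2 * h by ring]
  change ‖∫ x in (0 : ℝ)..δ, e x‖ ≤ _
  have : ∫ x in (0 : ℝ)..δ, e x = (∫ x in h..(δ - h), (q (x - h) - q x) * e x) +
      (∫ x in (δ - h)..δ, q (x - h) * e x) - (∫ x in (0 : ℝ)..h, q x * e x) +
      ∫ x in (δ - h)..δ, e x := by
    rw [e4, e1, e2, e3, ← e5]
    ring
  rw [this]
  refine (norm_add_le _ _).trans ?_
  have c1 := norm_sub_le ((∫ x in h..(δ - h), (q (x - h) - q x) * e x) +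
      (∫ x in (δ - h)..δ, q (x - h) * e x)) (∫ x in (0 : ℝ)..h, q x * e x)
  have c2 := norm_add_le (∫ x in h..(δ - h), (q (x - h) - q x) * e x)
    (∫ x in (δ - h)..δ, q (x - h) * e x)
  linarith

/-- The integral telescopes to two integrals of first differences over end intervals of length `h`,
and a first difference is at most `L * h`. For convex `g` this controls the integral of the absolute
value. -/
theorem integral_second_difference_le {g : ℝ → ℝ} {δ h L : ℝ} (hh : 0 < h) (hδ : 2 * h ≤ δ)
    (hg : ContinuousOn g (Icc 0 δ))
    (hL : ∀ x ∈ Icc 0 δ, ∀ y ∈ Icc 0 δ, |g x - g y| ≤ L * |x - y|) :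
    ∫ x in (0 : ℝ)..(δ - 2 * h), (g (x + 2 * h) - 2 * g (x + h) + g x) ≤ 2 * L * h ^ 2 := by
  let D : ℝ → ℝ := fun x => g (x + h) - g x
  have hgs : ContinuousOn (fun x => g (x + h)) (Icc 0 (δ - h)) :=
    hg.comp (by fun_prop) fun x hx => ⟨by linarith [hx.1], by linarith [hx.2]⟩
  have hgr : ContinuousOn g (Icc 0 (δ - h)) := hg.mono (Icc_subset_Icc_right (by linarith))
  have hD : ContinuousOn D (Icc 0 (δ - h)) := hgs.sub hgr
  have hDs : ContinuousOn (fun x => D (x + h)) (Icc 0 (δ - 2 * h)) :=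
    hD.comp (by fun_prop) fun x hx => ⟨by linarith [hx.1], by linarith [hx.2]⟩
  have hDb : ∀ x ∈ Icc 0 (δ - h), ‖D x‖ ≤ L * h := by
    intro x hx
    have := hL (x + h) ⟨by linarith [hx.1], by linarith [hx.2]⟩ x ⟨hx.1, by linarith [hx.2]⟩
    rwa [add_sub_cancel_left, abs_of_pos hh] at this
  have hi : ∀ {f : ℝ → ℝ} {a b : ℝ}, a ≤ b → ContinuousOn f (Icc a b) →
      IntervalIntegrable f volume a b := fun hab hf => by
    rw [← uIcc_of_le hab] at hf
    exact hf.intervalIntegrable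
  have e1 : ∫ x in (0 : ℝ)..(δ - 2 * h), (g (x + 2 * h) - 2 * g (x + h) + g x) =
      (∫ x in h..(δ - h), D x) - ∫ x in (0 : ℝ)..(δ - 2 * h), D x := by
    have := intervalIntegral.integral_comp_add_right (a := 0) (b := δ - 2 * h) D h
    rw [zero_add, show δ - 2 * h + h = δ - h by ring] at this
    rw [← this, ← intervalIntegral.integral_sub (hi (by linarith) hDs)
      (hi (by linarith) (hD.mono (Icc_subset_Icc_right (by linarith))))]
    congr 1
    ext x
    simp only [D]
    ring_nf
  have e2 : (∫ x in h..(δ - h), D x) - ∫ x in (0 : ℝ)..(δ - 2 * h), D x =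
      (∫ x in (δ - 2 * h)..(δ - h), D x) - ∫ x in (0 : ℝ)..h, D x := by
    have i1 : IntervalIntegrable D volume 0 h :=
      hi hh.le (hD.mono (Icc_subset_Icc_right (by linarith)))
    have i2 : IntervalIntegrable D volume h (δ - h) :=
      hi (by linarith) (hD.mono (Icc_subset_Icc_left hh.le))
    have i3 : IntervalIntegrable D volume 0 (δ - 2 * h) :=
      hi (by linarith) (hD.mono (Icc_subset_Icc_right (by linarith)))
    have i4 : IntervalIntegrable D volume (δ - 2 * h) (δ - h) :=
      hi (by linarith) (hD.mono (Icc_subset_Icc_left (by linarith)))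
    have a1 := intervalIntegral.integral_add_adjacent_intervals i1 i2
    have a2 := intervalIntegral.integral_add_adjacent_intervals i3 i4
    linarith
  have b1 : ‖∫ x in (δ - 2 * h)..(δ - h), D x‖ ≤ L * h * h := by
    have := intervalIntegral.norm_integral_le_of_norm_le_const (a := δ - 2 * h) (b := δ - h)
      (C := L * h) (f := D) (fun x hx => by
        rw [uIoc_of_le (by linarith)] at hx
        exact hDb _ ⟨by linarith [hx.1], hx.2⟩)
    rwa [show δ - h - (δ - 2 * h) = h by ring, abs_of_pos hh] at this
  have b2 : ‖∫ x in (0 : ℝ)..h, D x‖ ≤ L * h * h := by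
    have := intervalIntegral.norm_integral_le_of_norm_le_const (a := 0) (b := h)
      (C := L * h) (f := D) (fun x hx => by
        rw [uIoc_of_le hh.le] at hx
        exact hDb _ ⟨by linarith [hx.1], by linarith [hx.2]⟩)
    rwa [sub_zero, abs_of_pos hh] at this
  rw [e1, e2]
  rw [Real.norm_eq_abs] at b1 b2
  have := (abs_le.1 b1).2
  have := (abs_le.1 b2).1
  nlinarith

end FiniteDifferences

/-! ### Convex arcs and the degenerate estimate in the plane. -/

section Curve

variable {W E : Type*} [NormedAddCommGroup W] [NormedSpace ℝ W]
  [NormedAddCommGroup E] [InnerProductSpace ℝ E]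

/-- Taylor expansion of `T` at the middle point `b`: the linear part sees the second difference of
the three points, and the remainders are quadratic because the derivative is locally Lipschitz. -/
theorem exists_norm_second_difference_le {T : W × E → E} (hT : ContDiff ℝ ∞ T) (s₀ : W) (x₀ : E) :
    ∃ ρ > 0, ∃ K : ℝ, 0 ≤ K ∧ ∀ s ∈ Metric.closedBall s₀ ρ, ∀ a ∈ Metric.closedBall x₀ ρ,
      ∀ b ∈ Metric.closedBall x₀ ρ, ∀ c ∈ Metric.closedBall x₀ ρ,
      ‖T (s, c) - (2 : ℝ) • T (s, b) + T (s, a)‖ ≤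
        K * (‖c - b‖ ^ 2 + ‖b - a‖ ^ 2 + ‖c - (2 : ℝ) • b + a‖) := by
  have hT' : ContDiff ℝ 1 (fderiv ℝ T) :=
    (hT.fderiv_right (m := ∞) (by simp)).of_le (by exact_mod_cast le_top)
  obtain ⟨K₁, U, hU, hK₁⟩ := hT'.contDiffAt.exists_lipschitzOnWith (x := (s₀, x₀))
  obtain ⟨ρ, hρ, hρU⟩ := Metric.nhds_basis_closedBall.mem_iff.1 hU
  let M := ‖fderiv ℝ T (s₀, x₀)‖ + K₁ * ρ
  have hmem : ∀ s ∈ Metric.closedBall s₀ ρ, ∀ a ∈ Metric.closedBall x₀ ρ,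
      (s, a) ∈ Metric.closedBall (s₀, x₀) ρ := fun s hs a ha => by
    rw [Metric.mem_closedBall, Prod.dist_eq, max_le_iff]
    exact ⟨hs, ha⟩
  have hM : ∀ p ∈ Metric.closedBall (s₀, x₀) ρ, ‖fderiv ℝ T p‖ ≤ M := by
    intro p hp
    have h1 := hK₁.dist_le_mul p (hρU hp) (s₀, x₀) (hρU (Metric.mem_closedBall_self hρ.le))
    rw [dist_eq_norm] at h1
    have h2 := norm_le_norm_add_norm_sub' (fderiv ℝ T p) (fderiv ℝ T (s₀, x₀))
    have h3 : (K₁ : ℝ) * dist p (s₀, x₀) ≤ K₁ * ρ := by gcongr; exact hp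
    simp only [M]
    linarith
  have htaylor : ∀ s ∈ Metric.closedBall s₀ ρ, ∀ b ∈ Metric.closedBall x₀ ρ,
      ∀ c ∈ Metric.closedBall x₀ ρ,
      ‖T (s, c) - T (s, b) - fderiv ℝ T (s, b) (0, c - b)‖ ≤ K₁ * ‖c - b‖ ^ 2 := by
    intro s hs b hb c hc
    have hseg : segment ℝ (s, b) (s, c) ⊆ Metric.closedBall (s₀, x₀) ρ :=
      (convex_closedBall _ _).segment_subset (hmem s hs b hb) (hmem s hs c hc)
    have hsub : (s, c) - (s, b) = ((0 : W), c - b) := by simp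
    have hn : ‖(s, c) - (s, b)‖ = ‖c - b‖ := by rw [hsub]; simp
    have := Convex.norm_image_sub_le_of_norm_fderiv_le' (𝕜 := ℝ) (f := T)
      (φ := fderiv ℝ T (s, b)) (C := K₁ * ‖c - b‖) (s := segment ℝ (s, b) (s, c))
      (fun p _ => hT.differentiable (by simp) p) (fun p hp => by
        have h1 := hK₁.dist_le_mul p (hρU (hseg hp)) (s, b) (hρU (hmem s hs b hb))
        rw [dist_eq_norm, dist_eq_norm] at h1
        refine h1.trans ?_
        gcongr
        rw [← hn]
        exact norm_sub_le_of_mem_segment hp)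
      (convex_segment _ _) (left_mem_segment ℝ _ _) (right_mem_segment ℝ _ _)
    rw [hsub] at this
    have h0 : ‖((0 : W), c - b)‖ = ‖c - b‖ := by simp
    rw [h0] at this
    calc _ ≤ _ := this
      _ = _ := by ring
  refine ⟨ρ, hρ, K₁ + M, by positivity, fun s hs a ha b hb c hc => ?_⟩
  have h1 := htaylor s hs b hb c hc
  have h2 := htaylor s hs b hb a ha
  have h3 : ‖fderiv ℝ T (s, b) (0, c - (2 : ℝ) • b + a)‖ ≤ M * ‖c - (2 : ℝ) • b + a‖ := by
    refine ((fderiv ℝ T (s, b)).le_opNorm _).trans ?_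
    have : ‖((0 : W), c - (2 : ℝ) • b + a)‖ = ‖c - (2 : ℝ) • b + a‖ := by simp
    rw [this]
    gcongr
    exact hM _ (hmem s hs b hb)
  have h4 : T (s, c) - (2 : ℝ) • T (s, b) + T (s, a) =
      (T (s, c) - T (s, b) - fderiv ℝ T (s, b) (0, c - b)) +
      (T (s, a) - T (s, b) - fderiv ℝ T (s, b) (0, a - b)) +
      fderiv ℝ T (s, b) (0, c - (2 : ℝ) • b + a) := by
    have : ((0 : W), c - (2 : ℝ) • b + a) = (0, c - b) + (0, a - b) := by
      ext
      · simp
      · simp only [Prod.snd_add, two_smul]; abel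
    rw [this, map_add, two_smul]
    abel
  rw [h4]
  have hM0 : 0 ≤ M := by positivity
  have hK0 : (0 : ℝ) ≤ K₁ := K₁.2
  rw [norm_sub_rev a b] at h2
  have h5 := norm_add₃_le (a := T (s, c) - T (s, b) - fderiv ℝ T (s, b) (0, c - b))
    (b := T (s, a) - T (s, b) - fderiv ℝ T (s, b) (0, a - b))
    (c := fderiv ℝ T (s, b) (0, c - (2 : ℝ) • b + a))
  nlinarith [mul_nonneg hM0 (sq_nonneg ‖c - b‖), mul_nonneg hM0 (sq_nonneg ‖b - a‖),
    mul_nonneg hK0 (norm_nonneg (c - (2 : ℝ) • b + a))]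

/-- One half of a convex graph in a plane: a curve with a one-sided strict derivative whose second
differences are positive multiples of a fixed vector. -/
structure IsConvexArc (Γ : ℝ → E) (a u₂ : E) (g : ℝ → ℝ) (δ₀ L : ℝ) : Prop where
  pos : 0 < δ₀
  continuous : Continuous Γ
  ne_zero : a ≠ 0
  strict : ∀ η > 0, ∃ δ > 0, ∀ t ∈ Icc 0 δ, ∀ τ ∈ Icc 0 δ,
    ‖Γ t - Γ τ - (t - τ) • a‖ ≤ η * |t - τ|
  continuousOn : ContinuousOn g (Icc 0 δ₀)
  lipschitz : ∀ x ∈ Icc 0 δ₀, ∀ y ∈ Icc 0 δ₀, |g x - g y| ≤ L * |x - y|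
  second_difference : ∀ x h, 0 ≤ x → 0 ≤ h → x + 2 * h ≤ δ₀ →
    Γ (x + 2 * h) - (2 : ℝ) • Γ (x + h) + Γ x = (g (x + 2 * h) - 2 * g (x + h) + g x) • u₂
  second_difference_nonneg : ∀ x h, 0 ≤ x → 0 ≤ h → x + 2 * h ≤ δ₀ →
    0 ≤ g (x + 2 * h) - 2 * g (x + h) + g x

/-- A van der Corput bound without a second derivative. First differences of the phase are close to
`h * c` by the one-sided strict derivative, and its second differences have integral `O(h²)` because
those of the arc have constant sign and telescope. -/
theorem IsConvexArc.exists_norm_integral_le {Γ : ℝ → E} {a u₂ : E} {g : ℝ → ℝ} {δ₀ L : ℝ}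
    (hΓ : IsConvexArc Γ a u₂ g δ₀ L) {T : W × E → E} (hT : ContDiff ℝ ∞ T) {s₀ : W} {Ξ₀ : E}
    (hc : inner ℝ Ξ₀ (fderiv ℝ T (s₀, Γ 0) (0, a)) ≠ 0) :
    ∃ ε > 0, ∀ δ, 0 < δ → δ ≤ ε → ∃ C : ℝ, ∀ s ∈ Metric.closedBall s₀ ε,
      ∀ Ξ : E, ‖Ξ - Ξ₀‖ ≤ ε → ∀ l : ℝ, 0 < l →
      ‖∫ t in (0 : ℝ)..δ, cexp (I * ((l * inner ℝ Ξ (T (s, Γ t)) : ℝ) : ℂ))‖ ≤ C / l := by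
  set c := inner ℝ Ξ₀ (fderiv ℝ T (s₀, Γ 0) (0, a)) with hcdef
  let J : E →L[ℝ] E := (fderiv ℝ T (s₀, Γ 0)).comp (ContinuousLinearMap.inr ℝ W E)
  have hJ : ∀ y, J y = fderiv ℝ T (s₀, Γ 0) (0, y) := fun y => by simp [J]
  have hc0 : 0 < |c| := abs_pos.2 hc
  obtain ⟨ρ, hρ, K, hK0, hK⟩ := exists_norm_second_difference_le hT s₀ (Γ 0)
  let N := ‖J a‖ + (‖Ξ₀‖ + 1) * (‖a‖ + 1 + ‖J‖)
  have hN : 0 < N := by positivity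
  obtain ⟨η, hη, hη1, hηN⟩ : ∃ η > 0, η ≤ 1 ∧ η * N ≤ |c| / 2 := by
    refine ⟨min 1 (|c| / (2 * N)), by positivity, min_le_left _ _, ?_⟩
    calc _ ≤ |c| / (2 * N) * N := by gcongr; exact min_le_right _ _
      _ = _ := by field_simp
  have hstr : HasStrictFDerivAt T (fderiv ℝ T (s₀, Γ 0)) (s₀, Γ 0) :=
    hT.contDiffAt.hasStrictFDerivAt (by simp)
  obtain ⟨ρ', hρ', hTstrict⟩ := exists_closedBall_strict hstr hη
  obtain ⟨δ₁, hδ₁, hΓstrict⟩ := hΓ.strict η hη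
  have hcont : ∀ᶠ t in 𝓝 (0 : ℝ), Γ t ∈ Metric.closedBall (Γ 0) (min ρ ρ') :=
    hΓ.continuous.continuousAt.eventually (Metric.closedBall_mem_nhds _ (by positivity))
  obtain ⟨δ₂, hδ₂, hΓball⟩ := Metric.nhds_basis_closedBall.mem_iff.1 hcont
  obtain ⟨ε, hε, e1, e2, e3, e4, e5, e6⟩ : ∃ ε > 0, ε ≤ ρ ∧ ε ≤ ρ' ∧ ε ≤ δ₁ ∧ ε ≤ δ₂ ∧
      ε ≤ δ₀ ∧ ε ≤ η := by
    have := hΓ.pos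
    refine ⟨min (min ρ ρ') (min (min δ₁ δ₂) (min δ₀ η)), by positivity, ?_⟩
    simp only [min_le_iff, le_refl, true_or, or_true, and_self]
  refine ⟨ε, hε, fun δ hδ hδε => ?_⟩
  let Q := (‖Ξ₀‖ + 1) * K * (2 * (‖a‖ + 1) ^ 2 * δ + ‖u₂‖ * (2 * L))
  have hL : 0 ≤ L := by
    have := hΓ.lipschitz 0 ⟨le_rfl, hΓ.pos.le⟩ δ₀ ⟨hΓ.pos.le, le_rfl⟩
    have h0 : 0 ≤ L * |0 - δ₀| := (abs_nonneg _).trans this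
    have h1 : 0 < |0 - δ₀| := abs_pos.2 (by linarith [hΓ.pos])
    exact nonneg_of_mul_nonneg_left h0 h1
  have hQ : 0 ≤ Q := by positivity
  refine ⟨9 / |c| + 16 * Q / |c| ^ 2, fun s hs Ξ hΞ l hl => ?_⟩
  have hΞn : ‖Ξ‖ ≤ ‖Ξ₀‖ + 1 := by
    have := norm_le_norm_add_norm_sub' Ξ Ξ₀
    linarith
  -- The step for which the phase advances by about one radian, within `1 / 2`, so that `e^{iθ} - 1`
  -- stays away from zero.
  let h := 1 / (l * |c|)
  have hh : 0 < h := by positivity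
  have hlh : l * h * |c| = 1 := by simp only [h]; field_simp
  let P : ℝ → ℝ := fun t => inner ℝ Ξ (T (s, Γ t))
  have hPc : Continuous P := by
    have h1 := hΓ.continuous
    have h2 := hT.continuous
    fun_prop
  have hball : ∀ t ∈ Icc 0 δ, Γ t ∈ Metric.closedBall (Γ 0) (min ρ ρ') := by
    intro t ht
    apply hΓball
    rw [Metric.mem_closedBall, dist_zero_right, Real.norm_eq_abs, abs_of_nonneg ht.1]
    linarith [ht.2]
  have hΓd : ∀ x ∈ Icc 0 (δ - h), ‖Γ (x + h) - Γ x - h • a‖ ≤ η * h := by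
    intro x hx
    have := hΓstrict (x + h) ⟨by linarith [hx.1], by linarith [hx.2]⟩ x
      ⟨hx.1, by linarith [hx.2]⟩
    rwa [add_sub_cancel_left, abs_of_pos hh] at this
  have hΓl : ∀ x ∈ Icc 0 (δ - h), ‖Γ (x + h) - Γ x‖ ≤ (‖a‖ + 1) * h := by
    intro x hx
    have h1 := hΓd x hx
    have h2 : ‖h • a‖ = h * ‖a‖ := by rw [norm_smul, Real.norm_eq_abs, abs_of_pos hh]
    have h3 := norm_add_le (Γ (x + h) - Γ x - h • a) (h • a)
    rw [sub_add_cancel] at h3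
    nlinarith
  have hfirst : ∀ x ∈ Icc 0 (δ - h), |P (x + h) - P x - h * c| ≤ h * (|c| / 2) := by
    intro x hx
    have m1 := hball (x + h) ⟨by linarith [hx.1], by linarith [hx.2]⟩
    have m2 := hball x ⟨hx.1, by linarith [hx.2]⟩
    have hmem : ∀ y ∈ Metric.closedBall (Γ 0) (min ρ ρ'),
        (s, y) ∈ Metric.closedBall (s₀, Γ 0) ρ' := by
      intro y hy
      rw [Metric.mem_closedBall, Prod.dist_eq, max_le_iff]
      exact ⟨(Metric.mem_closedBall.1 hs).trans e2,
        (Metric.mem_closedBall.1 hy).trans (min_le_right _ _)⟩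
    have h1 := (hTstrict _ (hmem _ m1) _ (hmem _ m2)).2.2
    have h2 : (s, Γ (x + h)) - (s, Γ x) = ((0 : W), Γ (x + h) - Γ x) := by simp
    have h3 : ‖((0 : W), Γ (x + h) - Γ x)‖ = ‖Γ (x + h) - Γ x‖ := by simp
    rw [h2, h3, ← hJ] at h1
    set R := T (s, Γ (x + h)) - T (s, Γ x) - h • J a with hR
    have hRb : ‖R‖ ≤ h * (η * (‖a‖ + 1 + ‖J‖)) := by
      have h4 : R = (T (s, Γ (x + h)) - T (s, Γ x) - J (Γ (x + h) - Γ x)) +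
          J (Γ (x + h) - Γ x - h • a) := by
        rw [hR, map_sub J _ (h • a), map_smul]; abel
      rw [h4]
      refine (norm_add_le _ _).trans ?_
      have h5 : ‖J (Γ (x + h) - Γ x - h • a)‖ ≤ ‖J‖ * (η * h) :=
        (J.le_opNorm _).trans (by gcongr; exact hΓd x hx)
      have h6 : η * ‖Γ (x + h) - Γ x‖ ≤ η * ((‖a‖ + 1) * h) := by gcongr; exact hΓl x hx
      nlinarith
    have h7 : P (x + h) - P x - h * c = h * inner ℝ (Ξ - Ξ₀) (J a) + inner ℝ Ξ R := by
      simp only [P, hR, hcdef, hJ, inner_sub_left, inner_sub_right, real_inner_smul_right]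
      ring
    rw [h7]
    have h8 : |inner ℝ (Ξ - Ξ₀) (J a)| ≤ η * ‖J a‖ :=
      (abs_real_inner_le_norm _ _).trans (by gcongr; linarith)
    have h9 : |inner ℝ Ξ R| ≤ (‖Ξ₀‖ + 1) * (h * (η * (‖a‖ + 1 + ‖J‖))) :=
      (abs_real_inner_le_norm _ _).trans (by gcongr)
    calc |h * inner ℝ (Ξ - Ξ₀) (J a) + inner ℝ Ξ R|
        ≤ h * |inner ℝ (Ξ - Ξ₀) (J a)| + |inner ℝ Ξ R| := by
          refine (abs_add_le _ _).trans ?_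
          rw [abs_mul, abs_of_pos hh]
      _ ≤ h * (η * ‖J a‖) + (‖Ξ₀‖ + 1) * (h * (η * (‖a‖ + 1 + ‖J‖))) := by gcongr
      _ = h * (η * N) := by simp only [N]; ring
      _ ≤ _ := by gcongr
  have hθ : ∀ x ∈ Icc 0 (δ - h),
      1 / 2 ≤ |l * (P (x + h) - P x)| ∧ |l * (P (x + h) - P x)| ≤ 3 / 2 := by
    intro x hx
    have h1 := hfirst x hx
    have h2 : |l * (P (x + h) - P x) - l * h * c| ≤ 1 / 2 := by
      have : l * (P (x + h) - P x) - l * h * c = l * (P (x + h) - P x - h * c) := by ring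
      rw [this, abs_mul, abs_of_pos hl]
      calc _ ≤ l * (h * (|c| / 2)) := by gcongr
        _ = l * h * |c| / 2 := by ring
        _ = _ := by rw [hlh]
    have h3 : |l * h * c| = 1 := by
      rw [abs_mul, abs_of_pos (by positivity : 0 < l * h), hlh]
    have h4 := abs_sub_abs_le_abs_sub (l * (P (x + h) - P x)) (l * h * c)
    have h5 := abs_sub_abs_le_abs_sub (l * h * c) (l * (P (x + h) - P x))
    rw [abs_sub_comm] at h5
    constructor <;> linarith
  have hsecond : 2 * h ≤ δ →
      ∫ x in (0 : ℝ)..(δ - 2 * h), |P (x + 2 * h) - 2 * P (x + h) + P x| ≤ Q * h ^ 2 := by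
    intro h2δ
    have hg' : ContinuousOn g (Icc 0 δ) :=
      hΓ.continuousOn.mono (Icc_subset_Icc_right (by linarith))
    have hg2 := integral_second_difference_le hh h2δ hg'
      (fun x hx y hy => hΓ.lipschitz x ⟨hx.1, by linarith [hx.2]⟩ y ⟨hy.1, by linarith [hy.2]⟩)
    have hgc : ContinuousOn (fun x => g (x + 2 * h) - 2 * g (x + h) + g x)
        (Icc 0 (δ - 2 * h)) := by
      have a1 : ContinuousOn (fun x => g (x + 2 * h)) (Icc 0 (δ - 2 * h)) :=
        hg'.comp (by fun_prop) fun x hx => ⟨by linarith [hx.1], by linarith [hx.2]⟩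
      have a2 : ContinuousOn (fun x => g (x + h)) (Icc 0 (δ - 2 * h)) :=
        hg'.comp (by fun_prop) fun x hx => ⟨by linarith [hx.1], by linarith [hx.2]⟩
      have a3 : ContinuousOn g (Icc 0 (δ - 2 * h)) :=
        hg'.mono (Icc_subset_Icc_right (by linarith))
      exact (a1.sub (continuousOn_const.mul a2)).add a3
    have hgi : IntervalIntegrable (fun x => g (x + 2 * h) - 2 * g (x + h) + g x) volume 0
        (δ - 2 * h) := by
      rw [← uIcc_of_le (by linarith)] at hgc
      exact hgc.intervalIntegrable
    have hpt : ∀ x ∈ Icc 0 (δ - 2 * h), |P (x + 2 * h) - 2 * P (x + h) + P x| ≤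
        (‖Ξ₀‖ + 1) * K * (2 * ((‖a‖ + 1) * h) ^ 2) +
          (‖Ξ₀‖ + 1) * K * ‖u₂‖ * (g (x + 2 * h) - 2 * g (x + h) + g x) := by
      intro x hx
      have m : ∀ y ∈ Icc 0 δ, Γ y ∈ Metric.closedBall (Γ 0) ρ := fun y hy =>
        Metric.closedBall_subset_closedBall (min_le_left _ _) (hball y hy)
      have h1 := hK s (Metric.closedBall_subset_closedBall e1 hs) (Γ x)
        (m x ⟨hx.1, by linarith [hx.2]⟩) (Γ (x + h))
        (m (x + h) ⟨by linarith [hx.1], by linarith [hx.2]⟩) (Γ (x + 2 * h))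
        (m (x + 2 * h) ⟨by linarith [hx.1], by linarith [hx.2]⟩)
      have hs1 := hΓl x ⟨hx.1, by linarith [hx.2]⟩
      have hs2 := hΓl (x + h) ⟨by linarith [hx.1], by linarith [hx.2]⟩
      rw [show x + h + h = x + 2 * h by ring] at hs2
      rw [hΓ.second_difference x h hx.1 hh.le (by linarith [hx.2]), norm_smul, Real.norm_eq_abs,
        abs_of_nonneg (hΓ.second_difference_nonneg x h hx.1 hh.le (by linarith [hx.2]))] at h1
      set G := g (x + 2 * h) - 2 * g (x + h) + g x
      have h3 : P (x + 2 * h) - 2 * P (x + h) + P x =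
          inner ℝ Ξ (T (s, Γ (x + 2 * h)) - (2 : ℝ) • T (s, Γ (x + h)) + T (s, Γ x)) := by
        simp only [P, inner_add_right, inner_sub_right, real_inner_smul_right]
      rw [h3]
      calc _ ≤ ‖Ξ‖ * _ := abs_real_inner_le_norm _ _
        _ ≤ (‖Ξ₀‖ + 1) * (K * (((‖a‖ + 1) * h) ^ 2 + ((‖a‖ + 1) * h) ^ 2 + G * ‖u₂‖)) := by
          gcongr
          refine h1.trans ?_
          gcongr
        _ = _ := by ring
    have hPi : IntervalIntegrable (fun x => |P (x + 2 * h) - 2 * P (x + h) + P x|) volume 0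
        (δ - 2 * h) := Continuous.intervalIntegrable (by fun_prop) _ _
    calc _ ≤ ∫ x in (0 : ℝ)..(δ - 2 * h), ((‖Ξ₀‖ + 1) * K * (2 * ((‖a‖ + 1) * h) ^ 2) +
          (‖Ξ₀‖ + 1) * K * ‖u₂‖ * (g (x + 2 * h) - 2 * g (x + h) + g x)) :=
        intervalIntegral.integral_mono_on (by linarith) hPi
          (intervalIntegrable_const.add (hgi.const_mul _)) hpt
      _ = (δ - 2 * h) * ((‖Ξ₀‖ + 1) * K * (2 * ((‖a‖ + 1) * h) ^ 2)) +
          (‖Ξ₀‖ + 1) * K * ‖u₂‖ *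
            ∫ x in (0 : ℝ)..(δ - 2 * h), (g (x + 2 * h) - 2 * g (x + h) + g x) := by
        rw [intervalIntegral.integral_add intervalIntegrable_const (hgi.const_mul _),
          intervalIntegral.integral_const, intervalIntegral.integral_const_mul, smul_eq_mul,
          sub_zero]
      _ ≤ δ * ((‖Ξ₀‖ + 1) * K * (2 * ((‖a‖ + 1) * h) ^ 2)) +
          (‖Ξ₀‖ + 1) * K * ‖u₂‖ * (2 * L * h ^ 2) := by
        gcongr
        linarith
      _ = _ := by simp only [Q]; ring
  have := norm_integral_phase_le_of_second_difference hh hl hδ.le hPc.continuousOn hθ hsecond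
    (by positivity)
  refine this.trans (le_of_eq ?_)
  simp only [h]
  field_simp

end Curve

/-! ### The local averaging bound for convex arcs. -/

section CurveAverage

variable {W E : Type*} [NormedAddCommGroup W] [NormedSpace ℝ W] [FiniteDimensional ℝ W]
  [MeasurableSpace W] [BorelSpace W] {μ : Measure W} [μ.IsAddHaarMeasure]
  [NormedAddCommGroup E] [InnerProductSpace ℝ E] [FiniteDimensional ℝ E]
  [MeasurableSpace E] [BorelSpace E]

theorem IsConvexArc.exists_strict {Γ : ℝ → E} {a u₂ : E} {g : ℝ → ℝ} {δ₀ L : ℝ}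
    (hΓ : IsConvexArc Γ a u₂ g δ₀ L) {ε : ℝ} (hε : 0 < ε) :
    ∃ δ > 0, ∀ t ∈ Icc 0 δ, ‖Γ t - Γ 0‖ ≤ ε ∧ ∀ τ ∈ Icc 0 δ, ‖t - τ‖ ≤ ε ∧
      ‖Γ t - Γ τ - ContinuousLinearMap.toSpanSingleton ℝ a (t - τ)‖ ≤ ε * ‖t - τ‖ := by
  obtain ⟨δ₁, hδ₁, h1⟩ := hΓ.strict ε hε
  have hcont : ∀ᶠ t in 𝓝 (0 : ℝ), Γ t ∈ Metric.closedBall (Γ 0) ε :=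
    hΓ.continuous.continuousAt.eventually (Metric.closedBall_mem_nhds _ hε)
  obtain ⟨δ₂, hδ₂, h2⟩ := Metric.nhds_basis_closedBall.mem_iff.1 hcont
  refine ⟨min δ₁ (min δ₂ ε), by positivity, fun t ht => ⟨?_, fun τ hτ => ⟨?_, ?_⟩⟩⟩
  · rw [← dist_eq_norm]
    apply h2
    rw [Metric.mem_closedBall, dist_zero_right, Real.norm_eq_abs, abs_of_nonneg ht.1]
    exact ht.2.trans ((min_le_right _ _).trans (min_le_left _ _))
  · have a1 := ht.2.trans ((min_le_right _ _).trans (min_le_right _ _))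
    have a2 := hτ.2.trans ((min_le_right _ _).trans (min_le_right _ _))
    rw [Real.norm_eq_abs, abs_le]
    constructor <;> linarith [ht.1, hτ.1]
  · have := h1 t ⟨ht.1, ht.2.trans (min_le_left _ _)⟩ τ ⟨hτ.1, hτ.2.trans (min_le_left _ _)⟩
    simpa using this

/-- The same dichotomy with a one-dimensional tangent space. If the mixed derivative does not kill
`a`, then `T T*` gives `1 / l`; if it does, the rank condition makes `hc` hold and every integral is
`O(1 / l)` pointwise in `s`, which more than suffices. -/
theorem IsConvexArc.exists_decay {Γ : ℝ → E} {a u₂ : E} {g : ℝ → ℝ} {δ₀ L : ℝ}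
    (hΓ : IsConvexArc Γ a u₂ g δ₀ L) {T : W × E → E} (hT : ContDiff ℝ ∞ T) {s₀ : W} {Ξ₀ : E}
    (hR : RankCondition T Ξ₀ s₀ (Γ 0)) :
    ∃ ε > 0, ∀ ψ : W → ℝ, ContDiff ℝ ∞ ψ → (∀ s, 0 ≤ ψ s) →
      (∀ s, s ∉ Metric.closedBall s₀ ε → ψ s = 0) → ∀ δ, 0 < δ → δ ≤ ε →
      ∃ C : ℝ≥0, ∀ Ξ : E, ‖Ξ - Ξ₀‖ ≤ ε → ∀ l : ℝ, 1 ≤ l →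
        ∫⁻ s, ENNReal.ofReal (ψ s) *
          ‖∫ t in Ioc 0 δ, cexp (I * ((l * inner ℝ Ξ (T (s, Γ t)) : ℝ) : ℂ))‖ₑ ^ 2 ∂μ ≤
        C * ENNReal.ofReal ((l ^ 1)⁻¹) := by
  by_cases hnd : ∃ w, fderiv ℝ (fun s => inner ℝ Ξ₀ (fderiv ℝ T (s, Γ 0) (0, a))) s₀ w ≠ 0
  · obtain ⟨w, hw⟩ := hnd
    have hnd : ∀ θ : ℝ, θ ≠ 0 → ∃ w, fderiv ℝ (fun s => inner ℝ Ξ₀ (fderiv ℝ T (s, Γ 0)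
        (0, ContinuousLinearMap.toSpanSingleton ℝ a θ))) s₀ w ≠ 0 := by
      intro θ hθ
      refine ⟨w, ?_⟩
      have h1 := fderiv_inner_add_smul hT Ξ₀ s₀ w (Γ 0) 0 a (-θ)
      simp only [neg_smul, sub_neg_eq_add, zero_add] at h1
      rw [ContinuousLinearMap.toSpanSingleton_apply, h1]
      have h0 : ((0 : W), (0 : E)) = 0 := rfl
      simp only [h0, map_zero, inner_zero_right, fderiv_fun_const, Pi.zero_apply,
        neg_mul]
      rw [_root_.zero_apply, zero_sub, neg_neg]
      exact mul_ne_zero hθ hw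
    obtain ⟨ε, hε, h⟩ := exists_lintegral_weight_mul_enorm_sq_le (μ := μ) (m := volume) hT
      (B := fun _ : W × ℝ => 1) contDiff_const (0 : ℝ) hnd
    obtain ⟨δ₁, hδ₁, hstrict⟩ := hΓ.exists_strict hε
    refine ⟨min ε δ₁, by positivity, fun ψ hψ hψ0 hψs δ hδ hδε => ?_⟩
    obtain ⟨C, hC⟩ := h ψ hψ hψ0 fun s hs => hψs s fun hs' =>
      hs (Metric.closedBall_subset_closedBall (min_le_left _ _) hs')
    have hsub : ∀ t ∈ Ioc 0 δ, t ∈ Icc 0 δ₁ := fun t ht =>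
      ⟨ht.1.le, ht.2.trans (hδε.trans (min_le_right _ _))⟩
    refine ⟨C * (volume (Ioc 0 δ)).toNNReal, fun Ξ hΞ l hl => ?_⟩
    have := hC Ξ (Ioc 0 δ) Γ (fun _ => 0) (fun _ => 1) 1 (hΞ.trans (min_le_left _ _))
      measurableSet_Ioc measure_Ioc_lt_top.ne hΓ.continuous.aestronglyMeasurable
      aestronglyMeasurable_const aestronglyMeasurable_const
      (fun t ht => (hstrict t (hsub t ht)).1) (fun t _ => by simpa using hε.le)
      (fun t _ => by simp) (fun t ht τ hτ => (hstrict t (hsub t ht)).2 τ (hsub τ hτ)) l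
      (by linarith)
    simp only [ofReal_one, mul_one, ENNReal.coe_one, one_pow, Module.finrank_self] at this
    push_cast
    rw [ENNReal.coe_toNNReal measure_Ioc_lt_top.ne, pow_one]
    simpa using this
  · push Not at hnd
    have hc : inner ℝ Ξ₀ (fderiv ℝ T (s₀, Γ 0) (0, a)) ≠ 0 := fun h0 =>
      hΓ.ne_zero (hR a h0 hnd)
    obtain ⟨ε, hε, h⟩ := hΓ.exists_norm_integral_le hT hc
    refine ⟨ε, hε, fun ψ hψ hψ0 hψs δ hδ hδε => ?_⟩
    obtain ⟨C, hC⟩ := h δ hδ hδε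
    have hψc : HasCompactSupport ψ := HasCompactSupport.intro (isCompact_closedBall s₀ ε) hψs
    have hfin : ∫⁻ s, ENNReal.ofReal (ψ s) ∂μ ≠ ⊤ := by
      have := (hψ.continuous.integrable_of_hasCompactSupport (μ := μ) hψc).hasFiniteIntegral
      refine ne_top_of_le_ne_top this.ne (lintegral_mono fun s => ?_)
      rw [← ofReal_norm]
      exact ENNReal.ofReal_le_ofReal (Real.le_norm_self _)
    refine ⟨(∫⁻ s, ENNReal.ofReal (ψ s) ∂μ).toNNReal * (C ^ 2).toNNReal, fun Ξ hΞ l hl => ?_⟩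
    have hl0 : 0 < l := by linarith
    rw [ENNReal.coe_mul, ENNReal.coe_toNNReal hfin]
    calc _ ≤ ∫⁻ s, ENNReal.ofReal (ψ s) * (ENNReal.ofReal (C ^ 2) * ENNReal.ofReal (l ^ 1)⁻¹) ∂μ := by
          refine lintegral_mono fun s => ?_
          by_cases hs : s ∈ Metric.closedBall s₀ ε
          · refine mul_le_mul_right ?_ _
            have h1 := hC s hs Ξ hΞ l hl0
            rw [intervalIntegral.integral_of_le hδ.le] at h1
            rw [← ofReal_norm, ← ENNReal.ofReal_pow (norm_nonneg _),
              ← ENNReal.ofReal_mul (sq_nonneg _)]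
            apply ENNReal.ofReal_le_ofReal
            calc _ ≤ (C / l) ^ 2 := pow_le_pow_left₀ (norm_nonneg _) h1 2
              _ = C ^ 2 * (l⁻¹ * l⁻¹) := by rw [div_pow]; field_simp
              _ ≤ C ^ 2 * (l⁻¹ * 1) := by
                gcongr
                exact inv_le_one_of_one_le₀ hl
              _ = C ^ 2 * (l ^ 1)⁻¹ := by rw [mul_one, pow_one]
          · simp [hψs s hs]
      _ = _ := by
          rw [lintegral_mul_const _ hψ.continuous.measurable.ennreal_ofReal, mul_assoc]
          rfl

theorem IsConvexArc.exists_averageBound {Γ : ℝ → E} {a u₂ : E} {g : ℝ → ℝ} {δ₀ L : ℝ}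
    (hΓ : IsConvexArc Γ a u₂ g δ₀ L) (hdim : Module.finrank ℝ E = 2) {T : W × E → E}
    (hT : ContDiff ℝ ∞ T) {s₀ : W}
    (hJ : Function.Injective fun y => fderiv ℝ T (s₀, Γ 0) (0, y))
    (hR : ∀ Ξ, ‖Ξ‖ = 1 → RankCondition T Ξ s₀ (Γ 0)) :
    ∃ V ∈ 𝓝 s₀, ∃ δ > 0, AverageBound 1 (μ.restrict V) (volume.restrict (Ioc 0 δ)) T Γ := by
  let 𝓜 : ℝ → Set (Measure ℝ) := fun ε => {ν | ∃ δ, 0 < δ ∧ δ ≤ ε ∧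
    ν = volume.restrict (Ioc 0 δ)}
  have h𝓜 : Monotone 𝓜 := by
    rintro ε ε' hεε' ν ⟨δ, h1, h2, h3⟩
    exact ⟨δ, h1, h2.trans hεε', h3⟩
  obtain ⟨ε₁, hε₁, hdec⟩ := exists_decay_sphere (μ := μ) (T := T) (Γ := Γ) (s₀ := s₀) h𝓜
    (d := 1) (fun Ξ₀ hΞ₀ => by
      obtain ⟨ε, hε, h⟩ := hΓ.exists_decay (μ := μ) hT (hR Ξ₀ hΞ₀)
      refine ⟨ε, hε, fun ψ h1 h2 h3 ν hν => ?_⟩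
      obtain ⟨δ, h4, h5, rfl⟩ := hν
      exact h ψ h1 h2 h3 δ h4 h5)
  let J : E →L[ℝ] E := (fderiv ℝ T (s₀, Γ 0)).comp (ContinuousLinearMap.inr ℝ W E)
  have hJ' : ∀ y, J y = fderiv ℝ T (s₀, Γ 0) (0, y) := fun y => by simp [J]
  have hdim' : Module.finrank ℝ ℝ + 1 = Module.finrank ℝ E := by
    rw [Module.finrank_self, hdim]
  obtain ⟨e, he⟩ := exists_transversal (J := J) (by
    intro a b hab; rw [hJ', hJ'] at hab; exact hJ hab)
    (A := ContinuousLinearMap.toSpanSingleton ℝ a) (smul_left_injective ℝ hΓ.ne_zero) hdim'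
  simp_rw [hJ'] at he
  obtain ⟨ε₂, hε₂, C₁, htr⟩ := exists_lintegral_transversal_le (m := (volume : Measure ℝ)) hT he
    hdim'
  obtain ⟨δ, hδ, hstrict⟩ := hΓ.exists_strict hε₂
  obtain ⟨ε, hε, hεε₁, hεε₂, hεδ⟩ : ∃ ε > 0, ε ≤ ε₁ ∧ ε ≤ ε₂ ∧ ε ≤ δ :=
    ⟨min ε₁ (min ε₂ δ), by positivity, min_le_left _ _,
      (min_le_right _ _).trans (min_le_left _ _), (min_le_right _ _).trans (min_le_right _ _)⟩
  let ψ : ContDiffBump s₀ := ⟨ε / 2, ε, by positivity, by linarith⟩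
  have hψs : ∀ s, s ∉ Metric.closedBall s₀ ε → ψ s = 0 := fun s hs =>
    ψ.zero_of_le_dist (le_of_lt (by simpa using hs))
  obtain ⟨C, hC⟩ := hdec ψ ψ.contDiff (fun s => ψ.nonneg) (fun s hs => hψs s fun h => hs
    (Metric.closedBall_subset_closedBall hεε₁ h)) (volume.restrict (Ioc 0 ε)) ⟨ε, hε, hεε₁, rfl⟩
  have hsub : ∀ t ∈ Ioc 0 ε, t ∈ Icc 0 δ := fun t ht => ⟨ht.1.le, ht.2.trans hεδ⟩
  exact ⟨_, Metric.closedBall_mem_nhds s₀ (half_pos hε), ε, hε,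
    averageBound_of_decay hT.continuous hΓ.continuous.measurable ψ.continuous hε hψs one_pos hC
    (e := e) (C₁ := C₁)
    (fun s hs F hF => htr (Ioc 0 ε) Γ measurableSet_Ioc hΓ.continuous.measurable
      (fun t ht => (hstrict t (hsub t ht)).1)
      (fun t ht τ hτ => ((hstrict t (hsub t ht)).2 τ (hsub τ hτ)).2) s
      (Metric.closedBall_subset_closedBall hεε₂ hs) F hF)
    (V := Metric.closedBall s₀ (ε / 2)) measurableSet_closedBall
    (fun s hs => (ψ.one_of_mem_closedBall hs).ge)⟩

end CurveAverage

/-! ### Planar convex boundaries as graphs. -/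

section ConvexGraph

variable {E : Type*} [NormedAddCommGroup E] [InnerProductSpace ℝ E] [FiniteDimensional ℝ E]

theorem exists_planar_coordinates (hdim : Module.finrank ℝ E = 2) {v : E} (hv : v ≠ 0) :
    ∃ u : E, ‖u‖ = 1 ∧ inner ℝ u v = 0 ∧
      ∀ z, z = inner ℝ u z • u + (inner ℝ v z / ‖v‖ ^ 2) • v := by
  have h1 : Module.finrank ℝ (Submodule.span ℝ {v})ᗮ = 1 := by
    have := Submodule.finrank_add_finrank_orthogonal (Submodule.span ℝ {v})
    rw [finrank_span_singleton hv] at this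
    omega
  have : Nontrivial (Submodule.span ℝ {v})ᗮ :=
    Module.nontrivial_of_finrank_pos (R := ℝ) (by omega)
  obtain ⟨w, hw⟩ := exists_ne (0 : (Submodule.span ℝ {v})ᗮ)
  have hw0 : (w : E) ≠ 0 := by simpa using hw
  have hvw : inner ℝ v (w : E) = 0 := Submodule.mem_orthogonal_singleton_iff_inner_right.1 w.2
  set u : E := ‖(w : E)‖⁻¹ • (w : E) with hu
  have hu1 : ‖u‖ = 1 := by
    rw [hu, norm_smul, norm_inv, norm_norm, inv_mul_cancel₀ (norm_ne_zero_iff.2 hw0)]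
  have huv : inner ℝ v u = 0 := by rw [hu, real_inner_smul_right, hvw, mul_zero]
  have huv' : inner ℝ u v = 0 := by rw [real_inner_comm]; exact huv
  clear_value u
  refine ⟨u, hu1, huv', fun z => ?_⟩
  have hu0 : u ≠ 0 := by rintro h; rw [h, norm_zero] at hu1; exact zero_ne_one hu1
  have h2 : Module.finrank ℝ (Submodule.span ℝ {u})ᗮ = 1 := by
    have := Submodule.finrank_add_finrank_orthogonal (Submodule.span ℝ {u})
    rw [finrank_span_singleton hu0] at this
    omega
  let v' : (Submodule.span ℝ {u})ᗮ := ⟨v, Submodule.mem_orthogonal_singleton_iff_inner_right.2 huv'⟩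
  have hv' : v' ≠ 0 := by
    intro h
    exact hv (congrArg Subtype.val h)
  have hz : z - inner ℝ u z • u ∈ (Submodule.span ℝ {u})ᗮ := by
    rw [Submodule.mem_orthogonal_singleton_iff_inner_right, inner_sub_right, real_inner_smul_right,
      real_inner_self_eq_norm_sq, hu1]
    ring
  obtain ⟨k, hk⟩ := (finrank_eq_one_iff_of_nonzero' v' hv').1 h2 ⟨_, hz⟩
  have hk' : k • v = z - inner ℝ u z • u := congrArg Subtype.val hk
  have hk2 : inner ℝ v z = k * ‖v‖ ^ 2 := by
    have h3 : z = inner ℝ u z • u + k • v := by rw [hk']; abel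
    rw [h3, inner_add_right, real_inner_smul_right, real_inner_smul_right, huv,
      real_inner_self_eq_norm_sq]
    ring
  have hvn : ‖v‖ ^ 2 ≠ 0 := pow_ne_zero 2 (norm_ne_zero_iff.2 hv)
  rw [hk2, mul_div_cancel_right₀ _ hvn, hk']
  abel

/-- The boundary of a planar convex set with interior points is locally the graph of a convex
function. -/
theorem exists_convexOn_graph (hdim : Module.finrank ℝ E = 2) {B : Set E} (hB : Convex ℝ B)
    (hBi : (interior B).Nonempty) {x₀ : E} (hx₀ : x₀ ∈ frontier B) :
    ∃ u₁ u₂ : E, ‖u₁‖ = 1 ∧ inner ℝ u₁ u₂ = 0 ∧ ∃ g : ℝ → ℝ, ∃ r > 0,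
      ConvexOn ℝ (Icc (-r) r) g ∧ g 0 = 0 ∧ ∀ᶠ y in 𝓝 x₀, y ∈ frontier B →
        y = x₀ + inner ℝ u₁ (y - x₀) • u₁ + g (inner ℝ u₁ (y - x₀)) • u₂ := by
  obtain ⟨p, hp⟩ := hBi
  set v := p - x₀ with hvdef
  have hv : v ≠ 0 := by
    intro h
    rw [hvdef, sub_eq_zero] at h
    exact hx₀.2 (h ▸ hp)
  obtain ⟨u, hu, huv, hz⟩ := exists_planar_coordinates hdim hv
  -- Coordinates whose vertical axis points from `x₀` to an interior point; the segment at height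
  -- `1` over `[-r, r]` lies in the interior.
  let q : ℝ → ℝ → E := fun x h => x₀ + x • u + h • v
  obtain ⟨r, hr, hrB⟩ := Metric.nhds_basis_closedBall.mem_iff.1 (isOpen_interior.mem_nhds hp)
  have hq1 : ∀ x, |x| ≤ r → q x 1 ∈ interior B := by
    intro x hx
    apply hrB
    have : q x 1 - p = x • u := by simp only [q, hvdef]; module
    rw [Metric.mem_closedBall, dist_eq_norm, this, norm_smul, hu, mul_one]
    exact hx
  have hq0 : q 0 0 = x₀ := by simp [q]
  have hcomb : ∀ x y h k a b : ℝ, a + b = 1 →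
      q (a * x + b * y) (a * h + b * k) = a • q x h + b • q y k := by
    intro x y h k a b hab
    obtain rfl : a = 1 - b := by linarith
    simp only [q]
    module
  -- An interior point at or below `x₀` on the vertical axis would, joined to the one at height `1`,
  -- make `x₀` interior.
  have hvert : ∀ k, q 0 k ∈ interior B → 0 < k := by
    intro k hk
    by_contra! hcon
    have h1 := hB.interior hk (hq1 0 (by simpa using hr.le)) (a := 1 / (1 - k)) (b := -k / (1 - k))
      (by apply div_nonneg <;> linarith) (by apply div_nonneg <;> linarith)
      (by rw [← add_div, ← sub_eq_add_neg, div_self (by linarith)])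
    rw [← hcomb _ _ _ _ _ _ (by rw [← add_div, ← sub_eq_add_neg, div_self (by linarith)])] at h1
    have h2 : 1 / (1 - k) * k + -k / (1 - k) * 1 = 0 := by ring
    rw [h2, mul_zero, mul_zero, add_zero, hq0] at h1
    exact hx₀.2 h1
  -- Averaging with the interior point of height `1` over `-x` gives an interior point over `0` of
  -- height `(h + 1) / 2`, which must be positive.
  have hlow : ∀ x, |x| ≤ r → ∀ h, q x h ∈ closure B → -1 ≤ h := by
    intro x hx h hh
    have h1 := hB.combo_closure_interior_mem_interior hh (hq1 (-x) (by rwa [abs_neg]))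
      (a := 1 / 2) (b := 1 / 2) (by norm_num) (by norm_num) (by norm_num)
    rw [← hcomb _ _ _ _ _ _ (by norm_num)] at h1
    have h2 : 1 / 2 * x + 1 / 2 * -x = 0 := by ring
    rw [h2] at h1
    have := hvert _ h1
    linarith
  let S : ℝ → Set ℝ := fun x => {h | q x h ∈ closure B}
  have hSb : ∀ x, |x| ≤ r → BddBelow (S x) := fun x hx => ⟨-1, fun h hh => hlow x hx h hh⟩
  have hSm : ∀ x, |x| ≤ r → sInf (S x) ∈ S x := by
    intro x hx
    refine IsClosed.csInf_mem ?_ ⟨1, subset_closure (interior_subset (hq1 x hx))⟩ (hSb x hx)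
    exact isClosed_closure.preimage (by fun_prop)
  have habs : ∀ x, x ∈ Icc (-r) r ↔ |x| ≤ r := fun x => abs_le.symm
  refine ⟨u, v, hu, huv, fun x => sInf (S x), r, hr, ⟨convex_Icc _ _, ?_⟩, ?_, ?_⟩
  · intro x hx y hy a b ha hb hab
    have hxy := convex_Icc (-r) r hx hy ha hb hab
    rw [habs] at hx hy hxy
    refine csInf_le (hSb _ hxy) ?_
    change q _ _ ∈ closure B
    simp only [smul_eq_mul]
    rw [hcomb _ _ _ _ _ _ hab]
    exact hB.closure (hSm x hx) (hSm y hy) ha hb hab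
  · have h0 : |(0 : ℝ)| ≤ r := by simpa using hr.le
    refine le_antisymm (csInf_le (hSb 0 h0) ?_) ?_
    · change q 0 0 ∈ closure B
      rw [hq0]
      exact hx₀.1
    · by_contra! hcon
      set k := sInf (S 0)
      have h1 := hB.combo_closure_interior_mem_interior (hSm 0 h0) (hq1 0 h0)
        (a := 1 / (1 - k)) (b := -k / (1 - k)) (by apply div_nonneg <;> linarith)
        (by apply div_pos <;> linarith)
        (by rw [← add_div, ← sub_eq_add_neg, div_self (by linarith)])
      rw [← hcomb _ _ _ _ _ _ (by rw [← add_div, ← sub_eq_add_neg, div_self (by linarith)])] at h1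
      have := hvert (1 / (1 - k) * k + -k / (1 - k) * 1) (by simpa using h1)
      have h2 : 1 / (1 - k) * k + -k / (1 - k) * 1 = 0 := by ring
      linarith
  · have e1 : ∀ᶠ y in 𝓝 x₀, |inner ℝ u (y - x₀)| < r := by
      have : ContinuousAt (fun y => |inner ℝ u (y - x₀)|) x₀ := by fun_prop
      exact this.eventually_lt continuousAt_const (by simpa using hr)
    have e2 : ∀ᶠ y in 𝓝 x₀, inner ℝ v (y - x₀) / ‖v‖ ^ 2 < 1 := by
      have : ContinuousAt (fun y => inner ℝ v (y - x₀) / ‖v‖ ^ 2) x₀ := by fun_prop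
      exact this.eventually_lt continuousAt_const (by simp)
    filter_upwards [e1, e2] with y h1 h2 hy
    set x := inner ℝ u (y - x₀)
    set h := inner ℝ v (y - x₀) / ‖v‖ ^ 2
    have hyq : y = q x h := by
      have := hz (y - x₀)
      rw [sub_eq_iff_eq_add] at this
      rw [this]
      simp only [q, x, h]
      abel
    have hS : h ∈ S x := by
      change q x h ∈ closure B
      rw [← hyq]
      exact hy.1
    -- A frontier point strictly above the lowest one would lie between a closure point and the
    -- interior point at height `1`, hence be interior.
    have heq : h = sInf (S x) := by
      refine le_antisymm ?_ (csInf_le (hSb x h1.le) hS)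
      by_contra! hcon
      set k := sInf (S x)
      have hk1 : 0 < 1 - k := by linarith
      have h3 := hB.combo_closure_interior_mem_interior (hSm x h1.le) (hq1 x h1.le)
        (a := (1 - h) / (1 - k)) (b := (h - k) / (1 - k)) (by apply div_nonneg <;> linarith)
        (by apply div_pos <;> linarith)
        (by rw [← add_div]; field_simp; ring)
      rw [← hcomb _ _ _ _ _ _ (by rw [← add_div]; field_simp; ring)] at h3
      have h4 : (1 - h) / (1 - k) * x + (h - k) / (1 - k) * x = x := by field_simp; ring
      have h5 : (1 - h) / (1 - k) * k + (h - k) / (1 - k) * 1 = h := by field_simp; ring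
      rw [h4, h5, ← hyq] at h3
      exact hy.2 h3
    rw [← heq]
    exact hyq

end ConvexGraph

/-! ### One-sided derivatives of convex functions. -/

section ConvexArcs

/-- The right derivative is the infimum of the slopes from `0`. Monotonicity of slopes squeezes
every chord in a short interval to the right of `0` between it and the slope of one further chord,
which is what makes the derivative strict on that side. -/
theorem exists_strict_right_of_convexOn {g : ℝ → ℝ} {r : ℝ} (hr : 0 < r)
    (hg : ConvexOn ℝ (Icc (-r) r) g) :
    ∃ a : ℝ, ∀ η > 0, ∃ δ > 0, ∀ t ∈ Icc 0 δ, ∀ τ ∈ Icc 0 δ,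
      |g t - g τ - (t - τ) * a| ≤ η * |t - τ| := by
  have h0 : (0 : ℝ) ∈ interior (Icc (-r) r) := by
    rw [interior_Icc]; exact ⟨by linarith, hr⟩
  let S := slope g 0 '' {y ∈ Icc (-r) r | 0 < y}
  have hbdd : BddBelow S := bddBelow_slope_lt_of_mem_interior hg h0
  have hslope : ∀ y, 0 < y → y ≤ r → sInf S ≤ (g y - g 0) / y := by
    intro y h1 h2
    have := csInf_le hbdd ⟨y, ⟨⟨by linarith, h2⟩, h1⟩, rfl⟩
    rwa [slope_def_field, sub_zero] at this
  refine ⟨sInf S, fun η hη => ?_⟩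
  obtain ⟨_, ⟨y₀, ⟨hy₀, hy0⟩, rfl⟩, hlt⟩ := exists_lt_of_csInf_lt
    (⟨_, r, ⟨⟨by linarith, le_rfl⟩, hr⟩, rfl⟩ : S.Nonempty)
    (show sInf S < sInf S + η / 2 by linarith)
  rw [slope_def_field, sub_zero] at hlt
  set a := sInf S
  set δ := y₀ / 2 with hδ
  have hδ0 : 0 < δ := by positivity
  have hyδ : y₀ = 2 * δ := by rw [hδ]; ring
  have hδr : 2 * δ ≤ r := hyδ ▸ hy₀.2
  rw [hyδ] at hlt
  -- This slope is twice the slope over `[0, 2δ]`, below `a + η / 2`, minus the slope over `[0, δ]`,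
  -- at least `a`.
  have hup : (g (2 * δ) - g δ) / (2 * δ - δ) ≤ a + η := by
    have h1 := hslope δ hδ0 (by linarith)
    have h2 : (g (2 * δ) - g δ) / (2 * δ - δ) =
        2 * ((g (2 * δ) - g 0) / (2 * δ)) - (g δ - g 0) / δ := by
      have : 2 * δ - δ = δ := by ring
      rw [this]
      field_simp
      ring
    rw [h2]
    linarith
  have key : ∀ τ t, 0 ≤ τ → τ < t → t ≤ δ → |g t - g τ - (t - τ) * a| ≤ η * |t - τ| := by
    intro τ t hτ hτt ht
    have hpos : 0 < t - τ := by linarith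
    have hlo : a ≤ (g t - g τ) / (t - τ) := by
      rcases hτ.eq_or_lt with rfl | hτ
      · simpa using hslope t hτt (by linarith)
      · have h1 := hg.slope_mono_adjacent (x := 0) (y := τ) (z := t) ⟨by linarith, hr.le⟩
          ⟨by linarith, by linarith⟩ hτ hτt
        have h2 := hslope τ hτ (by linarith)
        rw [sub_zero] at h1
        linarith
    have hhi : (g t - g τ) / (t - τ) ≤ a + η := by
      have h1 := hg.slope_mono_adjacent (x := τ) (y := t) (z := 2 * δ) ⟨by linarith, by linarith⟩
        ⟨by linarith, by linarith⟩ hτt (by linarith)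
      rcases ht.eq_or_lt with rfl | ht
      · exact h1.trans hup
      · have h2 := hg.secant_mono_aux3 (x := t) (y := δ) (z := 2 * δ) ⟨by linarith, by linarith⟩
          ⟨by linarith, by linarith⟩ ht (by linarith)
        linarith
    rw [le_div_iff₀ hpos] at hlo
    rw [div_le_iff₀ hpos] at hhi
    rw [abs_of_pos hpos, abs_le]
    constructor <;> nlinarith
  refine ⟨δ, hδ0, fun t ht τ hτ => ?_⟩
  rcases lt_trichotomy τ t with h | rfl | h
  · exact key τ t hτ.1 h ht.2
  · simp
  · have := key t τ ht.1 h hτ.2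
    rw [abs_sub_comm t τ, ← abs_neg]
    convert this using 2
    ring

variable {E : Type*} [NormedAddCommGroup E] [InnerProductSpace ℝ E]

theorem exists_isConvexArc {g : ℝ → ℝ} {r : ℝ} (hr : 0 < r) (hg : ConvexOn ℝ (Icc (-r) r) g)
    (hg0 : g 0 = 0) {u₁ u₂ : E} (hu : ‖u₁‖ = 1) (horth : inner ℝ u₁ u₂ = 0) (x₀ : E) :
    ∃ δ₀ > 0, ∃ Γ : ℝ → E, ∃ a : E, ∃ L M : ℝ, IsConvexArc Γ a u₂ g δ₀ L ∧ Γ 0 = x₀ ∧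
      (∀ t ∈ Icc 0 δ₀, Γ t = x₀ + t • u₁ + g t • u₂) ∧
      ∀ t ∈ Icc 0 δ₀, ∀ τ ∈ Icc 0 δ₀, ‖Γ t - Γ τ‖ ≤ M * |t - τ| := by
  have h0 : (0 : ℝ) ∈ interior (Icc (-r) r) := by
    rw [interior_Icc]; exact ⟨by linarith, hr⟩
  obtain ⟨K, U, hU, hK⟩ := hg.locallyLipschitzOn_interior h0
  rw [isOpen_interior.nhdsWithin_eq h0] at hU
  obtain ⟨δ₁, hδ₁, hδU⟩ := Metric.nhds_basis_closedBall.mem_iff.1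
    (inter_mem hU (isOpen_interior.mem_nhds h0))
  obtain ⟨δ₀, hδ₀, hδ₀1⟩ : ∃ δ₀ > 0, δ₀ ≤ δ₁ := ⟨δ₁, hδ₁, le_rfl⟩
  have hsub : Icc 0 δ₀ ⊆ U ∩ interior (Icc (-r) r) := by
    intro t ht
    apply hδU
    rw [Metric.mem_closedBall, dist_zero_right, Real.norm_eq_abs, abs_of_nonneg ht.1]
    exact ht.2.trans hδ₀1
  have hsub' : Icc 0 δ₀ ⊆ Icc (-r) r := fun t ht => interior_subset (hsub ht).2
  have hgL : ∀ x ∈ Icc 0 δ₀, ∀ y ∈ Icc 0 δ₀, |g x - g y| ≤ K * |x - y| := by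
    intro x hx y hy
    have := hK.dist_le_mul x (hsub hx).1 y (hsub hy).1
    rwa [Real.dist_eq, Real.dist_eq] at this
  have hgc : ContinuousOn g (Icc 0 δ₀) :=
    hK.continuousOn.mono fun t ht => (hsub ht).1
  -- Outside `[0, δ₀]` the function `g` is frozen at its end values, only to make `Γ` continuous on
  -- the whole line.
  let Γ : ℝ → E := fun t => x₀ + t • u₁ + IccExtend hδ₀.le ((Icc 0 δ₀).domRestrict g) t • u₂
  have hext : Continuous (IccExtend hδ₀.le ((Icc 0 δ₀).domRestrict g)) :=
    (continuousOn_iff_continuous_domRestrict.1 hgc).Icc_extend'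
  have hΓ : ∀ t ∈ Icc 0 δ₀, Γ t = x₀ + t • u₁ + g t • u₂ := by
    intro t ht
    simp only [Γ, IccExtend_of_mem _ _ ht, domRestrict_apply]
  obtain ⟨a, ha⟩ := exists_strict_right_of_convexOn hr hg
  have hsd : ∀ x h, 0 ≤ x → 0 ≤ h → x + 2 * h ≤ δ₀ →
      x ∈ Icc 0 δ₀ ∧ x + h ∈ Icc 0 δ₀ ∧ x + 2 * h ∈ Icc 0 δ₀ := fun x h hx hh hxh =>
    ⟨⟨hx, by linarith⟩, ⟨by linarith, by linarith⟩, ⟨by linarith, hxh⟩⟩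
  refine ⟨δ₀, hδ₀, Γ, u₁ + a • u₂, K, 1 + K * ‖u₂‖, ⟨hδ₀, ?_, ?_, ?_, hgc, hgL, ?_, ?_⟩, ?_, hΓ, ?_⟩
  · fun_prop
  · intro h
    have h1 : inner ℝ u₁ (u₁ + a • u₂) = 1 := by
      rw [inner_add_right, real_inner_smul_right, horth, real_inner_self_eq_norm_sq, hu]
      norm_num
    rw [h, inner_zero_right] at h1
    exact zero_ne_one h1
  · intro η hη
    obtain ⟨δ, hδ, h⟩ := ha (η / (‖u₂‖ + 1)) (by positivity)
    refine ⟨min δ δ₀, by positivity, fun t ht τ hτ => ?_⟩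
    have ht' : t ∈ Icc 0 δ₀ := ⟨ht.1, ht.2.trans (min_le_right _ _)⟩
    have hτ' : τ ∈ Icc 0 δ₀ := ⟨hτ.1, hτ.2.trans (min_le_right _ _)⟩
    have h1 : Γ t - Γ τ - (t - τ) • (u₁ + a • u₂) = (g t - g τ - (t - τ) * a) • u₂ := by
      rw [hΓ t ht', hΓ τ hτ']
      module
    rw [h1, norm_smul, Real.norm_eq_abs]
    have h2 := h t ⟨ht.1, ht.2.trans (min_le_left _ _)⟩ τ ⟨hτ.1, hτ.2.trans (min_le_left _ _)⟩
    calc _ ≤ η / (‖u₂‖ + 1) * |t - τ| * (‖u₂‖ + 1) := by gcongr; linarith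
      _ = _ := by field_simp
  · intro x h hx hh hxh
    obtain ⟨m1, m2, m3⟩ := hsd x h hx hh hxh
    rw [hΓ _ m1, hΓ _ m2, hΓ _ m3]
    module
  · intro x h hx hh hxh
    obtain ⟨m1, m2, m3⟩ := hsd x h hx hh hxh
    have hhalf : (0 : ℝ) ≤ 1 / 2 := by norm_num
    have := hg.2 (hsub' m1) (hsub' m3) hhalf hhalf (by norm_num)
    simp only [smul_eq_mul] at this
    rw [show 1 / 2 * x + 1 / 2 * (x + 2 * h) = x + h by ring] at this
    linarith
  · rw [hΓ 0 ⟨le_rfl, hδ₀.le⟩, hg0]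
    simp
  · intro t ht τ hτ
    have h1 : Γ t - Γ τ = (t - τ) • u₁ + (g t - g τ) • u₂ := by
      rw [hΓ t ht, hΓ τ hτ]
      module
    rw [h1]
    refine (norm_add_le _ _).trans ?_
    rw [norm_smul, norm_smul, hu, Real.norm_eq_abs, Real.norm_eq_abs]
    have := hgL t ht τ hτ
    nlinarith [norm_nonneg u₂]

end ConvexArcs

/-! ### The local averaging bound for bi-Lipschitz convex curves. -/

section ConvexCurve

variable {W E G : Type*} [NormedAddCommGroup W] [NormedSpace ℝ W] [FiniteDimensional ℝ W]
  [MeasurableSpace W] [BorelSpace W] {μ : Measure W} [μ.IsAddHaarMeasure]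
  [NormedAddCommGroup E] [InnerProductSpace ℝ E] [FiniteDimensional ℝ E]
  [MeasurableSpace E] [BorelSpace E]
  [NormedAddCommGroup G] [NormedSpace ℝ G] [FiniteDimensional ℝ G]
  [MeasurableSpace G] [BorelSpace G] {m : Measure G} [m.IsAddHaarMeasure]

/-- Passage from the given parameter to the abscissa `X`: the lower bound `hK` makes the image of
`m` under `X` at most a multiple of Lebesgue measure. -/
theorem AverageBound.of_antilipschitz (hG : Module.finrank ℝ G = 1) {d : ℕ} {σ : Measure W}
    {T : W × E → E} {Γ : ℝ → E} {δ : ℝ}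
    (h : AverageBound d σ (volume.restrict (Ioc 0 δ)) T Γ)
    (hT : ∀ s, Measurable fun x => T (s, x)) (hΓ : Measurable Γ) {X : G → ℝ} (hX : Measurable X)
    {D : Set G} (hD : MeasurableSet D) {γ : G → E} (hγ : ∀ t ∈ D, X t ∈ Ioc 0 δ ∧ γ t = Γ (X t))
    {K : ℝ} (hK : ∀ t ∈ D, ∀ τ ∈ D, ‖t - τ‖ ≤ K * |X t - X τ|) :
    AverageBound d σ (m.restrict D) T γ := by
  obtain ⟨C, hC⟩ := exists_lintegral_comp_le_of_antilipschitz m (volume : Measure ℝ)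
    (by rw [hG, Module.finrank_self]) K.toNNReal
  refine h.of_le_mul hT (c := C) fun F hF => ?_
  have := hC D X hD hX (fun t ht τ hτ => (hK t ht τ hτ).trans (by
    rw [Real.norm_eq_abs]
    gcongr
    exact Real.le_coe_toNNReal K)) ((Ioc 0 δ).indicator fun x => F (Γ x))
    ((hF.comp hΓ).indicator measurableSet_Ioc)
  rw [lintegral_indicator measurableSet_Ioc] at this
  refine le_trans (le_of_eq ?_) this
  refine setLIntegral_congr_fun hD fun t ht => ?_
  rw [indicator_of_mem (hγ t ht).1, (hγ t ht).2]

/-- A convex graph has one-sided derivatives only, so the curve is cut at `γ t₀` into two arcs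
starting there. The lower bi-Lipschitz bound on `γ` and the Lipschitz bound on the arcs compare the
parameter with the abscissa. -/
theorem exists_averageBound_of_convex_curve (hG : Module.finrank ℝ G = 1)
    (hdim : Module.finrank ℝ E = 2) {T : W × E → E} (hT : ContDiff ℝ ∞ T) {γ : G → E}
    (hγm : Measurable γ) {t₀ : G} {B : Set E} (hB : Convex ℝ B) (hBi : (interior B).Nonempty)
    (hfr : ∀ᶠ t in 𝓝 t₀, γ t ∈ frontier B) {c L : ℝ} (hc : 0 < c) {U : Set G} (hU : U ∈ 𝓝 t₀)
    (hbi : ∀ u ∈ U, ∀ v ∈ U, c * ‖u - v‖ ≤ ‖γ u - γ v‖ ∧ ‖γ u - γ v‖ ≤ L * ‖u - v‖) {s₀ : W}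
    (hJ : Function.Injective fun y => fderiv ℝ T (s₀, γ t₀) (0, y))
    (hR : ∀ Ξ, ‖Ξ‖ = 1 → RankCondition T Ξ s₀ (γ t₀)) :
    ∃ V ∈ 𝓝 s₀, ∃ V' ∈ 𝓝 t₀, AverageBound 1 (μ.restrict V) (m.restrict V') T γ := by
  have : Nontrivial G := Module.nontrivial_of_finrank_pos (R := ℝ) (by omega)
  obtain ⟨u₁, u₂, hu, horth, g, r, hr, hg, hg0, hgraph⟩ :=
    exists_convexOn_graph hdim hB hBi hfr.self_of_nhds
  have hg' : ConvexOn ℝ (Icc (-r) r) fun x => g (-x) := by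
    refine ⟨convex_Icc _ _, fun x hx y hy a b ha hb hab => ?_⟩
    have := hg.2 (x := -x) (y := -y) ⟨by linarith [hx.2], by linarith [hx.1]⟩
      ⟨by linarith [hy.2], by linarith [hy.1]⟩ ha hb hab
    convert this using 2
    simp only [smul_eq_mul]
    ring
  obtain ⟨δ₁, hδ₁, Γ₁, a₁, L₁, M₁, hΓ₁, h01, heq1, hM₁⟩ :=
    exists_isConvexArc hr hg hg0 hu horth (γ t₀)
  -- The left arc is traversed from `γ t₀` outwards, as the right arc of the reflected function with
  -- `-u₁`.
  obtain ⟨δ₂, hδ₂, Γ₂, a₂, L₂, M₂, hΓ₂, h02, heq2, hM₂⟩ :=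
    exists_isConvexArc hr hg' (by simpa using hg0) (u₁ := -u₁) (by rwa [norm_neg])
      (by rw [inner_neg_left, horth, neg_zero]) (γ t₀)
  obtain ⟨V₁, hV₁, ε₁, hε₁, hA₁⟩ := hΓ₁.exists_averageBound (μ := μ) hdim hT (s₀ := s₀)
    (by rwa [h01]) (by rwa [h01])
  obtain ⟨V₂, hV₂, ε₂, hε₂, hA₂⟩ := hΓ₂.exists_averageBound (μ := μ) hdim hT (s₀ := s₀)
    (by rwa [h02]) (by rwa [h02])
  obtain ⟨ε, hε, e1, e2, e3, e4⟩ : ∃ ε > 0, ε ≤ δ₁ ∧ ε ≤ δ₂ ∧ ε ≤ ε₁ ∧ ε ≤ ε₂ := by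
    refine ⟨min (min δ₁ δ₂) (min ε₁ ε₂), by positivity, ?_⟩
    simp only [min_le_iff, le_refl, true_or, or_true, and_self]
  let X : G → ℝ := fun t => inner ℝ u₁ (γ t - γ t₀)
  have hXm : Measurable X := measurable_const.inner (hγm.sub_const _)
  have hγc : ContinuousAt γ t₀ := by
    rw [ContinuousAt, tendsto_iff_norm_sub_tendsto_zero]
    have h1 : Tendsto (fun t => L * ‖t - t₀‖) (𝓝 t₀) (𝓝 0) := by
      have : ContinuousAt (fun t => L * ‖t - t₀‖) t₀ := by fun_prop
      simpa [ContinuousAt] using this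
    refine squeeze_zero' (Eventually.of_forall fun t => norm_nonneg _) ?_ h1
    filter_upwards [hU] with t ht
    exact (hbi t ht t₀ (mem_of_mem_nhds hU)).2
  have hXc : ∀ᶠ t in 𝓝 t₀, |X t| ≤ ε := by
    have h1 : ContinuousAt X t₀ := by
      have := hγc.sub_const (γ t₀)
      exact continuousAt_const.inner this
    have h2 : Tendsto (fun t => |X t|) (𝓝 t₀) (𝓝 0) := by
      have := h1.abs
      simpa [ContinuousAt, X] using this
    filter_upwards [h2.eventually_lt_const hε] with t ht
    exact ht.le
  obtain ⟨ρ, hρ, hball⟩ := Metric.nhds_basis_closedBall.mem_iff.1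
    (inter_mem (inter_mem hU hXc) (inter_mem hfr (hγc.eventually hgraph)))
  let V' := Metric.closedBall t₀ ρ
  have hγX : ∀ t ∈ V', γ t = γ t₀ + X t • u₁ + g (X t) • u₂ := fun t ht =>
    (hball ht).2.2 (hball ht).2.1
  have hXε : ∀ t ∈ V', |X t| ≤ ε := fun t ht => (hball ht).1.2
  have hVU : ∀ t ∈ V', t ∈ U := fun t ht => (hball ht).1.1
  let D₁ := V' ∩ {t | 0 < X t}
  let D₂ := V' ∩ {t | X t < 0}
  have hD₁ : MeasurableSet D₁ :=
    measurableSet_closedBall.inter (measurableSet_lt measurable_const hXm)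
  have hD₂ : MeasurableSet D₂ :=
    measurableSet_closedBall.inter (measurableSet_lt hXm measurable_const)
  have hTs : ∀ s, Measurable fun x => T (s, x) := fun s =>
    (hT.continuous.comp (continuous_const.prodMk continuous_id)).measurable
  have hm₁ : ∀ t ∈ D₁, X t ∈ Icc 0 ε := fun t ht => ⟨ht.2.le, (le_abs_self _).trans (hXε t ht.1)⟩
  have hm₂ : ∀ t ∈ D₂, -X t ∈ Icc 0 ε := fun t ht =>
    ⟨by have := ht.2; simp only [mem_ofPred_eq] at this; linarith,
      (neg_le_abs _).trans (hXε t ht.1)⟩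
  have hq₁ : ∀ t ∈ D₁, γ t = Γ₁ (X t) := fun t ht => by
    rw [heq1 _ (Icc_subset_Icc_right e1 (hm₁ t ht))]
    exact hγX t ht.1
  have hq₂ : ∀ t ∈ D₂, γ t = Γ₂ (-X t) := fun t ht => by
    rw [heq2 _ (Icc_subset_Icc_right e2 (hm₂ t ht)), neg_neg, neg_smul_neg]
    exact hγX t ht.1
  have hB₁ : AverageBound 1 (μ.restrict V₁) (m.restrict D₁) T γ := by
    refine hA₁.of_antilipschitz hG hTs hΓ₁.continuous.measurable hXm hD₁
      (fun t ht => ⟨⟨ht.2, (hm₁ t ht).2.trans e3⟩, hq₁ t ht⟩) (K := M₁ / c)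
      (fun t ht τ hτ => ?_)
    have h1 := (hbi t (hVU t ht.1) τ (hVU τ hτ.1)).1
    rw [hq₁ t ht, hq₁ τ hτ] at h1
    have h2 := h1.trans (hM₁ _ (Icc_subset_Icc_right e1 (hm₁ t ht)) _
      (Icc_subset_Icc_right e1 (hm₁ τ hτ)))
    rw [div_mul_eq_mul_div, le_div_iff₀ hc]
    linarith
  have hB₂ : AverageBound 1 (μ.restrict V₂) (m.restrict D₂) T γ := by
    refine hA₂.of_antilipschitz hG hTs hΓ₂.continuous.measurable hXm.neg hD₂
      (fun t ht => ⟨⟨neg_pos.2 ht.2, (hm₂ t ht).2.trans e4⟩, hq₂ t ht⟩) (K := M₂ / c)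
      (fun t ht τ hτ => ?_)
    have h1 := (hbi t (hVU t ht.1) τ (hVU τ hτ.1)).1
    rw [hq₂ t ht, hq₂ τ hτ] at h1
    have h2 := h1.trans (hM₂ _ (Icc_subset_Icc_right e2 (hm₂ t ht)) _
      (Icc_subset_Icc_right e2 (hm₂ τ hτ)))
    rw [div_mul_eq_mul_div, le_div_iff₀ hc]
    simp only [Pi.neg_apply]
    linarith
  refine ⟨V₁ ∩ V₂, inter_mem hV₁ hV₂, V', Metric.closedBall_mem_nhds _ hρ, ?_⟩
  refine (hB₁.mono_left (Measure.restrict_mono inter_subset_left le_rfl)).of_le_add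
    (hB₂.mono_left (Measure.restrict_mono inter_subset_right le_rfl)) hT.continuous.measurable
    hγm fun F hF => ?_
  -- Abscissa zero means `γ t = γ t₀`, hence `t = t₀` by the lower bi-Lipschitz bound; a single
  -- point is a null set.
  have hcover : V' ⊆ (D₁ ∪ D₂) ∪ {t₀} := by
    intro t ht
    rcases lt_trichotomy (X t) 0 with h | h | h
    · exact Or.inl (Or.inr ⟨ht, h⟩)
    · right
      have h1 := hγX t ht
      rw [h, hg0, zero_smul, zero_smul, add_zero, add_zero] at h1
      have h2 := (hbi t (hVU t ht) t₀ (mem_of_mem_nhds hU)).1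
      rw [h1, sub_self, norm_zero] at h2
      have h3 : ‖t - t₀‖ ≤ 0 := nonpos_of_mul_nonpos_right h2 hc
      exact sub_eq_zero.1 (norm_le_zero_iff.1 h3)
    · exact Or.inl (Or.inl ⟨ht, h⟩)
  calc ∫⁻ t in V', F (γ t) ∂m ≤ ∫⁻ t in (D₁ ∪ D₂) ∪ {t₀}, F (γ t) ∂m := lintegral_mono_set hcover
    _ ≤ (∫⁻ t in D₁ ∪ D₂, F (γ t) ∂m) + ∫⁻ t in {t₀}, F (γ t) ∂m := lintegral_union_le _ _ _
    _ ≤ _ := by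
      have : ∫⁻ t in {t₀}, F (γ t) ∂m = 0 :=
        setLIntegral_measure_zero _ _ (measure_singleton t₀)
      rw [this, add_zero]
      exact lintegral_union_le _ _ _

end ConvexCurve

/-! ### From nonnegative averages to the `L^p` statement. -/

section LpBound

variable {W E X : Type*} [MeasurableSpace W]
  [NormedAddCommGroup E] [InnerProductSpace ℝ E] [FiniteDimensional ℝ E]
  [MeasurableSpace E] [BorelSpace E] [MeasurableSpace X]

/-- The bound applied to the indicator of a null set shows that almost every translated surface
meets it in a null set. Hence `f` may be replaced by a measurable representative. -/
theorem AverageBound.ae_eq {d : ℕ} {σ : Measure W} [SFinite σ] {ν : Measure X} [SFinite ν]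
    {T : W × E → E} {Γ : X → E} (h : AverageBound d σ ν T Γ) (hT : Measurable T)
    (hΓ : Measurable Γ) {β : Type*} {f g : E → β} (hfg : f =ᵐ[volume] g) :
    ∀ᵐ p ∂(volume : Measure E).prod σ,
      ∀ᵐ t ∂ν, f (p.1 + T (p.2, Γ t)) = g (p.1 + T (p.2, Γ t)) := by
  obtain ⟨C, hC⟩ := h
  let N := toMeasurable volume {x | f x ≠ g x}
  have hN : MeasurableSet N := measurableSet_toMeasurable _ _
  have hN0 : (volume : Measure E) N = 0 := by
    rw [measure_toMeasurable]
    exact hfg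
  have hd : (0 : ℝ) < d + 2 := by positivity
  have hd1 : (0 : ℝ) < d + 1 := by positivity
  let F : E → ℝ≥0∞ := N.indicator 1
  have hF : Measurable F := measurable_one.indicator hN
  have h0 : ∫⁻ x, F x ^ (((d : ℝ) + 2) / ((d : ℝ) + 1)) = 0 := by
    refine (lintegral_eq_zero_iff (hF.pow_const _)).2 ?_
    have : ∀ᵐ x ∂(volume : Measure E), x ∉ N := measure_eq_zero_iff_ae_notMem.1 hN0
    filter_upwards [this] with x hx
    simp only [F, indicator_of_notMem hx, Pi.zero_apply]
    exact ENNReal.zero_rpow_of_pos (by positivity)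
  have h1 := hC F hF
  rw [h0, ENNReal.zero_rpow_of_pos hd1, mul_zero, nonpos_iff_eq_zero] at h1
  have hm : Measurable fun z : (E × W) × X => F (z.1.1 + T (z.1.2, Γ z.2)) := by fun_prop
  have hm2 : Measurable fun p : E × W => ∫⁻ t, F (p.1 + T (p.2, Γ t)) ∂ν :=
    hm.lintegral_prod_right'
  have h2 : ∫⁻ p, (∫⁻ t, F (p.1 + T (p.2, Γ t)) ∂ν) ^ ((d : ℝ) + 2)
      ∂(volume : Measure E).prod σ = 0 := by
    rw [lintegral_prod_symm' _ (hm2.pow_const _)]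
    exact h1
  rw [lintegral_eq_zero_iff (hm2.pow_const _)] at h2
  filter_upwards [h2] with p hp
  rw [Pi.zero_apply, ENNReal.rpow_eq_zero_iff_of_pos hd] at hp
  have hm3 : Measurable fun t => F (p.1 + T (p.2, Γ t)) := hm.comp measurable_prodMk_left
  rw [lintegral_eq_zero_iff hm3] at hp
  filter_upwards [hp] with t ht
  by_contra hne
  have hmem : p.1 + T (p.2, Γ t) ∈ N := subset_toMeasurable _ _ hne
  simp only [F, indicator_of_mem hmem, Pi.one_apply, Pi.zero_apply] at ht
  exact one_ne_zero ht

/-- The bounded amplitude `χ` is dominated by its supremum and the average of `f` by that of `|f|`.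
Finiteness of the latter almost everywhere gives absolute convergence. -/
theorem AverageBound.exists_eLpNorm_le {d : ℕ} {σ : Measure W} [SFinite σ] {ν : Measure X}
    [SFinite ν] {T : W × E → E} {Γ : X → E} (h : AverageBound d σ ν T Γ) (hT : Measurable T)
    (hΓ : Measurable Γ) {χ : X → ℝ} (hχ : Measurable χ) {M : ℝ≥0} (hM : ∀ t, ‖χ t‖ ≤ M) :
    ∃ C : ℝ≥0, ∀ f : E → ℂ, MemLp f (((d : ℝ≥0∞) + 2) / (d + 1)) volume →
      (∀ᵐ p ∂(volume : Measure E).prod σ,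
        Integrable (fun t => f (p.1 + T (p.2, Γ t)) * (χ t : ℂ)) ν) ∧
      MemLp (fun p : E × W => ∫ t, f (p.1 + T (p.2, Γ t)) * (χ t : ℂ) ∂ν) ((d : ℝ≥0∞) + 2)
        ((volume : Measure E).prod σ) ∧
      eLpNorm (fun p : E × W => ∫ t, f (p.1 + T (p.2, Γ t)) * (χ t : ℂ) ∂ν) ((d : ℝ≥0∞) + 2)
        ((volume : Measure E).prod σ) ≤
        C * eLpNorm f (((d : ℝ≥0∞) + 2) / (d + 1)) volume := by
  obtain ⟨C, hC⟩ := id h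
  have hd : (0 : ℝ) < d + 2 := by positivity
  have hd1 : (0 : ℝ) < d + 1 := by positivity
  have hPt : ((d : ℝ≥0∞) + 2).toReal = (d : ℝ) + 2 := by
    rw [ENNReal.toReal_add (by simp) (by simp)]; simp
  have hd1t : ((d : ℝ≥0∞) + 1).toReal = (d : ℝ) + 1 := by
    rw [ENNReal.toReal_add (by simp) (by simp)]; simp
  have hpt : (((d : ℝ≥0∞) + 2) / (d + 1)).toReal = ((d : ℝ) + 2) / (d + 1) := by
    rw [ENNReal.toReal_div, hPt, hd1t]
  have hP0 : (d : ℝ≥0∞) + 2 ≠ 0 := by simp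
  have hPT : (d : ℝ≥0∞) + 2 ≠ ⊤ := by simp
  have hp0 : ((d : ℝ≥0∞) + 2) / (d + 1) ≠ 0 := ENNReal.div_ne_zero.2 ⟨hP0, by simp⟩
  have hpT : ((d : ℝ≥0∞) + 2) / (d + 1) ≠ ⊤ := ENNReal.div_ne_top hPT (by simp)
  have hr : (0 : ℝ) ≤ 1 / ((d : ℝ) + 2) := by positivity
  refine ⟨M * C ^ (1 / ((d : ℝ) + 2)), fun f hf => ?_⟩
  let f₀ := hf.1.mk f
  have hf₀ : StronglyMeasurable f₀ := hf.1.stronglyMeasurable_mk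
  let F : E → ℝ≥0∞ := fun x => ‖f₀ x‖ₑ
  have hF : Measurable F := hf₀.measurable.enorm
  let A : E × W → ℝ≥0∞ := fun p => ∫⁻ t, F (p.1 + T (p.2, Γ t)) ∂ν
  have hm : Measurable fun z : (E × W) × X => F (z.1.1 + T (z.1.2, Γ z.2)) := by fun_prop
  have hA : Measurable A := hm.lintegral_prod_right'
  let H : (E × W) × X → ℂ := fun z => f₀ (z.1.1 + T (z.1.2, Γ z.2)) * (χ z.2 : ℂ)
  have hH : Measurable H := by
    have h1 : Measurable f₀ := hf₀.measurable
    have h2 : Measurable fun z : (E × W) × X => f₀ (z.1.1 + T (z.1.2, Γ z.2)) := by fun_prop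
    have h3 : Measurable fun z : (E × W) × X => (χ z.2 : ℂ) := by fun_prop
    exact h2.mul h3
  have hHb : ∀ p t, ‖H (p, t)‖ₑ ≤ M * F (p.1 + T (p.2, Γ t)) := by
    intro p t
    simp only [H, F, enorm_mul]
    rw [mul_comm]
    gcongr
    rw [← ofReal_norm, norm_real]
    exact ENNReal.ofReal_le_coe.2 (hM t)
  have hlinH : ∀ p, ∫⁻ t, ‖H (p, t)‖ₑ ∂ν ≤ M * A p := by
    intro p
    rw [← lintegral_const_mul' _ _ ENNReal.coe_ne_top]
    exact lintegral_mono (hHb p)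
  have hnorm : eLpNorm f (((d : ℝ≥0∞) + 2) / (d + 1)) volume =
      (∫⁻ x, F x ^ (((d : ℝ) + 2) / ((d : ℝ) + 1))) ^ (((d : ℝ) + 1) / (d + 2)) := by
    rw [eLpNorm_congr_ae hf.1.ae_eq_mk, eLpNorm_eq_lintegral_rpow_enorm_toReal hp0 hpT, hpt, one_div_div]
  have hAint : ∫⁻ p, A p ^ ((d : ℝ) + 2) ∂(volume : Measure E).prod σ ≤
      C * (∫⁻ x, F x ^ (((d : ℝ) + 2) / ((d : ℝ) + 1))) ^ ((d : ℝ) + 1) := by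
    rw [lintegral_prod_symm' _ (hA.pow_const _)]
    exact hC F hF
  have hroot : (∫⁻ p, A p ^ ((d : ℝ) + 2) ∂(volume : Measure E).prod σ) ^ (1 / ((d : ℝ) + 2)) ≤
      (C : ℝ≥0∞) ^ (1 / ((d : ℝ) + 2)) * eLpNorm f (((d : ℝ≥0∞) + 2) / (d + 1)) volume := by
    refine (ENNReal.rpow_le_rpow hAint hr).trans (le_of_eq ?_)
    rw [ENNReal.mul_rpow_of_nonneg _ _ hr, hnorm, ← ENNReal.rpow_mul]
    congr 2
    ring
  have hfin : ∫⁻ p, A p ^ ((d : ℝ) + 2) ∂(volume : Measure E).prod σ ≠ ⊤ := by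
    intro htop
    rw [htop, ENNReal.top_rpow_of_pos (by positivity)] at hroot
    exact (ENNReal.mul_lt_top (ENNReal.rpow_lt_top_of_nonneg hr ENNReal.coe_ne_top) hf.2).not_ge hroot
  have hAfin : ∀ᵐ p ∂(volume : Measure E).prod σ, A p < ⊤ := by
    filter_upwards [ae_lt_top (hA.pow_const _) hfin] with p hp
    by_contra hcon
    rw [not_lt, top_le_iff] at hcon
    rw [hcon, ENNReal.top_rpow_of_pos hd] at hp
    exact lt_irrefl _ hp
  have hae := h.ae_eq hT hΓ hf.1.ae_eq_mk
  have hHi : ∀ᵐ p ∂(volume : Measure E).prod σ, Integrable (fun t => H (p, t)) ν := by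
    filter_upwards [hAfin] with p hp
    exact ⟨(hH.comp measurable_prodMk_left).aestronglyMeasurable,
      (hlinH p).trans_lt (ENNReal.mul_lt_top ENNReal.coe_lt_top hp)⟩
  have hcongr : ∀ᵐ p ∂(volume : Measure E).prod σ,
      (fun t => f (p.1 + T (p.2, Γ t)) * (χ t : ℂ)) =ᵐ[ν] fun t => H (p, t) := by
    filter_upwards [hae] with p hp
    filter_upwards [hp] with t ht
    simp only [H, f₀, ht]
  have hcongr' : (fun p : E × W => ∫ t, f (p.1 + T (p.2, Γ t)) * (χ t : ℂ) ∂ν)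
      =ᵐ[(volume : Measure E).prod σ] fun p => ∫ t, H (p, t) ∂ν := by
    filter_upwards [hcongr] with p hp
    exact integral_congr_ae hp
  have hsm : StronglyMeasurable fun p => ∫ t, H (p, t) ∂ν :=
    hH.stronglyMeasurable.integral_prod_right'
  have hbound : eLpNorm (fun p : E × W => ∫ t, f (p.1 + T (p.2, Γ t)) * (χ t : ℂ) ∂ν)
      ((d : ℝ≥0∞) + 2) ((volume : Measure E).prod σ) ≤
      (M * C ^ (1 / ((d : ℝ) + 2)) : ℝ≥0) *
        eLpNorm f (((d : ℝ≥0∞) + 2) / (d + 1)) volume := by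
    rw [eLpNorm_congr_ae hcongr', eLpNorm_eq_lintegral_rpow_enorm_toReal hP0 hPT, hPt]
    have hMr : (M : ℝ≥0∞) ^ ((d : ℝ) + 2) ≠ ⊤ := ENNReal.rpow_ne_top_of_nonneg hd.le (by simp)
    calc _ ≤ (∫⁻ p, (M : ℝ≥0∞) ^ ((d : ℝ) + 2) * A p ^ ((d : ℝ) + 2)
            ∂(volume : Measure E).prod σ) ^ (1 / ((d : ℝ) + 2)) := by
          refine ENNReal.rpow_le_rpow (lintegral_mono fun p => ?_) hr
          rw [← ENNReal.mul_rpow_of_nonneg _ _ hd.le]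
          exact ENNReal.rpow_le_rpow ((enorm_integral_le_lintegral_enorm _).trans (hlinH p)) hd.le
      _ = M * (∫⁻ p, A p ^ ((d : ℝ) + 2) ∂(volume : Measure E).prod σ) ^ (1 / ((d : ℝ) + 2)) := by
          rw [lintegral_const_mul' _ _ hMr, ENNReal.mul_rpow_of_nonneg _ _ hr, ← ENNReal.rpow_mul,
            mul_one_div_cancel hd.ne', ENNReal.rpow_one]
      _ ≤ _ := by
          rw [ENNReal.coe_mul, ENNReal.coe_rpow_of_nonneg _ hr, mul_assoc]
          gcongr
  refine ⟨?_, ⟨(hsm.aestronglyMeasurable).congr hcongr'.symm, hbound.trans_lt ?_⟩, hbound⟩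
  · filter_upwards [hHi, hcongr] with p h1 h2
    exact h1.congr h2.symm
  · exact ENNReal.mul_lt_top ENNReal.coe_lt_top hf.2

end LpBound

/-! ### Globally smooth replacements near a parameter. -/

section Globalization

variable {W X E : Type*} [NormedAddCommGroup W] [NormedSpace ℝ W] [FiniteDimensional ℝ W]
  [NormedAddCommGroup X] [NormedSpace ℝ X] [NormedAddCommGroup E] [NormedSpace ℝ E]

/-- A cutoff in the first variable alone suffices, since smoothness holds for all values of the
second. -/
theorem exists_contDiff_eventually_eq {k : ℕ∞} {f : W × X → E} {U : Set W} (hU : IsOpen U)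
    (hf : ContDiffOn ℝ k f (U ×ˢ univ)) {s₀ : W} (hs₀ : s₀ ∈ U) :
    ∃ g : W × X → E, ContDiff ℝ k g ∧ ∀ᶠ s in 𝓝 s₀, ∀ x, g (s, x) = f (s, x) := by
  obtain ⟨ε, hε, hεU⟩ := Metric.nhds_basis_closedBall.mem_iff.1 (hU.mem_nhds hs₀)
  let η : ContDiffBump s₀ := ⟨ε / 2, ε, by positivity, by linarith⟩
  refine ⟨fun z => η z.1 • f z, contDiff_iff_contDiffAt.2 fun z => ?_, ?_⟩
  · by_cases hz : z.1 ∈ U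
    · have h1 : ContDiffAt ℝ k f z :=
        hf.contDiffAt ((hU.prod isOpen_univ).mem_nhds ⟨hz, mem_univ _⟩)
      have h2 : ContDiffAt ℝ k (fun z : W × X => η z.1) z := (η.contDiff.comp contDiff_fst).contDiffAt
      exact h2.smul h1
    · have hz' : z.1 ∈ (Metric.closedBall s₀ ε)ᶜ := fun h => hz (hεU h)
      have h1 : (fun z : W × X => η z.1 • f z) =ᶠ[𝓝 z] fun _ => 0 := by
        have := continuous_fst.continuousAt.eventually
          (Metric.isClosed_closedBall.isOpen_compl.mem_nhds hz')
        filter_upwards [this] with y hy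
        rw [η.zero_of_le_dist (le_of_lt (by simpa using hy)), zero_smul]
      exact contDiffAt_const.congr_of_eventuallyEq h1
  · filter_upwards [Metric.closedBall_mem_nhds s₀ (half_pos hε)] with s hs x
    have : η s = 1 := η.one_of_mem_closedBall hs
    simp only [this, one_smul]

end Globalization

/-! ### The matrix condition in invariant form. -/

section Rank

variable {n m : ℕ}

theorem vecMul_jacobian_dotProduct (F : EuclideanSpace ℝ (Fin n) → EuclideanSpace ℝ (Fin n))
    (Ξ x y : EuclideanSpace ℝ (Fin n)) :
    dotProduct (Matrix.vecMul (fun i => Ξ i) (jacobian F x)) (fun j => y j) =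
      inner ℝ Ξ (fderiv ℝ F x y) := by
  have h1 : Matrix.mulVec (jacobian F x) (fun j => y j) = fun i => fderiv ℝ F x y i := by
    ext i
    have hy : y = ∑ j, y j • EuclideanSpace.single j (1 : ℝ) := by
      ext k
      simp [Finset.sum_apply, Pi.single_apply]
    conv_rhs => rw [hy]
    simp only [map_sum, map_smul, Matrix.mulVec, dotProduct, jacobian, Matrix.of_apply]
    simp [Finset.sum_apply, mul_comm]
  rw [← Matrix.dotProduct_mulVec, h1, PiLp.inner_apply]
  simp [dotProduct, mul_comm]

/-- Symmetry of the second derivative: the matrix differentiates first in `s`, the oscillatory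
estimates first in `x`. -/
theorem fderiv_fderiv_apply {W E : Type*} [NormedAddCommGroup W] [NormedSpace ℝ W]
    [NormedAddCommGroup E] [NormedSpace ℝ E] {T : W × E → E} (hT : ContDiff ℝ ∞ T) (s w : W)
    (x y : E) :
    fderiv ℝ (fun x' => fderiv ℝ T (s, x') (w, 0)) x y =
      fderiv ℝ (fun s' => fderiv ℝ T (s', x) (0, y)) s w := by
  have h1 : HasFDerivAt (fderiv ℝ T) (fderiv ℝ (fderiv ℝ T) (s, x)) (s, x) :=
    ((hT.fderiv_right (m := ∞) (by simp)).differentiable (by simp) _).hasFDerivAt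
  have h2 : HasFDerivAt (fun x' => fderiv ℝ T (s, x') (w, 0)) _ x :=
    (ContinuousLinearMap.apply ℝ E ((w, 0) : W × E)).hasFDerivAt.comp x
      (h1.comp x (hasFDerivAt_prodMk_right s x))
  have h3 : HasFDerivAt (fun s' => fderiv ℝ T (s', x) (0, y)) _ s :=
    (ContinuousLinearMap.apply ℝ E ((0, y) : W × E)).hasFDerivAt.comp s
      (h1.comp s (hasFDerivAt_prodMk_left s x))
  rw [h2.fderiv, h3.fderiv]
  have hsymm : IsSymmSndFDerivAt ℝ T (s, x) :=
    hT.contDiffAt.isSymmSndFDerivAt (by rw [minSmoothness_of_isRCLikeNormedField]; exact ENat.LEInfty.out)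
  simpa using hsymm (0, y) (w, 0)

/-- The rank condition on the matrix of derivatives, in terms of a globally smooth family that
agrees with `T` for parameters near `s₀`. -/
theorem rankCondition_of_rank_rowMatrix (hn : 2 ≤ n)
    {T : EuclideanSpace ℝ (Fin m) → EuclideanSpace ℝ (Fin n) → EuclideanSpace ℝ (Fin n)}
    {T' : EuclideanSpace ℝ (Fin m) × EuclideanSpace ℝ (Fin n) → EuclideanSpace ℝ (Fin n)}
    (hT' : ContDiff ℝ ∞ T') {s₀ : EuclideanSpace ℝ (Fin m)}
    (hTT' : ∀ᶠ s in 𝓝 s₀, ∀ x, T' (s, x) = T s x) {Ξ x : EuclideanSpace ℝ (Fin n)}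
    {ι : Fin (n - 1) ↪ Fin m} (hrank : (rowMatrix T ι Ξ s₀ x).rank = n) :
    RankCondition T' Ξ s₀ x ∧ ∃ y, inner ℝ Ξ (fderiv ℝ T' (s₀, x) (0, y)) ≠ 0 := by
  obtain ⟨n, rfl⟩ : ∃ k, n = k + 1 := ⟨n - 1, by omega⟩
  have hd := hT'.differentiable (by simp)
  have hx : ∀ x' y, fderiv ℝ (T s₀) x' y = fderiv ℝ T' (s₀, x') (0, y) := by
    intro x' y
    have h1 : T s₀ = fun x => T' (s₀, x) := funext fun x => (hTT'.self_of_nhds x).symm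
    have h2 : HasFDerivAt (fun x => T' (s₀, x)) _ x' :=
      (hd (s₀, x')).hasFDerivAt.comp x' (hasFDerivAt_prodMk_right s₀ x')
    rw [h1, h2.fderiv]
    simp
  have hs : ∀ k, paramDeriv T k s₀ =
      fun x' => fderiv ℝ T' (s₀, x') (EuclideanSpace.single k 1, 0) := by
    intro k
    ext1 x'
    have h1 : (fun s' => T s' x') =ᶠ[𝓝 s₀] fun s' => T' (s', x') := by
      filter_upwards [hTT'] with s hs
      exact (hs x').symm
    have h2 : HasFDerivAt (fun s => T' (s, x')) _ s₀ :=
      (hd (s₀, x')).hasFDerivAt.comp s₀ (hasFDerivAt_prodMk_left s₀ x')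
    rw [paramDeriv, h1.fderiv_eq, h2.fderiv]
    simp
  -- Once the dimension is a successor the matrix is visibly square, and full rank means invertible.
  let A : Matrix (Fin (n + 1)) (Fin (n + 1)) ℝ := rowMatrix T ι Ξ s₀ x
  have hA : IsUnit A := by
    have : LinearIndependent ℝ A.row := by
      rw [linearIndependent_iff_card_eq_finrank_span, Fintype.card_fin, Set.finrank,
        ← Matrix.rank_eq_finrank_span_row]
      exact hrank.symm
    exact Matrix.linearIndependent_rows_iff_isUnit.1 this
  have hrow0 : ∀ y : EuclideanSpace ℝ (Fin (n + 1)), Matrix.mulVec A (fun j => y j) 0 =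
      inner ℝ Ξ (fderiv ℝ T' (s₀, x) (0, y)) := by
    intro y
    rw [← hx, ← vecMul_jacobian_dotProduct]
    rfl
  constructor
  · intro y h0 hw
    have hz : Matrix.mulVec A (fun j => y j) = 0 := by
      ext i
      refine Fin.cases ?_ (fun k => ?_) i
      · rw [hrow0, h0]; rfl
      · have h1 : Matrix.mulVec A (fun j => y j) (Fin.succ k) =
            inner ℝ Ξ (fderiv ℝ (paramDeriv T (ι k) s₀) x y) := by
          rw [← vecMul_jacobian_dotProduct]
          rfl
        rw [h1, hs, fderiv_fderiv_apply hT']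
        have h2 := hw (EuclideanSpace.single (ι k) 1)
        have h3 : DifferentiableAt ℝ (fun s' => fderiv ℝ T' (s', x) (0, y)) s₀ := by
          have h4 : ContDiff ℝ ∞ (fderiv ℝ T') := hT'.fderiv_right (by simp)
          have h5 : ContDiff ℝ ∞ (fun s' => fderiv ℝ T' (s', x) (0, y)) :=
            (h4.comp (g := fderiv ℝ T') (by fun_prop)).clm_apply (by fun_prop)
          exact h5.differentiable (by simp) _
        rw [fderiv_inner_apply ℝ (differentiableAt_const _) h3] at h2
        simpa using h2
    have h1 := Matrix.mulVec_injective_of_isUnit hA (hz.trans (Matrix.mulVec_zero A).symm)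
    ext j
    exact congrFun h1 j
  -- Invertibility also forbids the first row to vanish; over all `Ξ` this says that the derivative
  -- of `T` in `x` is invertible.
  · obtain ⟨v, hv⟩ := Matrix.mulVec_surjective_iff_isUnit.2 hA (Pi.single 0 1)
    refine ⟨WithLp.toLp 2 v, ?_⟩
    rw [← hrow0]
    change Matrix.mulVec A v 0 ≠ 0
    rw [hv]
    simp

/-- No unit vector is orthogonal to the range, so the map is onto, hence injective in finite
dimension. -/
theorem injective_of_forall_exists_inner_ne_zero {E : Type*} [NormedAddCommGroup E]
    [InnerProductSpace ℝ E] [FiniteDimensional ℝ E] {J : E →L[ℝ] E}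
    (h : ∀ Ξ, ‖Ξ‖ = 1 → ∃ y, inner ℝ Ξ (J y) ≠ 0) : Function.Injective J := by
  have hs : Function.Surjective (J : E →ₗ[ℝ] E) := by
    rw [← LinearMap.range_eq_top]
    by_contra hne
    have h1 : (LinearMap.range (J : E →ₗ[ℝ] E))ᗮ ≠ ⊥ := by
      rwa [ne_eq, Submodule.orthogonal_eq_bot_iff]
    obtain ⟨v, hv, hv0⟩ := Submodule.exists_mem_ne_zero_of_ne_bot h1
    obtain ⟨y, hy⟩ := h (‖v‖⁻¹ • v) (by
      rw [norm_smul, norm_inv, norm_norm, inv_mul_cancel₀ (norm_ne_zero_iff.2 hv0)])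
    apply hy
    have h2 : inner ℝ (J y) v = 0 :=
      (Submodule.mem_orthogonal _ _).1 hv _ (LinearMap.mem_range_self _ y)
    rw [real_inner_smul_left, real_inner_comm, h2, mul_zero]
  exact LinearMap.injective_iff_surjective.2 hs

end Rank

/-! ### Patching by compactness. -/

section Patching

variable {W E X : Type*} [TopologicalSpace W] [MeasurableSpace W]
  [NormedAddCommGroup E] [InnerProductSpace ℝ E] [FiniteDimensional ℝ E]
  [MeasurableSpace E] [BorelSpace E] [TopologicalSpace X] [MeasurableSpace X]

theorem AverageBound.of_isCompact_left {d : ℕ} {μ : Measure W} {ν : Measure X} {T : W × E → E}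
    {Γ : X → E} {K : Set W} (hK : IsCompact K)
    (h : ∀ s ∈ K, ∃ V ∈ 𝓝 s, AverageBound d (μ.restrict V) ν T Γ) :
    AverageBound d (μ.restrict K) ν T Γ := by
  refine hK.induction_on (p := fun S => AverageBound d (μ.restrict S) ν T Γ) ?_ ?_ ?_ ?_
  · exact ⟨0, fun F _ => by simp⟩
  · exact fun S S' hS h => h.mono_left (Measure.restrict_mono hS le_rfl)
  · exact fun S S' h h' => (h.add_left h').mono_left (Measure.restrict_union_le _ _)
  · intro s hs
    obtain ⟨V, hV, h⟩ := h s hs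
    exact ⟨V, mem_nhdsWithin_of_mem_nhds hV, h⟩

/-- The neighbourhood of `s₀` depends on `t`; only finitely many are intersected. -/
theorem AverageBound.of_isCompact_right {d : ℕ} {μ : Measure W} {ν : Measure X} [SFinite ν]
    {T : W × E → E} (hT : Measurable T) {Γ : X → E} (hΓ : Measurable Γ) {s₀ : W} {S : Set X}
    (hS : IsCompact S)
    (h : ∀ t ∈ S, ∃ V ∈ 𝓝 s₀, ∃ V' ∈ 𝓝 t, AverageBound d (μ.restrict V) (ν.restrict V') T Γ) :
    ∃ V ∈ 𝓝 s₀, AverageBound d (μ.restrict V) (ν.restrict S) T Γ := by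
  have hTs : ∀ s, Measurable fun x => T (s, x) := fun s => hT.comp measurable_prodMk_left
  refine hS.induction_on
    (p := fun S => ∃ V ∈ 𝓝 s₀, AverageBound d (μ.restrict V) (ν.restrict S) T Γ) ?_ ?_ ?_ ?_
  · refine ⟨univ, univ_mem, 0, fun F _ => ?_⟩
    have : (0 : ℝ) < d + 2 := by positivity
    simp [ENNReal.zero_rpow_of_pos this]
  · rintro S S' hS ⟨V, hV, h⟩
    refine ⟨V, hV, h.of_le_mul hTs (c := 1) fun F _ => ?_⟩
    rw [ENNReal.coe_one, one_mul]
    exact lintegral_mono_set hS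
  · rintro S S' ⟨V, hV, h⟩ ⟨V', hV', h'⟩
    exact ⟨V ∩ V', inter_mem hV hV',
      (h.mono_left (Measure.restrict_mono inter_subset_left le_rfl)).of_le_add
        (h'.mono_left (Measure.restrict_mono inter_subset_right le_rfl)) hT hΓ
        fun F _ => lintegral_union_le _ _ _⟩
  · intro t ht
    obtain ⟨V, hV, V', hV', h⟩ := h t ht
    exact ⟨V', mem_nhdsWithin_of_mem_nhds hV', V, hV, h⟩

end Patching

/-! ### Assembly of the local estimates. -/

section Assembly

variable {n m : ℕ}

theorem IsConvexParametrization.continuousOn {A : Set (EuclideanSpace ℝ (Fin (n - 1)))}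
    {γ : EuclideanSpace ℝ (Fin (n - 1)) → EuclideanSpace ℝ (Fin n)}
    (hγ : IsConvexParametrization A γ) : ContinuousOn γ A := by
  by_cases hn : n = 2
  · intro t ht
    obtain ⟨V, hV, c, hc, L, hL⟩ := hγ.bilipschitz_of_eq_two hn t ht
    apply ContinuousAt.continuousWithinAt
    rw [ContinuousAt, tendsto_iff_norm_sub_tendsto_zero]
    have h1 : Tendsto (fun u => L * ‖u - t‖) (𝓝 t) (𝓝 0) := by
      have : ContinuousAt (fun u => L * ‖u - t‖) t := by fun_prop
      simpa [ContinuousAt] using this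
    refine squeeze_zero' (Eventually.of_forall fun u => norm_nonneg _) ?_ h1
    filter_upwards [hV] with u hu
    exact (hL u hu t (mem_of_mem_nhds hV)).2
  · exact (hγ.contDiffOn_of_ne_two hn).continuousOn

/-- Nothing is known about `γ` off `A`, so it is set to zero there to obtain a measurable map. -/
theorem IsConvexParametrization.measurable_indicator {A : Set (EuclideanSpace ℝ (Fin (n - 1)))}
    {γ : EuclideanSpace ℝ (Fin (n - 1)) → EuclideanSpace ℝ (Fin n)}
    (hγ : IsConvexParametrization A γ) (hA : IsOpen A) : Measurable (A.indicator γ) := by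
  classical
  rw [← piecewise_eq_indicator]
  exact hγ.continuousOn.measurable_piecewise continuousOn_const hA.measurableSet

theorem IsConvexParametrization.exists_averageBound (hn : 2 ≤ n)
    {A : Set (EuclideanSpace ℝ (Fin (n - 1)))} (hA : IsOpen A)
    {γ : EuclideanSpace ℝ (Fin (n - 1)) → EuclideanSpace ℝ (Fin n)}
    (hγ : IsConvexParametrization A γ)
    {T : EuclideanSpace ℝ (Fin m) × EuclideanSpace ℝ (Fin n) → EuclideanSpace ℝ (Fin n)}
    (hT : ContDiff ℝ ∞ T) {s₀ : EuclideanSpace ℝ (Fin m)} {t₀ : EuclideanSpace ℝ (Fin (n - 1))}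
    (ht₀ : t₀ ∈ A) (hJ : Function.Injective fun y => fderiv ℝ T (s₀, γ t₀) (0, y))
    (hR : ∀ Ξ, ‖Ξ‖ = 1 → RankCondition T Ξ s₀ (γ t₀)) :
    ∃ V ∈ 𝓝 s₀, ∃ V' ∈ 𝓝 t₀, AverageBound (n - 1) (volume.restrict V) (volume.restrict V') T
      (A.indicator γ) := by
  have heq : ∀ᶠ t in 𝓝 t₀, A.indicator γ t = γ t := by
    filter_upwards [hA.mem_nhds ht₀] with t ht
    exact indicator_of_mem ht γ
  by_cases hn2 : n = 2
  · subst hn2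
    obtain ⟨B, hB, hBi, hfr⟩ := hγ.convex
    obtain ⟨V, hV, c, hc, L, hL⟩ := hγ.bilipschitz_of_eq_two rfl t₀ ht₀
    have h0 : A.indicator γ t₀ = γ t₀ := indicator_of_mem ht₀ γ
    refine exists_averageBound_of_convex_curve (by simp) (by simp) hT
      (hγ.measurable_indicator hA) hB hBi (t₀ := t₀) (L := L) ?_ hc
      (inter_mem hV (hA.mem_nhds ht₀)) (fun u hu v hv => ?_) (by rwa [h0]) (by rwa [h0])
    · filter_upwards [hA.mem_nhds ht₀] with t ht
      rw [indicator_of_mem ht]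
      exact hfr ht
    · rw [indicator_of_mem hu.2, indicator_of_mem hv.2]
      exact hL u hu.1 v hv.1
  · have hfin : Module.finrank ℝ (EuclideanSpace ℝ (Fin (n - 1))) = n - 1 := by simp
    -- The extension lemma for families is used with a dummy second variable to extend `γ` itself.
    obtain ⟨g, hg, hgeq⟩ := exists_contDiff_eventually_eq (X := ℝ) (k := 2) hA
      (f := fun z => γ z.1) ((hγ.contDiffOn_of_ne_two hn2).comp contDiff_fst.contDiffOn
        fun z hz => hz.1) ht₀
    let γ' : EuclideanSpace ℝ (Fin (n - 1)) → EuclideanSpace ℝ (Fin n) := fun t => g (t, 0)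
    have hγ' : ContDiff ℝ 2 γ' := hg.comp (by fun_prop)
    have hγeq : γ' =ᶠ[𝓝 t₀] γ := by
      filter_upwards [hgeq] with t ht
      exact ht 0
    have h0 : γ' t₀ = γ t₀ := hγeq.self_of_nhds
    obtain ⟨V, hV, V', hV', h⟩ := exists_averageBound_of_contDiff (μ := volume)
      (by rw [hfin]; omega) (by rw [hfin, finrank_euclideanSpace_fin]; omega) hT hγ'
      (s₀ := s₀) (t₀ := t₀)
      (by rw [hγeq.fderiv_eq]; exact hγ.immersion_of_ne_two hn2 t₀ ht₀)
      (by rwa [h0]) (by rwa [h0])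
    rw [hfin] at h
    obtain ⟨O, hO, hOo, htO⟩ := mem_nhds_iff.1 (inter_mem hV' (heq.and hγeq))
    refine ⟨V, hV, O, hOo.mem_nhds htO, h.of_le_mul (fun s => (hT.continuous.comp
      (continuous_const.prodMk continuous_id)).measurable) (c := 1) fun F _ => ?_⟩
    rw [ENNReal.coe_one, one_mul]
    calc ∫⁻ t in O, F (A.indicator γ t) = ∫⁻ t in O, F (γ' t) := by
          refine setLIntegral_congr_fun hOo.measurableSet fun t ht => ?_
          have := (hO ht).2
          simp only [this.1, this.2]
      _ ≤ _ := lintegral_mono_set fun t ht => (hO ht).1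

theorem averageBound_of_rank (hn : 2 ≤ n)
    {A : Set (EuclideanSpace ℝ (Fin (n - 1)))} (hA : IsOpen A)
    {γ : EuclideanSpace ℝ (Fin (n - 1)) → EuclideanSpace ℝ (Fin n)}
    (hγ : IsConvexParametrization A γ) {S : Set (EuclideanSpace ℝ (Fin (n - 1)))}
    (hS : IsCompact S) (hSA : S ⊆ A)
    {K U : Set (EuclideanSpace ℝ (Fin m))} (hK : IsCompact K) (hU : IsOpen U) (hKU : K ⊆ U)
    {T : EuclideanSpace ℝ (Fin m) → EuclideanSpace ℝ (Fin n) → EuclideanSpace ℝ (Fin n)}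
    (hT : ContDiffOn ℝ ∞ (Function.uncurry T) (U ×ˢ univ))
    (hrank : ∀ Ξ : EuclideanSpace ℝ (Fin n), ‖Ξ‖ = 1 → ∀ s ∈ K, ∀ x ∈ γ '' A,
      ∃ ι : Fin (n - 1) ↪ Fin m, (rowMatrix T ι Ξ s x).rank = n) :
    AverageBound (n - 1) (volume.restrict K) (volume.restrict S)
      ((U ×ˢ univ).indicator (Function.uncurry T)) (A.indicator γ) := by
  refine AverageBound.of_isCompact_left hK fun s₀ hs₀ => ?_
  obtain ⟨T', hT', hTT'⟩ := exists_contDiff_eventually_eq hU hT (hKU hs₀)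
  have hcond : ∀ t ∈ A, ∀ Ξ, ‖Ξ‖ = 1 → RankCondition T' Ξ s₀ (γ t) ∧
      ∃ y, inner ℝ Ξ (fderiv ℝ T' (s₀, γ t) (0, y)) ≠ 0 := by
    intro t ht Ξ hΞ
    obtain ⟨ι, hι⟩ := hrank Ξ hΞ s₀ hs₀ (γ t) ⟨t, ht, rfl⟩
    exact rankCondition_of_rank_rowMatrix hn hT' hTT' hι
  obtain ⟨V, hV, h⟩ := AverageBound.of_isCompact_right (μ := volume) (ν := volume)
    hT'.continuous.measurable (hγ.measurable_indicator hA) hS (s₀ := s₀) (d := n - 1)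
    fun t ht => by
      refine hγ.exists_averageBound hn hA hT' (hSA ht) ?_ fun Ξ hΞ => (hcond t (hSA ht) Ξ hΞ).1
      let J := (fderiv ℝ T' (s₀, γ t)).comp (ContinuousLinearMap.inr ℝ _ _)
      have hJ : (fun y => fderiv ℝ T' (s₀, γ t) (0, y)) = J := by ext1 y; simp [J]
      rw [hJ]
      refine injective_of_forall_exists_inner_ne_zero fun Ξ hΞ => ?_
      obtain ⟨y, hy⟩ := (hcond t (hSA ht) Ξ hΞ).2
      exact ⟨y, by simpa [J] using hy⟩
  obtain ⟨O, hO, hOo, hsO⟩ := mem_nhds_iff.1 (inter_mem hV (hTT'.and (hU.mem_nhds (hKU hs₀))))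
  refine ⟨O, hOo.mem_nhds hsO, (h.mono_left (Measure.restrict_mono (fun s hs => (hO hs).1)
    le_rfl)).congr_ae ?_⟩
  refine ae_restrict_of_forall_mem hOo.measurableSet fun s hs x => ?_
  have h1 := (hO hs).2
  have h2 : (s, x) ∈ U ×ˢ univ := ⟨h1.2, mem_univ _⟩
  rw [indicator_of_mem h2, h1.1 x]

end Assembly

end OverdeterminedRadon

theorem theorem4 (n m : ℕ) (hn : 2 ≤ n) (hm : n - 1 ≤ m)
    (A : Set (EuclideanSpace ℝ (Fin (n - 1)))) (hA : IsOpen A)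
    (γ : EuclideanSpace ℝ (Fin (n - 1)) → EuclideanSpace ℝ (Fin n))
    (hγ : OverdeterminedRadon.IsConvexParametrization A γ)
    (χ : EuclideanSpace ℝ (Fin (n - 1)) → ℝ) (hχ : ContDiff ℝ ∞ χ)
    (hχc : HasCompactSupport χ) (hχA : tsupport χ ⊆ A)
    (K U : Set (EuclideanSpace ℝ (Fin m))) (hK : IsCompact K) (hU : IsOpen U) (hKU : K ⊆ U)
    (T : EuclideanSpace ℝ (Fin m) → EuclideanSpace ℝ (Fin n) → EuclideanSpace ℝ (Fin n))
    (hT : ContDiffOn ℝ ∞ (Function.uncurry T) (U ×ˢ Set.univ))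
    (hrank : ∀ Ξ : EuclideanSpace ℝ (Fin n), ‖Ξ‖ = 1 → ∀ s ∈ K, ∀ x ∈ γ '' A,
      ∃ ι : Fin (n - 1) ↪ Fin m, (OverdeterminedRadon.rowMatrix T ι Ξ s x).rank = n) :
    ∃ C : ℝ≥0, ∀ f : EuclideanSpace ℝ (Fin n) → ℂ,
      MeasureTheory.MemLp f (((n : ℝ≥0∞) + 1) / n) MeasureTheory.volume →
        (∀ᵐ p ∂((MeasureTheory.volume : MeasureTheory.Measure (EuclideanSpace ℝ (Fin n))).prod
            ((MeasureTheory.volume : MeasureTheory.Measure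
              (EuclideanSpace ℝ (Fin m))).restrict K)),
          MeasureTheory.Integrable (fun t => f (p.1 + T p.2 (γ t)) * (χ t : ℂ))
            MeasureTheory.volume) ∧
        MeasureTheory.MemLp (OverdeterminedRadon.radon T γ χ f) ((n : ℝ≥0∞) + 1)
          ((MeasureTheory.volume : MeasureTheory.Measure (EuclideanSpace ℝ (Fin n))).prod
            ((MeasureTheory.volume : MeasureTheory.Measure
              (EuclideanSpace ℝ (Fin m))).restrict K)) ∧
        MeasureTheory.eLpNorm (OverdeterminedRadon.radon T γ χ f) ((n : ℝ≥0∞) + 1)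
          ((MeasureTheory.volume : MeasureTheory.Measure (EuclideanSpace ℝ (Fin n))).prod
            ((MeasureTheory.volume : MeasureTheory.Measure
              (EuclideanSpace ℝ (Fin m))).restrict K)) ≤
          C * MeasureTheory.eLpNorm f (((n : ℝ≥0∞) + 1) / n) MeasureTheory.volume := by
  classical
  -- `T` and `γ` are uncontrolled off `U` and `A`. Truncation makes them measurable and leaves the
  -- integrand unchanged for `s ∈ K`, because `χ` vanishes off `A`.
  let T' := (U ×ˢ Set.univ).indicator (Function.uncurry T)
  let γ' := A.indicator γ
  have hT'm : Measurable T' := by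
    rw [show T' = _ from (Set.piecewise_eq_indicator (s := U ×ˢ Set.univ)).symm]
    exact hT.continuousOn.measurable_piecewise continuousOn_const
      (hU.prod isOpen_univ).measurableSet
  have hγ'm : Measurable γ' := hγ.measurable_indicator hA
  have hbound := OverdeterminedRadon.averageBound_of_rank hn hA hγ hχc.isCompact hχA hK hU hKU hT
    hrank
  obtain ⟨M, hM⟩ := hχc.exists_bound_of_continuous hχ.continuous
  obtain ⟨C, hC⟩ := hbound.exists_eLpNorm_le hT'm hγ'm hχ.continuous.measurable (M := M.toNNReal)
    fun t => (hM t).trans (Real.le_coe_toNNReal M)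
  -- The general bound is stated with `d = n - 1`; its exponents become `(n + 1) / n` and `n + 1`.
  have hcast : ((n - 1 : ℕ) : ℝ≥0∞) + 1 = n := by
    exact_mod_cast Nat.sub_add_cancel (by omega : 1 ≤ n)
  have hcast' : ((n - 1 : ℕ) : ℝ≥0∞) + 2 = (n : ℝ≥0∞) + 1 := by
    rw [← hcast, add_assoc, one_add_one_eq_two]
  rw [hcast, hcast'] at hC
  have hχ0 : ∀ t, t ∉ tsupport χ → χ t = 0 := fun t => image_eq_zero_of_notMem_tsupport
  have hK' : ∀ᵐ p ∂((MeasureTheory.volume : MeasureTheory.Measure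
      (EuclideanSpace ℝ (Fin n))).prod ((MeasureTheory.volume : MeasureTheory.Measure
        (EuclideanSpace ℝ (Fin m))).restrict K)), p.2 ∈ K :=
    MeasureTheory.Measure.quasiMeasurePreserving_snd.ae
      (MeasureTheory.ae_restrict_mem hK.measurableSet)
  have hcongr : ∀ (f : EuclideanSpace ℝ (Fin n) → ℂ)
      (p : EuclideanSpace ℝ (Fin n) × EuclideanSpace ℝ (Fin m)), p.2 ∈ K →
      (fun t => f (p.1 + T p.2 (γ t)) * (χ t : ℂ)) =
        fun t => f (p.1 + T' (p.2, γ' t)) * (χ t : ℂ) := by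
    intro f p hp
    ext t
    by_cases ht : t ∈ tsupport χ
    · have h1 : γ' t = γ t := Set.indicator_of_mem (hχA ht) γ
      have hmem : (p.2, γ t) ∈ U ×ˢ Set.univ := ⟨hKU hp, Set.mem_univ _⟩
      have h2 : T' (p.2, γ t) = T p.2 (γ t) := Set.indicator_of_mem hmem _
      rw [h1, h2]
    · rw [hχ0 t ht]
      simp
  refine ⟨C, fun f hf => ?_⟩
  obtain ⟨h1, h2, h3⟩ := hC f hf
  have hradon : OverdeterminedRadon.radon T γ χ f =ᵐ[(MeasureTheory.volume :
      MeasureTheory.Measure (EuclideanSpace ℝ (Fin n))).prod ((MeasureTheory.volume :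
        MeasureTheory.Measure (EuclideanSpace ℝ (Fin m))).restrict K)]
      fun p => ∫ t in tsupport χ, f (p.1 + T' (p.2, γ' t)) * (χ t : ℂ) := by
    filter_upwards [hK'] with p hp
    rw [OverdeterminedRadon.radon, hcongr f p hp,
      MeasureTheory.setIntegral_eq_integral_of_forall_compl_eq_zero]
    intro t ht
    rw [hχ0 t ht]
    simp
  refine ⟨?_, h2.ae_eq hradon.symm, (MeasureTheory.eLpNorm_congr_ae hradon).trans_le h3⟩
  filter_upwards [h1, hK'] with p hp hpK
  rw [hcongr f p hpK]
  refine (MeasureTheory.integrableOn_iff_integrable_of_support_subset fun t ht => ?_).1 hp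
  by_contra hcon
  apply ht
  rw [hχ0 t hcon]
  simp
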